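/- Consider, in four-dimensional Minkowski space (signature $(+,-,-,-)$), the model with two free real scalar fields, $\psi$ of mass $m>0$ and $\varphi$ massless, acting on the usual domain $\mathcal D_0$ of the Fock space with vacuum $\Omega$, and with the interaction vertex $\mathcal L=\tfrac12\psi^2\varphi$. Let $T$ be any family of Epstein--Glaser time-ordered products, i.e. operator-valued Schwartz distributions $T(B_1(x_1),\ldots,B_n(x_n))$ on $\mathcal D_0$, multilinear in the polynomials $B_j$ in the symbols $\partial^\alpha\psi,\partial^\alpha\varphi$, which satisfy translational covariance, the Wick expansion, $T(\emptyset)=1$, $T(B(x))={:}B(x){:}$, $T(B_1(x_1),\ldots,B_n(x_n),1(x_{n+1}))=T(B_1(x_1),\ldots,B_n(x_n))$, symmetry, causality, and the bound $\sum_j(\dim B_j+\mathsf C)$ on the Steinmann scaling degree of their vacuum expectation values for homogeneous $B_j$, with a fixed constant $\mathsf C\in\{0,1\}$. Fourier transforms are $\tilde t(q)=\int e^{\mathrm i q\cdot x}t(x)\,\mathrm dx$. Write the Fourier transform of $(\Omega|T(\psi^2(x_1),\psi^2(x_2))\Omega)$ as $(2\pi)^4\delta(q_1+q_2)\,\Sigma(q_1)$,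 where (up to a constant factor) $\Sigma$ is the second-order self-energy of $\varphi$. A distribution $t\in\mathcal S'(\mathbb R^N)$ has the value $v$ at zero in the sense of Łojasiewicz if $\lim_{\epsilon\searrow0}\int\frac{\mathrm d^Nq}{(2\pi)^N}t(q)\,\epsilon^{-N}g(q/\epsilon)=v$ for all $g\in\mathcal S(\mathbb R^N)$ with $\int\frac{\mathrm d^Nq}{(2\pi)^N}g(q)=1$. Suppose that the mass normalization of $\varphi$ is not the correct one: $\Sigma(0)=c$ with $c\neq0$ (for example because $c\,\delta(x_1-x_2)$ has been added to a $(\Omega|T(\psi^2(x_1),\psi^2(x_2))\Omega)$ for which $\Sigma(0)=0$). Let $S(\mathbf g)$ be the generating functional of the time-ordered products and let $\mathrm{Adv}$ and $\mathrm{Ret}$ be the advanced and retarded products, generated by $S(\mathbf g+\mathbf h)S(\mathbf g)^{-1}$ and $S(\mathbf g)^{-1}S(\mathbf g+\mathbf h)$. Then for every $f\in\mathcal S(\mathbb R^8)$ with $\tilde f(0,0)\neq0$ neither of the two Schwartz distributions in $(q_1,q_2)$ $$\int\mathrm d^4x_1\,\mathrm d^4x_2\,f(x_1,x_2)\,(\Omega|\mathrm{Adv}(\tilde{\mathcal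 L}(q_1),\tilde{\mathcal L}(q_2);\varphi(x_1),\varphi(x_2))\Omega),$$ $$\int\mathrm d^4x_1\,\mathrm d^4x_2\,f(x_1,x_2)\,(\Omega|\mathrm{Ret}(\tilde{\mathcal L}(q_1),\tilde{\mathcal L}(q_2);\varphi(x_1),\varphi(x_2))\Omega)$$ has a value at $q_1=q_2=0$ in the sense of Łojasiewicz. Hence the weak adiabatic limit of the second-order correction to the two-point Green function of $\varphi$ does not exist: the correct mass normalization $\Sigma(0)=0$ is necessary. -/

import Mathlib

open MeasureTheory Filter Topology
open scoped SchwartzMap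

noncomputable section

namespace EG

/-! ### Minkowski space, configurations and test functions -/

/-- Minkowski space `ℝ⁴`; the coordinate `0` is the time coordinate. -/
abbrev Mink := EuclideanSpace ℝ (Fin 4)

/-- Configurations of `n` points of Minkowski space, i.e. `ℝ⁴ⁿ`. -/
abbrev Cfg (n : ℕ) := EuclideanSpace ℝ (Fin n × Fin 4)

/-- The `j`-th point of a configuration. -/
def pt {n : ℕ} (x : Cfg n) (j : Fin n) : Mink := WithLp.toLp 2 fun μ => x (j, μ)

/-- The configuration made of the given points. -/
def cfg {n : ℕ} (v : Fin n → Mink) : Cfg n := WithLp.toLp 2 fun p => v p.1 p.2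

/-- The diagonal entries of the metric with signature `(+,-,-,-)`. -/
def metricSign (μ : Fin 4) : ℝ := if μ = 0 then 1 else -1

/-- The Minkowski product. -/
def mdot (k x : Mink) : ℝ := ∑ μ, metricSign μ * k μ * x μ

/-- The closed cone of future-directed timelike and lightlike vectors. -/
def closedForwardCone : Set Mink := {v | 0 ≤ v 0 ∧ 0 ≤ mdot v v}

lemma metricSign_mul_self (μ : Fin 4) : metricSign μ * metricSign μ = 1 := by
  unfold metricSign; split_ifs <;> norm_num

/-- The map `x ↦ -(2π)⁻¹ η x` on `ℝ⁴ⁿ`, with `η` the metric acting on each point. -/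
def fourierScale (n : ℕ) : Cfg n ≃L[ℝ] Cfg n :=
  LinearEquiv.toContinuousLinearEquiv
    { toFun := fun x => WithLp.toLp 2 fun p => -(2 * Real.pi)⁻¹ * (metricSign p.2 * x p)
      invFun := fun x => WithLp.toLp 2 fun p => -(2 * Real.pi) * (metricSign p.2 * x p)
      map_add' := by intro x y; ext p; simp; ring
      map_smul' := by intro c x; ext p; simp; ring
      left_inv := by
        intro x; ext p
        have h := metricSign_mul_self p.2
        have hpi := Real.pi_ne_zero
        simp only
        field_simp
        linear_combination (x p) * h
      right_inv := by
        intro x; ext p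
        have h := metricSign_mul_self p.2
        have hpi := Real.pi_ne_zero
        simp only
        field_simp
        linear_combination (x p) * h }

/-- The Fourier transform `f̃(k) = ∫ exp(i k·x) f(x) dx` of Schwartz functions on `ℝ⁴ⁿ`, where
`k·x` is the sum of the Minkowski products of the components. -/
def fourierM (n : ℕ) : 𝓢(Cfg n, ℂ) →L[ℂ] 𝓢(Cfg n, ℂ) :=
  (SchwartzMap.compCLMOfContinuousLinearEquiv ℂ (fourierScale n)).comp
    (SchwartzMap.fourierTransformCLM ℂ)

lemma fourierM_apply {n : ℕ} (f : 𝓢(Cfg n, ℂ)) (k : Cfg n) :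
    fourierM n f k =
      ∫ x : Cfg n, Complex.exp (Complex.I * ((∑ j, mdot (pt k j) (pt x j) : ℝ) : ℂ)) * f x := by
  have h1 : fourierM n f k = FourierTransform.fourier (f : Cfg n → ℂ) (fourierScale n k) := rfl
  rw [h1, Real.fourier_eq']
  refine integral_congr_ae (Eventually.of_forall fun x => ?_)
  simp only [smul_eq_mul]
  congr 2
  have h2 : inner ℝ x (fourierScale n k) =
      -(2 * Real.pi)⁻¹ * ∑ j, mdot (pt k j) (pt x j) := by
    simp only [PiLp.inner_apply, fourierScale, mdot, pt, Fintype.sum_prod_type, Finset.mul_sum]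
    refine Finset.sum_congr rfl fun j _ => Finset.sum_congr rfl fun μ _ => ?_
    simp
    ring
  rw [h2]
  have hpi := Real.pi_ne_zero
  have : -2 * Real.pi * (-(2 * Real.pi)⁻¹ * ∑ j, mdot (pt k j) (pt x j)) =
      ∑ j, mdot (pt k j) (pt x j) := by
    field_simp
  rw [this, mul_comm]

/-- The identification of `ℝ⁴⁽ⁿ⁺¹⁾` with `ℝ⁴ⁿ × ℝ⁴` sending `(x₁,…,xₙ₊₁)` to
`((x₁ - c xₙ₊₁, …, xₙ - c xₙ₊₁), xₙ₊₁)`. -/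
def splitLast (n : ℕ) (c : ℝ) : Cfg (n + 1) ≃L[ℝ] Cfg n × Mink :=
  LinearEquiv.toContinuousLinearEquiv
    { toFun := fun x =>
        (WithLp.toLp 2 fun p => x (p.1.castSucc, p.2) - c * x (Fin.last n, p.2),
          WithLp.toLp 2 fun μ => x (Fin.last n, μ))
      invFun := fun y => WithLp.toLp 2 fun p =>
        Fin.lastCases (motive := fun _ => ℝ) (y.2 p.2) (fun j => y.1 (j, p.2) + c * y.2 p.2) p.1
      map_add' := by
        intro x y
        refine Prod.ext ?_ ?_
        · ext p; simp; ring
        · ext p; simp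
      map_smul' := by
        intro a x
        refine Prod.ext ?_ ?_
        · ext p; simp; ring
        · ext p; simp
      left_inv := by
        intro x; ext ⟨j, μ⟩
        refine Fin.lastCases ?_ (fun i => ?_) j <;> simp
      right_inv := by
        intro y
        refine Prod.ext ?_ ?_
        · ext p; simp
        · ext p; simp }

section Tensor

variable {E F : Type*} [NormedAddCommGroup E] [NormedSpace ℝ E]
  [NormedAddCommGroup F] [NormedSpace ℝ F]

lemma norm_iteratedFDeriv_comp_le_of_norm_le_one (L : E →L[ℝ] F) (hL : ‖L‖ ≤ 1)
    (f : 𝓢(F, ℂ)) (i : ℕ) (x : E) :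
    ‖iteratedFDeriv ℝ i (fun y => f (L y)) x‖ ≤ ‖iteratedFDeriv ℝ i f (L x)‖ := by
  have h := L.iteratedFDeriv_comp_right (f.smooth i) x (i := i) le_rfl
  have h2 : iteratedFDeriv ℝ i (fun y => f (L y)) x =
      (iteratedFDeriv ℝ i f (L x)).compContinuousLinearMap fun _ => L := h
  rw [h2]
  refine (ContinuousMultilinearMap.norm_compContinuousLinearMap_le _ _).trans ?_
  have : ∏ _j : Fin i, ‖L‖ ≤ 1 := Finset.prod_le_one (fun _ _ => norm_nonneg _) (fun _ _ => hL)
  exact mul_le_of_le_one_right (norm_nonneg _) this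

lemma tensor_bound (f : 𝓢(F, ℂ)) (k n : ℕ) (g : 𝓢(E, ℂ)) (z : E × F) :
    ‖z‖ ^ k * ‖iteratedFDeriv ℝ n (fun z : E × F => g z.1 * f z.2) z‖ ≤
      (2 ^ n * (2 ^ k * (2 ^ k * ((Finset.Iic (k, n)).sup (schwartzSeminormFamily ℂ F ℂ)) f))) *
        ((Finset.Iic (k, n)).sup (schwartzSeminormFamily ℂ E ℂ)) g := by
  have hz : ‖z‖ ^ k ≤ (1 + ‖z.1‖) ^ k * (1 + ‖z.2‖) ^ k := by
    rw [← mul_pow]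
    refine pow_le_pow_left₀ (norm_nonneg _) ?_ _
    have h1 := norm_nonneg z.1
    have h2 := norm_nonneg z.2
    rw [Prod.norm_def]
    refine max_le ?_ ?_ <;> nlinarith [mul_nonneg h1 h2]
  have hd := norm_iteratedFDeriv_mul_le (𝕜 := ℝ) (N := (n : ℕ∞))
    (f := fun z : E × F => g z.1) (g := fun z : E × F => f z.2)
    ((g.smooth n).comp contDiff_fst) ((f.smooth n).comp contDiff_snd) z (n := n) le_rfl
  refine (mul_le_mul hz hd (norm_nonneg _) (by positivity)).trans ?_
  rw [Finset.mul_sum]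
  have hs : ∀ i ∈ Finset.range (n + 1),
      (1 + ‖z.1‖) ^ k * (1 + ‖z.2‖) ^ k *
        ((n.choose i : ℝ) * ‖iteratedFDeriv ℝ i (fun z : E × F => g z.1) z‖ *
          ‖iteratedFDeriv ℝ (n - i) (fun z : E × F => f z.2) z‖) ≤
      (n.choose i : ℝ) * ((2 ^ k * ((Finset.Iic (k, n)).sup (schwartzSeminormFamily ℂ E ℂ)) g) *
        (2 ^ k * ((Finset.Iic (k, n)).sup (schwartzSeminormFamily ℂ F ℂ)) f)) := by
    intro i hi
    have hi' : i ≤ n := by simpa [Nat.lt_succ_iff] using hi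
    have a1 := norm_iteratedFDeriv_comp_le_of_norm_le_one (ContinuousLinearMap.fst ℝ E F)
      (ContinuousLinearMap.norm_fst_le ℝ E F) g i z
    have a2 := norm_iteratedFDeriv_comp_le_of_norm_le_one (ContinuousLinearMap.snd ℝ E F)
      (ContinuousLinearMap.norm_snd_le ℝ E F) f (n - i) z
    have b1 := SchwartzMap.one_add_le_sup_seminorm_apply (𝕜 := ℂ) (m := (k, n)) (k := k) (n := i)
      le_rfl hi' g z.1
    have b2 := SchwartzMap.one_add_le_sup_seminorm_apply (𝕜 := ℂ) (m := (k, n)) (k := k)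
      (n := n - i) le_rfl (Nat.sub_le n i) f z.2
    have c1 : (1 + ‖z.1‖) ^ k * ‖iteratedFDeriv ℝ i (fun z : E × F => g z.1) z‖ ≤ _ :=
      (mul_le_mul_of_nonneg_left a1 (by positivity)).trans b1
    have c2 : (1 + ‖z.2‖) ^ k * ‖iteratedFDeriv ℝ (n - i) (fun z : E × F => f z.2) z‖ ≤ _ :=
      (mul_le_mul_of_nonneg_left a2 (by positivity)).trans b2
    have c3 := mul_le_mul c1 c2 (by positivity) ((by positivity : (0:ℝ) ≤ _).trans c1)
    calc _ = (n.choose i : ℝ) *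
          (((1 + ‖z.1‖) ^ k * ‖iteratedFDeriv ℝ i (fun z : E × F => g z.1) z‖) *
            ((1 + ‖z.2‖) ^ k * ‖iteratedFDeriv ℝ (n - i) (fun z : E × F => f z.2) z‖)) := by ring
      _ ≤ _ := mul_le_mul_of_nonneg_left c3 (by positivity)
  refine (Finset.sum_le_sum hs).trans (le_of_eq ?_)
  rw [← Finset.sum_mul, ← Nat.cast_sum, Nat.sum_range_choose]
  push_cast
  ring

/-- The tensor product `(x, y) ↦ g(x) f(y)` of Schwartz functions, as a continuous linear map
of `g`. -/
def tensorLeft (f : 𝓢(F, ℂ)) : 𝓢(E, ℂ) →L[ℂ] 𝓢(E × F, ℂ) :=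
  SchwartzMap.mkCLM (fun g z => g z.1 * f z.2)
    (by intro g h z; simp [add_mul])
    (by intro a g z; simp [mul_assoc])
    (by
      intro g
      exact ((g.smooth ⊤).comp contDiff_fst).mul ((f.smooth ⊤).comp contDiff_snd))
    (by
      rintro ⟨k, n⟩
      exact ⟨Finset.Iic (k, n), _, by positivity, fun g z => tensor_bound f k n g z⟩)

lemma tensorLeft_apply (f : 𝓢(F, ℂ)) (g : 𝓢(E, ℂ)) (z : E × F) :
    tensorLeft f g z = g z.1 * f z.2 := rfl

end Tensor

/-- The constant `c`, as a test function on `ℝ⁰`. -/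
def constZero (c : ℂ) : 𝓢(Cfg 0, ℂ) where
  toFun := fun _ => c
  smooth' := contDiff_const
  decay' := by
    intro k n
    refine ⟨‖(0 : Cfg 0)‖ ^ k * ‖iteratedFDeriv ℝ n (fun _ : Cfg 0 => c) 0‖, fun x => ?_⟩
    rw [Subsingleton.elim x 0]

/-- The test function `(x₁,…,xₙ) ↦ g₁(x₁)⋯gₙ(xₙ)` on `ℝ⁴ⁿ`. -/
def tensor : (n : ℕ) → (Fin n → 𝓢(Mink, ℂ)) → 𝓢(Cfg n, ℂ)
  | 0, _ => constZero 1
  | n + 1, g => SchwartzMap.compCLMOfContinuousLinearEquiv ℂ (splitLast n 0)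
      (tensorLeft (g (Fin.last n)) (tensor n fun j => g j.castSucc))

lemma tensor_apply : ∀ (n : ℕ) (g : Fin n → 𝓢(Mink, ℂ)) (x : Cfg n),
    tensor n g x = ∏ j, g j (pt x j)
  | 0, g, x => by
    have h : tensor 0 g x = 1 := rfl
    rw [h]; simp
  | n + 1, g, x => by
    have h : tensor (n + 1) g x = tensor n (fun j => g j.castSucc) (splitLast n 0 x).1 *
        g (Fin.last n) (splitLast n 0 x).2 := rfl
    rw [h, tensor_apply n, Fin.prod_univ_castSucc]
    congr 1
    refine Finset.prod_congr rfl fun j _ => ?_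
    congr 1
    ext μ
    simp [splitLast, pt]

/-! ### Tempered distributions -/

/-- The rescaled test function `q ↦ ε⁻⁴ⁿ g(q/ε)`, for `ε ≠ 0`. -/
def dilate {n : ℕ} (ε : ℝ) (g : 𝓢(Cfg n, ℂ)) : 𝓢(Cfg n, ℂ) :=
  if h : ε = 0 then 0 else
    ((ε : ℂ) ^ (4 * n))⁻¹ • SchwartzMap.compCLMOfContinuousLinearEquiv ℂ
      (ContinuousLinearEquiv.smulLeft (Units.mk0 ε h)⁻¹ : Cfg n ≃L[ℝ] Cfg n) g

lemma dilate_apply {n : ℕ} {ε : ℝ} (hε : ε ≠ 0) (g : 𝓢(Cfg n, ℂ)) (q : Cfg n) :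
    dilate ε g q = ((ε : ℂ) ^ (4 * n))⁻¹ * g (ε⁻¹ • q) := by
  simp only [dilate, hε, dite_false]
  rfl

/-- The tempered distribution `t(q)` on `ℝ⁴ⁿ` has the value `c` at zero in the sense of
Łojasiewicz: `∫ dq/(2π)⁴ⁿ t(q) g_ε(q) → c` as `ε ↘ 0`, whenever `∫ dq/(2π)⁴ⁿ g(q) = 1`, where
`g_ε(q) = ε⁻⁴ⁿ g(q/ε)`. -/
def HasLojasiewiczValue {n : ℕ} (t : 𝓢'(Cfg n, ℂ)) (c : ℂ) : Prop :=
  ∀ g : 𝓢(Cfg n, ℂ), (((2 * Real.pi) ^ (4 * n) : ℝ) : ℂ)⁻¹ * ∫ q, g q = 1 →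
    Tendsto (fun ε : ℝ => (((2 * Real.pi) ^ (4 * n) : ℝ) : ℂ)⁻¹ * t (dilate ε g))
      (𝓝[>] 0) (𝓝 c)

/-- The Fourier transform `t̃(q) = ∫ exp(i q·x) t(x) dx` of tempered distributions. -/
def fourierDist {n : ℕ} (t : 𝓢'(Cfg n, ℂ)) : 𝓢'(Cfg n, ℂ) :=
  PointwiseConvergenceCLM.precomp ℂ (fourierM n) t

/-- The Steinmann scaling degree of a tempered distribution with respect to the origin. -/
def scalingDegree {n : ℕ} (t : 𝓢'(Cfg n, ℂ)) : EReal :=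
  sInf ((fun s : ℝ => (s : EReal)) '' {s : ℝ | ∀ g : 𝓢(Cfg n, ℂ),
    Tendsto (fun l : ℝ => ((l ^ s : ℝ) : ℂ) * t (dilate l g)) (𝓝[>] 0) (𝓝 0)})

/-- `τ(x₁,…,xₙ) = t(x₁,…,xₙ,0)` for a translationally invariant distribution `t` on `ℝ⁴⁽ⁿ⁺¹⁾`:
`t` applied to `g(x₁ - xₙ₊₁, …, xₙ - xₙ₊₁) h(xₙ₊₁)` equals `τ(g) ∫ h`. -/
def IsReduction {n : ℕ} (t : 𝓢'(Cfg (n + 1), ℂ)) (τ : 𝓢'(Cfg n, ℂ)) : Prop :=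
  ∀ (g : 𝓢(Cfg n, ℂ)) (h : 𝓢(Mink, ℂ)),
    t (SchwartzMap.compCLMOfContinuousLinearEquiv ℂ (splitLast n 1) (tensorLeft h g)) =
      τ g * ∫ x, h x

/-- The distribution `∫ dx f(x) t(y, x)` in `y`. -/
def smearRight {n k : ℕ} (t : 𝓢'(Cfg n × Cfg k, ℂ)) (f : 𝓢(Cfg k, ℂ)) : 𝓢'(Cfg n, ℂ) :=
  PointwiseConvergenceCLM.precomp ℂ (tensorLeft f) t

/-! ### Symbolic fields -/

/-- The two basic generators: `true` is the massive field `ψ`, `false` the massless field `φ`. -/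
abbrev Species := Bool

/-- The generators `∂^α A`, where `A` is a basic generator and `α` a multi-index. -/
abbrev Gen := Species × (Fin 4 → ℕ)

/-- The algebra of symbolic fields; both fields are bosonic. -/
abbrev Sym := MvPolynomial Gen ℂ

/-- The symbolic field `ψ`. -/
def psi : Sym := MvPolynomial.X (true, 0)

/-- The symbolic field `φ`. -/
def phi : Sym := MvPolynomial.X (false, 0)

/-- The interaction vertex `½ ψ² φ`. -/
def vertex : Sym := MvPolynomial.C (1 / 2) * psi ^ 2 * phi

/-- The canonical dimension of the generators, `dim ∂^α A = 1 + |α|`. -/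
def genDim (G : Gen) : ℕ := 1 + ∑ μ, G.2 μ

/-- The sub-polynomial `B^(s)`: the iterated derivative of `B` with respect to the generators, with
multiplicities given by the super-quadri-index `s`. -/
def subPoly (s : Gen →₀ ℕ) (B : Sym) : Sym :=
  (Finsupp.toMultiset s).toList.foldr (fun G C => MvPolynomial.pderiv G C) B

/-- `s! = ∏ s(i,α)!`. -/
def idxFactorial (s : Gen →₀ ℕ) : ℂ := s.prod fun _ k => (k.factorial : ℂ)

/-! ### Fock space -/

/-- Labels of one-particle states: the species and the spatial momentum. -/
abbrev OneP := Species × EuclideanSpace ℝ (Fin 3)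

/-- The masses: `m` for `ψ` and `0` for `φ`. -/
def mass (m : ℝ) (i : Species) : ℝ := if i then m else 0

def energy (m : ℝ) (κ : OneP) : ℝ := Real.sqrt (‖κ.2‖ ^ 2 + mass m κ.1 ^ 2)

/-- The on-shell four-momentum. -/
def onShell (m : ℝ) (κ : OneP) : Mink := WithLp.toLp 2 (Fin.cons (energy m κ) fun j => κ.2 j)

/-- The invariant measure `(2π)⁻³ d³k / (2 k⁰)` on each of the two mass shells. -/
def shell (m : ℝ) : Measure OneP :=
  ((Measure.count : Measure Species).prod volume).withDensity fun κ =>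
    ENNReal.ofReal (1 / ((2 * Real.pi) ^ 3 * (2 * energy m κ)))

/-- Families of `n`-particle wave functions. The wave function of a vector `Ψ` is
`(k₁,…,kₙ) ↦ (Ω| a(k₁)⋯a(kₙ) Ψ)`, with `[a(k), a*(k')]` the delta function of the invariant
measure. -/
abbrev Fock := (n : ℕ) → (Fin n → OneP) → ℂ

/-- The inner product `(Ψ|Φ)`. -/
def fockInner (m : ℝ) (Ψ Φ : Fock) : ℂ :=
  ∑' n : ℕ, ((n.factorial : ℂ))⁻¹ *
    ∫ κ : Fin n → OneP, (starRingEnd ℂ) (Ψ n κ) * Φ n κ ∂(Measure.pi fun _ => shell m)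

/-- The vacuum. -/
def vacuum : Fock := fun n _ => if n = 0 then 1 else 0

open Classical in
/-- The vector `∫ f(x₁,…,xₙ) :A_{i₁}(x₁)⋯A_{iₙ}(xₙ): Ω`. -/
def monoVec (m : ℝ) {n : ℕ} (i : Fin n → Species) (f : 𝓢(Cfg n, ℂ)) : Fock := fun r κ =>
  ∑ e : Fin n ≃ Fin r, if ∀ j, (κ (e j)).1 = i j then
    fourierM n f (cfg fun j => onShell m (κ (e j))) else 0

/-- The domain `𝒟₀`: the span of the vectors `∫ f(x₁,…,xₙ) A_{i₁}(x₁)⋯A_{iₙ}(xₙ) Ω`. By Wick's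
theorem it is also spanned by the vectors with the normally ordered products. -/
def domain (m : ℝ) : Submodule ℂ Fock :=
  Submodule.span ℂ ({vacuum} ∪
    {Ψ | ∃ (n : ℕ) (i : Fin n → Species) (f : 𝓢(Cfg n, ℂ)), Ψ = monoVec m i f})

/-- The vacuum as an element of the domain. -/
def vac (m : ℝ) : domain m := ⟨vacuum, Submodule.subset_span (Or.inl rfl)⟩

/-- The translation operators on families of wave functions. -/
def translateFock (m : ℝ) (a : Mink) : Fock →ₗ[ℂ] Fock where
  toFun Ψ := fun n κ => Complex.exp (Complex.I * ((∑ j, mdot (onShell m (κ j)) a : ℝ) : ℂ)) * Ψ n κ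
  map_add' Ψ Φ := by funext n κ; simp [mul_add]
  map_smul' c Ψ := by funext n κ; simp; ring

lemma fourierM_translate {n : ℕ} (f : 𝓢(Cfg n, ℂ)) (a : Mink) (k : Cfg n) :
    fourierM n (SchwartzMap.compSubConstCLM ℂ (cfg fun _ => a) f) k =
      Complex.exp (Complex.I * ((∑ j, mdot (pt k j) a : ℝ) : ℂ)) * fourierM n f k := by
  rw [fourierM_apply, fourierM_apply, ← integral_const_mul]
  rw [← integral_add_right_eq_self _ (cfg fun _ => a : Cfg n)]
  refine integral_congr_ae (Eventually.of_forall fun x => ?_)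
  simp only [SchwartzMap.compSubConstCLM_apply, add_sub_cancel_right]
  rw [← mul_assoc, ← Complex.exp_add]
  congr 2
  rw [← mul_add, ← Complex.ofReal_add, ← Finset.sum_add_distrib]
  congr 2
  refine Finset.sum_congr rfl fun j _ => ?_
  simp only [mdot, ← Finset.sum_add_distrib]
  refine Finset.sum_congr rfl fun μ _ => ?_
  simp [pt, cfg]
  ring

lemma translateFock_mem (m : ℝ) (a : Mink) {Ψ : Fock} (h : Ψ ∈ domain m) :
    translateFock m a Ψ ∈ domain m := by
  refine Submodule.span_induction (p := fun Ψ _ => translateFock m a Ψ ∈ domain m)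
    ?_ ?_ ?_ ?_ h
  · rintro Ψ (h | ⟨n, i, f, rfl⟩)
    · rw [Set.mem_singleton_iff] at h
      subst h
      have : translateFock m a vacuum = vacuum := by
        funext n κ
        by_cases hn : n = 0
        · subst hn; simp [translateFock, vacuum]
        · simp [translateFock, vacuum, hn]
      rw [this]
      exact Submodule.subset_span (Or.inl rfl)
    · have : translateFock m a (monoVec m i f) =
          monoVec m i (SchwartzMap.compSubConstCLM ℂ (cfg fun _ => a) f) := by
        funext r κ
        simp only [translateFock, monoVec, LinearMap.coe_mk, AddHom.coe_mk, Finset.mul_sum]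
        refine Finset.sum_congr rfl fun e _ => ?_
        split_ifs
        · rw [fourierM_translate]
          congr 4
          exact (Equiv.sum_comp e fun j => mdot (onShell m (κ j)) a).symm
        · simp
      rw [this]
      exact Submodule.subset_span (Or.inr ⟨n, i, _, rfl⟩)
  · simp
  · intro x y _ _ hx hy
    rw [map_add]
    exact add_mem hx hy
  · intro c x _ hx
    rw [map_smul]
    exact Submodule.smul_mem _ _ hx

/-- The translation operators `U(a)` on the domain. -/
def translate (m : ℝ) (a : Mink) : Module.End ℂ (domain m) :=
  (translateFock m a).restrict fun _ h => translateFock_mem m a h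

/-- The annihilation operator `a(κ)`. -/
def ann (κ : OneP) (Φ : Fock) : Fock := fun n p => Φ (n + 1) (Fin.cons κ p)

/-- The one-particle function of the generator `∂^α A`: `∂^α exp(-i k·x)` on the mass shell. -/
def mode (m : ℝ) (G : Gen) (κ : OneP) (x : Mink) : ℂ :=
  (∏ μ, (-Complex.I * ((metricSign μ * onShell m κ μ : ℝ) : ℂ)) ^ G.2 μ) *
    Complex.exp (-Complex.I * ((mdot (onShell m κ) x : ℝ) : ℂ))

open Classical in
/-- The matrix element `(Ψ| :G₁(x₁)⋯G_l(x_l): Φ)` of a normally ordered product of the free fields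
`G(x) = ∫ (mode a + conj(mode) a*)` and their derivatives: in normally ordered products the
creation operators act on the left vector and the annihilation operators on the right one. -/
def wickElem (m : ℝ) : List (Gen × Mink) → Fock → Fock → ℂ
  | [], Ψ, Φ => fockInner m Ψ Φ
  | (G, x) :: L, Ψ, Φ => ∫ κ : OneP,
      (if κ.1 = G.1 then
        (starRingEnd ℂ) (mode m G κ x) * wickElem m L (ann κ Ψ) Φ +
          mode m G κ x * wickElem m L Ψ (ann κ Φ)
      else 0) ∂(shell m)

/-- The list of the factors of `A^{s₁}(x₁)⋯A^{sₙ}(xₙ)`. -/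
def legs {n : ℕ} (s : Fin n → Gen →₀ ℕ) (x : Cfg n) : List (Gen × Mink) :=
  (List.finRange n).flatMap fun j => (Finsupp.toMultiset (s j)).toList.map fun G => (G, pt x j)

/-- The matrix element `(Ψ| :A^{s₁}(x₁)⋯A^{sₙ}(xₙ): Φ)`, a function of `(x₁,…,xₙ)`. -/
def wickFun (m : ℝ) {n : ℕ} (s : Fin n → Gen →₀ ℕ) (Ψ Φ : Fock) (x : Cfg n) : ℂ :=
  wickElem m (legs s x) Ψ Φ

/-! ### Time-ordered products -/

/-- Time-ordered products in the model with the fields `ψ` (of mass `m`) and `φ` (massless).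
The constant `ce` is the one in the bound on the scaling degree. All fields are bosonic, so that
there are no signs, and the condition on the fermion number is void. -/
structure TimeOrdered (m : ℝ) (ce : ℕ) where
  /-- The product of `B₁(x₁),…,Bₙ(xₙ)`, smeared with a test function on `ℝ⁴ⁿ`. -/
  T : (n : ℕ) → MultilinearMap ℂ (fun _ : Fin n => Sym)
    (𝓢(Cfg n, ℂ) →ₗ[ℂ] Module.End ℂ (domain m))
  /-- The products are operator-valued Schwartz distributions. -/
  distribution : ∀ (n : ℕ) (B : Fin n → Sym) (Ψ Φ : domain m), ∃ t : 𝓢'(Cfg n, ℂ),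
    ∀ g, t g = fockInner m Ψ (T n B g Φ : domain m)
  /-- Translational covariance. -/
  translation : ∀ (n : ℕ) (B : Fin n → Sym) (a : Mink) (g : 𝓢(Cfg n, ℂ)),
    translate m a * T n B g =
      T n B (SchwartzMap.compSubConstCLM ℂ (cfg fun _ => a) g) * translate m a
  /-- Wick expansion. -/
  wick : ∀ (n : ℕ) (B : Fin n → Sym) (g : 𝓢(Cfg n, ℂ)) (Ψ Φ : domain m),
    fockInner m Ψ (T n B g Φ : domain m) =
      ∑ᶠ s : Fin n → Gen →₀ ℕ, (∏ j, idxFactorial (s j))⁻¹ *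
        fockInner m (vac m) (T n (fun j => subPoly (s j) (B j))
          (SchwartzMap.smulLeftCLM ℂ (wickFun m s Ψ Φ) g) (vac m) : domain m)
  /-- The empty product is the identity. -/
  empty : ∀ (B : Fin 0 → Sym) (g : 𝓢(Cfg 0, ℂ)), T 0 B g = g 0 • 1
  /-- The product with one argument is the Wick polynomial. -/
  one_arg : ∀ (B : Fin 1 → Sym) (g : 𝓢(Cfg 1, ℂ)) (Ψ Φ : domain m),
    fockInner m Ψ (T 1 B g Φ : domain m) =
      ∑ s ∈ (B 0).support, MvPolynomial.coeff s (B 0) *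
        ∫ x : Cfg 1, g x * wickFun m (fun _ => s) Ψ Φ x
  /-- Arguments equal to the unity of the algebra of symbolic fields can be dropped. -/
  unit_arg : ∀ (n : ℕ) (B : Fin n → Sym) (g : Fin n → 𝓢(Mink, ℂ)) (h : 𝓢(Mink, ℂ)),
    T (n + 1) (Fin.snoc (α := fun _ => Sym) B 1)
        (tensor (n + 1) (Fin.snoc (α := fun _ => 𝓢(Mink, ℂ)) g h)) =
      (∫ x, h x) • T n B (tensor n g)
  /-- Symmetry. -/
  symmetric : ∀ (n : ℕ) (B : Fin n → Sym) (g : Fin n → 𝓢(Mink, ℂ)) (π : Equiv.Perm (Fin n)),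
    T n (B ∘ π) (tensor n (g ∘ π)) = T n B (tensor n g)
  /-- Causality: if none of the points `x₁,…,xₙ` is in the causal past of any of the points
  `y₁,…,y_k`, then the product factorizes. -/
  causality : ∀ (n k : ℕ) (B : Fin n → Sym) (C : Fin k → Sym) (g : Fin n → 𝓢(Mink, ℂ))
    (h : Fin k → 𝓢(Mink, ℂ)),
    (∀ i j, ∀ x ∈ tsupport (g i), ∀ y ∈ tsupport (h j), y - x ∉ closedForwardCone) →
    T (n + k) (Fin.append B C) (tensor (n + k) (Fin.append g h)) =
      T n B (tensor n g) * T k C (tensor k h)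
  /-- Bound on the Steinmann scaling degree of the vacuum expectation values. -/
  scaling : ∀ (n : ℕ) (B : Fin (n + 1) → Sym) (d : Fin (n + 1) → ℕ),
    (∀ j, MvPolynomial.IsWeightedHomogeneous genDim (B j) (d j)) →
    ∀ (t : 𝓢'(Cfg (n + 1), ℂ)) (τ : 𝓢'(Cfg n, ℂ)),
      (∀ g, t g = fockInner m (vac m) (T (n + 1) B g (vac m) : domain m)) →
      IsReduction t τ →
      scalingDegree τ ≤ ((∑ j, (d j + ce) : ℕ) : EReal)

namespace TimeOrdered

variable {m : ℝ} {ce : ℕ} (P : TimeOrdered m ce)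

/-- The vacuum expectation value `(Ω| T(B₁(x₁),…,Bₙ(xₙ)) Ω)`. -/
def vev {n : ℕ} (B : Fin n → Sym) : 𝓢'(Cfg n, ℂ) :=
  (P.distribution n B (vac m) (vac m)).choose

lemma vev_apply {n : ℕ} (B : Fin n → Sym) (g : 𝓢(Cfg n, ℂ)) :
    P.vev B g = fockInner m (vac m) (P.T n B g (vac m) : domain m) :=
  (P.distribution n B (vac m) (vac m)).choose_spec g

open Classical in
/-- The generating functional `S(∑ g_j ⊗ B_j)`, as a formal power series: the variable with the
index `j` multiplies `g_j`. -/
def genFun {σ : Type} [Fintype σ] (B : σ → Sym) (g : σ → 𝓢(Mink, ℂ)) :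
    MvPowerSeries σ (Module.End ℂ (domain m)) := fun e =>
  (Complex.I ^ e.degree / (e.degree.factorial : ℂ)) •
    ∑ j : Fin e.degree → σ, if ∑ k, Finsupp.single (j k) 1 = e then
      P.T e.degree (B ∘ j) (tensor e.degree (g ∘ j)) else 0

/-- The exponent of the product of all variables. -/
def allOnes (σ : Type) [Fintype σ] : σ →₀ ℕ := ∑ j : σ, Finsupp.single j 1

/-- The generating functional `S(g + h)`, with `g = ∑ g_j ⊗ B_j` and `h = ∑ h_j ⊗ C_j`. -/
def genFull {n k : ℕ} (B : Fin n → Sym) (C : Fin k → Sym) (g : Fin n → 𝓢(Mink, ℂ))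
    (h : Fin k → 𝓢(Mink, ℂ)) : MvPowerSeries (Fin n ⊕ Fin k) (Module.End ℂ (domain m)) :=
  P.genFun (Sum.elim B C) (Sum.elim g h)

/-- The inverse `S(g)⁻¹`, with `g = ∑ g_j ⊗ B_j`. -/
def genInv {n : ℕ} (k : ℕ) (B : Fin n → Sym) (g : Fin n → 𝓢(Mink, ℂ)) :
    MvPowerSeries (Fin n ⊕ Fin k) (Module.End ℂ (domain m)) :=
  MvPowerSeries.invOfUnit (P.genFun (Sum.elim B fun _ => 0) (Sum.elim g fun _ => 0)) 1

/-- The advanced product `Adv(B₁(y₁),…,Bₙ(yₙ); C₁(x₁),…,C_k(x_k))`, smeared with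
`g₁(y₁)⋯gₙ(yₙ) h₁(x₁)⋯h_k(x_k)`: the functional derivative of `S(g + h) S(g)⁻¹`. -/
def advanced {n k : ℕ} (B : Fin n → Sym) (C : Fin k → Sym) (g : Fin n → 𝓢(Mink, ℂ))
    (h : Fin k → 𝓢(Mink, ℂ)) : Module.End ℂ (domain m) :=
  (-Complex.I) ^ (n + k) •
    MvPowerSeries.coeff (allOnes (Fin n ⊕ Fin k)) (P.genFull B C g h * P.genInv k B g)

/-- The retarded product: the functional derivative of `S(g)⁻¹ S(g + h)`. -/
def retarded {n k : ℕ} (B : Fin n → Sym) (C : Fin k → Sym) (g : Fin n → 𝓢(Mink, ℂ))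
    (h : Fin k → 𝓢(Mink, ℂ)) : Module.End ℂ (domain m) :=
  (-Complex.I) ^ (n + k) •
    MvPowerSeries.coeff (allOnes (Fin n ⊕ Fin k)) (P.genInv k B g * P.genFull B C g h)

/-- `a` is the vacuum expectation value of the advanced product. A tempered distribution is
determined by its values on products of test functions. -/
def IsAdvVEV {n k : ℕ} (B : Fin n → Sym) (C : Fin k → Sym) (a : 𝓢'(Cfg n × Cfg k, ℂ)) : Prop :=
  ∀ (g : Fin n → 𝓢(Mink, ℂ)) (h : Fin k → 𝓢(Mink, ℂ)),
    a (tensorLeft (tensor k h) (tensor n g)) =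
      fockInner m (vac m) (P.advanced B C g h (vac m) : domain m)

/-- `r` is the vacuum expectation value of the retarded product. -/
def IsRetVEV {n k : ℕ} (B : Fin n → Sym) (C : Fin k → Sym) (r : 𝓢'(Cfg n × Cfg k, ℂ)) : Prop :=
  ∀ (g : Fin n → 𝓢(Mink, ℂ)) (h : Fin k → 𝓢(Mink, ℂ)),
    r (tensorLeft (tensor k h) (tensor n g)) =
      fockInner m (vac m) (P.retarded B C g h (vac m) : domain m)

/-- The self-energy of `φ` in the second order has the value `c` at zero. Here the Fourier
transform of `(Ω| T(ψ²(x₁), ψ²(x₂)) Ω)` is `(2π)⁴ δ(q₁ + q₂) Σ(q₁)`, i.e. `Σ` is the Fourier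
transform of the distribution `(Ω| T(ψ²(x), ψ²(0)) Ω)`. -/
def SelfEnergyAtZero (c : ℂ) : Prop :=
  ∃ τ : 𝓢'(Cfg 1, ℂ), IsReduction (P.vev ![psi ^ 2, psi ^ 2]) τ ∧
    HasLojasiewiczValue (fourierDist τ) c

end TimeOrdered

end EG

end

/-! Suppose that the value at zero exists. In position space this means that the smeared product,
evaluated on `u(ε y₁, ε y₂)`, converges to a multiple of `u(0)` as `ε → 0`
(`HasLojasiewiczValue.tendsto_scaleArg`). Let `u = g ⊗ g`, where the support of `g` lies at strictly
positive times for Adv and at strictly negative times for Ret. Then `u(0) = 0` and the limit has to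
be zero. For a suitable `g` it is not.

Causality: put `ε = δ²` and cut off `f` at distances of order `δ⁻¹`, which is harmless because `f`
decays rapidly. The vertices sit at times of order `δ⁻²`, beyond all fields, so the product
factorizes (`advVEV_eq`, `retVEV_eq`). What remains is, up to a sign, the vacuum expectation value
of the commutator of `T(L,L)` with `T(φ,φ)`, and terms with a single `L` next to the vacuum. Since
`ψ` is massive, `L(g)Ω` and `(Ω|L(g)` see only momenta of norm at least `m`, whereas the rescaled
`g` has its Fourier transform concentrated at zero. Hence these terms tend to zero
(`tendsto_bilinear_scaleArg`); uniformity with respect to the moving cutoff comes from the uniform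
boundedness principle for bilinear forms.

Commutator: `T(φ,φ)Ω` is a multiple of the vacuum plus a state of two massless particles. In the
Wick expansion of `T(L,L)` only two terms survive: the one without external legs, which cancels in
the commutator, and the one with one `φ` leg at each vertex, whose coefficient is a quarter of
`(Ω|T(ψ²,ψ²)Ω)` (`innerLin_commutator`). Rescale the massless momenta by `ε`. The factor `ε⁴` of the
invariant measures cancels the `ε⁻⁴` of the integral over common translations, the wave function
tends to `2 f̃(0)`, and the self-energy contributes its value `c` (`tendsto_half_commutator`). The
limit is `½ f̃(0) c (I₊ - I₋)` with `I± = pairIntegral m (±1) (g ⊗ g)`; formally `I±` is the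
integral of `g(y)² D±(y)²`, where `D±` are the massless two-point functions.

Non-vanishing: take `g(y) = t χ(t) B(l x)`, with `t` the time and `x` the position. As `l → 0` the
two particles become back to back, the squared weight `|k|⁻²` cancels the `r²` of the radial
measure, and the integral of a derivative over a half-line remains. It is a boundary term
proportional to `± i ∫ t χ²`, so `I₊` and `I₋` have opposite nonzero limits and differ for some `l`
(`exists_pairIntegral_ne`). -/

noncomputable section
namespace EG

/-! ### Schwartz space as a Fréchet space and the uniform boundedness principle -/

section SchwartzNorm

variable {E F : Type*} [NormedAddCommGroup E] [NormedSpace ℝ E]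
  [NormedAddCommGroup F] [NormedSpace ℝ F]

/-- The maximum of the Schwartz seminorms with at most `N` powers and `N` derivatives. -/
def schwartzNorm (N : ℕ) : Seminorm ℂ 𝓢(E, ℂ) :=
  (Finset.Iic (N, N)).sup (schwartzSeminormFamily ℂ E ℂ)

lemma seminorm_le_schwartzNorm {N k n : ℕ} (hk : k ≤ N) (hn : n ≤ N) (f : 𝓢(E, ℂ)) :
    SchwartzMap.seminorm ℂ k n f ≤ schwartzNorm N f := by
  have : schwartzSeminormFamily ℂ E ℂ (k, n) ≤ schwartzNorm N :=
    Finset.le_sup (f := schwartzSeminormFamily ℂ E ℂ) (Finset.mem_Iic.2 (Prod.mk_le_mk.2 ⟨hk, hn⟩))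
  exact this f

lemma schwartzNorm_le {N : ℕ} {f : 𝓢(E, ℂ)} {C : ℝ} (hC : 0 ≤ C)
    (h : ∀ k ≤ N, ∀ n ≤ N, SchwartzMap.seminorm ℂ k n f ≤ C) : schwartzNorm N f ≤ C := by
  refine Seminorm.finset_sup_apply_le hC ?_
  rintro ⟨k, n⟩ hkn
  rw [Finset.mem_Iic, Prod.mk_le_mk] at hkn
  exact h k hkn.1 n hkn.2

lemma schwartzNorm_le' {N : ℕ} {f : 𝓢(E, ℂ)} {C : ℝ} (hC : 0 ≤ C)
    (h : ∀ k ≤ N, ∀ n ≤ N, ∀ x, ‖x‖ ^ k * ‖iteratedFDeriv ℝ n f x‖ ≤ C) :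
    schwartzNorm N f ≤ C :=
  schwartzNorm_le hC fun k hk n hn => SchwartzMap.seminorm_le_bound ℂ k n f hC (h k hk n hn)

lemma schwartzNorm_mono {N M : ℕ} (h : N ≤ M) (f : 𝓢(E, ℂ)) :
    schwartzNorm N f ≤ schwartzNorm M f :=
  schwartzNorm_le (apply_nonneg _ _) fun _ hk _ hn =>
    seminorm_le_schwartzNorm (hk.trans h) (hn.trans h) f

lemma pow_mul_iteratedFDeriv_le {N k n : ℕ} (hk : k ≤ N) (hn : n ≤ N) (f : 𝓢(E, ℂ)) (x : E) :
    ‖x‖ ^ k * ‖iteratedFDeriv ℝ n f x‖ ≤ schwartzNorm N f :=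
  (SchwartzMap.le_seminorm ℂ k n f x).trans (seminorm_le_schwartzNorm hk hn f)

lemma one_add_pow_mul_iteratedFDeriv_le {N k n : ℕ} (hk : k ≤ N) (hn : n ≤ N) (f : 𝓢(E, ℂ))
    (x : E) : (1 + ‖x‖) ^ k * ‖iteratedFDeriv ℝ n f x‖ ≤ 2 ^ N * schwartzNorm N f :=
  SchwartzMap.one_add_le_sup_seminorm_apply (𝕜 := ℂ) (m := (N, N)) hk hn f x

lemma norm_apply_le_schwartzNorm (N : ℕ) (f : 𝓢(E, ℂ)) (x : E) : ‖f x‖ ≤ schwartzNorm N f := by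
  simpa using pow_mul_iteratedFDeriv_le (Nat.zero_le N) (Nat.zero_le N) f x

lemma norm_apply_le_one_add_inv (N : ℕ) (f : 𝓢(E, ℂ)) (x : E) :
    ‖f x‖ ≤ 2 ^ N * schwartzNorm N f * ((1 + ‖x‖) ^ N)⁻¹ := by
  have h := one_add_pow_mul_iteratedFDeriv_le le_rfl (Nat.zero_le N) f x
  rw [norm_iteratedFDeriv_zero] at h
  have hp : (0 : ℝ) < (1 + ‖x‖) ^ N := by positivity
  rw [← div_eq_mul_inv, le_div_iff₀ hp, mul_comm]
  exact h

/-- The topology is generated by the seminorms, and `schwartzNorm N` increases with `N`. Hence one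
index, the largest occurring in the finite family that bounds `q`, suffices. -/
lemma exists_schwartzNorm_bound_of_continuous {q : Seminorm ℂ 𝓢(E, ℂ)} (hq : Continuous q) :
    ∃ (N : ℕ) (C : ℝ), 0 ≤ C ∧ ∀ f, q f ≤ C * schwartzNorm N f := by
  obtain ⟨s, C, -, h⟩ := Seminorm.bound_of_continuous (schwartz_withSeminorms ℂ E ℂ) q hq
  refine ⟨s.sup (fun p => max p.1 p.2), C, C.2, fun f => (h f).trans ?_⟩
  rw [smul_apply, NNReal.smul_def, smul_eq_mul]
  refine mul_le_mul_of_nonneg_left ?_ C.2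
  refine Seminorm.finset_sup_apply_le (apply_nonneg _ _) fun p hp => ?_
  have hle := Finset.le_sup (f := fun p : ℕ × ℕ => max p.1 p.2) hp
  exact seminorm_le_schwartzNorm ((le_max_left _ _).trans hle) ((le_max_right _ _).trans hle) f

lemma continuous_schwartzNorm (N : ℕ) : Continuous (schwartzNorm N : Seminorm ℂ 𝓢(E, ℂ)) := by
  have h : ∀ s : Finset (ℕ × ℕ), Continuous ⇑(s.sup (schwartzSeminormFamily ℂ E ℂ)) := by
    intro s
    refine Seminorm.continuous' (r := 1) ?_
    exact (schwartz_withSeminorms ℂ E ℂ).mem_nhds_iff _ _ |>.2 ⟨s, 1, one_pos, by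
      intro x hx
      rw [Seminorm.mem_closedBall]
      rw [Seminorm.mem_ball] at hx
      exact hx.le⟩
  exact h _

lemma exists_bound_clm (D : 𝓢(E, ℂ) →L[ℂ] ℂ) :
    ∃ (N : ℕ) (C : ℝ), 0 ≤ C ∧ ∀ f, ‖D f‖ ≤ C * schwartzNorm N f :=
  exists_schwartzNorm_bound_of_continuous
    (q := (normSeminorm ℂ ℂ).comp (D : 𝓢(E, ℂ) →ₗ[ℂ] ℂ)) (continuous_norm.comp D.continuous)

lemma exists_bound_map (D : 𝓢(E, ℂ) →L[ℂ] 𝓢(F, ℂ)) (M : ℕ) :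
    ∃ (N : ℕ) (C : ℝ), 0 ≤ C ∧ ∀ f, schwartzNorm M (D f) ≤ C * schwartzNorm N f :=
  exists_schwartzNorm_bound_of_continuous
    (q := (schwartzNorm M).comp (D : 𝓢(E, ℂ) →ₗ[ℂ] 𝓢(F, ℂ)))
    ((continuous_schwartzNorm M).comp D.continuous)

lemma tendsto_schwartz_iff {ι : Type*} {l : Filter ι} {u : ι → 𝓢(E, ℂ)} {f : 𝓢(E, ℂ)} :
    Tendsto u l (𝓝 f) ↔ ∀ N, Tendsto (fun i => schwartzNorm N (u i - f)) l (𝓝 0) := by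
  constructor
  · intro h N
    have := ((continuous_schwartzNorm N).tendsto (0 : 𝓢(E, ℂ))).comp (tendsto_sub_nhds_zero_iff.2 h)
    simpa [Function.comp_def] using this
  · intro h
    refine ((schwartz_withSeminorms ℂ E ℂ).tendsto_nhds u f).2 ?_
    rintro ⟨k, n⟩ ε hε
    filter_upwards [(h (max k n)).eventually (gt_mem_nhds hε)] with i hi
    exact (seminorm_le_schwartzNorm (le_max_left k n) (le_max_right k n) _).trans_lt hi

/-- The sum of a series of Schwartz functions with summable seminorms. -/
def schwartzTsum (g : ℕ → 𝓢(E, ℂ)) (hg : ∀ k n, Summable fun j => SchwartzMap.seminorm ℂ k n (g j)) :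
    𝓢(E, ℂ) where
  toFun x := ∑' j, g j x
  smooth' := contDiff_tsum (v := fun k j => SchwartzMap.seminorm ℂ 0 k (g j))
    (fun j => (g j).smooth ⊤) (fun k _ => hg 0 k)
    (fun k j x _ => SchwartzMap.norm_iteratedFDeriv_le_seminorm ℂ (g j) k x)
  decay' := by
    intro k n
    refine ⟨∑' j, SchwartzMap.seminorm ℂ k n (g j), fun x => ?_⟩
    rw [iteratedFDeriv_tsum_apply (v := fun k j => SchwartzMap.seminorm ℂ 0 k (g j)) (N := ⊤)
      (fun j => (g j).smooth ⊤) (fun k _ => hg 0 k)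
      (fun k j x _ => SchwartzMap.norm_iteratedFDeriv_le_seminorm ℂ (g j) k x) (le_top)]
    rw [← norm_norm x, ← norm_pow, ← norm_smul, ← tsum_const_smul'']
    refine tsum_of_norm_bounded (hg k n).hasSum fun j => ?_
    rw [norm_smul, norm_pow, norm_norm]
    exact SchwartzMap.le_seminorm ℂ k n (g j) x

lemma seminorm_schwartzTsum_le (g : ℕ → 𝓢(E, ℂ))
    (hg : ∀ k n, Summable fun j => SchwartzMap.seminorm ℂ k n (g j)) (k n : ℕ) :
    SchwartzMap.seminorm ℂ k n (schwartzTsum g hg) ≤ ∑' j, SchwartzMap.seminorm ℂ k n (g j) := by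
  refine SchwartzMap.seminorm_le_bound ℂ k n _ (tsum_nonneg fun j => apply_nonneg _ _) fun x => ?_
  have : (schwartzTsum g hg : E → ℂ) = fun x => ∑' j, g j x := rfl
  rw [this, iteratedFDeriv_tsum_apply (v := fun k j => SchwartzMap.seminorm ℂ 0 k (g j)) (N := ⊤)
      (fun j => (g j).smooth ⊤) (fun k _ => hg 0 k)
      (fun k j x _ => SchwartzMap.norm_iteratedFDeriv_le_seminorm ℂ (g j) k x) (le_top)]
  rw [← norm_norm x, ← norm_pow, ← norm_smul, ← tsum_const_smul'']
  refine tsum_of_norm_bounded (hg k n).hasSum fun j => ?_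
  rw [norm_smul, norm_pow, norm_norm]
  exact SchwartzMap.le_seminorm ℂ k n (g j) x

instance schwartz_uniformity_isCountablyGenerated : (uniformity 𝓢(E, ℂ)).IsCountablyGenerated :=
  IsUniformAddGroup.uniformity_countably_generated

lemma schwartzNorm_le_sum (f : 𝓢(E, ℂ)) (N : ℕ) (a : ℕ × ℕ → ℝ) (h0 : ∀ p, 0 ≤ a p)
    (h : ∀ k n, SchwartzMap.seminorm ℂ k n f ≤ a (k, n)) :
    schwartzNorm N f ≤ ∑ p ∈ Finset.Iic (N, N), a p := by
  refine schwartzNorm_le (Finset.sum_nonneg fun p _ => h0 p) fun k hk n hn => ?_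
  have hmem : (k, n) ∈ Finset.Iic (N, N) := Finset.mem_Iic.2 (Prod.mk_le_mk.2 ⟨hk, hn⟩)
  exact (h k n).trans (Finset.single_le_sum (fun p _ => h0 p) hmem)

/-- Telescoping: the limit is `u 0` plus the series of the increments, and the distance of `u J`
from it is a tail of that series, estimated in every seminorm by the tail of a convergent numerical
series. -/
lemma exists_tendsto_of_summable_seminorm (u : ℕ → 𝓢(E, ℂ))
    (hs : ∀ k n, Summable fun j => SchwartzMap.seminorm ℂ k n (u (j + 1) - u j)) :
    ∃ f, Tendsto u atTop (𝓝 f) := by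
  have hs' : ∀ J k n, Summable fun j => SchwartzMap.seminorm ℂ k n (u (j + J + 1) - u (j + J)) :=
    fun J k n => (summable_nat_add_iff (f := fun j =>
      SchwartzMap.seminorm ℂ k n (u (j + 1) - u j)) J).2 (hs k n)
  set R : ℕ → 𝓢(E, ℂ) := fun J => schwartzTsum _ (hs' J) with hR
  have hd : ∀ J, u J - (u 0 + R 0) = - R J := by
    intro J
    ext x
    have h1 : Summable fun j => (u (j + 1) - u j) x := by
      refine Summable.of_norm_bounded (hs 0 0) fun j => ?_
      exact SchwartzMap.norm_le_seminorm ℂ (u (j + 1) - u j) x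
    have h2 := h1.sum_add_tsum_nat_add J
    have h3 : ∑ j ∈ Finset.range J, (u (j + 1) - u j) x = u J x - u 0 x :=
      Finset.sum_range_sub (fun j => u j x) J
    change u J x - (u 0 x + ∑' j, (u (j + 1) - u j) x) = - ∑' j, (u (j + J + 1) - u (j + J)) x
    rw [← h2, h3]
    ring
  refine ⟨u 0 + R 0, ?_⟩
  rw [tendsto_schwartz_iff]
  intro N
  have hle : ∀ J, schwartzNorm N (u J - (u 0 + R 0)) ≤
      ∑ p ∈ Finset.Iic (N, N), ∑' j, SchwartzMap.seminorm ℂ p.1 p.2 (u (j + J + 1) - u (j + J)) := by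
    intro J
    rw [hd, map_neg_eq_map]
    refine schwartzNorm_le_sum _ N (fun p =>
      ∑' j, SchwartzMap.seminorm ℂ p.1 p.2 (u (j + J + 1) - u (j + J))) (fun p => ?_) fun k n => ?_
    · exact tsum_nonneg fun j => apply_nonneg _ _
    · exact seminorm_schwartzTsum_le _ (hs' J) k n
  have hlim : Tendsto (fun J => ∑ p ∈ Finset.Iic (N, N),
      ∑' j, SchwartzMap.seminorm ℂ p.1 p.2 (u (j + J + 1) - u (j + J))) atTop
      (𝓝 (∑ p ∈ Finset.Iic (N, N), (0 : ℝ))) :=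
    tendsto_finsetSum _ fun p _ =>
      tendsto_sum_nat_add fun j => SchwartzMap.seminorm ℂ p.1 p.2 (u (j + 1) - u j)
  rw [Finset.sum_const_zero] at hlim
  exact squeeze_zero (fun J => apply_nonneg _ _) hle hlim

/-- The uniformity has a countable basis, so it is enough to treat sequences whose increments are
controlled by `2⁻ᴺ` in the `N`-th norm. In each fixed seminorm such increments are eventually
dominated by a geometric series. -/
instance schwartz_completeSpace : CompleteSpace 𝓢(E, ℂ) := by
  refine UniformSpace.complete_of_convergent_controlled_sequences
    (fun N : ℕ => {p : 𝓢(E, ℂ) × 𝓢(E, ℂ) | schwartzNorm N (p.2 - p.1) < (1 / 2) ^ N}) ?_ ?_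
  · intro N
    rw [uniformity_eq_comap_nhds_zero]
    refine ⟨{f | schwartzNorm N f < (1 / 2) ^ N}, ?_, fun p hp => hp⟩
    exact (isOpen_lt (continuous_schwartzNorm N) continuous_const).mem_nhds (by simp)
  · intro u hu
    refine exists_tendsto_of_summable_seminorm u fun k n => ?_
    refine Summable.of_norm_bounded_eventually_nat (g := fun j => (1 / 2 : ℝ) ^ j)
      summable_geometric_two ?_
    filter_upwards [eventually_ge_atTop (max k n)] with j hj
    rw [Real.norm_of_nonneg (apply_nonneg _ _)]
    exact (seminorm_le_schwartzNorm ((le_max_left k n).trans hj) ((le_max_right k n).trans hj)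
      _).trans (hu j j (j + 1) le_rfl (Nat.le_succ j)).le

/-- Complete and metrizable implies Baire, and Baire implies barrelled. This is the hypothesis of
the Banach–Steinhaus theorem. -/
instance schwartz_barrelledSpace : BarrelledSpace ℂ 𝓢(E, ℂ) := by
  let _ := UniformSpace.pseudoMetricSpace 𝓢(E, ℂ)
  have : BaireSpace 𝓢(E, ℂ) := inferInstance
  exact BaireSpace.instBarrelledSpace

/-- The uniform boundedness principle for tempered distributions. -/
lemma exists_uniform_bound {ι : Type*} (D : ι → 𝓢(E, ℂ) →L[ℂ] ℂ)
    (h : ∀ f, ∃ C, ∀ i, ‖D i f‖ ≤ C) :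
    ∃ (N : ℕ) (C : ℝ), 0 ≤ C ∧ ∀ i f, ‖D i f‖ ≤ C * schwartzNorm N f := by
  set p : ι → Seminorm ℂ 𝓢(E, ℂ) := fun i =>
    (normSeminorm ℂ ℂ).comp (D i : 𝓢(E, ℂ) →ₗ[ℂ] ℂ) with hp
  have hb : BddAbove (Set.range p) := by
    rw [Seminorm.bddAbove_range_iff]
    intro f
    obtain ⟨C, hC⟩ := h f
    exact ⟨C, by rintro _ ⟨i, rfl⟩; exact hC i⟩
  have hc := Seminorm.continuous_iSup p (fun i => continuous_norm.comp (D i).continuous) hb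
  rw [← Seminorm.coe_iSup_eq hb] at hc
  obtain ⟨N, C, hC, hle⟩ := exists_schwartzNorm_bound_of_continuous hc
  refine ⟨N, C, hC, fun i f => le_trans ?_ (hle f)⟩
  have hi : p i ≤ ⨆ i, p i := le_ciSup (f := p) hb i
  exact hi f

end SchwartzNorm
end EG
end

open scoped SchwartzMap LineDeriv BoundedContinuousFunction
noncomputable section
namespace EG

/-! ### Interchanging tempered distributions with integrals of Schwartz functions -/

section Superposition

variable {E : Type*} [NormedAddCommGroup E] [NormedSpace ℝ E]
variable {Z : Type*} [MeasurableSpace Z] {μ : Measure Z}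

/-- `z ↦ γ z` is a family of Schwartz functions all of whose seminorms are integrable. -/
structure SchwartzIntegrable (γ : Z → 𝓢(E, ℂ)) (μ : Measure Z) : Prop where
  aestronglyMeasurable : AEStronglyMeasurable γ μ
  integrable_norm : ∀ N, Integrable (fun z => schwartzNorm N (γ z)) μ

lemma SchwartzIntegrable.map {F : Type*} [NormedAddCommGroup F] [NormedSpace ℝ F]
    {γ : Z → 𝓢(E, ℂ)} (hγ : SchwartzIntegrable γ μ) (A : 𝓢(E, ℂ) →L[ℂ] 𝓢(F, ℂ)) :
    SchwartzIntegrable (fun z => A (γ z)) μ where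
  aestronglyMeasurable := A.continuous.comp_aestronglyMeasurable hγ.1
  integrable_norm M := by
    obtain ⟨N, C, hC, h⟩ := exists_bound_map A M
    refine ((hγ.2 N).const_mul C).mono' ?_ (Eventually.of_forall fun z => ?_)
    · exact ((continuous_schwartzNorm M).comp A.continuous).comp_aestronglyMeasurable hγ.1
    · rw [Real.norm_of_nonneg (apply_nonneg _ _)]
      exact h _

lemma SchwartzIntegrable.clm {γ : Z → 𝓢(E, ℂ)} (hγ : SchwartzIntegrable γ μ)
    (D : 𝓢(E, ℂ) →L[ℂ] ℂ) : Integrable (fun z => D (γ z)) μ := by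
  obtain ⟨N, C, hC, h⟩ := exists_bound_clm D
  exact ((hγ.2 N).const_mul C).mono' (D.continuous.comp_aestronglyMeasurable hγ.1)
    (Eventually.of_forall fun z => h _)

lemma SchwartzIntegrable.apply {γ : Z → 𝓢(E, ℂ)} (hγ : SchwartzIntegrable γ μ) (x : E) :
    Integrable (fun z => γ z x) μ :=
  hγ.clm (TemperedDistribution.delta x)

/-- Differentiation under the integral sign; the sup norm of the derivative of `γ z`, which does not
depend on the point, serves as the integrable majorant. -/
lemma lineDerivOp_apply_eq_integral {γ : Z → 𝓢(E, ℂ)} (hγ : SchwartzIntegrable γ μ)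
    {H : 𝓢(E, ℂ)} (hH : ∀ x, H x = ∫ z, γ z x ∂μ) (m x : E) :
    (∂_{m} H) x = ∫ z, (∂_{m} (γ z)) x ∂μ := by
  have hγ' : SchwartzIntegrable (fun z => ∂_{m} (γ z)) μ :=
    hγ.map (LineDeriv.lineDerivOpCLM ℂ 𝓢(E, ℂ) m)
  have key := hasDerivAt_integral_of_dominated_loc_of_deriv_le (𝕜 := ℝ) (μ := μ)
    (F := fun t z => γ z (x + t • m)) (F' := fun t z => (∂_{m} (γ z)) (x + t • m)) (x₀ := 0)
    (s := Set.univ) (bound := fun z => schwartzNorm 0 (∂_{m} (γ z))) univ_mem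
    (Eventually.of_forall fun t => (hγ.apply _).1) (hγ.apply _) (hγ'.apply _).1
    (Eventually.of_forall fun z t _ => norm_apply_le_schwartzNorm 0 _ _) (hγ'.2 0)
    (Eventually.of_forall fun z t _ => by
      have h1 := ((γ z).hasFDerivAt (x + t • m)).comp_hasDerivAt t
        (((hasDerivAt_id t).smul_const m).const_add x)
      rw [one_smul] at h1
      rw [SchwartzMap.lineDerivOp_apply_eq_fderiv]
      exact h1)
  have h2 : HasDerivAt (fun t : ℝ => H (x + t • m)) (∫ z, (∂_{m} (γ z)) x ∂μ) 0 := by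
    simpa [hH] using key.2
  rw [SchwartzMap.lineDerivOp_apply]
  exact h2.deriv

lemma iteratedFDeriv_apply_eq_integral {n : ℕ} (m : Fin n → E) {γ : Z → 𝓢(E, ℂ)}
    (hγ : SchwartzIntegrable γ μ) {H : 𝓢(E, ℂ)} (hH : ∀ x, H x = ∫ z, γ z x ∂μ) (x : E) :
    iteratedFDeriv ℝ n H x m = ∫ z, iteratedFDeriv ℝ n (γ z) x m ∂μ := by
  simp only [← SchwartzMap.iteratedLineDerivOp_eq_iteratedFDeriv]
  induction n generalizing γ H with
  | zero => simpa using hH x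
  | succ n ih =>
    simp only [LineDeriv.iteratedLineDerivOp_succ_right]
    exact ih _ (hγ.map (LineDeriv.lineDerivOpCLM ℂ 𝓢(E, ℂ) (m (Fin.last n))))
      (fun x => lineDerivOp_apply_eq_integral hγ hH _ x)

/-- Bounded continuous functions recording the weighted derivatives up to the order `N`. -/
def JetSpace (E : Type*) [NormedAddCommGroup E] [NormedSpace ℝ E] (N : ℕ) :=
  ∀ p : Fin (N + 1) × Fin (N + 1), E →ᵇ (E [×(p.2 : ℕ)]→L[ℝ] ℂ)

instance (N : ℕ) : NormedAddCommGroup (JetSpace E N) :=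
  inferInstanceAs (NormedAddCommGroup
    (∀ p : Fin (N + 1) × Fin (N + 1), E →ᵇ (E [×(p.2 : ℕ)]→L[ℝ] ℂ)))

instance (N : ℕ) : NormedSpace ℂ (JetSpace E N) :=
  inferInstanceAs (NormedSpace ℂ
    (∀ p : Fin (N + 1) × Fin (N + 1), E →ᵇ (E [×(p.2 : ℕ)]→L[ℝ] ℂ)))

instance (N : ℕ) : CompleteSpace (JetSpace E N) :=
  inferInstanceAs (CompleteSpace
    (∀ p : Fin (N + 1) × Fin (N + 1), E →ᵇ (E [×(p.2 : ℕ)]→L[ℝ] ℂ)))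

/-- The weighted derivatives `‖x‖ᵏ Dⁿ f(x)`, for `k, n ≤ N`. -/
def jet (N : ℕ) : 𝓢(E, ℂ) →ₗ[ℂ] JetSpace E N where
  toFun f p := BoundedContinuousFunction.ofNormedAddCommGroup
    (fun x => (‖x‖ ^ (p.1 : ℕ) : ℝ) • iteratedFDeriv ℝ p.2 f x)
    ((continuous_norm.pow _).smul ((f.smooth ⊤).continuous_iteratedFDeriv (mod_cast le_top)))
    (schwartzNorm N f) (fun x => by
      rw [norm_smul, norm_pow, norm_norm]
      exact pow_mul_iteratedFDeriv_le (Fin.is_le _) (Fin.is_le _) f x)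
  map_add' f g := by
    funext p
    ext x m
    have : iteratedFDeriv ℝ p.2 (f + g : 𝓢(E, ℂ)) x =
        iteratedFDeriv ℝ p.2 f x + iteratedFDeriv ℝ p.2 g x :=
      iteratedFDeriv_add_apply ((f.smooth _).contDiffAt) ((g.smooth _).contDiffAt)
    change (‖x‖ ^ (p.1 : ℕ) : ℝ) • iteratedFDeriv ℝ p.2 (f + g : 𝓢(E, ℂ)) x m =
      (‖x‖ ^ (p.1 : ℕ) : ℝ) • iteratedFDeriv ℝ p.2 f x m +
      (‖x‖ ^ (p.1 : ℕ) : ℝ) • iteratedFDeriv ℝ p.2 g x m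
    rw [this, add_apply, smul_add]
  map_smul' c f := by
    funext p
    ext x m
    have : iteratedFDeriv ℝ p.2 (c • f : 𝓢(E, ℂ)) x = c • iteratedFDeriv ℝ p.2 f x :=
      iteratedFDeriv_const_smul_apply ((f.smooth _).contDiffAt)
    change (‖x‖ ^ (p.1 : ℕ) : ℝ) • iteratedFDeriv ℝ p.2 (c • f : 𝓢(E, ℂ)) x m =
      c • (‖x‖ ^ (p.1 : ℕ) : ℝ) • iteratedFDeriv ℝ p.2 f x m
    rw [this, smul_apply, smul_comm]

lemma jet_apply (N : ℕ) (f : 𝓢(E, ℂ)) (p : Fin (N + 1) × Fin (N + 1)) (x : E) :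
    jet N f p x = (‖x‖ ^ (p.1 : ℕ) : ℝ) • iteratedFDeriv ℝ p.2 f x := rfl

lemma norm_jet_le (N : ℕ) (f : 𝓢(E, ℂ)) : ‖jet N f‖ ≤ schwartzNorm N f := by
  refine (pi_norm_le_iff_of_nonneg (x := (jet N f : ∀ p : Fin (N + 1) × Fin (N + 1),
    E →ᵇ (E [×(p.2 : ℕ)]→L[ℝ] ℂ))) (apply_nonneg _ _)).2 fun p => ?_
  refine (BoundedContinuousFunction.norm_le (apply_nonneg _ _)).2 fun x => ?_
  rw [jet_apply, norm_smul, norm_pow, norm_norm]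
  exact pow_mul_iteratedFDeriv_le (Fin.is_le _) (Fin.is_le _) f x

lemma schwartzNorm_le_norm_jet (N : ℕ) (f : 𝓢(E, ℂ)) : schwartzNorm N f ≤ ‖jet N f‖ := by
  refine schwartzNorm_le' (norm_nonneg _) fun k hk n hn x => ?_
  have h1 := (jet N f (⟨k, Nat.lt_succ_of_le hk⟩, ⟨n, Nat.lt_succ_of_le hn⟩)).norm_coe_le_norm x
  rw [jet_apply, norm_smul, norm_pow, norm_norm] at h1
  exact h1.trans (norm_le_pi_norm (jet N f : ∀ p : Fin (N + 1) × Fin (N + 1),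
    E →ᵇ (E [×(p.2 : ℕ)]→L[ℝ] ℂ)) _)

/-- The evaluation of a jet. -/
def jetEval (N : ℕ) (p : Fin (N + 1) × Fin (N + 1)) (x : E) (m : Fin p.2 → E) :
    JetSpace E N →L[ℂ] ℂ :=
  LinearMap.mkContinuous
    { toFun := fun φ => φ p x m
      map_add' := fun _ _ => rfl
      map_smul' := fun _ _ => rfl } (∏ i, ‖m i‖) fun φ => by
    have h1 : ‖φ p x m‖ ≤ ‖φ p x‖ * ∏ i, ‖m i‖ := (φ p x).le_opNorm m
    have h2 : ‖φ p‖ ≤ ‖φ‖ := norm_le_pi_norm (φ : ∀ p : Fin (N + 1) × Fin (N + 1),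
      E →ᵇ (E [×(p.2 : ℕ)]→L[ℝ] ℂ)) p
    have h3 := ((φ p).norm_coe_le_norm x).trans h2
    rw [mul_comm]
    exact h1.trans (mul_le_mul_of_nonneg_right h3 (by positivity))

lemma continuous_jet (N : ℕ) : Continuous (jet N : 𝓢(E, ℂ) →ₗ[ℂ] JetSpace E N) := by
  refine continuous_of_continuousAt_zero (jet N).toAddMonoidHom ?_
  have h0 : Tendsto (fun f : 𝓢(E, ℂ) => schwartzNorm N f) (𝓝 0) (𝓝 0) := by
    simpa using (continuous_schwartzNorm (E := E) N).tendsto 0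
  have h1 : Tendsto (fun f : 𝓢(E, ℂ) => jet N f) (𝓝 0) (𝓝 0) :=
    squeeze_zero_norm (fun f => norm_jet_le N f) h0
  change Tendsto (fun f : 𝓢(E, ℂ) => jet N f) (𝓝 0) (𝓝 (jet N 0))
  rw [map_zero]
  exact h1

lemma jet_injective (N : ℕ) : Function.Injective (jet N : 𝓢(E, ℂ) →ₗ[ℂ] JetSpace E N) := by
  refine (injective_iff_map_eq_zero (jet N)).2 fun f hf => ?_
  have h := schwartzNorm_le_norm_jet N f
  rw [hf, norm_zero] at h
  ext x
  have := (norm_apply_le_schwartzNorm N f x).trans h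
  simpa using this

/-- Schwartz space is not normed, so the Bochner integral is not directly available in it. A
distribution is however bounded by one norm, hence factors through the jets in a Banach space, and
the Hahn–Banach theorem extends it to all of that space. -/
lemma exists_extension_jet (D : 𝓢(E, ℂ) →L[ℂ] ℂ) :
    ∃ (N : ℕ) (l : JetSpace E N →L[ℂ] ℂ), ∀ f, l (jet N f) = D f := by
  obtain ⟨N, C, hC, hD⟩ := exists_bound_clm D
  set e := LinearEquiv.ofInjective (jet N : 𝓢(E, ℂ) →ₗ[ℂ] JetSpace E N) (jet_injective N) with he
  set φ : LinearMap.range (jet N : 𝓢(E, ℂ) →ₗ[ℂ] JetSpace E N) →ₗ[ℂ] ℂ :=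
    (D : 𝓢(E, ℂ) →ₗ[ℂ] ℂ).comp (e.symm : _ →ₗ[ℂ] 𝓢(E, ℂ)) with hφ
  have hb : ∀ v, ‖φ v‖ ≤ C * ‖v‖ := by
    intro v
    obtain ⟨f, rfl⟩ := e.surjective v
    have h1 : φ (e f) = D f := by simp [hφ]
    rw [h1]
    exact (hD f).trans (mul_le_mul_of_nonneg_left (schwartzNorm_le_norm_jet N f) hC)
  obtain ⟨l, hl, -⟩ := exists_extension_norm_eq _ (φ.mkContinuous C hb)
  refine ⟨N, l, fun f => ?_⟩
  have := hl (e f)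
  rw [LinearMap.mkContinuous_apply] at this
  have h1 : φ (e f) = D f := by simp [hφ]
  rw [← h1, ← this]
  rfl

/-- Tempered distributions can be interchanged with integrals of Schwartz functions. -/
theorem clm_apply_eq_integral {γ : Z → 𝓢(E, ℂ)} (hγ : SchwartzIntegrable γ μ) {H : 𝓢(E, ℂ)}
    (hH : ∀ x, H x = ∫ z, γ z x ∂μ) (D : 𝓢(E, ℂ) →L[ℂ] ℂ) : D H = ∫ z, D (γ z) ∂μ := by
  obtain ⟨N, l, hl⟩ := exists_extension_jet D
  have hint : Integrable (fun z => jet N (γ z)) μ :=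
    (hγ.2 N).mono' ((continuous_jet N).comp_aestronglyMeasurable hγ.1)
      (Eventually.of_forall fun z => norm_jet_le N _)
  -- Elements of the jet space are determined by their point evaluations. These are continuous
  -- functionals, so they commute with the Bochner integral, and the claim becomes differentiation
  -- under the integral sign.
  have hJ : jet N H = ∫ z, jet N (γ z) ∂μ := by
    funext p
    ext x m
    have h1 := ContinuousLinearMap.integral_comp_comm (jetEval N p x m) hint
    have h2 : jet N H p x m = ∫ z, jet N (γ z) p x m ∂μ := by
      simp only [jet_apply, smul_apply]
      rw [iteratedFDeriv_apply_eq_integral m hγ hH x, integral_smul]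
    rw [h2]
    exact h1
  rw [← hl, hJ, ← ContinuousLinearMap.integral_comp_comm _ hint]
  simp only [hl]

end Superposition

/-! ### Equicontinuity of families of bilinear forms -/

section Bilinear

variable {E F : Type*} [NormedAddCommGroup E] [NormedSpace ℝ E]
  [NormedAddCommGroup F] [NormedSpace ℝ F]

/-- A pointwise bounded family of separately continuous bilinear forms is equicontinuous. -/
theorem exists_uniform_bound_bilinear {ι : Type*} (B : ι → 𝓢(E, ℂ) → 𝓢(F, ℂ) → ℂ)
    (h1 : ∀ i g, ∃ D : 𝓢(E, ℂ) →L[ℂ] ℂ, ∀ f, D f = B i f g)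
    (h2 : ∀ i f, ∃ D : 𝓢(F, ℂ) →L[ℂ] ℂ, ∀ g, D g = B i f g)
    (hb : ∀ f g, ∃ C, ∀ i, ‖B i f g‖ ≤ C) :
    ∃ (N : ℕ) (C : ℝ), 0 ≤ C ∧ ∀ i f g, ‖B i f g‖ ≤ C * schwartzNorm N f * schwartzNorm N g := by
  choose D1 hD1 using h1
  choose D2 hD2 using h2
  have hsm1 : ∀ i (c : ℂ) f g, B i (c • f) g = c * B i f g := fun i c f g => by
    rw [← hD1, ← hD1, map_smul, smul_eq_mul]
  have hsm2 : ∀ i (c : ℂ) f g, B i f (c • g) = c * B i f g := fun i c f g => by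
    rw [← hD2, ← hD2, map_smul, smul_eq_mul]
  -- If no `N` works, there are violating `f n`, `g n` of norm at most one in the `n`-th norm.
  -- Divided by `n + 1` they form null sequences in every norm, yet the forms remain larger than one
  -- on them.
  have key : ∃ N : ℕ, ∀ i f g, schwartzNorm N f ≤ 1 → schwartzNorm N g ≤ 1 →
      ‖B i f g‖ ≤ ((N : ℝ) + 1) ^ 2 := by
    by_contra! hcon
    choose i f g hf hg hB using hcon
    set u : ℕ → 𝓢(E, ℂ) := fun n => ((n : ℂ) + 1)⁻¹ • f n with hu
    set v : ℕ → 𝓢(F, ℂ) := fun n => ((n : ℂ) + 1)⁻¹ • g n with hv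
    have hnn : ∀ n : ℕ, ‖((n : ℂ) + 1)⁻¹‖ = ((n : ℝ) + 1)⁻¹ := fun n => by
      rw [norm_inv]
      have : ((n : ℂ) + 1) = ((n + 1 : ℕ) : ℂ) := by push_cast; ring
      rw [this, Complex.norm_natCast]
      push_cast; ring
    have hlim : Tendsto (fun n : ℕ => ((n : ℝ) + 1)⁻¹) atTop (𝓝 0) := by
      simpa [one_div] using tendsto_one_div_add_atTop_nhds_zero_nat (𝕜 := ℝ)
    have hu0 : ∀ N, Tendsto (fun n => schwartzNorm N (u n)) atTop (𝓝 0) := by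
      intro N
      refine squeeze_zero' (Eventually.of_forall fun n => apply_nonneg _ _) ?_ hlim
      filter_upwards [eventually_ge_atTop N] with n hn
      rw [hu, map_smul_eq_mul, hnn]
      refine mul_le_of_le_one_right (by positivity) ?_
      exact (schwartzNorm_mono hn _).trans (hf n)
    have hv0 : ∀ N, Tendsto (fun n => schwartzNorm N (v n)) atTop (𝓝 0) := by
      intro N
      refine squeeze_zero' (Eventually.of_forall fun n => apply_nonneg _ _) ?_ hlim
      filter_upwards [eventually_ge_atTop N] with n hn
      rw [hv, map_smul_eq_mul, hnn]
      refine mul_le_of_le_one_right (by positivity) ?_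
      exact (schwartzNorm_mono hn _).trans (hg n)
    -- Banach–Steinhaus is used twice. For fixed `g'` the functionals of the first argument are
    -- equibounded, so they stay bounded along `u n`. Hence the functionals `B (i n) (u n) ·` are
    -- pointwise bounded, thus equibounded, and tend to zero along `v n`: a contradiction.
    obtain ⟨N, C, hC, hbd⟩ := exists_uniform_bound (fun n => D2 (i n) (u n)) (fun g' => by
      obtain ⟨N, C, hC, hbd⟩ := exists_uniform_bound (fun n => D1 (i n) g') (fun f' => by
        obtain ⟨C, hC⟩ := hb f' g'
        exact ⟨C, fun n => by rw [hD1]; exact hC _⟩)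
      obtain ⟨A, hA⟩ := (hu0 N).bddAbove_range
      refine ⟨C * A, fun n => ?_⟩
      rw [hD2, ← hD1]
      exact (hbd n (u n)).trans (mul_le_mul_of_nonneg_left (hA ⟨n, rfl⟩) hC))
    have h0 : Tendsto (fun n => C * schwartzNorm N (v n)) atTop (𝓝 0) := by
      simpa using (hv0 N).const_mul C
    obtain ⟨n, hn⟩ := (h0.eventually (gt_mem_nhds one_pos)).exists
    have h3 := (hbd n (v n)).trans_lt hn
    rw [hD2, hu, hv, hsm1, hsm2, norm_mul, norm_mul, hnn] at h3
    have h4 := hB n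
    have hp : (0 : ℝ) < (n : ℝ) + 1 := by positivity
    have h5 : ((n : ℝ) + 1)⁻¹ * (((n : ℝ) + 1)⁻¹ * ‖B (i n) (f n) (g n)‖) =
      ‖B (i n) (f n) (g n)‖ / ((n : ℝ) + 1) ^ 2 := by field_simp
    rw [h5, div_lt_one (by positivity)] at h3
    linarith
  obtain ⟨N, hN⟩ := key
  refine ⟨N, ((N : ℝ) + 1) ^ 2, by positivity, fun i f g => ?_⟩
  -- Homogeneity with `r`, `s` strictly above the norms avoids division by a vanishing norm. Letting
  -- `r`, `s` decrease to the norms gives the bound.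
  have hs : ∀ r s : ℝ, schwartzNorm N f < r → schwartzNorm N g < s →
      ‖B i f g‖ ≤ ((N : ℝ) + 1) ^ 2 * r * s := by
    intro r s hr hs
    have hr0 : 0 < r := (apply_nonneg _ _).trans_lt hr
    have hs0 : 0 < s := (apply_nonneg _ _).trans_lt hs
    have h1 := hN i (((r⁻¹ : ℝ) : ℂ) • f) (((s⁻¹ : ℝ) : ℂ) • g) (by
      rw [map_smul_eq_mul, Complex.norm_real, Real.norm_of_nonneg (by positivity),
        inv_mul_le_iff₀ hr0, mul_one]
      exact hr.le) (by
      rw [map_smul_eq_mul, Complex.norm_real, Real.norm_of_nonneg (by positivity),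
        inv_mul_le_iff₀ hs0, mul_one]
      exact hs.le)
    rw [hsm1, hsm2, norm_mul, norm_mul, Complex.norm_real, Complex.norm_real,
      Real.norm_of_nonneg (by positivity), Real.norm_of_nonneg (by positivity)] at h1
    rw [inv_mul_le_iff₀ hr0, inv_mul_le_iff₀ hs0] at h1
    linarith [h1]
  have hlim : Tendsto (fun δ : ℝ => ((N : ℝ) + 1) ^ 2 * (schwartzNorm N f + δ) *
      (schwartzNorm N g + δ)) (𝓝[>] 0) (𝓝 (((N : ℝ) + 1) ^ 2 * schwartzNorm N f *
        schwartzNorm N g)) := by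
    have : Continuous fun δ : ℝ => ((N : ℝ) + 1) ^ 2 * (schwartzNorm N f + δ) *
      (schwartzNorm N g + δ) := by fun_prop
    simpa using (this.tendsto 0).mono_left nhdsWithin_le_nhds
  refine ge_of_tendsto hlim ?_
  filter_upwards [self_mem_nhdsWithin] with δ hδ
  exact hs _ _ (lt_add_of_pos_right _ hδ) (lt_add_of_pos_right _ hδ)

end Bilinear
end EG
end

noncomputable section
namespace EG

/-! ### Multipliers, dilations and cutoffs -/

section Multipliers

variable {E F : Type*} [NormedAddCommGroup E] [NormedSpace ℝ E]
  [NormedAddCommGroup F] [NormedSpace ℝ F]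

/-- The product of two Schwartz functions, as a continuous linear map of the second one. -/
def schwartzMul (f : 𝓢(E, ℂ)) : 𝓢(E, ℂ) →L[ℂ] 𝓢(E, ℂ) := SchwartzMap.smulLeftCLM ℂ f

lemma schwartzMul_apply (f g : 𝓢(E, ℂ)) (x : E) : schwartzMul f g x = f x * g x :=
  SchwartzMap.smulLeftCLM_apply_apply f.hasTemperateGrowth g x

lemma norm_iteratedFDeriv_mul_le_of_bound {κ : E → ℂ} (hκ : ContDiff ℝ ((⊤ : ℕ∞) : WithTop ℕ∞) κ) {g h : 𝓢(E, ℂ)}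
    (hh : ∀ x, h x = κ x * g x) {n : ℕ} {x : E} {a b : ℝ} (ha : 0 ≤ a)
    (hκb : ∀ i ≤ n, ‖iteratedFDeriv ℝ i κ x‖ ≤ a)
    (hgb : ∀ i ≤ n, ‖iteratedFDeriv ℝ i g x‖ ≤ b) :
    ‖iteratedFDeriv ℝ n h x‖ ≤ 2 ^ n * (a * b) := by
  have h0 : (h : E → ℂ) = fun x => κ x * g x := funext hh
  rw [h0]
  refine (norm_iteratedFDeriv_mul_le (𝕜 := ℝ) (N := (⊤ : ℕ∞)) hκ (g.smooth ⊤) x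
    (n := n) (mod_cast le_top)).trans ?_
  have h2 : (2 : ℝ) ^ n = ∑ i ∈ Finset.range (n + 1), (n.choose i : ℝ) := by
    rw [← Nat.cast_sum, Nat.sum_range_choose]
    push_cast
    rfl
  rw [h2, Finset.sum_mul]
  refine Finset.sum_le_sum fun i hi => ?_
  have hi' : i ≤ n := by simpa [Nat.lt_succ_iff] using hi
  rw [mul_assoc]
  refine mul_le_mul_of_nonneg_left ?_ (by positivity)
  exact mul_le_mul (hκb i hi') (hgb _ (Nat.sub_le _ _)) (norm_nonneg _) ha

/-- Leibniz rule; the polynomial growth of order `e` of the multiplier is paid for by `e` additional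
weights on `g`. -/
lemma schwartzNorm_mul_le {κ : E → ℂ} (hκ : ContDiff ℝ ((⊤ : ℕ∞) : WithTop ℕ∞) κ) {g h : 𝓢(E, ℂ)}
    (hh : ∀ x, h x = κ x * g x) {N e : ℕ} {A : ℝ} (hA : 0 ≤ A)
    (hκb : ∀ i ≤ N, ∀ x, ‖iteratedFDeriv ℝ i κ x‖ ≤ A * (1 + ‖x‖) ^ e) :
    schwartzNorm N h ≤ 2 ^ N * 2 ^ (N + e) * A * schwartzNorm (N + e) g := by
  have hnn := apply_nonneg (schwartzNorm (N + e)) g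
  refine schwartzNorm_le' (by positivity) fun k hk n hn x => ?_
  have hp : (0 : ℝ) < (1 + ‖x‖) ^ (k + e) := by positivity
  have h1 := norm_iteratedFDeriv_mul_le_of_bound hκ hh (n := n) (x := x)
    (a := A * (1 + ‖x‖) ^ e)
    (b := 2 ^ (N + e) * schwartzNorm (N + e) g * ((1 + ‖x‖) ^ (k + e))⁻¹) (by positivity)
    (fun i hi => hκb i (hi.trans hn) x) (fun i hi => by
      rw [← div_eq_mul_inv, le_div_iff₀ hp, mul_comm]
      exact one_add_pow_mul_iteratedFDeriv_le (by omega) (by omega) g x)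
  have h2 : ‖x‖ ^ k ≤ (1 + ‖x‖) ^ k :=
    pow_le_pow_left₀ (norm_nonneg _) (by linarith [norm_nonneg x]) _
  have h3 : (2 : ℝ) ^ n ≤ 2 ^ N := pow_le_pow_right₀ one_le_two hn
  calc ‖x‖ ^ k * ‖iteratedFDeriv ℝ n h x‖ ≤ (1 + ‖x‖) ^ k * (2 ^ n * (A * (1 + ‖x‖) ^ e *
        (2 ^ (N + e) * schwartzNorm (N + e) g * ((1 + ‖x‖) ^ (k + e))⁻¹))) :=
        mul_le_mul h2 h1 (norm_nonneg _) (by positivity)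
    _ = 2 ^ n * (2 ^ (N + e) * A * schwartzNorm (N + e) g) := by
        rw [pow_add (1 + ‖x‖)]
        field_simp
    _ ≤ 2 ^ N * (2 ^ (N + e) * A * schwartzNorm (N + e) g) :=
        mul_le_mul_of_nonneg_right h3 (by positivity)
    _ = _ := by ring

/-- Multiplication with a bounded function that vanishes on the ball of radius `R`. -/
lemma schwartzNorm_mul_le_of_eq_zero {κ : E → ℂ} (hκ : ContDiff ℝ ((⊤ : ℕ∞) : WithTop ℕ∞) κ) {g h : 𝓢(E, ℂ)}
    (hh : ∀ x, h x = κ x * g x) {N : ℕ} {A : ℝ} (hA : 0 ≤ A)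
    (hκb : ∀ i ≤ N, ∀ x, ‖iteratedFDeriv ℝ i κ x‖ ≤ A) {R : ℝ} (hR : 0 < R)
    (h0 : ∀ x, ‖x‖ < R → κ x = 0) (M : ℕ) :
    schwartzNorm N h ≤ 2 ^ N * A * R⁻¹ ^ M * schwartzNorm (N + M) g := by
  have hnn := apply_nonneg (schwartzNorm (N + M)) g
  refine schwartzNorm_le' (by positivity) fun k hk n hn x => ?_
  rcases lt_or_ge ‖x‖ R with hx | hx
  · have h1 : (h : E → ℂ) =ᶠ[𝓝 x] fun _ => 0 := by
      filter_upwards [(isOpen_lt continuous_norm continuous_const).mem_nhds hx] with y hy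
      rw [hh, h0 y hy, zero_mul]
    have h2 : iteratedFDeriv ℝ n h x = 0 := by
      rw [(h1.iteratedFDeriv ℝ n).eq_of_nhds]
      exact congrFun (iteratedFDeriv_fun_zero (𝕜 := ℝ) (E := E) (F := ℂ) (n := n)) x
    rw [h2, norm_zero, mul_zero]
    positivity
  · have hx0 : 0 < ‖x‖ := hR.trans_le hx
    have hp : (0 : ℝ) < ‖x‖ ^ (k + M) := by positivity
    have h1 := norm_iteratedFDeriv_mul_le_of_bound hκ hh (n := n) (x := x) (a := A)
      (b := schwartzNorm (N + M) g * (‖x‖ ^ (k + M))⁻¹) hA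
      (fun i hi => hκb i (hi.trans hn) x) (fun i hi => by
        rw [← div_eq_mul_inv, le_div_iff₀ hp, mul_comm]
        exact pow_mul_iteratedFDeriv_le (by omega) (by omega) g x)
    have h3 : (2 : ℝ) ^ n ≤ 2 ^ N := pow_le_pow_right₀ one_le_two hn
    have h4 : (‖x‖⁻¹) ^ M ≤ R⁻¹ ^ M :=
      pow_le_pow_left₀ (by positivity) (inv_anti₀ hR hx) _
    calc ‖x‖ ^ k * ‖iteratedFDeriv ℝ n h x‖ ≤
          ‖x‖ ^ k * (2 ^ n * (A * (schwartzNorm (N + M) g * (‖x‖ ^ (k + M))⁻¹))) :=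
          mul_le_mul_of_nonneg_left h1 (by positivity)
      _ = 2 ^ n * (A * schwartzNorm (N + M) g) * ‖x‖⁻¹ ^ M := by
          rw [pow_add, inv_pow]
          field_simp
      _ ≤ 2 ^ N * (A * schwartzNorm (N + M) g) * R⁻¹ ^ M :=
          mul_le_mul (mul_le_mul_of_nonneg_right h3 (by positivity)) h4 (by positivity)
            (by positivity)
      _ = _ := by ring

lemma pow_le_one_add_norm_pow {E : Type*} [NormedAddCommGroup E] (k : E) {i N : ℕ} (hi : i ≤ N) : ‖k‖ ^ i ≤ (1 + ‖k‖) ^ N :=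
  (pow_le_pow_left₀ (norm_nonneg _) (by linarith [norm_nonneg k]) i).trans
    (pow_le_pow_right₀ (by linarith [norm_nonneg k]) hi)

/-- The rescaled function `x ↦ f(ε x)`, for `ε ≠ 0`. -/
def scaleArg (ε : ℝ) : 𝓢(E, ℂ) →L[ℂ] 𝓢(E, ℂ) :=
  if h : ε = 0 then 0 else SchwartzMap.compCLMOfContinuousLinearEquiv ℂ
    (ContinuousLinearEquiv.smulLeft (Units.mk0 ε h) : E ≃L[ℝ] E)

lemma scaleArg_apply {ε : ℝ} (hε : ε ≠ 0) (f : 𝓢(E, ℂ)) (x : E) :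
    scaleArg ε f x = f (ε • x) := by
  simp only [scaleArg, hε, dite_false]
  rfl

lemma norm_iteratedFDeriv_scaleArg {ε : ℝ} (hε : ε ≠ 0) (f : 𝓢(E, ℂ)) (n : ℕ) (x : E) :
    ‖iteratedFDeriv ℝ n (scaleArg ε f) x‖ = |ε| ^ n * ‖iteratedFDeriv ℝ n f (ε • x)‖ := by
  have h0 : (scaleArg ε f : E → ℂ) = fun x => f (ε • x) := funext (scaleArg_apply hε f)
  rw [h0, iteratedFDeriv_comp_const_smul ε (f.smooth n), norm_smul, norm_pow,
    Real.norm_eq_abs]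

/-- For `ε ≤ 1` derivatives only produce factors at most one, and each weight costs one `ε⁻¹`. The
essential point is that the loss is polynomial, of an order fixed by the norm. -/
lemma schwartzNorm_scaleArg_le {ε : ℝ} (hε : 0 < ε) (hε1 : ε ≤ 1) (N : ℕ) (f : 𝓢(E, ℂ)) :
    schwartzNorm N (scaleArg ε f) ≤ ε⁻¹ ^ N * schwartzNorm N f := by
  have hnn := apply_nonneg (schwartzNorm N) f
  refine schwartzNorm_le' (by positivity) fun k hk n hn x => ?_
  rw [norm_iteratedFDeriv_scaleArg hε.ne', abs_of_pos hε]
  have h1 := pow_mul_iteratedFDeriv_le hk hn f (ε • x)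
  rw [norm_smul, Real.norm_of_nonneg hε.le, mul_pow] at h1
  have h2 : ε ^ n ≤ 1 := pow_le_one₀ hε.le hε1
  have h3 : ε⁻¹ ^ k ≤ ε⁻¹ ^ N := pow_le_pow_right₀ ((one_le_inv₀ hε).2 hε1) hk
  calc ‖x‖ ^ k * (ε ^ n * ‖iteratedFDeriv ℝ n f (ε • x)‖) =
        ε ^ n * (ε⁻¹ ^ k * (ε ^ k * ‖x‖ ^ k * ‖iteratedFDeriv ℝ n f (ε • x)‖)) := by
        rw [inv_pow]
        field_simp
    _ ≤ 1 * (ε⁻¹ ^ N * schwartzNorm N f) :=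
        mul_le_mul h2 (mul_le_mul h3 h1 (by positivity) (by positivity)) (by positivity) zero_le_one
    _ = _ := one_mul _

/-- Cutting off a Schwartz function at the distance `ε⁻¹`. -/
lemma exists_bound_cutoff (c : 𝓢(E, ℂ)) (hc : ∀ x, ‖x‖ < 1 → c x = 1) (N : ℕ) :
    ∃ C, 0 ≤ C ∧ ∀ (M : ℕ) (ε : ℝ), 0 < ε → ε ≤ 1 → ∀ f : 𝓢(E, ℂ),
      schwartzNorm N (f - schwartzMul (scaleArg ε c) f) ≤ C * ε ^ M * schwartzNorm (N + M) f := by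
  have hnn := apply_nonneg (schwartzNorm N) c
  refine ⟨2 ^ N * (1 + schwartzNorm N c), by positivity, fun M ε hε hε1 f => ?_⟩
  have hsm : ContDiff ℝ ((⊤ : ℕ∞) : WithTop ℕ∞) fun x : E => (1 : ℂ) - scaleArg ε c x :=
    contDiff_const.sub ((scaleArg ε c).smooth ⊤)
  -- The factor `1 - c(ε x)` vanishes for `‖x‖ < ε⁻¹`, so with `R = ε⁻¹` every extra weight on `f`
  -- yields a power of `ε`. The constant does not depend on the number `M` of these powers, which
  -- later can be chosen to beat any polynomial loss.
  have h := schwartzNorm_mul_le_of_eq_zero (κ := fun x : E => (1 : ℂ) - scaleArg ε c x) hsm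
    (g := f) (h := f - schwartzMul (scaleArg ε c) f) (fun x => by
      have : (f - schwartzMul (scaleArg ε c) f) x = f x - schwartzMul (scaleArg ε c) f x := rfl
      rw [this, schwartzMul_apply]; ring) (N := N) (A := 1 + schwartzNorm N c) (by positivity)
    (fun i hi x => by
      have h1 : iteratedFDeriv ℝ i (fun x : E => (1 : ℂ) - scaleArg ε c x) x =
          iteratedFDeriv ℝ i (fun _ : E => (1 : ℂ)) x - iteratedFDeriv ℝ i (scaleArg ε c) x :=
        iteratedFDeriv_sub_apply contDiffAt_const (((scaleArg ε c).smooth _).contDiffAt)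
      rw [h1]
      refine (norm_sub_le _ _).trans (add_le_add ?_ ?_)
      · rcases Nat.eq_zero_or_pos i with rfl | hi0
        · simp
        · rw [iteratedFDeriv_const_of_ne hi0.ne']
          simp
      · rw [norm_iteratedFDeriv_scaleArg hε.ne', abs_of_pos hε]
        have h2 := pow_mul_iteratedFDeriv_le (Nat.zero_le N) hi c (ε • x)
        rw [pow_zero, one_mul] at h2
        calc ε ^ i * ‖iteratedFDeriv ℝ i c (ε • x)‖ ≤ 1 * schwartzNorm N c :=
              mul_le_mul (pow_le_one₀ hε.le hε1) h2 (norm_nonneg _) zero_le_one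
          _ = _ := one_mul _)
    (R := ε⁻¹) (by positivity) (fun x hx => by
      rw [scaleArg_apply hε.ne', hc, sub_self]
      rw [norm_smul, Real.norm_of_nonneg hε.le]
      have := mul_lt_mul_of_pos_left hx hε
      rwa [mul_inv_cancel₀ hε.ne'] at this) M
  simpa using h

end Multipliers

/-! ### Modulation by plane waves -/

section Modulation

variable {V : Type*} [NormedAddCommGroup V] [InnerProductSpace ℝ V]

/-- The plane wave `exp(i ⟪k, x⟫)`. -/
def planeWave (k x : V) : ℂ := Complex.exp (Complex.I * ((inner ℝ k x : ℝ) : ℂ))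

lemma planeWave_add (k l x : V) : planeWave (k + l) x = planeWave k x * planeWave l x := by
  simp only [planeWave, inner_add_left, ← Complex.exp_add]
  push_cast
  ring_nf

lemma contDiff_planeWave (k : V) : ContDiff ℝ ((⊤ : ℕ∞) : WithTop ℕ∞) (planeWave k) := by
  unfold planeWave
  exact Complex.contDiff_exp.comp (contDiff_const.mul
    (Complex.ofRealCLM.contDiff.comp (contDiff_const.inner ℝ contDiff_id)))

lemma iteratedDeriv_exp_I_mul (n : ℕ) :
    iteratedDeriv n (fun t : ℝ => Complex.exp (Complex.I * (t : ℂ))) =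
      fun t : ℝ => Complex.I ^ n * Complex.exp (Complex.I * (t : ℂ)) := by
  induction n with
  | zero => simp
  | succ n ih =>
    rw [iteratedDeriv_succ, ih]
    funext t
    have h1 : HasDerivAt (fun t : ℝ => Complex.exp (Complex.I * (t : ℂ)))
        (Complex.exp (Complex.I * (t : ℂ)) * (Complex.I * 1)) t :=
      ((Complex.ofRealCLM.hasDerivAt (x := t)).const_mul Complex.I).cexp
    rw [(h1.const_mul (Complex.I ^ n)).deriv]
    ring

lemma norm_iteratedFDeriv_planeWave_le (k : V) (n : ℕ) (x : V) :
    ‖iteratedFDeriv ℝ n (planeWave k) x‖ ≤ ‖k‖ ^ n := by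
  have hs : ContDiff ℝ n fun t : ℝ => Complex.exp (Complex.I * (t : ℂ)) :=
    Complex.contDiff_exp.comp (contDiff_const.mul Complex.ofRealCLM.contDiff)
  have h1 := (innerSL ℝ k).iteratedFDeriv_comp_right hs x (i := n) le_rfl
  have h2 : iteratedFDeriv ℝ n (planeWave k) x = (iteratedFDeriv ℝ n
      (fun t : ℝ => Complex.exp (Complex.I * (t : ℂ))) (innerSL ℝ k x)).compContinuousLinearMap
        fun _ => innerSL ℝ k := h1
  rw [h2]
  refine (ContinuousMultilinearMap.norm_compContinuousLinearMap_le _ _).trans ?_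
  rw [norm_iteratedFDeriv_eq_norm_iteratedDeriv, iteratedDeriv_exp_I_mul, norm_mul, norm_pow,
    Complex.norm_I, one_pow, mul_comm Complex.I, Complex.norm_exp_ofReal_mul_I]
  simp

lemma hasTemperateGrowth_planeWave (k : V) : (planeWave k).HasTemperateGrowth := by
  refine ⟨contDiff_planeWave k, fun n => ⟨0, ‖k‖ ^ n, fun x => ?_⟩⟩
  simpa using norm_iteratedFDeriv_planeWave_le k n x

/-- The modulated function `x ↦ exp(i ⟪k, x⟫) g(x)`. -/
def modulate (k : V) : 𝓢(V, ℂ) →L[ℂ] 𝓢(V, ℂ) := SchwartzMap.smulLeftCLM ℂ (planeWave k)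

lemma modulate_apply (k : V) (g : 𝓢(V, ℂ)) (x : V) : modulate k g x = planeWave k x * g x :=
  SchwartzMap.smulLeftCLM_apply_apply (hasTemperateGrowth_planeWave k) g x

lemma schwartzNorm_modulate_le (N : ℕ) (k : V) (g : 𝓢(V, ℂ)) :
    schwartzNorm N (modulate k g) ≤ 2 ^ N * 2 ^ N * (1 + ‖k‖) ^ N * schwartzNorm N g := by
  refine schwartzNorm_mul_le (e := 0) (contDiff_planeWave k) (modulate_apply k g) (by positivity)
    fun i hi x => ?_
  rw [pow_zero, mul_one]
  exact (norm_iteratedFDeriv_planeWave_le k i x).trans (pow_le_one_add_norm_pow k hi)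

/-- The estimate `|exp(i⟪k,x⟫) - 1| ≤ ‖k‖ ‖x‖` gains the factor `‖k‖` for one additional weight; all
derivatives of the plane wave carry a factor `‖k‖` anyway. This is the continuity in `k` at the
origin. -/
lemma schwartzNorm_modulate_sub_le (N : ℕ) (k : V) (g : 𝓢(V, ℂ)) :
    schwartzNorm N (modulate k g - g) ≤
      2 ^ N * 2 ^ (N + 1) * (‖k‖ * (1 + ‖k‖) ^ N) * schwartzNorm (N + 1) g := by
  refine schwartzNorm_mul_le (κ := fun x => planeWave k x - 1) (e := 1)
    ((contDiff_planeWave k).sub contDiff_const) (fun x => ?_) (by positivity) fun i hi x => ?_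
  · have : (modulate k g - g) x = modulate k g x - g x := rfl
    rw [this, modulate_apply]; ring
  · rw [pow_one]
    rcases Nat.eq_zero_or_pos i with rfl | hi0
    · rw [norm_iteratedFDeriv_zero]
      have h1 : ‖planeWave k x - 1‖ ≤ ‖(inner ℝ k x : ℝ)‖ := by
        have := Real.norm_exp_I_mul_ofReal_sub_one_le (x := inner ℝ k x)
        exact this
      have h2 : ‖(inner ℝ k x : ℝ)‖ ≤ ‖k‖ * ‖x‖ := norm_inner_le_norm k x
      have h3 : (1 : ℝ) ≤ (1 + ‖k‖) ^ N := one_le_pow₀ (by linarith [norm_nonneg k])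
      calc _ ≤ ‖k‖ * 1 * (1 + ‖x‖) := by
            nlinarith [norm_nonneg k, norm_nonneg x, h1.trans h2]
        _ ≤ _ := by gcongr
    · have h1 : iteratedFDeriv ℝ i (fun x => planeWave k x - 1) x =
          iteratedFDeriv ℝ i (planeWave k) x - iteratedFDeriv ℝ i (fun _ : V => (1 : ℂ)) x :=
        iteratedFDeriv_sub_apply ((contDiff_planeWave k).contDiffAt.of_le (mod_cast le_top))
          contDiffAt_const
      rw [h1, iteratedFDeriv_const_of_ne hi0.ne', Pi.zero_apply, sub_zero]
      refine (norm_iteratedFDeriv_planeWave_le k i x).trans ?_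
      obtain ⟨j, rfl⟩ : ∃ j, i = j + 1 := ⟨i - 1, by omega⟩
      have h2 := pow_le_one_add_norm_pow k (show j ≤ N by omega)
      calc ‖k‖ ^ (j + 1) = ‖k‖ * ‖k‖ ^ j * 1 := by ring
        _ ≤ ‖k‖ * (1 + ‖k‖) ^ N * (1 + ‖x‖) := by
          gcongr
          linarith [norm_nonneg x]

lemma continuous_modulate (g : 𝓢(V, ℂ)) : Continuous fun k : V => modulate k g := by
  refine continuous_iff_continuousAt.2 fun k₀ => ?_
  refine tendsto_schwartz_iff.2 fun N => ?_
  -- Plane waves form a group, so continuity at `k₀` reduces to continuity at zero, applied to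
  -- `modulate k₀ g`.
  have h1 : ∀ k, modulate k g - modulate k₀ g =
      modulate (k - k₀) (modulate k₀ g) - modulate k₀ g := fun k => by
    congr 1
    ext x
    rw [modulate_apply, modulate_apply, modulate_apply, ← mul_assoc, ← planeWave_add,
      sub_add_cancel]
  simp only [h1]
  refine squeeze_zero (fun k => apply_nonneg _ _)
    (fun k => schwartzNorm_modulate_sub_le N (k - k₀) _) ?_
  have hc : Continuous fun k : V => 2 ^ N * 2 ^ (N + 1) * (‖k - k₀‖ * (1 + ‖k - k₀‖) ^ N) *
      schwartzNorm (N + 1) (modulate k₀ g) := by fun_prop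
  simpa using hc.tendsto k₀

end Modulation
end EG
end

noncomputable section
namespace EG

set_option linter.unusedSectionVars false

/-! ### Density of tensor products -/

section Density

open FourierTransform

variable {V : Type*} [NormedAddCommGroup V] [InnerProductSpace ℝ V] [FiniteDimensional ℝ V]
  [MeasurableSpace V] [BorelSpace V]

/-- The norms of a modulated function grow only polynomially in the wave vector, so it is enough
that the weight has finite polynomial moments. -/
lemma schwartzIntegrable_smul_modulate {Z : Type*} [MeasurableSpace Z] {μ : Measure Z}
    {w : Z → ℂ} {k : Z → V} (hw : AEStronglyMeasurable w μ) (hk : AEStronglyMeasurable k μ)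
    (hint : ∀ N : ℕ, Integrable (fun z => (1 + ‖k z‖) ^ N * ‖w z‖) μ) (G : 𝓢(V, ℂ)) :
    SchwartzIntegrable (fun z => w z • modulate (k z) G) μ where
  aestronglyMeasurable := hw.smul ((continuous_modulate G).comp_aestronglyMeasurable hk)
  integrable_norm N := by
    refine ((hint N).const_mul (2 ^ N * 2 ^ N * schwartzNorm N G)).mono'
      ((continuous_schwartzNorm N).comp_aestronglyMeasurable
        (hw.smul ((continuous_modulate G).comp_aestronglyMeasurable hk)))
      (Eventually.of_forall fun z => ?_)
    rw [Real.norm_of_nonneg (apply_nonneg _ _), map_smul_eq_mul]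
    have := mul_le_mul_of_nonneg_left (schwartzNorm_modulate_le N (k z) G) (norm_nonneg (w z))
    linarith

lemma integrable_one_add_norm_pow_mul (f : 𝓢(V, ℂ)) (a : ℝ) (N : ℕ) :
    Integrable (fun k : V => (1 + ‖a • k‖) ^ N * ‖f k‖) := by
  have h : (fun k : V => (1 + ‖a • k‖) ^ N * ‖f k‖) = fun k : V =>
      ∑ i ∈ Finset.range (N + 1), (|a| ^ i * (N.choose i : ℝ)) * (‖k‖ ^ i * ‖f k‖) := by
    funext k
    rw [add_comm, add_pow, Finset.sum_mul]
    refine Finset.sum_congr rfl fun i _ => ?_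
    rw [norm_smul, Real.norm_eq_abs]
    ring
  rw [h]
  exact integrable_finsetSum _ fun i _ => (f.integrable_pow_mul volume i).const_mul _

/-- Fourier inversion writes `f` as a superposition of plane waves, hence `f G` as a superposition
of modulations of `G`, through which the distribution can be pulled. -/
lemma clm_schwartzMul_eq_integral (D : 𝓢(V, ℂ) →L[ℂ] ℂ) (f G : 𝓢(V, ℂ)) :
    D (schwartzMul f G) = ∫ k : V, 𝓕 f k * D (modulate ((2 * Real.pi) • k) G) := by
  have hγ : SchwartzIntegrable (fun k : V => 𝓕 f k • modulate ((2 * Real.pi) • k) G) volume :=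
    schwartzIntegrable_smul_modulate ((𝓕 f).continuous.aestronglyMeasurable)
      (by fun_prop) (fun N => integrable_one_add_norm_pow_mul _ _ N) G
  rw [clm_apply_eq_integral hγ (H := schwartzMul f G) ?_ D]
  · simp
  · intro x
    have h1 : f x = 𝓕⁻ (𝓕 f) x := by rw [fourierInv_fourier_eq f]
    rw [schwartzMul_apply, h1, SchwartzMap.fourierInv_coe, Real.fourierInv_eq',
      ← integral_mul_const]
    refine integral_congr_ae (Eventually.of_forall fun k => ?_)
    have : (𝓕 f k • modulate ((2 * Real.pi) • k) G) x =
      𝓕 f k * modulate ((2 * Real.pi) • k) G x := rfl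
    beta_reduce
    rw [this, modulate_apply]
    simp only [planeWave, smul_eq_mul, real_inner_smul_left]
    rw [mul_comm Complex.I]
    ring

variable (V) in
/-- A bump function which is `1` on the ball of radius `1` and vanishes outside of the ball of
radius `2`. -/
def bump : 𝓢(V, ℂ) :=
  let b : ContDiffBump (0 : V) := ⟨1, 2, one_pos, one_lt_two⟩
  HasCompactSupport.toSchwartzMap (f := fun x => (b x : ℂ))
    (b.hasCompactSupport.comp_left Complex.ofReal_zero)
    (Complex.ofRealCLM.contDiff.comp b.contDiff)

lemma bump_eq_one {x : V} (hx : ‖x‖ < 1) : bump V x = 1 := by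
  have h := ContDiffBump.one_of_mem_closedBall (⟨1, 2, one_pos, one_lt_two⟩ :
    ContDiffBump (0 : V)) (x := x) (by simpa using hx.le)
  exact congrArg Complex.ofReal h

lemma bump_eq_zero {x : V} (hx : 2 ≤ ‖x‖) : bump V x = 0 := by
  have h := ContDiffBump.zero_of_le_dist (⟨1, 2, one_pos, one_lt_two⟩ :
    ContDiffBump (0 : V)) (x := x) (by simpa using hx)
  exact congrArg Complex.ofReal h

variable {W : Type*} [NormedAddCommGroup W] [InnerProductSpace ℝ W] [FiniteDimensional ℝ W]
  [MeasurableSpace W] [BorelSpace W]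

lemma scaleArg_tensorLeft {ε : ℝ} (hε : ε ≠ 0) (f : 𝓢(W, ℂ)) (g : 𝓢(V, ℂ)) :
    scaleArg ε (tensorLeft f g) = tensorLeft (scaleArg ε f) (scaleArg ε g) := by
  ext z
  simp only [scaleArg_apply hε, tensorLeft_apply, Prod.smul_fst, Prod.smul_snd]

/-- The cut-off functions converge to `f` at the rate `ε`, in the one norm that bounds `D`. -/
lemma clm_eq_zero_of_cutoff {E : Type*} [NormedAddCommGroup E] [NormedSpace ℝ E]
    (D : 𝓢(E, ℂ) →L[ℂ] ℂ) (c : 𝓢(E, ℂ)) (hc : ∀ x, ‖x‖ < 1 → c x = 1)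
    (h : ∀ ε : ℝ, 0 < ε → ∀ f, D (schwartzMul (scaleArg ε c) f) = 0) : D = 0 := by
  ext f
  obtain ⟨N, C, hC, hD⟩ := exists_bound_clm D
  obtain ⟨C', hC', hcut⟩ := exists_bound_cutoff c hc N
  have hb : ∀ᶠ ε : ℝ in 𝓝[>] 0, ‖D f‖ ≤ C * (C' * ε ^ 1 * schwartzNorm (N + 1) f) := by
    filter_upwards [Ioc_mem_nhdsGT (zero_lt_one (α := ℝ))] with ε hε
    have h1 : D f = D (f - schwartzMul (scaleArg ε c) f) := by
      rw [map_sub, h ε hε.1, sub_zero]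
    rw [h1]
    exact (hD _).trans (mul_le_mul_of_nonneg_left (hcut 1 ε hε.1 hε.2 f) hC)
  have ht : Tendsto (fun ε : ℝ => C * (C' * ε ^ 1 * schwartzNorm (N + 1) f)) (𝓝[>] 0) (𝓝 0) := by
    have hcont : Continuous fun ε : ℝ => C * (C' * ε ^ 1 * schwartzNorm (N + 1) f) := by fun_prop
    have := (hcont.tendsto 0).mono_left (nhdsWithin_le_nhds (s := Set.Ioi (0 : ℝ)))
    simpa using this
  have h0 : ‖D f‖ ≤ 0 := ge_of_tendsto ht hb
  simpa using h0

/-- Finite sums of products of test functions are dense: a distribution vanishing on products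
is zero. -/
theorem clm_eq_zero_of_tensorLeft (D : 𝓢(V × W, ℂ) →L[ℂ] ℂ)
    (h : ∀ (f : 𝓢(W, ℂ)) (g : 𝓢(V, ℂ)), D (tensorLeft f g) = 0) : D = 0 := by
  -- The product with the maximum norm carries no inner product; the Fourier transform is taken on
  -- the `L²` product and transported.
  let e : WithLp 2 (V × W) ≃L[ℝ] V × W := WithLp.prodContinuousLinearEquiv 2 ℝ V W
  let pull : 𝓢(V × W, ℂ) →L[ℂ] 𝓢(WithLp 2 (V × W), ℂ) :=
    SchwartzMap.compCLMOfContinuousLinearEquiv ℂ e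
  let push : 𝓢(WithLp 2 (V × W), ℂ) →L[ℂ] 𝓢(V × W, ℂ) :=
    SchwartzMap.compCLMOfContinuousLinearEquiv ℂ e.symm
  -- A plane wave on the product factorizes, so modulations of `g ⊗ f` are again tensor products,
  -- where `D` vanishes. Expanding `H` in plane waves, `D` vanishes on `(g ⊗ f) H` for every `H`, in
  -- particular on functions cut off by products of bumps.
  have key : ∀ (f : 𝓢(W, ℂ)) (g : 𝓢(V, ℂ)) (H : 𝓢(V × W, ℂ)),
      D (schwartzMul (tensorLeft f g) H) = 0 := by
    intro f g H
    have h1 : schwartzMul (tensorLeft f g) H =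
        push (schwartzMul (pull H) (pull (tensorLeft f g))) := by
      ext z
      have : push (schwartzMul (pull H) (pull (tensorLeft f g))) z =
        schwartzMul (pull H) (pull (tensorLeft f g)) (e.symm z) := rfl
      rw [this, schwartzMul_apply, schwartzMul_apply]
      change _ = H (e (e.symm z)) * (tensorLeft f g) (e (e.symm z))
      rw [e.apply_symm_apply, mul_comm]
    have h2 := clm_schwartzMul_eq_integral (D.comp push) (pull H) (pull (tensorLeft f g))
    have h3 : ∀ k : WithLp 2 (V × W), push (modulate k (pull (tensorLeft f g))) =
        tensorLeft (modulate k.snd f) (modulate k.fst g) := by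
      intro k
      ext z
      have : push (modulate k (pull (tensorLeft f g))) z =
        modulate k (pull (tensorLeft f g)) (e.symm z) := rfl
      rw [this, modulate_apply, tensorLeft_apply, modulate_apply, modulate_apply]
      have h4 : pull (tensorLeft f g) (e.symm z) = g z.1 * f z.2 := by
        change (tensorLeft f g) (e (e.symm z)) = _
        rw [e.apply_symm_apply, tensorLeft_apply]
      have h5 : planeWave k (e.symm z) = planeWave k.fst z.1 * planeWave k.snd z.2 := by
        simp only [planeWave, ← Complex.exp_add, WithLp.prod_inner_apply]
        rw [← mul_add, ← Complex.ofReal_add]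
        rfl
      rw [h4, h5]
      ring
    rw [h1]
    refine (h2.trans ?_)
    simp only [ContinuousLinearMap.comp_apply, h3, h, mul_zero, integral_zero]
  refine clm_eq_zero_of_cutoff D (tensorLeft (bump W) (bump V)) (fun x hx => ?_)
    fun ε hε f => ?_
  · rw [tensorLeft_apply, bump_eq_one ((norm_fst_le x).trans_lt hx),
      bump_eq_one ((norm_snd_le x).trans_lt hx), one_mul]
  · rw [scaleArg_tensorLeft hε.ne']
    exact key _ _ _

theorem clm_ext_tensorLeft {D₁ D₂ : 𝓢(V × W, ℂ) →L[ℂ] ℂ}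
    (h : ∀ (f : 𝓢(W, ℂ)) (g : 𝓢(V, ℂ)), D₁ (tensorLeft f g) = D₂ (tensorLeft f g)) : D₁ = D₂ :=
  sub_eq_zero.1 (clm_eq_zero_of_tensorLeft (D₁ - D₂) fun f g => by simp [h f g])

end Density
end EG
end

noncomputable section
namespace EG

set_option linter.unusedSectionVars false

/-! ### The value at zero as a long-distance limit -/

section Lojasiewicz

lemma fourierM_surjective (n : ℕ) : Function.Surjective (fourierM n) := by
  intro f
  refine ⟨FourierTransformInv.fourierInv
    (SchwartzMap.compCLMOfContinuousLinearEquiv ℂ (fourierScale n).symm f), ?_⟩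
  simp only [fourierM, ContinuousLinearMap.comp_apply, SchwartzMap.fourierTransformCLM_apply,
    FourierTransform.fourier_fourierInv_eq]
  ext x
  simp

lemma fourierM_zero {n : ℕ} (g : 𝓢(Cfg n, ℂ)) : fourierM n g 0 = ∫ x, g x := by
  rw [fourierM_apply]
  refine integral_congr_ae (Eventually.of_forall fun x => ?_)
  simp [mdot, pt]

lemma mdot_pt_smul {n : ℕ} (a : ℝ) (k x : Cfg n) :
    ∑ j, mdot (pt (a • k) j) (pt x j) = ∑ j, mdot (pt k j) (pt (a • x) j) := by
  refine Finset.sum_congr rfl fun j _ => Finset.sum_congr rfl fun μ _ => ?_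
  simp [pt]
  ring

lemma finrank_cfg (n : ℕ) : Module.finrank ℝ (Cfg n) = 4 * n := by
  simp [mul_comm]

lemma fourierM_dilate {n : ℕ} {ε : ℝ} (hε : 0 < ε) (g : 𝓢(Cfg n, ℂ)) :
    fourierM n (dilate ε g) = scaleArg ε (fourierM n g) := by
  ext k
  rw [scaleArg_apply hε.ne', fourierM_apply, fourierM_apply]
  have h1 := Measure.integral_comp_smul (volume : Measure (Cfg n)) (fun x =>
    Complex.exp (Complex.I * ((∑ j, mdot (pt k j) (pt x j) : ℝ) : ℂ)) * dilate ε g x) ε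
  rw [finrank_cfg, abs_of_pos (by positivity)] at h1
  have h2 : (∫ x : Cfg n, Complex.exp (Complex.I * ((∑ j, mdot (pt k j) (pt (ε • x) j) : ℝ) : ℂ)) *
      dilate ε g (ε • x)) = ((ε : ℂ) ^ (4 * n))⁻¹ * ∫ x : Cfg n,
        Complex.exp (Complex.I * ((∑ j, mdot (pt (ε • k) j) (pt x j) : ℝ) : ℂ)) * g x := by
    rw [← integral_const_mul]
    refine integral_congr_ae (Eventually.of_forall fun x => ?_)
    simp only [dilate_apply hε.ne', inv_smul_smul₀ hε.ne', mdot_pt_smul]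
    ring
  rw [h2] at h1
  have h3 : ((ε : ℂ) ^ (4 * n))⁻¹ ≠ 0 := by
    have : (ε : ℂ) ≠ 0 := by exact_mod_cast hε.ne'
    positivity
  rw [Complex.real_smul, Complex.ofReal_inv, Complex.ofReal_pow] at h1
  exact (mul_left_cancel₀ h3 h1).symm

/-- In position space, the value at zero in the sense of Łojasiewicz is a long distance limit. -/
lemma HasLojasiewiczValue.tendsto_scaleArg {n : ℕ} {t : 𝓢'(Cfg n, ℂ)} {v : ℂ}
    (h : HasLojasiewiczValue (fourierDist t) v) (u : 𝓢(Cfg n, ℂ)) :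
    Tendsto (fun ε : ℝ => t (scaleArg ε u)) (𝓝[>] 0) (𝓝 (v * u 0)) := by
  -- The normalized functions `g` of the definition correspond under the Fourier transform, up to
  -- the factor `(2π)⁴ⁿ`, to the functions with `u 0 = 1`.
  have h1 : ∀ u : 𝓢(Cfg n, ℂ), u 0 = 1 →
      Tendsto (fun ε : ℝ => t (scaleArg ε u)) (𝓝[>] 0) (𝓝 v) := by
    intro u hu
    have hp : (((2 * Real.pi) ^ (4 * n) : ℝ) : ℂ) ≠ 0 := by
      exact_mod_cast (by positivity : ((2 * Real.pi) ^ (4 * n) : ℝ) ≠ 0)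
    obtain ⟨g, hg⟩ := fourierM_surjective n ((((2 * Real.pi) ^ (4 * n) : ℝ) : ℂ) • u)
    have hg0 : ∫ q, g q = (((2 * Real.pi) ^ (4 * n) : ℝ) : ℂ) := by
      rw [← fourierM_zero, hg]
      change _ * u 0 = _
      rw [hu, mul_one]
    refine (h g (by rw [hg0, inv_mul_cancel₀ hp])).congr' ?_
    filter_upwards [self_mem_nhdsWithin] with ε hε
    change _ * t (fourierM n (dilate ε g)) = _
    rw [fourierM_dilate hε, hg, map_smul, map_smul, smul_eq_mul, ← mul_assoc,
      inv_mul_cancel₀ hp, one_mul]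
  have hb : bump (Cfg n) 0 = 1 := bump_eq_one (by simp)
  have h2 := h1 (bump (Cfg n)) hb
  -- An arbitrary `u` is a difference of a function with value one at zero and a multiple of the
  -- bump, which has value one there as well.
  have h3 := h1 (u + (1 - u 0) • bump (Cfg n)) (by
    change u 0 + (1 - u 0) * bump (Cfg n) 0 = 1
    rw [hb]; ring)
  have h4 := h3.sub (h2.const_mul (1 - u 0))
  refine (h4.congr fun ε => ?_).trans_eq ?_
  · simp only [map_add, map_smul, smul_eq_mul]
    ring
  · congr 1
    ring

end Lojasiewicz

/-! ### Integration over one group of variables -/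

section PartialIntegral

open FourierTransform
open scoped LineDeriv

variable {V W : Type*} [NormedAddCommGroup V] [InnerProductSpace ℝ V] [FiniteDimensional ℝ V]
  [MeasurableSpace V] [BorelSpace V] [NormedAddCommGroup W] [InnerProductSpace ℝ W]
  [FiniteDimensional ℝ W] [MeasurableSpace W] [BorelSpace W]

variable (V W) in
/-- The restriction of Schwartz functions to the first factor. -/
def restrictFst : 𝓢(V × W, ℂ) →L[ℂ] 𝓢(V, ℂ) :=
  SchwartzMap.compCLMOfAntilipschitz ℂ (K := 1) (g := fun v : V => (v, (0 : W)))
    (ContinuousLinearMap.inl ℝ V W).hasTemperateGrowth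
    (AntilipschitzWith.of_le_mul_dist fun x y => by simp [Prod.dist_eq])

variable (V W) in
/-- The restriction of Schwartz functions to the second factor. -/
def restrictSnd : 𝓢(V × W, ℂ) →L[ℂ] 𝓢(W, ℂ) :=
  SchwartzMap.compCLMOfAntilipschitz ℂ (K := 1) (g := fun w : W => ((0 : V), w))
    (ContinuousLinearMap.inr ℝ V W).hasTemperateGrowth
    (AntilipschitzWith.of_le_mul_dist fun x y => by simp [Prod.dist_eq])

variable (V W) in
/-- The integral of Schwartz functions over the second variable. -/
def integralSnd : 𝓢(V × W, ℂ) →L[ℂ] 𝓢(V, ℂ) :=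
  (fourierCLE ℂ 𝓢(V, ℂ)).symm.toContinuousLinearMap.comp ((restrictFst V W).comp
    ((SchwartzMap.compCLMOfContinuousLinearEquiv ℂ
      (WithLp.prodContinuousLinearEquiv 2 ℝ V W).symm).comp
    ((fourierCLE ℂ 𝓢(WithLp 2 (V × W), ℂ)).toContinuousLinearMap.comp
      (SchwartzMap.compCLMOfContinuousLinearEquiv ℂ (WithLp.prodContinuousLinearEquiv 2 ℝ V W)))))

/-- Restricting the Fourier transform to vanishing second momentum amounts to integrating over the
second variable. Defining the partial integral in this way makes its continuity automatic, and this
identity shows that it is the intended operation. -/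
lemma integralSnd_tensorLeft (f : 𝓢(W, ℂ)) (g : 𝓢(V, ℂ)) :
    integralSnd V W (tensorLeft f g) = (∫ y, f y) • g := by
  have h1 : integralSnd V W (tensorLeft f g) = 𝓕⁻ ((∫ y, f y) • 𝓕 g) := by
    change 𝓕⁻ (_ : 𝓢(V, ℂ)) = _
    congr 1
    ext v
    change 𝓕 (fun z : WithLp 2 (V × W) => g z.fst * f z.snd) (WithLp.toLp 2 (v, (0 : W))) =
      (∫ y, f y) * 𝓕 (g : V → ℂ) v
    rw [Real.fourier_eq', Real.fourier_eq', mul_comm (∫ y, f y)]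
    refine ((WithLp.volume_preserving_toLp V W).integral_comp
        (MeasurableEquiv.toLp 2 (V × W)).measurableEmbedding _).symm.trans ?_
    rw [Measure.volume_eq_prod]
    refine Eq.trans ?_ (integral_prod_mul (fun x : V =>
      Complex.exp (↑(-2 * Real.pi * inner ℝ x v) * Complex.I) • g x) fun y : W => f y)
    refine integral_congr_ae (Eventually.of_forall fun z => ?_)
    simp [WithLp.prod_inner_apply]
    ring
  rw [h1, fourierInv_smul (R := ℂ), fourierInv_fourier_eq]

/-- Both sides are continuous functionals of `H`, so products of test functions suffice. The same
device proves the other properties of the partial integral. -/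
lemma integralSnd_apply_zero (H : 𝓢(V × W, ℂ)) : integralSnd V W H 0 = ∫ y, H (0, y) := by
  have h := clm_ext_tensorLeft
    (D₁ := (TemperedDistribution.delta (0 : V) : 𝓢(V, ℂ) →L[ℂ] ℂ).comp (integralSnd V W))
    (D₂ := (SchwartzMap.integralCLM ℂ (volume : Measure W)).comp (restrictSnd V W)) ?_
  · have h2 := DFunLike.congr_fun h H
    refine Eq.trans ?_ (h2.trans ?_)
    · rfl
    · exact SchwartzMap.integralCLM_apply ℂ _
  · intro f g
    have h1 : ((TemperedDistribution.delta (0 : V) : 𝓢(V, ℂ) →L[ℂ] ℂ).comp (integralSnd V W))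
        (tensorLeft f g) = (integralSnd V W (tensorLeft f g)) 0 := rfl
    have h2 : ((SchwartzMap.integralCLM ℂ (volume : Measure W)).comp (restrictSnd V W))
        (tensorLeft f g) = ∫ y, g 0 * f y := SchwartzMap.integralCLM_apply ℂ _
    rw [h1, h2, integralSnd_tensorLeft, integral_const_mul, mul_comm]
    rfl

lemma integralSnd_ext {A B : 𝓢(V × W, ℂ) →L[ℂ] 𝓢(V, ℂ)}
    (h : ∀ (f : 𝓢(W, ℂ)) (g : 𝓢(V, ℂ)), A (tensorLeft f g) = B (tensorLeft f g)) : A = B := by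
  ext H v
  have := clm_ext_tensorLeft
    (D₁ := (TemperedDistribution.delta v : 𝓢(V, ℂ) →L[ℂ] ℂ).comp A)
    (D₂ := (TemperedDistribution.delta v : 𝓢(V, ℂ) →L[ℂ] ℂ).comp B)
    (fun f g => congrArg (fun F : 𝓢(V, ℂ) => F v) (h f g))
  exact DFunLike.congr_fun this H

lemma integralSnd_scaleArg {ε : ℝ} (hε : 0 < ε) (H : 𝓢(V × W, ℂ)) :
    integralSnd V W (scaleArg ε H) =
      ((ε : ℂ) ^ Module.finrank ℝ W)⁻¹ • scaleArg ε (integralSnd V W H) := by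
  have h := integralSnd_ext (A := (integralSnd V W).comp (scaleArg ε))
    (B := ((ε : ℂ) ^ Module.finrank ℝ W)⁻¹ • (scaleArg ε).comp (integralSnd V W)) ?_
  · exact DFunLike.congr_fun h H
  · intro f g
    change integralSnd V W (scaleArg ε (tensorLeft f g)) =
      ((ε : ℂ) ^ Module.finrank ℝ W)⁻¹ • scaleArg ε (integralSnd V W (tensorLeft f g))
    rw [scaleArg_tensorLeft hε.ne', integralSnd_tensorLeft, integralSnd_tensorLeft, map_smul,
      smul_smul]
    congr 1
    have h1 := Measure.integral_comp_smul (volume : Measure W) f ε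
    rw [abs_of_pos (by positivity), Complex.real_smul, Complex.ofReal_inv,
      Complex.ofReal_pow] at h1
    rw [← h1]
    exact integral_congr_ae (Eventually.of_forall fun x => scaleArg_apply hε.ne' f x)

lemma integral_lineDeriv_eq_zero (a : W) (f : 𝓢(W, ℂ)) : ∫ y, (∂_{a} f) y = 0 := by
  have h := integral_mul_fderiv_eq_neg_fderiv_mul_of_integrable (μ := (volume : Measure W))
    (f := fun _ : W => (1 : ℂ)) (g := f) (v := a) (by simp)
    (by simpa using (∂_{a} f).integrable (μ := volume))
    (by simpa using f.integrable (μ := volume))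
    (fun x _ => by fun_prop) (fun x _ => (f.smooth 1).differentiable one_ne_zero x)
  simpa [SchwartzMap.lineDerivOp_apply_eq_fderiv] using h

lemma integralSnd_lineDeriv (a : W) (H : 𝓢(V × W, ℂ)) :
    integralSnd V W (∂_{((0 : V), a)} H) = 0 := by
  have h := integralSnd_ext
    (A := (integralSnd V W).comp (LineDeriv.lineDerivOpCLM ℂ 𝓢(V × W, ℂ) ((0 : V), a)))
    (B := 0) ?_
  · exact DFunLike.congr_fun h H
  · intro f g
    have h1 : ∂_{((0 : V), a)} (tensorLeft f g) = tensorLeft (∂_{a} f) g := by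
      ext z
      rw [SchwartzMap.lineDerivOp_apply, tensorLeft_apply, SchwartzMap.lineDerivOp_apply]
      simp only [lineDeriv, tensorLeft_apply, Prod.fst_add, Prod.snd_add, Prod.smul_fst,
        Prod.smul_snd, smul_zero, add_zero]
      rw [deriv_const_mul_field]
    change integralSnd V W (∂_{((0 : V), a)} (tensorLeft f g)) = 0
    rw [h1, integralSnd_tensorLeft, integral_lineDeriv_eq_zero, zero_smul]

end PartialIntegral

/-! ### Translation invariant distributions and common translations of two points -/

section DifferenceVariables

open scoped LineDeriv

/-- The integral of `H(x + y, y)` over `y`, as a function of `x`. -/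
def diagIntegral : 𝓢(Cfg 2, ℂ) →L[ℂ] 𝓢(Cfg 1, ℂ) :=
  (integralSnd (Cfg 1) Mink).comp
    (SchwartzMap.compCLMOfContinuousLinearEquiv ℂ (splitLast 1 1).symm)

/-- The vector `(a, a)` of simultaneous translations of both points. -/
def diagVec (a : Mink) : Cfg 2 := (splitLast 1 1).symm (0, a)

lemma diagVec_apply (a : Mink) (p : Fin 2 × Fin 4) : diagVec a p = a p.2 := by
  obtain ⟨j, μ⟩ := p
  fin_cases j
  · change (0 : Cfg 1) (0, μ) + 1 * a μ = a μ
    simp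
  · rfl

/-- The reduction is specified only on functions that factorize in the difference variable and the
last point. By density this determines `t` everywhere: it depends on `H` only through the integral
over common translations. -/
lemma IsReduction.eq_diagIntegral {t : 𝓢'(Cfg 2, ℂ)} {τ : 𝓢'(Cfg 1, ℂ)} (h : IsReduction t τ)
    (H : 𝓢(Cfg 2, ℂ)) : t H = τ (diagIntegral H) := by
  have h1 := clm_ext_tensorLeft
    (D₁ := (t : 𝓢(Cfg 2, ℂ) →L[ℂ] ℂ).comp
      (SchwartzMap.compCLMOfContinuousLinearEquiv ℂ (splitLast 1 1)))
    (D₂ := (τ : 𝓢(Cfg 1, ℂ) →L[ℂ] ℂ).comp (integralSnd (Cfg 1) Mink)) ?_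
  · have h2 := DFunLike.congr_fun h1
      (SchwartzMap.compCLMOfContinuousLinearEquiv ℂ (splitLast 1 1).symm H)
    refine Eq.trans ?_ h2
    change t H = t _
    congr 1
    ext x
    simp
  · intro f g
    change t (SchwartzMap.compCLMOfContinuousLinearEquiv ℂ (splitLast 1 1) (tensorLeft f g)) =
      τ (integralSnd (Cfg 1) Mink (tensorLeft f g))
    rw [h, integralSnd_tensorLeft, map_smul, smul_eq_mul, mul_comm]

lemma diagIntegral_apply_zero (H : 𝓢(Cfg 2, ℂ)) : diagIntegral H 0 = ∫ y, H (diagVec y) :=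
  integralSnd_apply_zero _

/-- The factor `ε⁻⁴` is the Jacobian of the integral over the four-dimensional translations. In the
scaling limit it cancels against the invariant measures of two massless particles. -/
lemma diagIntegral_scaleArg {ε : ℝ} (hε : 0 < ε) (H : 𝓢(Cfg 2, ℂ)) :
    diagIntegral (scaleArg ε H) = ((ε : ℂ) ^ 4)⁻¹ • scaleArg ε (diagIntegral H) := by
  have h1 : SchwartzMap.compCLMOfContinuousLinearEquiv ℂ (splitLast 1 1).symm (scaleArg ε H) =
      scaleArg ε (SchwartzMap.compCLMOfContinuousLinearEquiv ℂ (splitLast 1 1).symm H) := by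
    ext x
    rw [scaleArg_apply hε.ne', SchwartzMap.compCLMOfContinuousLinearEquiv_apply,
      SchwartzMap.compCLMOfContinuousLinearEquiv_apply, Function.comp_apply, Function.comp_apply,
      scaleArg_apply hε.ne', ContinuousLinearEquiv.map_smul]
  rw [diagIntegral, ContinuousLinearMap.comp_apply, h1, integralSnd_scaleArg hε]
  simp

lemma diagIntegral_lineDeriv (a : Mink) (H : 𝓢(Cfg 2, ℂ)) :
    diagIntegral (∂_{diagVec a} H) = 0 := by
  rw [← integralSnd_lineDeriv a
    (SchwartzMap.compCLMOfContinuousLinearEquiv ℂ (splitLast 1 1).symm H),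
    SchwartzMap.lineDerivOp_compCLMOfContinuousLinearEquiv]
  rfl

lemma lineDeriv_modulate {V : Type*} [NormedAddCommGroup V] [InnerProductSpace ℝ V]
    (p w : V) (H : 𝓢(V, ℂ)) :
    ∂_{w} (modulate p H) =
      (Complex.I * ((inner ℝ p w : ℝ) : ℂ)) • modulate p H + modulate p (∂_{w} H) := by
  ext x
  have h2 : HasLineDerivAt ℝ H ((∂_{w} H) x) x w := by
    rw [SchwartzMap.lineDerivOp_apply_eq_fderiv]
    exact (H.hasFDerivAt x).hasLineDerivAt w
  have h1 : HasLineDerivAt ℝ (planeWave p) (Complex.I * ((inner ℝ p w : ℝ) : ℂ) * planeWave p x)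
      x w := by
    have h3 : HasDerivAt (fun t : ℝ => Complex.I * ((inner ℝ p (x + t • w) : ℝ) : ℂ))
        (Complex.I * ((inner ℝ p w : ℝ) : ℂ)) 0 := by
      have h4 : HasDerivAt (fun t : ℝ => (inner ℝ p (x + t • w) : ℝ)) (inner ℝ p w) 0 := by
        simp only [inner_add_right, inner_smul_right]
        simpa using ((hasDerivAt_id (0 : ℝ)).mul_const (inner ℝ p w)).const_add (inner ℝ p x)
      exact h4.ofReal_comp.const_mul _
    have h5 := h3.cexp
    rw [zero_smul, add_zero, mul_comm] at h5
    exact h5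
  have h6 : HasLineDerivAt ℝ (modulate p H)
      (Complex.I * ((inner ℝ p w : ℝ) : ℂ) * planeWave p x * H x + planeWave p x * (∂_{w} H) x)
      x w := by
    have h7 := HasDerivAt.fun_mul (𝕜 := ℝ) h1 h2
    simp only [zero_smul, add_zero] at h7
    have h8 : (modulate p H : V → ℂ) = fun y => planeWave p y * H y :=
      funext fun y => modulate_apply p H y
    rw [h8]
    exact h7
  rw [SchwartzMap.lineDerivOp_apply, h6.lineDeriv]
  change _ = (Complex.I * ((inner ℝ p w : ℝ) : ℂ)) * modulate p H x + modulate p (∂_{w} H) x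
  rw [modulate_apply, modulate_apply]
  ring

/-- Integration by parts along the diagonal: a derivative in the direction `(a, a)` integrates to
zero, and acting on the plane wave it produces the component of the total momentum along `a`. -/
lemma diagIntegral_modulate (p : Cfg 2) (a : Mink) (H : 𝓢(Cfg 2, ℂ)) :
    (Complex.I * ((inner ℝ p (diagVec a) : ℝ) : ℂ)) • diagIntegral (modulate p H) =
      -diagIntegral (modulate p (∂_{diagVec a} H)) := by
  have h := diagIntegral_lineDeriv a (modulate p H)
  rw [lineDeriv_modulate, map_add, map_smul] at h
  exact eq_neg_of_add_eq_zero_left h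

/-- `diagIntegral` of a modulated function decays in the total momentum. -/
lemma exists_bound_diagIntegral_modulate (a : Mink) (N : ℕ) :
    ∃ M : ℕ, ∀ (L : ℕ) (H : 𝓢(Cfg 2, ℂ)), ∃ C : ℝ, 0 ≤ C ∧ ∀ p : Cfg 2,
      |inner ℝ p (diagVec a)| ^ L * schwartzNorm N (diagIntegral (modulate p H)) ≤
        C * (1 + ‖p‖) ^ M := by
  obtain ⟨M, C, hC, h⟩ := exists_bound_map diagIntegral N
  -- `M` comes from the continuity of `diagIntegral` alone and is fixed before `L` and `H`. Each
  -- integration by parts moves one factor onto a derivative of `H` without changing `M`, so the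
  -- number `L` of decay factors can exceed the polynomial growth.
  refine ⟨M, fun L => ?_⟩
  induction L with
  | zero =>
    intro H
    refine ⟨C * (2 ^ M * 2 ^ M * schwartzNorm M H), ?_, fun p => ?_⟩
    · have := apply_nonneg (schwartzNorm M) H
      positivity
    · rw [pow_zero, one_mul]
      refine (h _).trans ?_
      have := mul_le_mul_of_nonneg_left (schwartzNorm_modulate_le M p H) hC
      linarith
  | succ L ih =>
    intro H
    obtain ⟨C', hC', h'⟩ := ih (∂_{diagVec a} H)
    refine ⟨C', hC', fun p => ?_⟩
    have h1 := congrArg (schwartzNorm N) (diagIntegral_modulate p a H)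
    rw [map_smul_eq_mul, map_neg_eq_map, norm_mul, Complex.norm_I, one_mul, Complex.norm_real,
      Real.norm_eq_abs] at h1
    rw [pow_succ, mul_assoc, h1]
    exact h' p

end DifferenceVariables
end EG
end

noncomputable section
namespace EG

set_option linter.unusedSectionVars false

/-! ### The invariant measure on the mass shells -/

section Shell

abbrev Mom := EuclideanSpace ℝ (Fin 3)

/-- In three dimensions the radial measure `y² dy` compensates a singularity of order at most two.
Order one is that of the massless invariant measure, order two occurs when two massless particles
become back to back. -/
lemma integrable_inv_norm_pow {a : ℕ} (ha : a ≤ 2) :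
    Integrable fun k : Mom => (‖k‖ ^ a)⁻¹ * ((1 + ‖k‖) ^ 5)⁻¹ := by
  have h := integrable_fun_norm_addHaar (volume : Measure Mom)
    (f := fun y : ℝ => (y ^ a)⁻¹ * ((1 + y) ^ 5)⁻¹)
  refine h.2 ?_
  have h2 : IntegrableOn (fun y : ℝ => (1 + ‖y‖) ^ (-(2 : ℝ))) (Set.Ioi 0) :=
    (integrable_one_add_norm (by simp)).integrableOn
  refine h2.mono' ?_ ?_
  · exact (by fun_prop : Measurable _).aestronglyMeasurable
  · refine (ae_restrict_iff' measurableSet_Ioi).2 (Eventually.of_forall fun y hy => ?_)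
    have hy : 0 < y := hy
    simp only [finrank_euclideanSpace, Fintype.card_fin, Nat.add_one_sub_one, smul_eq_mul]
    rw [Real.norm_of_nonneg (by positivity), Real.norm_of_nonneg hy.le, Real.rpow_neg (by positivity)]
    rw [show (1 + y) ^ (2 : ℝ) = (1 + y) ^ 2 by exact_mod_cast Real.rpow_natCast (1 + y) 2]
    have h3 : y ^ 2 * (y ^ a)⁻¹ ≤ (1 + y) ^ 2 := by
      interval_cases a
      · simp only [pow_zero, inv_one, mul_one]; nlinarith
      · rw [pow_one, show y ^ 2 * y⁻¹ = y by field_simp]; nlinarith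
      · rw [mul_inv_cancel₀ (by positivity)]; nlinarith
    calc y ^ 2 * ((y ^ a)⁻¹ * ((1 + y) ^ 5)⁻¹) = (y ^ 2 * (y ^ a)⁻¹) * ((1 + y) ^ 5)⁻¹ := by ring
      _ ≤ (1 + y) ^ 2 * ((1 + y) ^ 4)⁻¹ := by
          refine mul_le_mul h3 (inv_anti₀ (by positivity) ?_) (by positivity) (by positivity)
          exact pow_le_pow_right₀ (by linarith) (by norm_num)
      _ = _ := by field_simp

lemma energy_nonneg (m : ℝ) (κ : OneP) : 0 ≤ energy m κ := Real.sqrt_nonneg _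

lemma norm_le_energy (m : ℝ) (κ : OneP) : ‖κ.2‖ ≤ energy m κ :=
  Real.le_sqrt_of_sq_le (by nlinarith [sq_nonneg (mass m κ.1)])

lemma continuous_energy (m : ℝ) : Continuous (energy m) := by
  unfold energy
  have h : Continuous fun κ : OneP => mass m κ.1 :=
    (continuous_of_discreteTopology (f := mass m)).comp continuous_fst
  fun_prop

lemma continuous_onShell (m : ℝ) : Continuous (onShell m) := by
  unfold onShell
  refine (PiLp.continuous_toLp 2 _).comp (continuous_pi fun μ => ?_)
  refine Fin.cases ?_ (fun j => ?_) μ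
  · simpa using continuous_energy m
  · simp only [Fin.cons_succ]
    fun_prop

lemma onShell_zero (m : ℝ) (κ : OneP) : onShell m κ 0 = energy m κ := rfl

lemma onShell_succ (m : ℝ) (κ : OneP) (j : Fin 3) : onShell m κ j.succ = κ.2 j := rfl

/-- The density of the invariant measure. -/
def shellDensity (m : ℝ) (κ : OneP) : ℝ := 1 / ((2 * Real.pi) ^ 3 * (2 * energy m κ))

lemma shellDensity_nonneg (m : ℝ) (κ : OneP) : 0 ≤ shellDensity m κ := by
  have := energy_nonneg m κ
  unfold shellDensity
  positivity

lemma measurable_shellDensity (m : ℝ) : Measurable (shellDensity m) := by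
  have := (continuous_energy m).measurable
  unfold shellDensity
  fun_prop

lemma shell_eq (m : ℝ) : shell m = ((Measure.count : Measure Species).prod
    (volume : Measure Mom)).withDensity fun κ => ENNReal.ofReal (shellDensity m κ) := rfl

instance (m : ℝ) : SigmaFinite (shell m) := by
  rw [shell_eq]
  infer_instance

lemma integrable_shell_iff {m : ℝ} {h : OneP → ℂ} :
    Integrable h (shell m) ↔ Integrable (fun κ => (shellDensity m κ : ℂ) * h κ)
      ((Measure.count : Measure Species).prod (volume : Measure Mom)) := by
  rw [shell_eq, integrable_withDensity_iff_integrable_smul₀'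
    (measurable_shellDensity m).ennreal_ofReal.aemeasurable (by simp)]
  simp only [ENNReal.toReal_ofReal (shellDensity_nonneg m _), Complex.real_smul]

lemma ae_snd_ne_zero : ∀ᵐ κ ∂((Measure.count : Measure Species).prod (volume : Measure Mom)),
    κ.2 ≠ 0 := by
  have h : ∀ᵐ k : Mom, k ≠ 0 := by
    simp [ae_iff]
  exact Measure.quasiMeasurePreserving_snd.ae h

/-- The energy is at least the length of the momentum, so for both species the density is bounded by
`‖k‖⁻¹`, which is integrable at zero in three dimensions. -/
lemma integrable_shell_decay (m : ℝ) :
    Integrable (fun κ : OneP => (((1 + ‖κ.2‖) ^ 5)⁻¹ : ℝ)) (shell m) := by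
  have h1 : Integrable (fun κ : OneP => ((((1 + ‖κ.2‖) ^ 5)⁻¹ : ℝ) : ℂ)) (shell m) := by
    rw [integrable_shell_iff]
    have h2 := (integrable_inv_norm_pow (a := 1) (by norm_num)).comp_snd
      (Measure.count : Measure Species)
    refine h2.mono' ?_ ?_
    · have := measurable_shellDensity m
      exact (by fun_prop : Measurable _).aestronglyMeasurable
    · filter_upwards [ae_snd_ne_zero] with κ hκ
      have hκ' : 0 < ‖κ.2‖ := norm_pos_iff.2 hκ
      rw [norm_mul, Complex.norm_real, Complex.norm_real,
        Real.norm_of_nonneg (shellDensity_nonneg m κ), Real.norm_of_nonneg (by positivity), pow_one]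
      refine mul_le_mul_of_nonneg_right ?_ (by positivity)
      rw [shellDensity, one_div]
      refine inv_anti₀ hκ' ?_
      have h3 := norm_le_energy m κ
      have h4 : (1 : ℝ) ≤ (2 * Real.pi) ^ 3 := one_le_pow₀ (by linarith [Real.pi_gt_three])
      nlinarith
  exact (integrable_norm_iff h1.aestronglyMeasurable |>.2 h1).congr
    (Eventually.of_forall fun κ => by
      simp only [Complex.norm_real]
      exact Real.norm_of_nonneg (by positivity))

/-- The density is positive except possibly at zero momentum, where the massless density has the
default value of a division by zero; this set is null. The instance serves to conclude that a
continuous wave function vanishing almost everywhere vanishes. -/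
instance (m : ℝ) : (shell m).IsOpenPosMeasure := by
  have h : ((Measure.count : Measure Species).prod (volume : Measure Mom)) ≪ shell m := by
    rw [shell_eq]
    refine withDensity_absolutelyContinuous'
      (measurable_shellDensity m).ennreal_ofReal.aemeasurable ?_
    filter_upwards [ae_snd_ne_zero] with κ hκ
    have hκ' : 0 < ‖κ.2‖ := norm_pos_iff.2 hκ
    have h3 := hκ'.trans_le (norm_le_energy m κ)
    have : 0 < shellDensity m κ := by unfold shellDensity; positivity
    simpa using this
  have : ((Measure.count : Measure Species).prod (volume : Measure Mom)).IsOpenPosMeasure := by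
    have : (Measure.count : Measure Species).IsOpenPosMeasure :=
      ⟨fun U _ hU => (Measure.count_ne_zero_iff.2 hU)⟩
    infer_instance
  exact h.isOpenPosMeasure

end Shell
end EG
end

noncomputable section
namespace EG

set_option linter.unusedSectionVars false

/-! ### Regularity of wave functions and the inner product on the domain -/

section Fock

/-- The product measure on the `n`-particle momenta. -/
abbrev shellPi (m : ℝ) (n : ℕ) : Measure (Fin n → OneP) := Measure.pi fun _ => shell m

/-- Functions of the momenta with rapid decay. -/
def RapidDecay {n : ℕ} (h : (Fin n → OneP) → ℂ) : Prop :=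
  ∀ N : ℕ, ∃ C : ℝ, 0 ≤ C ∧ ∀ κ, ‖h κ‖ ≤ C * ∏ j, ((1 + ‖(κ j).2‖) ^ N)⁻¹

lemma one_add_norm_pow_inv_le_one {E : Type*} [NormedAddCommGroup E] (k : E) (N : ℕ) :
    ((1 + ‖k‖) ^ N)⁻¹ ≤ 1 :=
  inv_le_one_of_one_le₀ (one_le_pow₀ (by linarith [norm_nonneg k]))

lemma prod_decay_nonneg {n : ℕ} (κ : Fin n → OneP) (N : ℕ) :
    0 ≤ ∏ j, ((1 + ‖(κ j).2‖) ^ N)⁻¹ := Finset.prod_nonneg fun j _ => by positivity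

lemma RapidDecay.add {n : ℕ} {h h' : (Fin n → OneP) → ℂ} (hh : RapidDecay h)
    (hh' : RapidDecay h') : RapidDecay (h + h') := by
  intro N
  obtain ⟨C, hC, hb⟩ := hh N
  obtain ⟨C', hC', hb'⟩ := hh' N
  refine ⟨C + C', by positivity, fun κ => ?_⟩
  rw [add_mul]
  exact (norm_add_le _ _).trans (add_le_add (hb κ) (hb' κ))

lemma RapidDecay.smul {n : ℕ} {h : (Fin n → OneP) → ℂ} (hh : RapidDecay h) (c : ℂ) :
    RapidDecay (c • h) := by
  intro N
  obtain ⟨C, hC, hb⟩ := hh N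
  refine ⟨‖c‖ * C, by positivity, fun κ => ?_⟩
  rw [Pi.smul_apply, norm_smul, mul_assoc]
  exact mul_le_mul_of_nonneg_left (hb κ) (norm_nonneg _)

lemma RapidDecay.zero {n : ℕ} : RapidDecay (0 : (Fin n → OneP) → ℂ) :=
  fun _ => ⟨0, le_rfl, fun _ => by simp⟩

lemma RapidDecay.mul_bounded {n : ℕ} {h b : (Fin n → OneP) → ℂ} (hh : RapidDecay h) {A : ℝ}
    (hb : ∀ κ, ‖b κ‖ ≤ A) : RapidDecay fun κ => b κ * h κ := by
  intro N
  obtain ⟨C, hC, hh⟩ := hh N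
  refine ⟨|A| * C, by positivity, fun κ => ?_⟩
  rw [norm_mul, mul_assoc]
  exact mul_le_mul ((hb κ).trans (le_abs_self A)) (hh κ) (norm_nonneg _) (abs_nonneg _)

lemma RapidDecay.bounded {n : ℕ} {h : (Fin n → OneP) → ℂ} (hh : RapidDecay h) :
    ∃ C, 0 ≤ C ∧ ∀ κ, ‖h κ‖ ≤ C := by
  obtain ⟨C, hC, hb⟩ := hh 0
  exact ⟨C, hC, fun κ => by simpa using hb κ⟩

lemma integrable_prod_decay (m : ℝ) (n : ℕ) :
    Integrable (fun κ : Fin n → OneP => ∏ j, ((1 + ‖(κ j).2‖) ^ 5)⁻¹) (shellPi m n) :=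
  Integrable.fintype_prod (f := fun (_ : Fin n) (κ : OneP) => ((1 + ‖κ.2‖) ^ 5)⁻¹)
    fun _ => integrable_shell_decay m

lemma RapidDecay.integrable {n : ℕ} {h : (Fin n → OneP) → ℂ} (hh : RapidDecay h) {m : ℝ}
    (hm : AEStronglyMeasurable h (shellPi m n)) : Integrable h (shellPi m n) := by
  obtain ⟨C, hC, hb⟩ := hh 5
  exact ((integrable_prod_decay m n).const_mul C).mono' hm (Eventually.of_forall hb)

/-- The regularity of the wave functions of vectors in the domain. -/
structure IsRegular (Ψ : Fock) : Prop where
  continuous : ∀ n, Continuous (Ψ n)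
  decay : ∀ n, RapidDecay (Ψ n)
  symmetric : ∀ n (σ : Equiv.Perm (Fin n)) (κ : Fin n → OneP), Ψ n (κ ∘ σ) = Ψ n κ
  finite : ∃ K, ∀ n, K ≤ n → Ψ n = 0

lemma one_add_norm_snd_le {n : ℕ} (m : ℝ) (κ : Fin n → OneP) (j : Fin n) :
    1 + ‖(κ j).2‖ ≤ 1 + ‖cfg fun j => onShell m (κ j)‖ := by
  have h1 := norm_le_energy m (κ j)
  have h2 : ‖(cfg fun j => onShell m (κ j)) (j, 0)‖ ≤ ‖cfg fun j => onShell m (κ j)‖ :=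
    PiLp.norm_apply_le _ _
  have h3 : (cfg fun j => onShell m (κ j)) (j, 0) = energy m (κ j) := rfl
  rw [h3, Real.norm_of_nonneg (energy_nonneg m _)] at h2
  linarith

lemma continuous_cfg {n : ℕ} {X : Type*} [TopologicalSpace X] {v : X → Fin n → Mink}
    (hv : ∀ j, Continuous fun x => v x j) : Continuous fun x => cfg (v x) := by
  refine (PiLp.continuous_toLp 2 _).comp (continuous_pi fun p => ?_)
  have := hv p.1
  fun_prop

/-- The energy component of each on-shell momentum dominates its spatial part, so the norm of the
whole configuration dominates every single momentum. Giving each of the `n` momenta `N` powers takes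
`N * n` weights. -/
lemma exists_decay_schwartz_onShell (m : ℝ) (n N : ℕ) :
    ∃ C, 0 ≤ C ∧ ∀ (f : 𝓢(Cfg n, ℂ)) (κ : Fin n → OneP),
      ‖f (cfg fun j => onShell m (κ j))‖ ≤
        C * schwartzNorm (N * n) f * ∏ j, ((1 + ‖(κ j).2‖) ^ N)⁻¹ := by
  refine ⟨2 ^ (N * n), by positivity, fun f κ => ?_⟩
  set q := cfg fun j => onShell m (κ j)
  have h1 := one_add_pow_mul_iteratedFDeriv_le (N := N * n) (k := N * n) (n := 0) le_rfl
    (Nat.zero_le _) f q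
  rw [norm_iteratedFDeriv_zero] at h1
  have h2 : ∏ j, (1 + ‖(κ j).2‖) ^ N ≤ (1 + ‖q‖) ^ (N * n) := by
    calc ∏ j, (1 + ‖(κ j).2‖) ^ N ≤ ∏ _j : Fin n, (1 + ‖q‖) ^ N :=
          Finset.prod_le_prod (fun j _ => by positivity) fun j _ =>
            pow_le_pow_left₀ (by positivity) (one_add_norm_snd_le m κ j) N
      _ = _ := by rw [Finset.prod_const, Finset.card_univ, Fintype.card_fin, ← pow_mul]
  rw [Finset.prod_inv_distrib, ← div_eq_mul_inv, le_div_iff₀ (by positivity), mul_comm]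
  exact (mul_le_mul_of_nonneg_right h2 (norm_nonneg _)).trans h1

lemma isClopen_species {n r : ℕ} (i : Fin n → Species) (e : Fin n → Fin r) :
    IsClopen {κ : Fin r → OneP | ∀ j, (κ (e j)).1 = i j} := by
  have h : {κ : Fin r → OneP | ∀ j, (κ (e j)).1 = i j} =
      (fun κ : Fin r → OneP => fun j => (κ (e j)).1) ⁻¹' {i} := by
    ext κ
    simp [funext_iff]
  rw [h]
  exact (isClopen_discrete {i}).preimage (by fun_prop)

lemma isRegular_monoVec (m : ℝ) {n : ℕ} (i : Fin n → Species) (f : 𝓢(Cfg n, ℂ)) :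
    IsRegular (monoVec m i f) where
  continuous r := by
    unfold monoVec
    refine continuous_finsetSum _ fun e _ => ?_
    have hc : Continuous fun κ : Fin r → OneP => fourierM n f (cfg fun j => onShell m (κ (e j))) :=
      (fourierM n f).continuous.comp (continuous_cfg fun j =>
        (continuous_onShell m).comp (continuous_apply _))
    -- The condition on the species is both open and closed, so the indicator function does not
    -- spoil continuity.
    refine hc.if (fun κ hκ => ?_) continuous_const
    rw [(isClopen_species i e).frontier_eq] at hκ
    exact hκ.elim
  decay r := by
    unfold monoVec
    intro N
    obtain ⟨C, hC, hb⟩ := exists_decay_schwartz_onShell m n N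
    refine ⟨∑ _e : Fin n ≃ Fin r, C * schwartzNorm (N * n) (fourierM n f), ?_, fun κ => ?_⟩
    · have := apply_nonneg (schwartzNorm (N * n)) (fourierM n f)
      positivity
    · rw [Finset.sum_mul]
      refine norm_sum_le_of_le _ fun e _ => ?_
      have h1 := hb (fourierM n f) (κ ∘ e)
      have h2 : ∏ j, ((1 + ‖((κ ∘ e) j).2‖) ^ N)⁻¹ = ∏ j, ((1 + ‖(κ j).2‖) ^ N)⁻¹ :=
        Equiv.prod_comp e fun j => ((1 + ‖(κ j).2‖) ^ N)⁻¹
      rw [h2] at h1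
      split_ifs
      · exact h1
      · rw [norm_zero]
        exact (norm_nonneg _).trans h1
  symmetric r σ κ := by
    unfold monoVec
    refine Fintype.sum_equiv (Equiv.equivCongr (Equiv.refl _) σ) _ _ fun e => ?_
    rfl
  finite := by
    refine ⟨n + 1, fun r hr => ?_⟩
    funext κ
    have : IsEmpty (Fin n ≃ Fin r) := ⟨fun e => by
      have := Fintype.card_congr e
      simp at this
      omega⟩
    simp [monoVec]

lemma isRegular_vacuum : IsRegular vacuum where
  continuous n := continuous_const
  decay n := by
    intro N
    rcases Nat.eq_zero_or_pos n with rfl | hn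
    · exact ⟨1, zero_le_one, fun κ => by simp [vacuum]⟩
    · exact ⟨0, le_rfl, fun κ => by simp [vacuum, hn.ne']⟩
  symmetric n σ κ := rfl
  finite := ⟨1, fun n hn => by
    funext κ
    simp [vacuum, Nat.one_le_iff_ne_zero.1 hn]⟩

lemma isRegular_of_mem_domain {m : ℝ} {Ψ : Fock} (h : Ψ ∈ domain m) : IsRegular Ψ := by
  refine Submodule.span_induction (p := fun Ψ _ => IsRegular Ψ) ?_ ?_ ?_ ?_ h
  · rintro Ψ (h | ⟨n, i, f, rfl⟩)
    · rw [Set.mem_singleton_iff] at h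
      exact h ▸ isRegular_vacuum
    · exact isRegular_monoVec m i f
  · exact ⟨fun n => continuous_const, fun n => RapidDecay.zero, fun _ _ _ => rfl,
      ⟨0, fun _ _ => rfl⟩⟩
  · intro Ψ Φ _ _ hΨ hΦ
    obtain ⟨K, hK⟩ := hΨ.finite
    obtain ⟨K', hK'⟩ := hΦ.finite
    refine ⟨fun n => (hΨ.continuous n).add (hΦ.continuous n),
      fun n => (hΨ.decay n).add (hΦ.decay n), fun n σ κ => ?_, ⟨max K K', fun n hn => ?_⟩⟩
    · simp only [Pi.add_apply, hΨ.symmetric n σ κ, hΦ.symmetric n σ κ]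
    · rw [Pi.add_apply, hK n ((le_max_left _ _).trans hn), hK' n ((le_max_right _ _).trans hn),
        add_zero]
  · intro c Ψ _ hΨ
    obtain ⟨K, hK⟩ := hΨ.finite
    refine ⟨fun n => (hΨ.continuous n).const_smul c,
      fun n => (hΨ.decay n).smul c, fun n σ κ => ?_, ⟨K, fun n hn => ?_⟩⟩
    · simp only [Pi.smul_apply, hΨ.symmetric n σ κ]
    · rw [Pi.smul_apply, hK n hn, smul_zero]

lemma IsRegular.integrable_mul {Ψ Φ : Fock} (hΨ : IsRegular Ψ) (hΦ : IsRegular Φ) (m : ℝ) (n : ℕ) :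
    Integrable (fun κ => (starRingEnd ℂ) (Ψ n κ) * Φ n κ) (shellPi m n) := by
  obtain ⟨C, hC, hb⟩ := (hΨ.decay n).bounded
  refine ((hΦ.decay n).mul_bounded (A := C) fun κ => ?_).integrable ?_
  · rw [RCLike.norm_conj]
    exact hb κ
  · have h1 := hΨ.continuous n
    have h2 := hΦ.continuous n
    exact (Continuous.mul (Complex.continuous_conj.comp h1) h2).aestronglyMeasurable

lemma IsRegular.summable {Φ : Fock} (hΦ : IsRegular Φ) (m : ℝ) (Ψ : Fock) :
    Summable fun n : ℕ => ((n.factorial : ℂ))⁻¹ *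
      ∫ κ : Fin n → OneP, (starRingEnd ℂ) (Ψ n κ) * Φ n κ ∂(Measure.pi fun _ => shell m) := by
  obtain ⟨K, hK⟩ := hΦ.finite
  refine summable_of_ne_finset_zero (s := Finset.range K) fun n hn => ?_
  have : Φ n = 0 := hK n (by simpa using hn)
  simp [this]

lemma fockInner_conj (m : ℝ) (Ψ Φ : Fock) :
    (starRingEnd ℂ) (fockInner m Ψ Φ) = fockInner m Φ Ψ := by
  unfold fockInner
  rw [Complex.conj_tsum]
  refine tsum_congr fun n => ?_
  rw [map_mul, ← integral_conj]
  simp [mul_comm]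

lemma fockInner_vacuum_left (m : ℝ) (Φ : Fock) : fockInner m vacuum Φ = Φ 0 default := by
  unfold fockInner
  rw [tsum_eq_single 0]
  · rw [Measure.pi_of_empty, integral_dirac]
    simp [vacuum]
    congr 1
    exact Subsingleton.elim _ _
  · intro n hn
    simp [vacuum, hn]

lemma fockInner_zero_left (m : ℝ) (Φ : Fock) : fockInner m 0 Φ = 0 := by
  simp [fockInner]

variable {m : ℝ}

lemma fockInner_add_right (Ψ Φ Φ' : domain m) :
    fockInner m Ψ (Φ + Φ' : domain m) = fockInner m Ψ Φ + fockInner m Ψ Φ' := by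
  have h1 := isRegular_of_mem_domain Ψ.2
  have h2 := isRegular_of_mem_domain Φ.2
  have h3 := isRegular_of_mem_domain Φ'.2
  unfold fockInner
  rw [← (h2.summable m _).tsum_add (h3.summable m _)]
  refine tsum_congr fun n => ?_
  rw [← mul_add, ← integral_add (h1.integrable_mul h2 m n) (h1.integrable_mul h3 m n)]
  simp [mul_add]

lemma fockInner_smul_right (Ψ Φ : domain m) (c : ℂ) :
    fockInner m Ψ (c • Φ : domain m) = c * fockInner m Ψ Φ := by
  unfold fockInner
  rw [← tsum_mul_left]
  refine tsum_congr fun n => ?_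
  have h : ∀ κ : Fin n → OneP, (starRingEnd ℂ) ((Ψ : Fock) n κ) * ((c • Φ : domain m) : Fock) n κ =
      c * ((starRingEnd ℂ) ((Ψ : Fock) n κ) * (Φ : Fock) n κ) := fun κ => mul_left_comm _ _ _
  simp only [h]
  rw [integral_const_mul, mul_left_comm]

/-- The inner product as a linear functional of the second argument. -/
def innerLin (Ψ : domain m) : domain m →ₗ[ℂ] ℂ where
  toFun Φ := fockInner m Ψ Φ
  map_add' := fockInner_add_right Ψ
  map_smul' c Φ := fockInner_smul_right Ψ Φ c

lemma innerLin_apply (Ψ Φ : domain m) : innerLin Ψ Φ = fockInner m Ψ Φ := rfl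

lemma innerLin_conj (Ψ Φ : domain m) : (starRingEnd ℂ) (innerLin Ψ Φ) = innerLin Φ Ψ :=
  fockInner_conj m _ _

lemma innerLin_add_left (Ψ Ψ' Φ : domain m) :
    innerLin (Ψ + Ψ') Φ = innerLin Ψ Φ + innerLin Ψ' Φ := by
  rw [← innerLin_conj, map_add, map_add, innerLin_conj, innerLin_conj]

lemma innerLin_smul_left (c : ℂ) (Ψ Φ : domain m) :
    innerLin (c • Ψ) Φ = (starRingEnd ℂ) c * innerLin Ψ Φ := by
  rw [← innerLin_conj, map_smul, smul_eq_mul, map_mul, innerLin_conj]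

/-- All summands of `(D|D)` are nonnegative, so each `L²` norm vanishes; continuity and positivity
of the measure on open sets turn this into vanishing everywhere. It allows vectors to be identified
through matrix elements, the only data given by the Wick expansion. -/
lemma eq_zero_of_innerLin_self {D : domain m} (h : innerLin D D = 0) : D = 0 := by
  have hD := isRegular_of_mem_domain D.2
  set a : ℕ → ℝ := fun n => ((n.factorial : ℝ))⁻¹ *
    ∫ κ : Fin n → OneP, ‖(D : Fock) n κ‖ ^ 2 ∂(shellPi m n) with ha
  have h1 : ∀ n : ℕ, ((n.factorial : ℂ))⁻¹ * ∫ κ : Fin n → OneP,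
      (starRingEnd ℂ) ((D : Fock) n κ) * (D : Fock) n κ ∂(Measure.pi fun _ => shell m) = (a n : ℂ) := by
    intro n
    rw [ha]
    push_cast
    rw [← integral_complex_ofReal]
    congr 1
    refine integral_congr_ae (Eventually.of_forall fun κ => ?_)
    simp only [Complex.ofReal_pow]
    exact Complex.conj_mul' _
  have hs : Summable a := by
    have := hD.summable m D
    simp only [h1] at this
    exact_mod_cast this
  have h0 : ∑' n, a n = 0 := by
    have h2 : innerLin D D = ∑' n, (a n : ℂ) := tsum_congr h1
    rw [h] at h2
    exact_mod_cast h2.symm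
  have hnn : ∀ n, 0 ≤ a n := fun n => by positivity
  have h3 : a = 0 := (hasSum_zero_iff_of_nonneg hnn).1 (h0 ▸ hs.hasSum)
  refine Subtype.ext (funext fun n => ?_)
  have h4 : ∫ κ : Fin n → OneP, ‖(D : Fock) n κ‖ ^ 2 ∂(shellPi m n) = 0 := by
    have := congrFun h3 n
    simpa [ha, Nat.factorial_ne_zero] using this
  have h5 : Integrable (fun κ : Fin n → OneP => ‖(D : Fock) n κ‖ ^ 2) (shellPi m n) := by
    have := (hD.integrable_mul hD m n).norm
    refine this.congr (Eventually.of_forall fun κ => ?_)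
    simp [sq]
  rw [integral_eq_zero_iff_of_nonneg (fun κ => by positivity) h5] at h4
  have h6 := Continuous.ae_eq_iff_eq (shellPi m n) ((hD.continuous n).norm.pow 2)
    (continuous_const (y := (0 : ℝ))) |>.1 h4
  funext κ
  have h7 := congrFun h6 κ
  simpa using h7

end Fock
end EG
end

noncomputable section
namespace EG

set_option linter.unusedSectionVars false

/-! ### Matrix elements of normally ordered products -/

section WickElements

/-- The fields are real, so conjugation exchanges the creation and annihilation parts. Matrix
elements with the vacuum on the right are thereby reduced to those with the vacuum on the left. -/
lemma wickElem_conj (m : ℝ) (L : List (Gen × Mink)) (Ψ Φ : Fock) :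
    (starRingEnd ℂ) (wickElem m L Ψ Φ) = wickElem m L Φ Ψ := by
  induction L generalizing Ψ Φ with
  | nil => exact fockInner_conj m Ψ Φ
  | cons a L ih =>
    obtain ⟨G, x⟩ := a
    simp only [wickElem]
    rw [← integral_conj]
    refine integral_congr_ae (Eventually.of_forall fun κ => ?_)
    beta_reduce
    split_ifs
    · simp only [map_add, map_mul, ih, Complex.conj_conj]
      ring
    · simp

lemma ann_vacuum (κ : OneP) : ann κ vacuum = 0 := by
  funext n p
  simp [ann, vacuum]

lemma ann_zero (κ : OneP) : ann κ (0 : Fock) = 0 := rfl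

lemma wickElem_zero_left (m : ℝ) (L : List (Gen × Mink)) (Φ : Fock) : wickElem m L 0 Φ = 0 := by
  induction L generalizing Φ with
  | nil => exact fockInner_zero_left m Φ
  | cons a L ih =>
    obtain ⟨G, x⟩ := a
    simp [wickElem, ann_zero, ih]

open Classical in
lemma wickElem_cons_vacuum (m : ℝ) (G : Gen) (x : Mink) (L : List (Gen × Mink)) (Φ : Fock) :
    wickElem m ((G, x) :: L) vacuum Φ = ∫ κ : OneP,
      (if κ.1 = G.1 then mode m G κ x * wickElem m L vacuum (ann κ Φ) else 0) ∂(shell m) := by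
  simp [wickElem, ann_vacuum, wickElem_zero_left]

/-- Only the components with the right species contribute to `(Ω| :⋯: Φ)`. -/
lemma wickElem_vacuum_eq_zero (m : ℝ) (L : List (Gen × Mink)) (Φ : Fock)
    (h : ∀ κ : Fin L.length → OneP, (∀ j, (κ j).1 = (L.get j).1.1) → Φ L.length κ = 0) :
    wickElem m L vacuum Φ = 0 := by
  induction L generalizing Φ with
  | nil =>
    rw [wickElem, fockInner_vacuum_left]
    exact h _ fun j => j.elim0
  | cons a L ih =>
    obtain ⟨G, x⟩ := a
    rw [wickElem_cons_vacuum]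
    refine integral_eq_zero_of_ae (Eventually.of_forall fun κ => ?_)
    simp only [Pi.zero_apply]
    split_ifs with hκ
    · rw [ih, mul_zero]
      intro p hp
      refine h (Fin.cons κ p) fun j => ?_
      refine Fin.cases ?_ (fun j => ?_) j
      · exact hκ
      · exact hp j
    · rfl

lemma integral_pi_succ {m : ℝ} {n : ℕ} {F : (Fin (n + 1) → OneP) → ℂ}
    (hF : Integrable F (shellPi m (n + 1))) :
    ∫ κ, F κ ∂(shellPi m (n + 1)) = ∫ a, ∫ p, F (Fin.cons a p) ∂(shellPi m n) ∂(shell m) := by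
  have h := (measurePreserving_piFinSuccAbove (fun _ : Fin (n + 1) => shell m) 0).symm
  have h1 := h.integral_comp (MeasurableEquiv.measurableEmbedding _) F
  have h2 := (h.integrable_comp_emb (MeasurableEquiv.measurableEmbedding _)).2 hF
  rw [← h1, integral_prod]
  · refine integral_congr_ae (Eventually.of_forall fun a => integral_congr_ae
      (Eventually.of_forall fun p => ?_))
    simp [MeasurableEquiv.piFinSuccAbove_symm_apply]
    rfl
  · exact h2

/-- The plane wave `exp(-i ∑ κ_j·x_j)` on the mass shells. -/
def shellWave (m : ℝ) {n : ℕ} (κ : Fin n → OneP) (x : Fin n → Mink) : ℂ :=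
  Complex.exp (-Complex.I * ((∑ j, mdot (onShell m (κ j)) (x j) : ℝ) : ℂ))

lemma norm_shellWave (m : ℝ) {n : ℕ} (κ : Fin n → OneP) (x : Fin n → Mink) :
    ‖shellWave m κ x‖ = 1 := by
  rw [shellWave, neg_mul, ← mul_neg, mul_comm, ← Complex.ofReal_neg, Complex.norm_exp_ofReal_mul_I]

lemma mode_zero (m : ℝ) (i : Species) (κ : OneP) (x : Mink) :
    mode m (i, 0) κ x = Complex.exp (-Complex.I * ((mdot (onShell m κ) x : ℝ) : ℂ)) := by
  simp [mode]

lemma continuous_mdot_onShell (m : ℝ) (x : Mink) : Continuous fun κ => mdot (onShell m κ) x := by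
  have h : ∀ μ, Continuous fun κ => onShell m κ μ :=
    fun μ => (PiLp.continuous_apply 2 _ μ).comp (continuous_onShell m)
  exact continuous_finsetSum _ fun μ _ => (continuous_const.mul (h μ)).mul continuous_const

open Classical in
/-- The indicator function of the momenta of particles of the species `i`. -/
def speciesInd {n : ℕ} (i : Fin n → Species) (κ : Fin n → OneP) : ℂ :=
  if ∀ j, (κ j).1 = i j then 1 else 0

lemma continuous_speciesInd {n : ℕ} (i : Fin n → Species) : Continuous (speciesInd i) := by
  classical
  refine continuous_const.if (fun κ hκ => ?_) continuous_const
  have h := isClopen_species i (id : Fin n → Fin n)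
  simp only [id] at h
  rw [h.frontier_eq] at hκ
  exact hκ.elim

lemma norm_speciesInd_le {n : ℕ} (i : Fin n → Species) (κ : Fin n → OneP) :
    ‖speciesInd i κ‖ ≤ 1 := by
  unfold speciesInd
  split_ifs <;> simp

lemma conj_speciesInd {n : ℕ} (i : Fin n → Species) (κ : Fin n → OneP) :
    (starRingEnd ℂ) (speciesInd i κ) = speciesInd i κ := by
  unfold speciesInd
  split_ifs <;> simp

lemma continuous_shellWave (m : ℝ) {n : ℕ} (x : Fin n → Mink) :
    Continuous fun κ => shellWave m κ x := by
  unfold shellWave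
  have h : ∀ j : Fin n, Continuous fun κ : Fin n → OneP => mdot (onShell m (κ j)) (x j) :=
    fun j => (continuous_mdot_onShell m (x j)).comp (continuous_apply j)
  fun_prop

lemma norm_wave_mul_ind_le (m : ℝ) {n : ℕ} (i : Fin n → Species) (κ : Fin n → OneP)
    (x : Fin n → Mink) : ‖speciesInd i κ * shellWave m κ x‖ ≤ 1 := by
  rw [norm_mul, norm_shellWave, mul_one]
  exact norm_speciesInd_le i κ

lemma RapidDecay.cons {n : ℕ} {h : (Fin (n + 1) → OneP) → ℂ} (hh : RapidDecay h) (a : OneP) :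
    RapidDecay fun p : Fin n → OneP => h (Fin.cons a p) := by
  intro N
  obtain ⟨C, hC, hb⟩ := hh N
  refine ⟨C, hC, fun p => (hb _).trans (mul_le_mul_of_nonneg_left ?_ hC)⟩
  rw [Fin.prod_univ_succ]
  simp only [Fin.cons_zero, Fin.cons_succ]
  exact mul_le_of_le_one_left (prod_decay_nonneg p N) (one_add_norm_pow_inv_le_one _ _)

/-- The matrix elements of normally ordered products of the basic fields between the vacuum and
a vector, as integrals over the momenta. -/
lemma wickElem_ofFn_vacuum (m : ℝ) {n : ℕ} (i : Fin n → Species) (x : Fin n → Mink) (Φ : Fock)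
    (hc : Continuous (Φ n)) (hd : RapidDecay (Φ n)) :
    wickElem m (List.ofFn fun j => ((i j, 0), x j)) vacuum Φ =
      ∫ κ, speciesInd i κ * shellWave m κ x * Φ n κ ∂(shellPi m n) := by
  classical
  induction n generalizing Φ with
  | zero =>
    rw [List.ofFn_zero, wickElem, fockInner_vacuum_left, shellPi, Measure.pi_of_empty,
      integral_dirac]
    simp [speciesInd, shellWave]
    congr 1
    exact Subsingleton.elim _ _
  | succ n ih =>
    have hint : Integrable (fun κ => speciesInd i κ * shellWave m κ x * Φ (n + 1) κ)
        (shellPi m (n + 1)) :=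
      (hd.mul_bounded fun κ => norm_wave_mul_ind_le m i κ x).integrable
        (((continuous_speciesInd i).mul (continuous_shellWave m x)).mul hc).aestronglyMeasurable
    rw [List.ofFn_succ, wickElem_cons_vacuum, integral_pi_succ hint]
    refine integral_congr_ae (Eventually.of_forall fun a => ?_)
    simp only
    rw [ih (fun j => i j.succ) (fun j => x j.succ) (ann a Φ)
      (hc.comp (Continuous.finCons continuous_const continuous_id)) (hd.cons a)]
    have h1 : ∀ p : Fin n → OneP, shellWave m (Fin.cons a p : Fin (n + 1) → OneP) x =
        mode m (i 0, 0) a (x 0) * shellWave m p fun j => x j.succ := by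
      intro p
      simp only [shellWave, mode_zero, ← Complex.exp_add, Fin.sum_univ_succ, Fin.cons_zero,
        Fin.cons_succ]
      push_cast
      ring_nf
    have h2 : ∀ p : Fin n → OneP, speciesInd i (Fin.cons a p : Fin (n + 1) → OneP) =
        (if a.1 = i 0 then 1 else 0) * speciesInd (fun j => i j.succ) p := by
      intro p
      simp only [speciesInd, Fin.forall_fin_succ, Fin.cons_zero, Fin.cons_succ]
      split_ifs <;> simp_all
    split_ifs with ha
    · rw [← integral_const_mul]
      refine integral_congr_ae (Eventually.of_forall fun p => ?_)
      simp only [h1, h2, ha, if_true, ann]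
      ring
    · simp [h2, ha]

end WickElements

/-! ### Matrix elements as smooth multipliers of temperate growth -/

section Temperate

-- Pushing the measure forward to pairs of a covector and a coefficient turns the integral into a
-- Fourier integral over a normed space, which is smooth with bounded derivatives when all moments
-- are finite. The growth property is indispensable: `smulLeftCLM` is zero by default for a function
-- without it, and the Wick expansion would then carry no information.
open Real in
lemma hasTemperateGrowth_integral_planeWave {W Z : Type*} [NormedAddCommGroup W]
    [InnerProductSpace ℝ W] [FiniteDimensional ℝ W] [MeasurableSpace W] [BorelSpace W]
    [MeasurableSpace Z] {μ : Measure Z} {c : Z → ℂ} {k : Z → W} (hc : AEMeasurable c μ)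
    (hk : AEMeasurable k μ) (hint : ∀ n : ℕ, Integrable (fun z => ‖k z‖ ^ n * ‖c z‖) μ) {A : ℝ}
    (hA : ∀ z, ‖c z‖ ≤ A) :
    Function.HasTemperateGrowth fun y => ∫ z, c z * planeWave (k z) y ∂μ := by
  let φ : Z → W × ℂ := fun z => (-(2 * π)⁻¹ • k z, c z)
  have hφ : AEMeasurable φ μ := (hk.const_smul (-(2 * π)⁻¹)).prodMk hc
  let L : W × ℂ →L[ℝ] W →L[ℝ] ℝ := (innerSL ℝ).comp (ContinuousLinearMap.fst ℝ W ℂ)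
  have h1 : (fun y => ∫ z, c z * planeWave (k z) y ∂μ) =
      VectorFourier.fourierIntegral fourierChar (μ.map φ) L.toLinearMap₁₂ fun v : W × ℂ => v.2 := by
    funext y
    rw [VectorFourier.fourierIntegral, integral_map hφ]
    · refine integral_congr_ae (Eventually.of_forall fun z => ?_)
      simp only [planeWave, Circle.smul_def, fourierChar_apply, smul_eq_mul]
      rw [mul_comm]
      congr 2
      have : -(L.toLinearMap₁₂ (φ z) y) = (2 * π)⁻¹ * inner ℝ (k z) y := by
        change -(inner ℝ (-(2 * π)⁻¹ • k z) y) = _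
        rw [inner_smul_left]
        simp
      rw [this]
      have hpi := pi_ne_zero
      push_cast
      field_simp
    · have hcont : Continuous fun v : W × ℂ => fourierChar (-(L.toLinearMap₁₂ v y)) • v.2 := by
        have : Continuous fun v : W × ℂ => L.toLinearMap₁₂ v y :=
          (ContinuousLinearMap.apply ℝ ℝ y).continuous.comp L.continuous
        fun_prop
      exact hcont.aestronglyMeasurable
  have hint' : ∀ n : ℕ, Integrable (fun v : W × ℂ => ‖v‖ ^ n * ‖v.2‖) (μ.map φ) := by
    intro n
    refine (integrable_map_measure (by fun_prop) hφ).2 ?_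
    refine ((hint n).add ((hint 0).const_mul (|A| ^ n))).mono' ?_ (Eventually.of_forall fun z => ?_)
    · have : Continuous fun v : W × ℂ => ‖v‖ ^ n * ‖v.2‖ := by fun_prop
      exact (this.measurable.comp_aemeasurable hφ).aestronglyMeasurable
    · simp only [Function.comp_apply, Pi.add_apply, pow_zero, one_mul]
      rw [Real.norm_of_nonneg (by positivity), ← add_mul]
      refine mul_le_mul_of_nonneg_right ?_ (norm_nonneg _)
      -- The coefficients are bounded by `A`, so the moments of the image measure reduce to those of
      -- the covector `k`.
      have h2 : ‖φ z‖ ≤ max ‖k z‖ |A| := by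
        rw [Prod.norm_def]
        refine max_le_max ?_ ((hA z).trans (le_abs_self A))
        change ‖-(2 * π)⁻¹ • k z‖ ≤ _
        rw [norm_smul, norm_neg, Real.norm_of_nonneg (by positivity)]
        refine mul_le_of_le_one_left (norm_nonneg _) (inv_le_one_of_one_le₀ ?_)
        linarith [pi_gt_three]
      refine (pow_le_pow_left₀ (norm_nonneg _) h2 n).trans ?_
      rcases le_total ‖k z‖ |A| with h | h
      · rw [max_eq_right h]
        exact le_add_of_nonneg_left (by positivity)
      · rw [max_eq_left h]
        exact le_add_of_nonneg_right (by positivity)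
  rw [h1]
  refine ⟨VectorFourier.contDiff_fourierIntegral L (N := ⊤) fun n _ => hint' n, fun n => ?_⟩
  refine ⟨0, ∫ v, ‖VectorFourier.fourierPowSMulRight L (fun v : W × ℂ => v.2) v n‖ ∂(μ.map φ),
    fun x => ?_⟩
  rw [VectorFourier.iteratedFDeriv_fourierIntegral L (N := ⊤) (fun n _ => hint' n)
    (by fun_prop) (mod_cast le_top), pow_zero, mul_one]
  exact VectorFourier.norm_fourierIntegral_le_integral_norm _ _ _ _ _

/-- The covector `k` with `⟪k, x⟫ = -∑ κ_j·x_j`. -/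
def shellCovec (m : ℝ) {n : ℕ} (κ : Fin n → OneP) : Cfg n :=
  WithLp.toLp 2 fun p => -(metricSign p.2 * onShell m (κ p.1) p.2)

lemma inner_shellCovec (m : ℝ) {n : ℕ} (κ : Fin n → OneP) (x : Cfg n) :
    inner ℝ (shellCovec m κ) x = -∑ j, mdot (onShell m (κ j)) (pt x j) := by
  simp only [PiLp.inner_apply, shellCovec, mdot, pt, Fintype.sum_prod_type, ← Finset.sum_neg_distrib]
  refine Finset.sum_congr rfl fun j _ => Finset.sum_congr rfl fun μ _ => ?_
  simp
  ring

lemma shellWave_eq_planeWave (m : ℝ) {n : ℕ} (κ : Fin n → OneP) (x : Cfg n) :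
    shellWave m κ (pt x) = planeWave (shellCovec m κ) x := by
  rw [shellWave, planeWave, inner_shellCovec]
  push_cast
  ring_nf

lemma conj_shellWave_eq_planeWave (m : ℝ) {n : ℕ} (κ : Fin n → OneP) (x : Cfg n) :
    (starRingEnd ℂ) (shellWave m κ (pt x)) = planeWave (-shellCovec m κ) x := by
  rw [shellWave_eq_planeWave, planeWave, planeWave, ← Complex.exp_conj, inner_neg_left]
  simp

lemma continuous_shellCovec (m : ℝ) (n : ℕ) :
    Continuous fun κ : Fin n → OneP => shellCovec m κ := by
  refine (PiLp.continuous_toLp 2 _).comp (continuous_pi fun p => ?_)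
  have h : Continuous fun κ : Fin n → OneP => onShell m (κ p.1) p.2 :=
    ((PiLp.continuous_apply 2 _ p.2).comp (continuous_onShell m)).comp (continuous_apply p.1)
  exact (continuous_const.mul h).neg

lemma energy_le (m : ℝ) (κ : OneP) : energy m κ ≤ ‖κ.2‖ + |m| := by
  unfold energy
  refine Real.sqrt_le_iff.2 ⟨by positivity, ?_⟩
  have h : mass m κ.1 ^ 2 ≤ |m| ^ 2 := by
    unfold mass
    split_ifs
    · rw [sq_abs]
    · rw [zero_pow two_ne_zero]
      positivity
  nlinarith [mul_nonneg (norm_nonneg κ.2) (abs_nonneg m)]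

lemma one_le_prod_one_add_norm {n : ℕ} (s : Finset (Fin n)) (κ : Fin n → OneP) :
    (1 : ℝ) ≤ ∏ j ∈ s, (1 + ‖(κ j).2‖) := by
  have h := Finset.prod_le_prod (s := s) (f := fun _ => (1 : ℝ)) (g := fun j => 1 + ‖(κ j).2‖)
    (fun _ _ => zero_le_one) fun l _ => by linarith [norm_nonneg (κ l).2]
  simpa using h

lemma norm_shellCovec_le (m : ℝ) {n : ℕ} (κ : Fin n → OneP) :
    ‖shellCovec m κ‖ ≤ (4 * n * (1 + |m|)) * ∏ j, (1 + ‖(κ j).2‖) := by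
  have h1 : ‖shellCovec m κ‖ ≤ ∑ p : Fin n × Fin 4, ‖shellCovec m κ p‖ := by
    have h := norm_sum_le (Finset.univ : Finset (Fin n × Fin 4))
      fun p => (shellCovec m κ p) • (EuclideanSpace.basisFun (Fin n × Fin 4) ℝ p)
    have h2 : ∑ p, (shellCovec m κ p) • (EuclideanSpace.basisFun (Fin n × Fin 4) ℝ p) =
        shellCovec m κ := by
      have := (EuclideanSpace.basisFun (Fin n × Fin 4) ℝ).sum_repr (shellCovec m κ)
      simpa using this
    rw [h2] at h
    refine h.trans (Finset.sum_le_sum fun p _ => ?_)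
    rw [norm_smul, OrthonormalBasis.norm_eq_one, mul_one]
  have h3 : ∀ p : Fin n × Fin 4, ‖shellCovec m κ p‖ ≤ (1 + |m|) * ∏ j, (1 + ‖(κ j).2‖) := by
    rintro ⟨j, μ⟩
    have h4 : ‖shellCovec m κ (j, μ)‖ = |onShell m (κ j) μ| := by
      have : shellCovec m κ (j, μ) = -(metricSign μ * onShell m (κ j) μ) := rfl
      rw [this, norm_neg, norm_mul, Real.norm_eq_abs, Real.norm_eq_abs]
      have : |metricSign μ| = 1 := by unfold metricSign; split_ifs <;> simp
      rw [this, one_mul]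
    have h5 : |onShell m (κ j) μ| ≤ ‖(κ j).2‖ + |m| := by
      refine Fin.cases ?_ (fun l => ?_) μ
      · rw [onShell_zero, abs_of_nonneg (energy_nonneg _ _)]
        exact energy_le m _
      · rw [onShell_succ, ← Real.norm_eq_abs]
        exact (PiLp.norm_apply_le (κ j).2 l).trans (le_add_of_nonneg_right (abs_nonneg m))
    have h6 : 1 + ‖(κ j).2‖ ≤ ∏ j, (1 + ‖(κ j).2‖) := by
      rw [← Finset.mul_prod_erase _ _ (Finset.mem_univ j)]
      refine le_mul_of_one_le_right (by positivity) ?_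
      exact one_le_prod_one_add_norm _ _
    rw [h4]
    calc _ ≤ ‖(κ j).2‖ + |m| := h5
      _ ≤ (1 + |m|) * (1 + ‖(κ j).2‖) := by
        nlinarith [mul_nonneg (norm_nonneg (κ j).2) (abs_nonneg m), norm_nonneg (κ j).2]
      _ ≤ _ := mul_le_mul_of_nonneg_left h6 (by positivity)
  refine h1.trans ((Finset.sum_le_sum fun p _ => h3 p).trans (le_of_eq ?_))
  rw [Finset.sum_const, Finset.card_univ, Fintype.card_prod, Fintype.card_fin, Fintype.card_fin,
    nsmul_eq_mul]
  push_cast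
  ring

lemma RapidDecay.integrable_one_add_pow {n : ℕ} {h : (Fin n → OneP) → ℂ} (hh : RapidDecay h)
    {m : ℝ} (hm : AEStronglyMeasurable h (shellPi m n)) (N : ℕ) :
    Integrable (fun κ => (1 + ‖shellCovec m κ‖) ^ N * ‖h κ‖) (shellPi m n) := by
  obtain ⟨C, hC, hb⟩ := hh (5 + N)
  set B : ℝ := 1 + 4 * n * (1 + |m|)
  refine ((integrable_prod_decay m n).const_mul (C * B ^ N)).mono' ?_
    (Eventually.of_forall fun κ => ?_)
  · exact ((continuous_const.add (continuous_shellCovec m n).norm).pow N).aestronglyMeasurable.mul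
      hm.norm
  · rw [Real.norm_of_nonneg (by positivity)]
    have hP : (1 : ℝ) ≤ ∏ j, (1 + ‖(κ j).2‖) :=
      one_le_prod_one_add_norm _ _
    have h1 : (1 + ‖shellCovec m κ‖) ^ N ≤ B ^ N * ∏ j, (1 + ‖(κ j).2‖) ^ N := by
      rw [Finset.prod_pow, ← mul_pow]
      refine pow_le_pow_left₀ (by positivity) ?_ _
      have := norm_shellCovec_le m κ
      simp only [B]
      linarith
    calc _ ≤ (B ^ N * ∏ j, (1 + ‖(κ j).2‖) ^ N) * (C * ∏ j, ((1 + ‖(κ j).2‖) ^ (5 + N))⁻¹) :=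
          mul_le_mul h1 (hb κ) (norm_nonneg _) (by positivity)
      _ = C * B ^ N * ((∏ j, (1 + ‖(κ j).2‖) ^ N) * ∏ j, ((1 + ‖(κ j).2‖) ^ (5 + N))⁻¹) := by ring
      _ = _ := by
        rw [← Finset.prod_mul_distrib]
        congr 2
        funext j
        rw [pow_add]
        field_simp

/-- The indices of the product of the basic fields of the given species. -/
def speciesIdx {n : ℕ} (i : Fin n → Species) (j : Fin n) : Gen →₀ ℕ := Finsupp.single (i j, 0) 1

lemma legs_speciesIdx {n : ℕ} (i : Fin n → Species) (x : Cfg n) :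
    legs (speciesIdx i) x = List.ofFn fun j => ((i j, 0), pt x j) := by
  rw [legs, List.ofFn_eq_map, List.map_eq_flatMap]
  congr 1
  funext j
  simp [speciesIdx]

lemma IsRegular.continuous_ind_mul {Φ : Fock} (hΦ : IsRegular Φ) {n : ℕ} (i : Fin n → Species) :
    Continuous fun κ => speciesInd i κ * Φ n κ := (continuous_speciesInd i).mul (hΦ.continuous n)

lemma IsRegular.decay_ind_mul {Φ : Fock} (hΦ : IsRegular Φ) {n : ℕ} (i : Fin n → Species) :
    RapidDecay fun κ => speciesInd i κ * Φ n κ :=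
  (hΦ.decay n).mul_bounded (norm_speciesInd_le i)

lemma wickFun_vacuum_left {m : ℝ} {Φ : Fock} (hΦ : IsRegular Φ) {n : ℕ} (i : Fin n → Species)
    (x : Cfg n) : wickFun m (speciesIdx i) vacuum Φ x =
      ∫ κ, (speciesInd i κ * Φ n κ) * planeWave (shellCovec m κ) x ∂(shellPi m n) := by
  rw [wickFun, legs_speciesIdx, wickElem_ofFn_vacuum m i _ Φ (hΦ.continuous n) (hΦ.decay n)]
  refine integral_congr_ae (Eventually.of_forall fun κ => ?_)
  simp only [shellWave_eq_planeWave]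
  ring

lemma wickFun_vacuum_right {m : ℝ} {Φ : Fock} (hΦ : IsRegular Φ) {n : ℕ} (i : Fin n → Species)
    (x : Cfg n) : wickFun m (speciesIdx i) Φ vacuum x =
      ∫ κ, (speciesInd i κ * (starRingEnd ℂ) (Φ n κ)) * planeWave (-shellCovec m κ) x
        ∂(shellPi m n) := by
  have h : wickFun m (speciesIdx i) Φ vacuum x =
      (starRingEnd ℂ) (wickFun m (speciesIdx i) vacuum Φ x) := (wickElem_conj m _ _ _).symm
  rw [h, wickFun_vacuum_left hΦ, ← integral_conj]
  refine integral_congr_ae (Eventually.of_forall fun κ => ?_)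
  simp only [map_mul, conj_speciesInd, ← shellWave_eq_planeWave, conj_shellWave_eq_planeWave]

lemma RapidDecay.conj {n : ℕ} {h : (Fin n → OneP) → ℂ} (hh : RapidDecay h) :
    RapidDecay fun κ => (starRingEnd ℂ) (h κ) := by
  intro N
  obtain ⟨C, hC, hb⟩ := hh N
  exact ⟨C, hC, fun κ => by rw [RCLike.norm_conj]; exact hb κ⟩

lemma RapidDecay.integrable_pow {n : ℕ} {h : (Fin n → OneP) → ℂ} (hh : RapidDecay h)
    {m : ℝ} (hm : AEStronglyMeasurable h (shellPi m n)) (N : ℕ) :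
    Integrable (fun κ => ‖shellCovec m κ‖ ^ N * ‖h κ‖) (shellPi m n) := by
  refine (hh.integrable_one_add_pow hm N).mono' ?_ (Eventually.of_forall fun κ => ?_)
  · exact ((continuous_shellCovec m n).norm.pow N).aestronglyMeasurable.mul hm.norm
  · rw [Real.norm_of_nonneg (by positivity)]
    gcongr
    linarith

lemma hasTemperateGrowth_integral_shell {m : ℝ} {n : ℕ} {c : (Fin n → OneP) → ℂ}
    (hc : Continuous c) (hd : RapidDecay c) {s : ℝ} (hs : |s| = 1) :
    Function.HasTemperateGrowth fun x : Cfg n =>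
      ∫ κ, c κ * planeWave (s • shellCovec m κ) x ∂(shellPi m n) := by
  obtain ⟨A, hA, hb⟩ := hd.bounded
  refine hasTemperateGrowth_integral_planeWave hc.measurable.aemeasurable
    ((continuous_shellCovec m n).const_smul s).measurable.aemeasurable (fun N => ?_) hb
  simp only [norm_smul, Real.norm_eq_abs, hs, one_mul]
  exact hd.integrable_pow hc.aestronglyMeasurable N

lemma schwartzIntegrable_shell {m : ℝ} {n : ℕ} {c : (Fin n → OneP) → ℂ}
    (hc : Continuous c) (hd : RapidDecay c) {s : ℝ} (hs : |s| = 1) (H : 𝓢(Cfg n, ℂ)) :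
    SchwartzIntegrable (fun κ => c κ • modulate (s • shellCovec m κ) H) (shellPi m n) := by
  refine schwartzIntegrable_smul_modulate (w := c) (k := fun κ => s • shellCovec m κ)
    hc.aestronglyMeasurable
    ((continuous_shellCovec m n).const_smul s).aestronglyMeasurable (fun N => ?_) H
  simp only [norm_smul, Real.norm_eq_abs, hs, one_mul]
  exact hd.integrable_one_add_pow hc.aestronglyMeasurable N

/-- The multiplier is a superposition of plane waves, so the momentum integral can be pulled out of
the distribution. The sign `s` distinguishes absorbed (`s = 1`) from emitted (`s = -1`) particles.
-/
lemma clm_smulLeft_integral_shell {m : ℝ} {n : ℕ} {c : (Fin n → OneP) → ℂ}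
    (hc : Continuous c) (hd : RapidDecay c) {s : ℝ} (hs : |s| = 1) (D : 𝓢(Cfg n, ℂ) →L[ℂ] ℂ)
    (H : 𝓢(Cfg n, ℂ)) :
    D (SchwartzMap.smulLeftCLM ℂ (fun x : Cfg n =>
      ∫ κ, c κ * planeWave (s • shellCovec m κ) x ∂(shellPi m n)) H) =
      ∫ κ, c κ * D (modulate (s • shellCovec m κ) H) ∂(shellPi m n) := by
  rw [clm_apply_eq_integral (schwartzIntegrable_shell (m := m) hc hd hs H) (fun x => ?_) D]
  · simp
  · rw [SchwartzMap.smulLeftCLM_apply_apply (hasTemperateGrowth_integral_shell hc hd hs),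
      smul_eq_mul, ← integral_mul_const]
    refine integral_congr_ae (Eventually.of_forall fun κ => ?_)
    change _ = c κ * modulate (s • shellCovec m κ) H x
    rw [modulate_apply]
    ring

lemma clm_smulLeft_wickFun_left {m : ℝ} {Φ : Fock} (hΦ : IsRegular Φ) {n : ℕ}
    (i : Fin n → Species) (D : 𝓢(Cfg n, ℂ) →L[ℂ] ℂ) (H : 𝓢(Cfg n, ℂ)) :
    D (SchwartzMap.smulLeftCLM ℂ (wickFun m (speciesIdx i) vacuum Φ) H) =
      ∫ κ, (speciesInd i κ * Φ n κ) * D (modulate ((1 : ℝ) • shellCovec m κ) H)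
        ∂(shellPi m n) := by
  rw [← clm_smulLeft_integral_shell (hΦ.continuous_ind_mul i) (hΦ.decay_ind_mul i) abs_one]
  congr 3
  funext x
  rw [wickFun_vacuum_left hΦ]
  simp only [one_smul]

lemma clm_smulLeft_wickFun_right {m : ℝ} {Φ : Fock} (hΦ : IsRegular Φ) {n : ℕ}
    (i : Fin n → Species) (D : 𝓢(Cfg n, ℂ) →L[ℂ] ℂ) (H : 𝓢(Cfg n, ℂ)) :
    D (SchwartzMap.smulLeftCLM ℂ (wickFun m (speciesIdx i) Φ vacuum) H) =
      ∫ κ, (speciesInd i κ * (starRingEnd ℂ) (Φ n κ)) *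
        D (modulate ((-1 : ℝ) • shellCovec m κ) H) ∂(shellPi m n) := by
  rw [← clm_smulLeft_integral_shell
    (c := fun κ => speciesInd i κ * (starRingEnd ℂ) (Φ n κ))
    ((continuous_speciesInd i).mul (Complex.continuous_conj.comp (hΦ.continuous n)))
    ((hΦ.decay n).conj.mul_bounded (norm_speciesInd_le i)) (by simp)]
  congr 3
  funext x
  rw [wickFun_vacuum_right hΦ]
  simp only [neg_smul, one_smul]

end Temperate
end EG
end

noncomputable section
namespace EG

set_option linter.unusedSectionVars false

/-! ### Sub-polynomials of the field and of the vertex -/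

section SubPoly

/-- The commutator of two derivations is a derivation and vanishes on the generators. Consequently
`subPoly` does not depend on the arbitrary order in which the multi-index is listed. -/
lemma pderiv_pderiv_comm (G G' : Gen) (B : Sym) :
    MvPolynomial.pderiv G (MvPolynomial.pderiv G' B) =
      MvPolynomial.pderiv G' (MvPolynomial.pderiv G B) := by
  have h : ⁅(MvPolynomial.pderiv G : Derivation ℂ Sym Sym), (MvPolynomial.pderiv G' : Derivation ℂ Sym Sym)⁆ = 0 := by
    refine MvPolynomial.derivation_ext fun i => ?_
    simp [Derivation.commutator_apply, MvPolynomial.pderiv_X, Pi.single_apply, apply_ite]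
  have h2 := DFunLike.congr_fun h B
  rw [Derivation.commutator_apply] at h2
  exact sub_eq_zero.1 h2

instance : LeftCommutative fun (G : Gen) (C : Sym) => MvPolynomial.pderiv G C :=
  ⟨fun G G' B => pderiv_pderiv_comm G G' B⟩

lemma subPoly_eq_foldr (s : Gen →₀ ℕ) (B : Sym) :
    subPoly s B = Multiset.foldr (fun G C => MvPolynomial.pderiv G C) B (Finsupp.toMultiset s) := by
  conv_rhs => rw [← Multiset.coe_toList (Finsupp.toMultiset s)]
  rfl

lemma subPoly_zero_left (B : Sym) : subPoly 0 B = B := by simp [subPoly]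

lemma subPoly_add_single (s : Gen →₀ ℕ) (G : Gen) (B : Sym) :
    subPoly (s + Finsupp.single G 1) B = subPoly s (MvPolynomial.pderiv G B) := by
  rw [subPoly_eq_foldr, subPoly_eq_foldr, map_add, Multiset.foldr_add]
  simp

lemma subPoly_single (G : Gen) (B : Sym) :
    subPoly (Finsupp.single G 1) B = MvPolynomial.pderiv G B := by
  rw [← zero_add (Finsupp.single G 1), subPoly_add_single, subPoly_zero_left]

lemma subPoly_zero_right (s : Gen →₀ ℕ) : subPoly s 0 = 0 := by
  rw [subPoly]
  induction (Finsupp.toMultiset s).toList with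
  | nil => rfl
  | cons a L ih => rw [List.foldr_cons, ih, map_zero]

lemma eq_add_single {s : Gen →₀ ℕ} {G : Gen} (h : s G ≠ 0) :
    s = (s - Finsupp.single G 1) + Finsupp.single G 1 :=
  (tsub_add_cancel_of_le (Finsupp.single_le_iff.2 (Nat.one_le_iff_ne_zero.2 h))).symm

lemma subPoly_eq_zero {s : Gen →₀ ℕ} {G : Gen} (h : s G ≠ 0) {B : Sym}
    (hB : MvPolynomial.pderiv G B = 0) : subPoly s B = 0 := by
  rw [eq_add_single h, subPoly_add_single, hB, subPoly_zero_right]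

lemma subPoly_eq_zero_of_two_le {s : Gen →₀ ℕ} {G : Gen} (h : 2 ≤ s G) {B : Sym}
    (hB : MvPolynomial.pderiv G (MvPolynomial.pderiv G B) = 0) : subPoly s B = 0 := by
  have h0 : s G ≠ 0 := by omega
  rw [eq_add_single h0, subPoly_add_single]
  refine subPoly_eq_zero (G := G) ?_ hB
  simp
  omega

lemma pderiv_phi (G : Gen) :
    MvPolynomial.pderiv G phi = if G = (false, 0) then 1 else 0 := by
  rw [phi, MvPolynomial.pderiv_X, Pi.single_apply]
  simp only [eq_comm]

lemma pderiv_psi (G : Gen) :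
    MvPolynomial.pderiv G psi = if G = (true, 0) then 1 else 0 := by
  rw [psi, MvPolynomial.pderiv_X, Pi.single_apply]
  simp only [eq_comm]

lemma pderiv_phi_vertex :
    MvPolynomial.pderiv ((false, 0) : Gen) vertex = (1 / 2 : ℂ) • psi ^ 2 := by
  rw [vertex, Derivation.leibniz, Derivation.leibniz, Derivation.leibniz_pow, pderiv_phi,
    pderiv_psi, MvPolynomial.pderiv_C]
  simp [MvPolynomial.smul_eq_C_mul]

lemma pderiv_phi_pderiv_phi_vertex :
    MvPolynomial.pderiv ((false, 0) : Gen) (MvPolynomial.pderiv ((false, 0) : Gen) vertex) = 0 := by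
  rw [pderiv_phi_vertex, Derivation.map_smul, Derivation.leibniz_pow, pderiv_psi]
  simp

lemma pderiv_vertex_eq_zero {G : Gen} (h1 : G ≠ (false, 0)) (h2 : G ≠ (true, 0)) :
    MvPolynomial.pderiv G vertex = 0 := by
  rw [vertex, Derivation.leibniz, Derivation.leibniz, Derivation.leibniz_pow, pderiv_phi,
    pderiv_psi, MvPolynomial.pderiv_C]
  simp [h1, h2]

lemma subPoly_phi_ne_zero {s : Gen →₀ ℕ} (h : subPoly s phi ≠ 0) :
    s = 0 ∨ s = Finsupp.single (false, 0) 1 := by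
  rw [or_iff_not_imp_left]
  intro hs
  obtain ⟨G, hG⟩ := Finsupp.ne_iff.1 hs
  have hG' : s G ≠ 0 := hG
  have hGf : G = (false, 0) := by
    by_contra hne
    exact h (subPoly_eq_zero hG' (by rw [pderiv_phi, if_neg hne]))
  subst hGf
  rw [eq_add_single hG', subPoly_add_single, pderiv_phi, if_pos rfl] at h
  have h0 : s - Finsupp.single (false, 0) 1 = 0 := by
    by_contra hne
    obtain ⟨G, hG⟩ := Finsupp.ne_iff.1 hne
    exact h (subPoly_eq_zero hG MvPolynomial.pderiv_one)
  rw [eq_add_single hG', h0, zero_add]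

end SubPoly

/-! ### Tensor products of test functions on two points, and their integrals -/

section TensorDensity

/-- The identification of `ℝ⁴¹` with `ℝ⁴`. -/
def cfgOne : Cfg 1 ≃L[ℝ] Mink :=
  LinearEquiv.toContinuousLinearEquiv
    { toFun := fun x => pt x 0
      invFun := fun v => cfg fun _ => v
      map_add' := by intro x y; rfl
      map_smul' := by intro a x; rfl
      left_inv := by
        intro x; ext ⟨j, μ⟩
        fin_cases j
        rfl
      right_inv := by intro v; rfl }

lemma tensor_one_surjective (G : 𝓢(Cfg 1, ℂ)) : ∃ g : 𝓢(Mink, ℂ), tensor 1 (fun _ => g) = G := by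
  refine ⟨SchwartzMap.compCLMOfContinuousLinearEquiv ℂ cfgOne.symm G, ?_⟩
  ext x
  rw [tensor_apply]
  simp only [Finset.univ_unique, Fin.default_eq_zero, Finset.prod_singleton]
  change G (cfgOne.symm (cfgOne x)) = G x
  rw [ContinuousLinearEquiv.symm_apply_apply]

lemma clm_ext_tensor_two {D₁ D₂ : 𝓢(Cfg 2, ℂ) →L[ℂ] ℂ}
    (h : ∀ g : Fin 2 → 𝓢(Mink, ℂ), D₁ (tensor 2 g) = D₂ (tensor 2 g)) : D₁ = D₂ := by
  let pull : 𝓢(Cfg 1 × Mink, ℂ) →L[ℂ] 𝓢(Cfg 2, ℂ) :=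
    SchwartzMap.compCLMOfContinuousLinearEquiv ℂ (splitLast 1 0)
  have h1 : D₁.comp pull = D₂.comp pull := by
    refine clm_ext_tensorLeft fun f g => ?_
    obtain ⟨g', rfl⟩ := tensor_one_surjective g
    have h2 := h ![g', f]
    have h3 : tensor 2 ![g', f] = pull (tensorLeft f (tensor 1 fun _ => g')) := by
      change pull (tensorLeft f (tensor 1 _)) = _
      congr 3
    rw [h3] at h2
    exact h2
  ext H
  have h4 := DFunLike.congr_fun h1
    (SchwartzMap.compCLMOfContinuousLinearEquiv ℂ (splitLast 1 0).symm H)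
  have h5 : pull (SchwartzMap.compCLMOfContinuousLinearEquiv ℂ (splitLast 1 0).symm H) = H := by
    ext x
    simp [pull]
  rw [ContinuousLinearMap.comp_apply, ContinuousLinearMap.comp_apply, h5] at h4
  exact h4

/-- `splitLast n 0` as an isometry. -/
def splitIsometry (n : ℕ) : Cfg (n + 1) ≃ₗᵢ[ℝ] WithLp 2 (Cfg n × Mink) where
  toLinearEquiv := (splitLast n 0).toLinearEquiv.trans (WithLp.linearEquiv 2 ℝ (Cfg n × Mink)).symm
  norm_map' x := by
    have h : ∀ μ, (WithLp.toLp 2 (splitLast n 0 x)).snd μ = x (Fin.last n, μ) := fun μ => rfl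
    have h' : ∀ p, (WithLp.toLp 2 (splitLast n 0 x)).fst p = x (p.1.castSucc, p.2) := fun p => by
      change x (p.1.castSucc, p.2) - 0 * _ = _
      rw [zero_mul, sub_zero]
    change ‖WithLp.toLp 2 (splitLast n 0 x)‖ = _
    rw [WithLp.prod_norm_eq_of_L2, EuclideanSpace.norm_sq_eq, EuclideanSpace.norm_sq_eq,
      EuclideanSpace.norm_eq]
    congr 1
    simp only [h, h', Fintype.sum_prod_type, Fin.sum_univ_castSucc (n := n)]

lemma integral_tensor (n : ℕ) (g : Fin n → 𝓢(Mink, ℂ)) :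
    ∫ x, tensor n g x = ∏ j, ∫ x, g j x := by
  induction n with
  | zero =>
    rw [Finset.univ_eq_empty, Finset.prod_empty]
    have h1 : ∀ x : Cfg 0, tensor 0 g x = 1 := fun _ => rfl
    simp only [h1]
    rw [integral_const]
    -- The zero-dimensional space has total volume one, which matches the empty product.
    have h2 := (EuclideanSpace.volume_preserving_symm_measurableEquiv_toLp (Fin 0 × Fin 4)).measure_preimage
      (s := Set.univ) MeasurableSet.univ.nullMeasurableSet
    have h3 : volume (Set.univ : Set (Fin 0 × Fin 4 → ℝ)) = 1 := by
      rw [volume_pi, Measure.pi_univ]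
      simp
    rw [Set.preimage_univ, h3] at h2
    rw [Measure.real, h2]
    simp
  | succ n ih =>
    rw [Fin.prod_univ_castSucc, ← ih fun j => g j.castSucc, ← integral_prod_mul,
      ← Measure.volume_eq_prod]
    have h1 := (splitIsometry n).measurePreserving.integral_comp
      (splitIsometry n).toMeasurableEquiv.measurableEmbedding
      (fun z => tensor n (fun j => g j.castSucc) z.fst * g (Fin.last n) z.snd)
    have h2 := (WithLp.volume_preserving_toLp (Cfg n) Mink).integral_comp
        (MeasurableEquiv.toLp 2 (Cfg n × Mink)).measurableEmbedding
        (fun z => tensor n (fun j => g j.castSucc) z.fst * g (Fin.last n) z.snd)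
    exact h1.trans h2.symm

end TensorDensity
end EG
end

noncomputable section
namespace EG

set_option linter.unusedSectionVars false

/-! ### Vectors generated from the vacuum by normally ordered products -/

section MonoVec

variable {m : ℝ}

/-- The vector `∫ f :A_{i₁}⋯A_{iₙ}: Ω` as an element of the domain. -/
def monoElt (m : ℝ) {n : ℕ} (i : Fin n → Species) (f : 𝓢(Cfg n, ℂ)) : domain m :=
  ⟨monoVec m i f, Submodule.subset_span (Or.inr ⟨n, i, f, rfl⟩)⟩

lemma monoVec_eq_zero_of_ne {n r : ℕ} (h : r ≠ n) (i : Fin n → Species) (f : 𝓢(Cfg n, ℂ)) :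
    monoVec m i f r = 0 := by
  funext κ
  have : IsEmpty (Fin n ≃ Fin r) := ⟨fun e => h (by simpa using (Fintype.card_congr e).symm)⟩
  simp [monoVec]

lemma monoVec_self {n : ℕ} (i : Fin n → Species) (f : 𝓢(Cfg n, ℂ)) (κ : Fin n → OneP) :
    monoVec m i f n κ = ∑ e : Fin n ≃ Fin n, speciesInd i (κ ∘ e) *
      fourierM n f (cfg fun j => onShell m ((κ ∘ e) j)) := by
  classical
  unfold monoVec speciesInd
  refine Finset.sum_congr rfl fun e _ => ?_
  simp only [Function.comp_apply]
  split_ifs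
  · simp
  · simp

lemma integral_shellPi_comp (n : ℕ) (e : Fin n ≃ Fin n) (F : (Fin n → OneP) → ℂ) :
    ∫ κ, F (κ ∘ e) ∂(shellPi m n) = ∫ κ, F κ ∂(shellPi m n) := by
  have h := measurePreserving_piCongrLeft (fun _ : Fin n => shell m) e.symm
  have h1 := h.integral_comp (MeasurableEquiv.measurableEmbedding _) F
  rw [← h1]
  refine integral_congr_ae (Eventually.of_forall fun κ => ?_)
  simp only
  congr 1
  funext j
  have := MeasurableEquiv.piCongrLeft_apply_apply (β := fun _ : Fin n => OneP) e.symm κ (e j)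
  simpa using this.symm

/-- Since the wave function of `Ψ` is symmetric, the `n!` permutations in the wave function of the
monomial contribute equally and cancel the `1/n!` of the inner product. -/
lemma innerLin_monoElt {n : ℕ} (i : Fin n → Species) (f : 𝓢(Cfg n, ℂ)) (Ψ : domain m) :
    innerLin Ψ (monoElt m i f) = ∫ κ, speciesInd i κ * (starRingEnd ℂ) ((Ψ : Fock) n κ) *
      fourierM n f (cfg fun j => onShell m (κ j)) ∂(shellPi m n) := by
  have hΨ := isRegular_of_mem_domain Ψ.2
  change fockInner m Ψ (monoVec m i f) = _
  rw [fockInner, tsum_eq_single n]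
  · set F : (Fin n → OneP) → ℂ := fun κ => speciesInd i κ * (starRingEnd ℂ) ((Ψ : Fock) n κ) *
      fourierM n f (cfg fun j => onShell m (κ j)) with hF
    have hc : Continuous F := ((continuous_speciesInd i).mul
      (Complex.continuous_conj.comp (hΨ.continuous n))).mul
        ((fourierM n f).continuous.comp (continuous_cfg fun j =>
          (continuous_onShell m).comp (continuous_apply j)))
    have hd : RapidDecay F := by
      have := ((hΨ.decay n).conj.mul_bounded (norm_speciesInd_le i)).mul_bounded
        (b := fun κ => fourierM n f (cfg fun j => onShell m (κ j)))
        (A := schwartzNorm 0 (fourierM n f)) fun κ => norm_apply_le_schwartzNorm 0 _ _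
      refine (funext fun κ => ?_ : F = _) ▸ this
      simp only [hF]
      ring
    have h1 : ∀ κ, (starRingEnd ℂ) ((Ψ : Fock) n κ) * monoVec m i f n κ =
        ∑ e : Fin n ≃ Fin n, F (κ ∘ e) := by
      intro κ
      rw [monoVec_self, Finset.mul_sum]
      refine Finset.sum_congr rfl fun e _ => ?_
      simp only [hF, hΨ.symmetric n e κ]
      ring
    have h2 : ∀ e : Fin n ≃ Fin n, Integrable (fun κ => F (κ ∘ e)) (shellPi m n) := by
      intro e
      refine RapidDecay.integrable ?_ (hc.comp (by fun_prop)).aestronglyMeasurable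
      intro N
      obtain ⟨C, hC, hb⟩ := hd N
      refine ⟨C, hC, fun κ => (hb _).trans (le_of_eq ?_)⟩
      congr 1
      exact Equiv.prod_comp e fun j => ((1 + ‖(κ j).2‖) ^ N)⁻¹
    simp only [h1]
    rw [integral_finsetSum _ fun e _ => h2 e]
    simp only [integral_shellPi_comp]
    rw [Finset.sum_const, Finset.card_univ, Fintype.card_equiv (Equiv.refl _), Fintype.card_fin,
      nsmul_eq_mul, ← mul_assoc, inv_mul_cancel₀ (by exact_mod_cast n.factorial_ne_zero), one_mul]
  · intro r hr
    simp [monoVec_eq_zero_of_ne hr]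

end MonoVec

/-! ### The Wick expansion of `T(φ, φ)` and adjoints -/

namespace TimeOrdered

variable {m : ℝ} {ce : ℕ} (P : TimeOrdered m ce)

lemma vev_eq_innerLin {n : ℕ} (B : Fin n → Sym) (g : 𝓢(Cfg n, ℂ)) :
    P.vev B g = innerLin (vac m) (P.T n B g (vac m)) := P.vev_apply B g

lemma T_eq_zero {n : ℕ} {B : Fin n → Sym} {j : Fin n} (h : B j = 0) (g : 𝓢(Cfg n, ℂ)) :
    P.T n B g = 0 := by
  rw [(P.T n).map_coord_zero j h]
  rfl

/-- The terms of the Wick expansion. -/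
def wickTerm {n : ℕ} (B : Fin n → Sym) (g : 𝓢(Cfg n, ℂ)) (Ψ Φ : Fock) (s : Fin n → Gen →₀ ℕ) : ℂ :=
  (∏ j, idxFactorial (s j))⁻¹ * P.vev (fun j => subPoly (s j) (B j))
    (SchwartzMap.smulLeftCLM ℂ (wickFun m s Ψ Φ) g)

lemma innerLin_T {n : ℕ} (B : Fin n → Sym) (g : 𝓢(Cfg n, ℂ)) (Ψ Φ : domain m) :
    innerLin Ψ (P.T n B g Φ) = ∑ᶠ s, P.wickTerm B g Ψ Φ s := by
  rw [innerLin_apply, P.wick]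
  simp only [wickTerm, vev_apply]

lemma wickTerm_eq_zero_of_subPoly {n : ℕ} {B : Fin n → Sym} (g : 𝓢(Cfg n, ℂ)) (Ψ Φ : Fock)
    {s : Fin n → Gen →₀ ℕ} {j : Fin n} (h : subPoly (s j) (B j) = 0) :
    P.wickTerm B g Ψ Φ s = 0 := by
  rw [wickTerm, vev_eq_innerLin, P.T_eq_zero (j := j) h]
  simp

lemma wickTerm_eq_zero_of_wickFun {n : ℕ} (B : Fin n → Sym) (g : 𝓢(Cfg n, ℂ)) {Ψ Φ : Fock}
    {s : Fin n → Gen →₀ ℕ} (h : wickFun m s Ψ Φ = 0) : P.wickTerm B g Ψ Φ s = 0 := by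
  have : SchwartzMap.smulLeftCLM ℂ (wickFun m s Ψ Φ) g = 0 := by
    rw [h]
    ext x
    rw [SchwartzMap.smulLeftCLM_apply_apply (by exact Function.HasTemperateGrowth.zero)]
    simp
  rw [wickTerm, this, map_zero, mul_zero]

lemma wickTerm_zero {n : ℕ} (B : Fin n → Sym) (g : 𝓢(Cfg n, ℂ)) (Ψ Φ : Fock) :
    P.wickTerm B g Ψ Φ 0 = fockInner m Ψ Φ * P.vev B g := by
  have h1 : wickFun m (0 : Fin n → Gen →₀ ℕ) Ψ Φ = fun _ => fockInner m Ψ Φ := by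
    funext x
    have : legs (0 : Fin n → Gen →₀ ℕ) x = [] := by simp [legs]
    rw [wickFun, this, wickElem]
  have h2 : SchwartzMap.smulLeftCLM ℂ (fun _ : Cfg n => fockInner m Ψ Φ) g =
      fockInner m Ψ Φ • g := by
    ext x
    rw [SchwartzMap.smulLeftCLM_apply_apply (Function.HasTemperateGrowth.const _)]
    rfl
  rw [wickTerm, h1, h2, map_smul]
  simp [idxFactorial, subPoly_zero_left]

/-- The indices of `φ(x₁)φ(x₂)`. -/
def phiPair : Fin 2 → Gen →₀ ℕ := speciesIdx ![false, false]

lemma phiPair_apply (j : Fin 2) : phiPair j = Finsupp.single (false, 0) 1 := by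
  fin_cases j <;> rfl

lemma wickTerm_phiPair (B : Fin 2 → Sym) (g : 𝓢(Cfg 2, ℂ)) (Ψ Φ : Fock) :
    P.wickTerm B g Ψ Φ phiPair =
      P.vev (fun j => MvPolynomial.pderiv ((false, 0) : Gen) (B j))
        (SchwartzMap.smulLeftCLM ℂ (wickFun m phiPair Ψ Φ) g) := by
  simp [wickTerm, phiPair_apply, subPoly_single, idxFactorial]

lemma finsum_two {α : Type*} {F : α → ℂ} {a b : α} (hab : a ≠ b)
    (h : ∀ s, s ≠ a → s ≠ b → F s = 0) : ∑ᶠ s, F s = F a + F b := by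
  classical
  rw [finsum_eq_sum_of_support_subset (s := {a, b}), Finset.sum_pair hab]
  intro s hs
  simp only [Finset.coe_insert, Finset.coe_singleton, Set.mem_insert_iff, Set.mem_singleton_iff]
  by_contra hne
  rw [not_or] at hne
  exact hs (h s hne.1 hne.2)

lemma zero_ne_phiPair : (0 : Fin 2 → Gen →₀ ℕ) ≠ phiPair := by
  intro h
  have := congrArg (fun s : Fin 2 → Gen →₀ ℕ => s 0 (false, 0)) h
  simp [phiPair_apply] at this

lemma T_one_last (n : ℕ) (B : Fin (n + 1) → Sym) (hB : B (Fin.last n) = 1)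
    (g : Fin (n + 1) → 𝓢(Mink, ℂ)) :
    P.T (n + 1) B (tensor (n + 1) g) =
      (∫ x, g (Fin.last n) x) • P.T n (fun j => B j.castSucc) (tensor n fun j => g j.castSucc) := by
  have h := P.unit_arg n (fun j => B j.castSucc) (fun j => g j.castSucc) (g (Fin.last n))
  have h1 : (Fin.snoc (α := fun _ => Sym) (fun j : Fin n => B j.castSucc) 1) = B := by
    rw [← hB]
    exact Fin.snoc_init_self B
  have h2 : (Fin.snoc (α := fun _ => 𝓢(Mink, ℂ)) (fun j : Fin n => g j.castSucc)
      (g (Fin.last n))) = g := Fin.snoc_init_self g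
  rw [h1, h2] at h
  exact h

lemma vev_one_tensor (n : ℕ) (g : Fin n → 𝓢(Mink, ℂ)) :
    P.T n (fun _ => 1) (tensor n g) = (∏ j, ∫ x, g j x) • 1 := by
  induction n with
  | zero =>
    have h : tensor 0 g 0 = 1 := rfl
    rw [P.empty, h]
    simp
  | succ n ih =>
    rw [T_one_last P n _ rfl, ih, smul_smul, Fin.prod_univ_castSucc, mul_comm]

lemma innerLin_vac_vac : innerLin (vac m) (vac m) = 1 := by
  rw [innerLin_apply]
  change fockInner m vacuum vacuum = 1
  rw [fockInner_vacuum_left]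
  simp [vacuum]

lemma vev_one_two (g : 𝓢(Cfg 2, ℂ)) : P.vev (fun _ : Fin 2 => 1) g = ∫ x, g x := by
  have h := clm_ext_tensor_two (D₁ := P.vev (fun _ : Fin 2 => 1))
    (D₂ := SchwartzMap.integralCLM ℂ (volume : Measure (Cfg 2))) fun g => ?_
  · exact DFunLike.congr_fun h g
  · refine Eq.trans ?_ (SchwartzMap.integralCLM_apply ℂ _).symm
    rw [integral_tensor]
    refine (P.vev_eq_innerLin _ _).trans ?_
    rw [vev_one_tensor, LinearMap.smul_apply, map_smul, Module.End.one_apply, innerLin_vac_vac,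
      smul_eq_mul, mul_one]

lemma vev_phi (g : 𝓢(Cfg 1, ℂ)) (B : Fin 1 → Sym) (hB : B 0 = phi) : P.vev B g = 0 := by
  rw [P.vev_apply, P.one_arg, hB]
  refine Finset.sum_eq_zero fun s hs => ?_
  have hs' : s = Finsupp.single (false, 0) 1 := by
    rw [phi] at hs
    simpa [MvPolynomial.X, MvPolynomial.support_monomial] using hs
  have h0 : ∀ x, wickFun m (fun _ : Fin 1 => s) (vac m) (vac m) x = 0 := by
    intro x
    refine wickElem_vacuum_eq_zero m _ _ fun κ _ => ?_
    have : (legs (fun _ : Fin 1 => s) x).length = 1 := by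
      simp [legs, hs', List.finRange_succ]
    change (if (legs (fun _ : Fin 1 => s) x).length = 0 then (1 : ℂ) else 0) = 0
    rw [this]
    simp
  simp [h0]

lemma vev_phi_one (g : 𝓢(Cfg 2, ℂ)) : P.vev ![phi, 1] g = 0 := by
  have h := clm_ext_tensor_two (D₁ := P.vev ![phi, 1]) (D₂ := 0) fun g => ?_
  · exact DFunLike.congr_fun h g
  · refine (P.vev_eq_innerLin _ _).trans ?_
    rw [T_one_last P 1 _ rfl, LinearMap.smul_apply, map_smul, ← vev_eq_innerLin,
      vev_phi P _ _ rfl, smul_zero]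
    rfl

lemma vev_one_phi (g : 𝓢(Cfg 2, ℂ)) : P.vev ![1, phi] g = 0 := by
  have h := clm_ext_tensor_two (D₁ := P.vev ![1, phi]) (D₂ := 0) fun g => ?_
  · exact DFunLike.congr_fun h g
  · refine (P.vev_eq_innerLin _ _).trans ?_
    have h1 := P.symmetric 2 ![1, phi] g (Equiv.swap 0 1)
    have h2 : (![1, phi] : Fin 2 → Sym) ∘ (Equiv.swap 0 1) = ![phi, 1] := by
      funext j
      fin_cases j <;> rfl
    rw [← h1, h2, ← vev_eq_innerLin, vev_phi_one]
    rfl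

/-- The Wick expansion of `T(φ, φ)`. -/
lemma innerLin_T_phi_phi (f : 𝓢(Cfg 2, ℂ)) (Ψ Φ : domain m) :
    innerLin Ψ (P.T 2 ![phi, phi] f Φ) = P.vev ![phi, phi] f * innerLin Ψ Φ +
      ∫ x, SchwartzMap.smulLeftCLM ℂ (wickFun m phiPair Ψ Φ) f x := by
  rw [innerLin_T, finsum_two zero_ne_phiPair, wickTerm_zero, wickTerm_phiPair, mul_comm,
    innerLin_apply]
  · congr 1
    have : (fun j => MvPolynomial.pderiv ((false, 0) : Gen) ((![phi, phi] : Fin 2 → Sym) j)) =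
        fun _ => 1 := by
      funext j
      fin_cases j <;> simp [pderiv_phi]
    rw [this, vev_one_two]
  · intro s h0 h1
    by_contra hne
    -- A polynomial linear in `φ` leaves only the indices with at most one undifferentiated `φ` at
    -- each point. The two mixed cases carry the vacuum expectation value of a single field, which
    -- is zero.
    have hs : ∀ j, s j = 0 ∨ s j = Finsupp.single (false, 0) 1 := by
      intro j
      refine subPoly_phi_ne_zero fun h => hne ?_
      refine P.wickTerm_eq_zero_of_subPoly f _ _ (j := j) ?_
      fin_cases j <;> exact h
    rcases hs 0 with ha | ha <;> rcases hs 1 with hb | hb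
    · refine h0 (funext fun j => ?_)
      fin_cases j
      · exact ha
      · exact hb
    · refine hne ?_
      have : (fun j => subPoly (s j) ((![phi, phi] : Fin 2 → Sym) j)) = ![phi, 1] := by
        funext j
        fin_cases j
        · simp [ha, subPoly_zero_left]
        · simp [hb, subPoly_single, pderiv_phi]
      rw [wickTerm, this, vev_phi_one, mul_zero]
    · refine hne ?_
      have : (fun j => subPoly (s j) ((![phi, phi] : Fin 2 → Sym) j)) = ![1, phi] := by
        funext j
        fin_cases j
        · simp [ha, subPoly_single, pderiv_phi]
        · simp [hb, subPoly_zero_left]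
      rw [wickTerm, this, vev_one_phi, mul_zero]
    · refine h1 (funext fun j => ?_)
      rw [phiPair_apply]
      fin_cases j
      · exact ha
      · exact hb


lemma integral_modulate_neg_shellCovec {n : ℕ} (κ : Fin n → OneP) (f : 𝓢(Cfg n, ℂ)) :
    ∫ x, modulate ((-1 : ℝ) • shellCovec m κ) f x =
      fourierM n f (cfg fun j => onShell m (κ j)) := by
  rw [fourierM_apply]
  refine integral_congr_ae (Eventually.of_forall fun x => ?_)
  simp only [modulate_apply, planeWave, neg_smul, one_smul, inner_neg_left, inner_shellCovec,
    neg_neg]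
  rfl

/-- `T(φ, φ) Ω` is the sum of a multiple of the vacuum and a two-particle vector. -/
lemma T_phi_phi_vac (f : 𝓢(Cfg 2, ℂ)) :
    P.T 2 ![phi, phi] f (vac m) = P.vev ![phi, phi] f • vac m + monoElt m ![false, false] f := by
  -- All matrix elements of the difference vanish, including the one with the difference itself, so
  -- positive definiteness applies.
  have key : ∀ Ψ : domain m, innerLin Ψ (P.T 2 ![phi, phi] f (vac m) -
      (P.vev ![phi, phi] f • vac m + monoElt m ![false, false] f)) = 0 := by
    intro Ψ
    have h := clm_smulLeft_wickFun_right (m := m) (isRegular_of_mem_domain Ψ.2) ![false, false]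
      (SchwartzMap.integralCLM ℂ (volume : Measure (Cfg 2))) f
    simp only [SchwartzMap.integralCLM_apply, integral_modulate_neg_shellCovec] at h
    rw [map_sub, map_add, map_smul, innerLin_T_phi_phi, innerLin_monoElt, smul_eq_mul,
      add_sub_add_left_eq_sub]
    exact sub_eq_zero.2 h
  exact sub_eq_zero.1 (eq_zero_of_innerLin_self (key _))

/-- The conjugate test function. -/
def conjTest {n : ℕ} : 𝓢(Cfg n, ℂ) → 𝓢(Cfg n, ℂ) :=
  SchwartzMap.postcompCLM (𝕜 := ℝ) (Complex.conjCLE : ℂ →L[ℝ] ℂ)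

lemma conjTest_apply {n : ℕ} (f : 𝓢(Cfg n, ℂ)) (x : Cfg n) :
    conjTest f x = (starRingEnd ℂ) (f x) := rfl

lemma conjTest_conjTest {n : ℕ} (f : 𝓢(Cfg n, ℂ)) : conjTest (conjTest f) = f := by
  ext x
  simp [conjTest_apply]

lemma wickFun_conj {n : ℕ} (s : Fin n → Gen →₀ ℕ) (Ψ Φ : Fock) (x : Cfg n) :
    (starRingEnd ℂ) (wickFun m s Ψ Φ x) = wickFun m s Φ Ψ x := wickElem_conj m _ _ _

lemma hasTemperateGrowth_wickFun_symm {n : ℕ} {s : Fin n → Gen →₀ ℕ} {Ψ Φ : Fock}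
    (h : (wickFun m s Ψ Φ).HasTemperateGrowth) : (wickFun m s Φ Ψ).HasTemperateGrowth := by
  have h1 : wickFun m s Φ Ψ = fun x => Complex.conjCLE (wickFun m s Ψ Φ x) := by
    funext x
    exact (wickFun_conj s Ψ Φ x).symm
  rw [h1]
  exact (Complex.conjCLE : ℂ →L[ℝ] ℂ).hasTemperateGrowth.comp h

lemma integral_smulLeft_wickFun_conj {n : ℕ} (s : Fin n → Gen →₀ ℕ) (Ψ Φ : Fock)
    (f : 𝓢(Cfg n, ℂ)) :
    (starRingEnd ℂ) (∫ x, SchwartzMap.smulLeftCLM ℂ (wickFun m s Ψ Φ) f x) =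
      ∫ x, SchwartzMap.smulLeftCLM ℂ (wickFun m s Φ Ψ) (conjTest f) x := by
  -- Without temperate growth both multiplication operators are zero by default, and the identity is
  -- trivial.
  by_cases h : (wickFun m s Ψ Φ).HasTemperateGrowth
  · rw [← integral_conj]
    refine integral_congr_ae (Eventually.of_forall fun x => ?_)
    beta_reduce
    rw [SchwartzMap.smulLeftCLM_apply_apply h,
      SchwartzMap.smulLeftCLM_apply_apply (hasTemperateGrowth_wickFun_symm h), smul_eq_mul,
      smul_eq_mul, map_mul, wickFun_conj, conjTest_apply]
  · have h' : ¬ (wickFun m s Φ Ψ).HasTemperateGrowth :=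
      fun h' => h (hasTemperateGrowth_wickFun_symm h')
    rw [SchwartzMap.smulLeftCLM, SchwartzMap.smulLeftCLM, dif_neg h, dif_neg h']
    simp

/-- The adjoint of `T(φ, φ)` on the domain. -/
def phiPairAdjoint (f : 𝓢(Cfg 2, ℂ)) : Module.End ℂ (domain m) :=
  P.T 2 ![phi, phi] (conjTest f) +
    ((starRingEnd ℂ) (P.vev ![phi, phi] f) - P.vev ![phi, phi] (conjTest f)) • 1

/-- By the Wick expansion `T(φ, φ)` differs from a normally ordered product by a number. The
normally ordered part has the expected adjoint because matrix elements conjugate correctly, so only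
the number needs correcting; unitarity of the time-ordered products is not used. -/
lemma innerLin_phiPairAdjoint (f : 𝓢(Cfg 2, ℂ)) (Ψ Φ : domain m) :
    innerLin (P.phiPairAdjoint f Ψ) Φ = innerLin Ψ (P.T 2 ![phi, phi] f Φ) := by
  rw [← innerLin_conj, phiPairAdjoint, LinearMap.add_apply, LinearMap.smul_apply,
    Module.End.one_apply, map_add, map_smul, innerLin_T_phi_phi, innerLin_T_phi_phi]
  simp only [map_add, smul_eq_mul, map_mul, map_sub, Complex.conj_conj, innerLin_conj,
    integral_smulLeft_wickFun_conj, conjTest_conjTest]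
  ring

/-- The operator `L(g)` for the interaction vertex. -/
def vertexOp (g : 𝓢(Cfg 1, ℂ)) : Module.End ℂ (domain m) := P.T 1 ![vertex] g

lemma vertex_eq_monomial :
    vertex = MvPolynomial.monomial (Finsupp.single (true, 0) 2 + Finsupp.single (false, 0) 1)
      (1 / 2 : ℂ) := by
  rw [vertex, psi, phi, MvPolynomial.X_pow_eq_monomial, MvPolynomial.C_mul_monomial,
    MvPolynomial.X, MvPolynomial.monomial_mul, mul_one, mul_one]

/-- The index of `ψ²φ`. -/
def vertexIdx : Gen →₀ ℕ := Finsupp.single (true, 0) 2 + Finsupp.single (false, 0) 1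

lemma innerLin_vertexOp (g : 𝓢(Cfg 1, ℂ)) (Ψ Φ : domain m) :
    innerLin Ψ (P.vertexOp g Φ) =
      (1 / 2 : ℂ) * ∫ x : Cfg 1, g x * wickFun m (fun _ => vertexIdx) Ψ Φ x := by
  rw [innerLin_apply, vertexOp, P.one_arg]
  have h : (![vertex] : Fin 1 → Sym) 0 = MvPolynomial.monomial vertexIdx (1 / 2 : ℂ) :=
    vertex_eq_monomial
  rw [h, MvPolynomial.support_monomial, if_neg (by norm_num), Finset.sum_singleton,
    MvPolynomial.coeff_monomial, if_pos rfl]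

lemma innerLin_vertexOp_conj (g : 𝓢(Cfg 1, ℂ)) (Ψ Φ : domain m) :
    innerLin (P.vertexOp (conjTest g) Ψ) Φ = innerLin Ψ (P.vertexOp g Φ) := by
  rw [← innerLin_conj, innerLin_vertexOp, innerLin_vertexOp, map_mul, ← integral_conj]
  simp only [map_mul, wickFun_conj, conjTest_apply, Complex.conj_conj]
  simp only [one_div, map_inv₀, map_ofNat]

end TimeOrdered
end EG
end

/-! ### The Wick expansion of `T(L, L)`, the commutator with `T(φ, φ)`, and the mass threshold -/

noncomputable section
namespace EG

set_option linter.unusedSectionVars false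

lemma length_legs_two (s : Fin 2 → Gen →₀ ℕ) (x : Cfg 2) :
    (legs s x).length = (Finsupp.toMultiset (s 0)).card + (Finsupp.toMultiset (s 1)).card := by
  simp [legs, List.finRange_succ]

lemma mem_legs_of_ne_zero {n : ℕ} {s : Fin n → Gen →₀ ℕ} (x : Cfg n) {j : Fin n} {G : Gen}
    (h : s j G ≠ 0) : (G, pt x j) ∈ legs s x := by
  simp only [legs, List.mem_flatMap, List.mem_map, Multiset.mem_toList, Finsupp.mem_toMultiset,
    Finsupp.mem_support_iff]
  exact ⟨j, List.mem_finRange j, G, h, rfl⟩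

namespace TimeOrdered

variable {m : ℝ} {ce : ℕ} (P : TimeOrdered m ce)

/-- Vectors that consist of a multiple of the vacuum and two massless particles. -/
def IsPhiPairVec (Φ : Fock) : Prop :=
  ∀ n κ, Φ n κ ≠ 0 → (n = 0 ∨ n = 2) ∧ ∀ j, (κ j).1 = false

/-- Against the vacuum all legs must be absorbed by `Φ`, so they are massless and their number is
zero or two. The vertex is linear in `φ`, so each point supplies at most one; this leaves no leg, or
one at each point. -/
lemma wickFun_vertex_vertex {Φ : Fock} (hΦ : IsPhiPairVec Φ) {s : Fin 2 → Gen →₀ ℕ} (h0 : s ≠ 0)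
    (h1 : s ≠ phiPair) (hs : ∀ j, subPoly (s j) vertex ≠ 0) : wickFun m s vacuum Φ = 0 := by
  funext x
  by_contra hne
  have hex : ∃ κ : Fin (legs s x).length → OneP,
      (∀ j, (κ j).1 = ((legs s x).get j).1.1) ∧ Φ (legs s x).length κ ≠ 0 := by
    by_contra hcon
    push Not at hcon
    exact hne (wickElem_vacuum_eq_zero m _ _ hcon)
  obtain ⟨κ, hκ, hΦκ⟩ := hex
  obtain ⟨hlen, hsp⟩ := hΦ _ _ hΦκ
  have hG : ∀ j G, s j G ≠ 0 → G = (false, 0) := by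
    intro j G hG
    obtain ⟨l, hl⟩ := List.get_of_mem (mem_legs_of_ne_zero x hG)
    have hf : G.1 = false := by
      have := hκ l
      rw [hsp l, hl] at this
      exact this.symm
    by_contra hG1
    exact hs j (subPoly_eq_zero hG (pderiv_vertex_eq_zero hG1 fun h => by
      rw [h] at hf
      exact absurd hf (by simp)))
  have hle : ∀ j, s j (false, 0) ≤ 1 := by
    intro j
    by_contra hcon
    exact hs j (subPoly_eq_zero_of_two_le (by omega) pderiv_phi_pderiv_phi_vertex)
  have hsingle : ∀ j, s j = Finsupp.single (false, 0) (s j (false, 0)) := by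
    intro j
    ext G
    by_cases hG0 : G = (false, 0)
    · rw [hG0, Finsupp.single_eq_same]
    · rw [Finsupp.single_eq_of_ne hG0]
      by_contra hne0
      exact hG0 (hG j G hne0)
  have hcard : ∀ j, (Finsupp.toMultiset (s j)).card = s j (false, 0) := by
    intro j
    rw [hsingle j]
    simp
  rw [length_legs_two, hcard, hcard] at hlen
  have ha := hle 0
  have hb := hle 1
  rcases hlen with hlen | hlen
  · refine h0 (funext fun j => ?_)
    rw [hsingle j]
    fin_cases j
    · have : s 0 (false, 0) = 0 := by omega
      simp [this]
    · have : s 1 (false, 0) = 0 := by omega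
      simp [this]
  · refine h1 (funext fun j => ?_)
    rw [hsingle j, phiPair_apply]
    fin_cases j
    · have : s 0 (false, 0) = 1 := by omega
      simp [this]
    · have : s 1 (false, 0) = 1 := by omega
      simp [this]

lemma vev_smul_psi_sq (g : 𝓢(Cfg 2, ℂ)) :
    P.vev (fun j => MvPolynomial.pderiv ((false, 0) : Gen) ((![vertex, vertex] : Fin 2 → Sym) j)) g =
      (1 / 4 : ℂ) * P.vev ![psi ^ 2, psi ^ 2] g := by
  have h : (fun j => MvPolynomial.pderiv ((false, 0) : Gen) ((![vertex, vertex] : Fin 2 → Sym) j)) =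
      fun j => (fun _ : Fin 2 => (1 / 2 : ℂ)) j • (![psi ^ 2, psi ^ 2] : Fin 2 → Sym) j := by
    funext j
    fin_cases j <;> exact pderiv_phi_vertex
  rw [vev_eq_innerLin, h, MultilinearMap.map_smul_univ, vev_eq_innerLin]
  simp only [Finset.prod_const, Finset.card_univ, Fintype.card_fin, LinearMap.smul_apply, map_smul,
    smul_eq_mul]
  norm_num

lemma innerLin_T_vertex_vertex_aux (H : 𝓢(Cfg 2, ℂ)) {Ψ Φ : domain m}
    (hw : ∀ s : Fin 2 → Gen →₀ ℕ, s ≠ 0 → s ≠ phiPair → (∀ j, subPoly (s j) vertex ≠ 0) →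
      wickFun m s Ψ Φ = 0) :
    innerLin Ψ (P.T 2 ![vertex, vertex] H Φ) = innerLin Ψ Φ * P.vev ![vertex, vertex] H +
      (1 / 4 : ℂ) * P.vev ![psi ^ 2, psi ^ 2]
        (SchwartzMap.smulLeftCLM ℂ (wickFun m phiPair Ψ Φ) H) := by
  rw [innerLin_T, finsum_two zero_ne_phiPair, wickTerm_zero, wickTerm_phiPair, vev_smul_psi_sq,
    innerLin_apply]
  intro s h0 h1
  by_cases hs : ∀ j, subPoly (s j) vertex ≠ 0
  · exact P.wickTerm_eq_zero_of_wickFun _ _ (hw s h0 h1 hs)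
  · push Not at hs
    obtain ⟨j, hj⟩ := hs
    refine P.wickTerm_eq_zero_of_subPoly H _ _ (j := j) ?_
    fin_cases j <;> exact hj

lemma innerLin_vac_T_vertex_vertex (H : 𝓢(Cfg 2, ℂ)) {Φ : domain m} (hΦ : IsPhiPairVec Φ) :
    innerLin (vac m) (P.T 2 ![vertex, vertex] H Φ) =
      innerLin (vac m) Φ * P.vev ![vertex, vertex] H +
      (1 / 4 : ℂ) * ∫ κ, (speciesInd ![false, false] κ * (Φ : Fock) 2 κ) *
        P.vev ![psi ^ 2, psi ^ 2] (modulate ((1 : ℝ) • shellCovec m κ) H) ∂(shellPi m 2) := by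
  rw [innerLin_T_vertex_vertex_aux P H fun s h0 h1 hs => wickFun_vertex_vertex hΦ h0 h1 hs]
  congr 2
  exact clm_smulLeft_wickFun_left (isRegular_of_mem_domain Φ.2) _ (P.vev ![psi ^ 2, psi ^ 2]) H

lemma innerLin_T_vertex_vertex_vac (H : 𝓢(Cfg 2, ℂ)) {Φ : domain m} (hΦ : IsPhiPairVec Φ) :
    innerLin Φ (P.T 2 ![vertex, vertex] H (vac m)) =
      innerLin Φ (vac m) * P.vev ![vertex, vertex] H +
      (1 / 4 : ℂ) * ∫ κ, (speciesInd ![false, false] κ * (starRingEnd ℂ) ((Φ : Fock) 2 κ)) *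
        P.vev ![psi ^ 2, psi ^ 2] (modulate ((-1 : ℝ) • shellCovec m κ) H) ∂(shellPi m 2) := by
  rw [innerLin_T_vertex_vertex_aux P H fun s h0 h1 hs => ?_]
  · congr 2
    exact clm_smulLeft_wickFun_right (isRegular_of_mem_domain Φ.2) _ (P.vev ![psi ^ 2, psi ^ 2]) H
  · have := wickFun_vertex_vertex (m := m) hΦ h0 h1 hs
    funext x
    have h2 := congrArg (starRingEnd ℂ) (congrFun this x)
    rw [wickFun_conj] at h2
    have h3 : wickFun m s Φ vacuum x = 0 := by simpa only [map_zero, Pi.zero_apply] using h2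
    exact h3

/-- For `s = 1` the two-particle wave function of `T(φ, φ)(f) Ω`. -/
def pairWave (m s : ℝ) (f : 𝓢(Cfg 2, ℂ)) (κ : Fin 2 → OneP) : ℂ :=
  fourierM 2 f (s • cfg fun j => onShell m (κ j)) +
    fourierM 2 f (s • cfg fun j => onShell m (κ (Equiv.swap 0 1 j)))

lemma monoVec_pair (f : 𝓢(Cfg 2, ℂ)) (κ : Fin 2 → OneP) :
    monoVec m ![false, false] f 2 κ = speciesInd ![false, false] κ * pairWave m 1 f κ := by
  have h : (Finset.univ : Finset (Fin 2 ≃ Fin 2)) = {Equiv.refl _, Equiv.swap 0 1} := by decide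
  have h2 : (Equiv.refl (Fin 2)) ≠ Equiv.swap 0 1 := by decide
  have h3 : speciesInd ![false, false] (κ ∘ Equiv.swap (0 : Fin 2) 1) =
      speciesInd ![false, false] κ := by
    simp [speciesInd, Fin.forall_fin_two, and_comm]
  rw [monoVec_self, h, Finset.sum_pair h2, h3, pairWave, mul_add, one_smul, one_smul]
  rfl

lemma isPhiPairVec_T_phi_phi (f : 𝓢(Cfg 2, ℂ)) :
    IsPhiPairVec (P.T 2 ![phi, phi] f (vac m) : domain m) := by
  intro n κ h
  rw [T_phi_phi_vac] at h
  change P.vev ![phi, phi] f * vacuum n κ + monoVec m ![false, false] f n κ ≠ 0 at h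
  by_cases h0 : n = 0
  · subst h0
    exact ⟨Or.inl rfl, fun j => j.elim0⟩
  · by_cases h2 : n = 2
    · subst h2
      refine ⟨Or.inr rfl, ?_⟩
      by_contra hne
      refine h ?_
      have hs : speciesInd ![false, false] κ = 0 := by
        rw [speciesInd, if_neg]
        intro h'
        refine hne fun j => ?_
        rw [h' j]
        fin_cases j <;> rfl
      rw [monoVec_pair, hs]
      simp [vacuum]
    · refine absurd ?_ h
      rw [monoVec_eq_zero_of_ne h2]
      simp [vacuum, h0]

lemma T_phi_phi_vac_two (f : 𝓢(Cfg 2, ℂ)) (κ : Fin 2 → OneP) :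
    (P.T 2 ![phi, phi] f (vac m) : Fock) 2 κ = speciesInd ![false, false] κ * pairWave m 1 f κ := by
  rw [T_phi_phi_vac]
  change P.vev ![phi, phi] f * vacuum 2 κ + monoVec m ![false, false] f 2 κ = _
  rw [monoVec_pair]
  simp [vacuum]

lemma speciesInd_mul_self {n : ℕ} (i : Fin n → Species) (κ : Fin n → OneP) :
    speciesInd i κ * speciesInd i κ = speciesInd i κ := by
  unfold speciesInd
  split_ifs <;> simp

lemma fourierM_conjTest {n : ℕ} (f : 𝓢(Cfg n, ℂ)) (k : Cfg n) :
    (starRingEnd ℂ) (fourierM n (conjTest f) k) = fourierM n f (-k) := by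
  rw [fourierM_apply, fourierM_apply, ← integral_conj]
  refine integral_congr_ae (Eventually.of_forall fun x => ?_)
  beta_reduce
  rw [map_mul, conjTest_apply, Complex.conj_conj, ← Complex.exp_conj, map_mul, Complex.conj_I,
    Complex.conj_ofReal]
  congr 2
  have : ∑ j, mdot (pt (-k) j) (pt x j) = -∑ j, mdot (pt k j) (pt x j) := by
    simp [mdot, pt]
  rw [this]
  push_cast
  ring

lemma conj_pairWave (f : 𝓢(Cfg 2, ℂ)) (κ : Fin 2 → OneP) :
    (starRingEnd ℂ) (pairWave m 1 (conjTest f) κ) = pairWave m (-1) f κ := by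
  simp only [pairWave, map_add, fourierM_conjTest, one_smul, neg_smul]

/-- The difference of the two orders of `T(L, L)` and `T(φ, φ)`, as a superposition of vacuum
expectation values of `T(ψ², ψ²)`. -/
lemma innerLin_commutator (H f : 𝓢(Cfg 2, ℂ)) :
    innerLin (vac m) (P.T 2 ![vertex, vertex] H (P.T 2 ![phi, phi] f (vac m))) -
      innerLin (vac m) (P.T 2 ![phi, phi] f (P.T 2 ![vertex, vertex] H (vac m))) =
    (1 / 4 : ℂ) * (∫ κ, (speciesInd ![false, false] κ * pairWave m 1 f κ) *
        P.vev ![psi ^ 2, psi ^ 2] (modulate ((1 : ℝ) • shellCovec m κ) H) ∂(shellPi m 2) -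
      ∫ κ, (speciesInd ![false, false] κ *
        pairWave m (-1) f κ) *
        P.vev ![psi ^ 2, psi ^ 2] (modulate ((-1 : ℝ) • shellCovec m κ) H) ∂(shellPi m 2)) := by
  -- In the second term `T(φ, φ)` is moved onto the left vacuum by its adjoint, so that both terms
  -- pair `T(L, L)` with the vacuum and a two-particle vector. The products of the two vacuum
  -- expectation values then cancel.
  rw [innerLin_vac_T_vertex_vertex P H (P.isPhiPairVec_T_phi_phi f),
    ← innerLin_phiPairAdjoint P f (vac m) (P.T 2 ![vertex, vertex] H (vac m)),
    phiPairAdjoint, LinearMap.add_apply, LinearMap.smul_apply, Module.End.one_apply,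
    innerLin_add_left, innerLin_smul_left,
    innerLin_T_vertex_vertex_vac P H (P.isPhiPairVec_T_phi_phi (conjTest f))]
  simp only [T_phi_phi_vac_two, map_mul, conj_speciesInd, ← mul_assoc, speciesInd_mul_self,
    conj_pairWave]
  have h1 : innerLin (P.T 2 ![phi, phi] (conjTest f) (vac m)) (vac m) =
      (starRingEnd ℂ) (P.vev ![phi, phi] (conjTest f)) := by
    rw [vev_eq_innerLin, innerLin_conj]
  rw [h1, ← vev_eq_innerLin, ← vev_eq_innerLin]
  simp only [map_sub, Complex.conj_conj]
  ring

lemma integral_mul_shellWave {n : ℕ} (g : 𝓢(Cfg 1, ℂ)) (κ : Fin n → OneP) :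
    ∫ x : Cfg 1, g x * shellWave m κ (fun _ => pt x 0) =
      fourierM 1 g (-cfg fun _ => ∑ j, onShell m (κ j)) := by
  rw [fourierM_apply]
  refine integral_congr_ae (Eventually.of_forall fun x => ?_)
  beta_reduce
  rw [mul_comm, shellWave]
  congr 2
  rw [neg_mul, ← mul_neg, ← Complex.ofReal_neg]
  congr 2
  simp only [Finset.univ_unique, Fin.default_eq_zero, Finset.sum_singleton]
  have h : pt (-cfg fun _ : Fin 1 => ∑ j, onShell m (κ j)) 0 = -∑ j, onShell m (κ j) := rfl
  rw [h]
  simp only [mdot, PiLp.neg_apply, WithLp.ofLp_sum, Finset.sum_apply]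
  rw [Finset.sum_comm, ← Finset.sum_neg_distrib]
  refine Finset.sum_congr rfl fun μ _ => ?_
  rw [mul_neg, neg_mul, Finset.mul_sum, Finset.sum_mul]

lemma continuous_shellWave_pt (m : ℝ) (n : ℕ) :
    Continuous fun z : Cfg 1 × (Fin n → OneP) => shellWave m z.2 (fun _ => pt z.1 0) := by
  have h1 : ∀ (j : Fin n) (μ : Fin 4),
      Continuous fun z : Cfg 1 × (Fin n → OneP) => onShell m (z.2 j) μ := fun j μ =>
    (PiLp.continuous_apply 2 _ μ).comp ((continuous_onShell m).comp
      ((continuous_apply j).comp continuous_snd))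
  have h2 : ∀ μ : Fin 4, Continuous fun z : Cfg 1 × (Fin n → OneP) => pt z.1 0 μ :=
    fun μ => (PiLp.continuous_apply 2 _ ((0 : Fin 1), μ)).comp continuous_fst
  unfold shellWave mdot
  have h3 : Continuous fun z : Cfg 1 × (Fin n → OneP) =>
      ∑ j, ∑ μ, metricSign μ * onShell m (z.2 j) μ * pt z.1 0 μ :=
    continuous_finsetSum _ fun j _ => continuous_finsetSum _ fun μ _ =>
      (continuous_const.mul (h1 j μ)).mul (h2 μ)
  exact Complex.continuous_exp.comp (continuous_const.mul (Complex.continuous_ofReal.comp h3))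

lemma integral_mul_integral_shellWave {n : ℕ} (g : 𝓢(Cfg 1, ℂ)) {c : (Fin n → OneP) → ℂ}
    (hc : Continuous c) (hd : RapidDecay c) :
    ∫ x : Cfg 1, g x * ∫ κ, shellWave m κ (fun _ => pt x 0) * c κ ∂(shellPi m n) =
      ∫ κ, fourierM 1 g (-cfg fun _ => ∑ j, onShell m (κ j)) * c κ ∂(shellPi m n) := by
  have h1 : Integrable (fun z : Cfg 1 × (Fin n → OneP) => g z.1 * c z.2)
      (volume.prod (shellPi m n)) :=
    (g.integrable (μ := volume)).mul_prod (hd.integrable (m := m) hc.aestronglyMeasurable)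
  have h2 : Integrable (fun z : Cfg 1 × (Fin n → OneP) =>
      shellWave m z.2 (fun _ => pt z.1 0) * (g z.1 * c z.2)) (volume.prod (shellPi m n)) :=
    h1.bdd_mul (continuous_shellWave_pt m n).aestronglyMeasurable
      (Eventually.of_forall fun z => (norm_shellWave m _ _).le)
  have h3 := integral_integral_swap (f := fun (x : Cfg 1) (κ : Fin n → OneP) =>
    shellWave m κ (fun _ => pt x 0) * (g x * c κ)) h2
  calc _ = ∫ x : Cfg 1, ∫ κ, shellWave m κ (fun _ => pt x 0) * (g x * c κ) ∂(shellPi m n) := by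
        refine integral_congr_ae (Eventually.of_forall fun x => ?_)
        beta_reduce
        rw [← integral_const_mul]
        refine integral_congr_ae (Eventually.of_forall fun κ => ?_)
        ring
    _ = _ := by
        rw [h3]
        refine integral_congr_ae (Eventually.of_forall fun κ => ?_)
        beta_reduce
        rw [← integral_mul_shellWave, ← integral_mul_const]
        refine integral_congr_ae (Eventually.of_forall fun x => ?_)
        ring

lemma le_energy_of_massive {κ : OneP} (h : κ.1 = true) : m ≤ energy m κ := by
  refine (le_abs_self m).trans (Real.le_sqrt_of_sq_le ?_)
  rw [h, sq_abs]
  simp [mass]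

/-- Only the Fourier transform above the mass threshold contributes to `(Ω| L(g)`. -/
lemma innerLin_vac_vertexOp_eq_zero {g : 𝓢(Cfg 1, ℂ)}
    (hg : ∀ q, m ≤ ‖q‖ → fourierM 1 g q = 0) (X : domain m) :
    innerLin (vac m) (P.vertexOp g X) = 0 := by
  have hX := isRegular_of_mem_domain X.2
  set l : List Gen := (Finsupp.toMultiset vertexIdx).toList with hl
  have hmem : ∀ G, G ∈ l ↔ G = (true, 0) ∨ G = (false, 0) := by
    intro G
    rw [hl, Multiset.mem_toList, vertexIdx, map_add, Multiset.mem_add]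
    simp [Finsupp.toMultiset_single]
  set i : Fin l.length → Species := fun j => (l.get j).1
  have hlegs : ∀ x : Cfg 1, legs (fun _ : Fin 1 => vertexIdx) x =
      List.ofFn fun j : Fin l.length => ((i j, 0), pt x 0) := by
    intro x
    have h1 : legs (fun _ : Fin 1 => vertexIdx) x = l.map fun G => (G, pt x 0) := by
      simp [legs, List.finRange_succ, hl]
    have h2 : ∀ j : Fin l.length, ((i j, 0) : Gen) = l.get j := by
      intro j
      rcases (hmem _).1 (l.get_mem j) with h | h
      · simp only [i, h]
      · simp only [i, h]
    simp only [h1, h2]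
    conv_lhs => rw [← List.ofFn_get l, List.map_ofFn]
    rfl
  obtain ⟨j₀, hj₀⟩ : ∃ j, i j = true := by
    obtain ⟨j, hj⟩ := List.get_of_mem ((hmem (true, 0)).2 (Or.inl rfl))
    exact ⟨j, by simp only [i, hj]⟩
  set c : (Fin l.length → OneP) → ℂ := fun κ => speciesInd i κ * (X : Fock) l.length κ
  have hc : Continuous c := hX.continuous_ind_mul i
  have hd : RapidDecay c := hX.decay_ind_mul i
  have hw : ∀ x : Cfg 1, wickFun m (fun _ : Fin 1 => vertexIdx) vacuum X x =
      ∫ κ, shellWave m κ (fun _ => pt x 0) * c κ ∂(shellPi m l.length) := by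
    intro x
    rw [wickFun, hlegs, wickElem_ofFn_vacuum m i _ X (hX.continuous _) (hX.decay _)]
    refine integral_congr_ae (Eventually.of_forall fun κ => ?_)
    simp only [c]
    ring
  rw [innerLin_vertexOp]
  change _ * ∫ x : Cfg 1, g x * wickFun m (fun _ : Fin 1 => vertexIdx) vacuum X x = 0
  simp only [hw]
  rw [integral_mul_integral_shellWave g hc hd]
  have h0 : ∀ κ, fourierM 1 g (-cfg fun _ => ∑ j, onShell m (κ j)) * c κ = 0 := by
    intro κ
    -- One leg is massive and all energies are nonnegative, so for the right species the total
    -- energy is at least `m`, and there the Fourier transform of `g` vanishes.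
    by_cases hκ : ∀ j, (κ j).1 = i j
    · rw [hg, zero_mul]
      have h1 : ‖(-cfg fun _ : Fin 1 => ∑ j, onShell m (κ j)) ((0 : Fin 1), (0 : Fin 4))‖ ≤
          ‖-cfg fun _ : Fin 1 => ∑ j, onShell m (κ j)‖ := PiLp.norm_apply_le _ _
      refine le_trans ?_ h1
      have h2 : (-cfg fun _ : Fin 1 => ∑ j, onShell m (κ j)) ((0 : Fin 1), (0 : Fin 4)) =
          -∑ j, energy m (κ j) := by
        change -((∑ j, onShell m (κ j)) 0) = _
        simp [onShell_zero]
      rw [h2, norm_neg, Real.norm_of_nonneg (Finset.sum_nonneg fun j _ => energy_nonneg _ _)]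
      exact (le_energy_of_massive (by rw [hκ, hj₀])).trans
        (Finset.single_le_sum (f := fun j => energy m (κ j)) (fun j _ => energy_nonneg _ _)
          (Finset.mem_univ j₀))
    · have : c κ = 0 := by simp [c, speciesInd, hκ]
      rw [this, mul_zero]
  simp [h0]

lemma innerLin_vertexOp_vac_eq_zero {g : 𝓢(Cfg 1, ℂ)}
    (hg : ∀ q, m ≤ ‖q‖ → fourierM 1 g q = 0) (X : domain m) :
    innerLin X (P.vertexOp g (vac m)) = 0 := by
  rw [← innerLin_vertexOp_conj, ← innerLin_conj, innerLin_vac_vertexOp_eq_zero, map_zero]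
  intro q hq
  have h := fourierM_conjTest (conjTest g) (-q)
  rw [conjTest_conjTest, neg_neg] at h
  rw [← h, hg _ (by rwa [norm_neg]), map_zero]

end TimeOrdered
end EG
end

/-! ### Formal power series at multiplicity-free exponents -/

noncomputable section
namespace EG

set_option linter.unusedSectionVars false

/-- The multiplicity-free exponent with the support `s`. -/
def setExp {σ : Type} (s : Finset σ) : σ →₀ ℕ := ∑ i ∈ s, Finsupp.single i 1

section SetExp

variable {σ : Type} [DecidableEq σ]

lemma setExp_apply (s : Finset σ) (i : σ) : setExp s i = if i ∈ s then 1 else 0 := by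
  simp [setExp, Finsupp.finsetSum_apply, Finsupp.single_apply]

lemma degree_setExp (s : Finset σ) : (setExp s).degree = s.card := by
  simp [setExp, map_sum]

lemma setExp_injective : Function.Injective (setExp (σ := σ)) := by
  intro s t h
  ext i
  have := DFunLike.congr_fun h i
  rw [setExp_apply, setExp_apply] at this
  by_cases hs : i ∈ s <;> by_cases ht : i ∈ t <;> simp_all

lemma setExp_add_sdiff {s t : Finset σ} (h : t ⊆ s) : setExp t + setExp (s \ t) = setExp s := by
  rw [setExp, setExp, add_comm]
  exact Finset.sum_sdiff h

/-- Below a multiplicity-free exponent every exponent is multiplicity-free, which is why products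
expand over subsets instead of general decompositions. -/
lemma eq_setExp_of_le {s : Finset σ} {e : σ →₀ ℕ} (h : e ≤ setExp s) : e = setExp e.support := by
  ext i
  have := h i
  rw [setExp_apply] at this ⊢
  simp only [Finsupp.mem_support_iff]
  split_ifs at this ⊢ <;> omega

/-- Coefficients of products at multiplicity-free exponents. -/
lemma coeff_mul_setExp {R : Type*} [Semiring R] (F G : MvPowerSeries σ R) (s : Finset σ) :
    MvPowerSeries.coeff (setExp s) (F * G) = ∑ t ∈ s.powerset,
      MvPowerSeries.coeff (setExp t) F * MvPowerSeries.coeff (setExp (s \ t)) G := by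
  rw [MvPowerSeries.coeff_mul]
  symm
  refine Finset.sum_bij (fun t _ => (setExp t, setExp (s \ t))) ?_ ?_ ?_ ?_
  · intro t ht
    rw [Finset.HasAntidiagonal.mem_antidiagonal]
    exact setExp_add_sdiff (Finset.mem_powerset.1 ht)
  · intro t _ t' _ h
    exact setExp_injective (Prod.ext_iff.1 h).1
  · rintro ⟨a, b⟩ hab
    rw [Finset.HasAntidiagonal.mem_antidiagonal] at hab
    have ha : a ≤ setExp s := hab ▸ le_self_add
    have ha' := eq_setExp_of_le ha
    have hsub : a.support ⊆ s := by
      intro i hi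
      have := ha i
      rw [setExp_apply] at this
      by_contra hs
      rw [if_neg hs] at this
      exact (Finsupp.mem_support_iff.1 hi) (by omega)
    refine ⟨a.support, Finset.mem_powerset.2 hsub, Prod.ext ha'.symm ?_⟩
    have h1 := setExp_add_sdiff hsub
    rw [← ha', ← hab] at h1
    exact add_left_cancel h1
  · intro t _
    rfl

/-- Coefficients at exponents that contain the variable `i` vanish for the inverse if they do for
the series. -/
lemma coeff_invOfUnit_eq_zero {R : Type*} [Ring R] {F : MvPowerSeries σ R} {i : σ}
    (hF : ∀ e : σ →₀ ℕ, e i ≠ 0 → MvPowerSeries.coeff e F = 0) (u : Rˣ) (e : σ →₀ ℕ)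
    (he : e i ≠ 0) : MvPowerSeries.coeff e (MvPowerSeries.invOfUnit F u) = 0 := by
  induction e using WellFoundedLT.induction with
  | ind e ih =>
    have h0 : e ≠ 0 := by
      rintro rfl
      exact he rfl
    rw [MvPowerSeries.coeff_invOfUnit, if_neg h0, Finset.sum_eq_zero, mul_zero]
    rintro ⟨a, b⟩ hab
    rw [Finset.HasAntidiagonal.mem_antidiagonal] at hab
    split_ifs with hlt
    · by_cases hb : b i = 0
      · have ha : a i ≠ 0 := by
          have := DFunLike.congr_fun hab i
          rw [Finsupp.add_apply, hb, add_zero] at this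
          exact this ▸ he
        rw [hF a ha, zero_mul]
      · rw [ih b hlt hb, mul_zero]
    · rfl

end SetExp

namespace TimeOrdered

variable {m : ℝ} {ce : ℕ} (P : TimeOrdered m ce)

/-! ### Coefficients of the generating functional -/

section GenFun

variable {σ : Type} [Fintype σ] [DecidableEq σ] (B : σ → Sym) (g : σ → 𝓢(Mink, ℂ))

/-- Replaces the arity `e.degree`, on which types depend, by a number `n` that can be a numeral. -/
lemma genFun_eq_of_degree {e : σ →₀ ℕ} {n : ℕ} (h : e.degree = n) :
    P.genFun B g e = (Complex.I ^ n / (n.factorial : ℂ)) •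
      ∑ j ∈ (Finset.univ : Finset (Fin n → σ)).filter
        (fun j => ∑ k, Finsupp.single (j k) 1 = e), P.T n (B ∘ j) (tensor n (g ∘ j)) := by
  subst h
  rw [genFun, Finset.sum_filter]
  congr 2
  funext j
  congr

lemma sum_single_eq_setExp {n : ℕ} {j : Fin n → σ} (hj : Function.Injective j) :
    ∑ k, Finsupp.single (j k) 1 = setExp (Finset.univ.image j) := by
  rw [setExp, Finset.sum_image fun a _ b _ h => hj h]

/-- The sum runs over the enumerations of the set, that is, over the `n!` permutations of `j`. By
the symmetry of `T` they contribute equally and cancel the factorial in the definition. -/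
lemma coeff_genFun_setExp {n : ℕ} {j : Fin n → σ} (hj : Function.Injective j) :
    MvPowerSeries.coeff (setExp (Finset.univ.image j)) (P.genFun B g) =
      Complex.I ^ n • P.T n (B ∘ j) (tensor n (g ∘ j)) := by
  have hcard : (setExp (Finset.univ.image j)).degree = n := by
    rw [degree_setExp, Finset.card_image_of_injective _ hj, Finset.card_univ, Fintype.card_fin]
  change P.genFun B g _ = _
  rw [P.genFun_eq_of_degree B g hcard]
  have h : ∑ i ∈ (Finset.univ : Finset (Fin n → σ)).filter
      (fun i => ∑ k, Finsupp.single (i k) 1 = setExp (Finset.univ.image j)),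
      P.T n (B ∘ i) (tensor n (g ∘ i)) =
      ∑ _π : Equiv.Perm (Fin n), P.T n (B ∘ j) (tensor n (g ∘ j)) := by
    symm
    refine Finset.sum_bij (fun π _ => j ∘ π) ?_ ?_ ?_ ?_
    · intro π _
      rw [Finset.mem_filter]
      refine ⟨Finset.mem_univ _, ?_⟩
      rw [← sum_single_eq_setExp hj]
      exact Equiv.sum_comp π fun k => Finsupp.single (j k) 1
    · intro π _ π' _ hπ
      exact Equiv.ext fun k => hj (congrFun hπ k)
    · intro i hi
      rw [Finset.mem_filter] at hi
      have hi' : ∀ x, ∑ k, (Finsupp.single (i k) 1 : σ →₀ ℕ) x =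
          if x ∈ Finset.univ.image j then 1 else 0 := fun x => by
        rw [← setExp_apply, ← hi.2, Finsupp.finsetSum_apply]
      have hinj : Function.Injective i := by
        intro a b hab
        by_contra hne
        have h1 := hi' (i a)
        have h2 : ∑ k ∈ {a, b}, (Finsupp.single (i k) 1 : σ →₀ ℕ) (i a) ≤
            ∑ k, (Finsupp.single (i k) 1 : σ →₀ ℕ) (i a) :=
          Finset.sum_le_sum_of_subset (Finset.subset_univ _)
        rw [Finset.sum_pair hne, ← hab, Finsupp.single_eq_same, h1] at h2
        split_ifs at h2 <;> omega
      have hmem : ∀ k, ∃ l, j l = i k := by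
        intro k
        by_contra hcon
        have h1 := hi' (i k)
        rw [if_neg (by simpa using hcon), Finset.sum_eq_zero_iff] at h1
        simpa using h1 k (Finset.mem_univ k)
      choose p hp using hmem
      have hpinj : Function.Injective p := fun a b hab => hinj (by rw [← hp a, ← hp b, hab])
      refine ⟨Equiv.ofBijective p (Finite.injective_iff_bijective.1 hpinj), Finset.mem_univ _, ?_⟩
      funext k
      exact hp k
    · intro π _
      exact (P.symmetric n (B ∘ j) (g ∘ j) π).symm
  rw [h, Finset.sum_const, Finset.card_univ, Fintype.card_perm, Fintype.card_fin,
    ← Nat.cast_smul_eq_nsmul ℂ, smul_smul, div_mul_cancel₀]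
  exact_mod_cast n.factorial_ne_zero

lemma coeff_genFun_eq_zero {i : σ} (hB : B i = 0) (e : σ →₀ ℕ) (he : e i ≠ 0) :
    MvPowerSeries.coeff e (P.genFun B g) = 0 := by
  change P.genFun B g e = 0
  rw [P.genFun_eq_of_degree B g rfl, Finset.sum_eq_zero, smul_zero]
  intro j hj
  rw [Finset.mem_filter] at hj
  have : ∃ k, j k = i := by
    by_contra hcon
    push Not at hcon
    refine he ?_
    rw [← hj.2, Finsupp.finsetSum_apply]
    exact Finset.sum_eq_zero fun k _ => Finsupp.single_eq_of_ne (hcon k).symm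
  obtain ⟨k, hk⟩ := this
  refine P.T_eq_zero (j := k) ?_ _
  rw [Function.comp_apply, hk, hB]

end GenFun


/-! ### Advanced and retarded products with two vertices and two fields -/

section FourPoints

abbrev Pts := Fin 2 ⊕ Fin 2

/-- The inverse series does not contain the variables of the fields, so both field points must go to
the other factor. Only the distribution of the two vertices is free, which gives four subsets. The
function `φ` stands for multiplication in either order. -/
lemma sum_powerset_pts {R : Type*} [Semiring R] {F G : MvPowerSeries Pts R}
    (hG : ∀ k (e : Pts →₀ ℕ), e (Sum.inr k) ≠ 0 → MvPowerSeries.coeff e G = 0)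
    (φ : R → R → R) (hφ : ∀ a, φ a 0 = 0) :
    ∑ t ∈ (Finset.univ : Finset Pts).powerset, φ (MvPowerSeries.coeff (setExp t) F)
        (MvPowerSeries.coeff (setExp (Finset.univ \ t)) G) =
      φ (MvPowerSeries.coeff (setExp Finset.univ) F) (MvPowerSeries.coeff (setExp ∅) G) +
      φ (MvPowerSeries.coeff (setExp {.inl 1, .inr 0, .inr 1}) F)
        (MvPowerSeries.coeff (setExp {.inl 0}) G) +
      φ (MvPowerSeries.coeff (setExp {.inl 0, .inr 0, .inr 1}) F)
        (MvPowerSeries.coeff (setExp {.inl 1}) G) +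
      φ (MvPowerSeries.coeff (setExp {.inr 0, .inr 1}) F)
        (MvPowerSeries.coeff (setExp {.inl 0, .inl 1}) G) := by
  have h0 : ∀ t : Finset Pts, t ∉ ({Finset.univ, {.inl 1, .inr 0, .inr 1},
      {.inl 0, .inr 0, .inr 1}, {.inr 0, .inr 1}} : Finset (Finset Pts)) →
      ∃ k, Sum.inr k ∈ Finset.univ \ t := by decide
  rw [← Finset.sum_subset (s₁ := {Finset.univ, {.inl 1, .inr 0, .inr 1},
      {.inl 0, .inr 0, .inr 1}, {.inr 0, .inr 1}}) (fun t _ => by simp) (fun t _ ht => by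
        obtain ⟨k, hk⟩ := h0 t ht
        rw [hG k _ (by rw [setExp_apply, if_pos hk]; exact one_ne_zero), hφ])]
  have e1 : (Finset.univ : Finset Pts) \ Finset.univ = ∅ := by decide
  have e2 : (Finset.univ : Finset Pts) \ {.inl 1, .inr 0, .inr 1} = {.inl 0} := by decide
  have e3 : (Finset.univ : Finset Pts) \ {.inl 0, .inr 0, .inr 1} = {.inl 1} := by decide
  have e4 : (Finset.univ : Finset Pts) \ {.inr 0, .inr 1} = {.inl 0, .inl 1} := by decide
  rw [Finset.sum_insert (by decide), Finset.sum_insert (by decide), Finset.sum_insert (by decide),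
    Finset.sum_singleton, e1, e2, e3, e4]
  simp only [add_assoc]

lemma allOnes_eq : allOnes Pts = setExp Finset.univ := rfl

lemma coeff_mul_pts {R : Type*} [Semiring R] {F G : MvPowerSeries Pts R}
    (hG : ∀ k (e : Pts →₀ ℕ), e (Sum.inr k) ≠ 0 → MvPowerSeries.coeff e G = 0) :
    MvPowerSeries.coeff (setExp Finset.univ) (F * G) =
      MvPowerSeries.coeff (setExp Finset.univ) F * MvPowerSeries.coeff (setExp ∅) G +
      MvPowerSeries.coeff (setExp {.inl 1, .inr 0, .inr 1}) F *
        MvPowerSeries.coeff (setExp {.inl 0}) G +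
      MvPowerSeries.coeff (setExp {.inl 0, .inr 0, .inr 1}) F *
        MvPowerSeries.coeff (setExp {.inl 1}) G +
      MvPowerSeries.coeff (setExp {.inr 0, .inr 1}) F *
        MvPowerSeries.coeff (setExp {.inl 0, .inl 1}) G := by
  rw [coeff_mul_setExp]
  exact sum_powerset_pts hG (fun a b => a * b) fun a => mul_zero a

lemma coeff_mul_pts' {R : Type*} [Semiring R] {F G : MvPowerSeries Pts R}
    (hG : ∀ k (e : Pts →₀ ℕ), e (Sum.inr k) ≠ 0 → MvPowerSeries.coeff e G = 0) :
    MvPowerSeries.coeff (setExp Finset.univ) (G * F) =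
      MvPowerSeries.coeff (setExp ∅) G * MvPowerSeries.coeff (setExp Finset.univ) F +
      MvPowerSeries.coeff (setExp {.inl 0}) G *
        MvPowerSeries.coeff (setExp {.inl 1, .inr 0, .inr 1}) F +
      MvPowerSeries.coeff (setExp {.inl 1}) G *
        MvPowerSeries.coeff (setExp {.inl 0, .inr 0, .inr 1}) F +
      MvPowerSeries.coeff (setExp {.inl 0, .inl 1}) G *
        MvPowerSeries.coeff (setExp {.inr 0, .inr 1}) F := by
  rw [coeff_mul_setExp]
  have h := sum_powerset_pts (F := F) hG (fun a b => b * a) fun a => zero_mul a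
  rw [← h]
  refine Finset.sum_bij' (fun t _ => Finset.univ \ t) (fun t _ => Finset.univ \ t) ?_ ?_ ?_ ?_ ?_
  · simp
  · simp
  · simp
  · simp
  · intro t _
    simp

variable (B C : Fin 2 → Sym) (g h : Fin 2 → 𝓢(Mink, ℂ))

/-- The coefficients of the inverse of a formal power series. -/
lemma coeff_inverse_pts {R : Type*} [Ring R] {F G : MvPowerSeries Pts R}
    (hF : MvPowerSeries.coeff (setExp ∅) F = 1) (hmul : F * G = 1) :
    MvPowerSeries.coeff (setExp ∅) G = 1 ∧
    (∀ i, MvPowerSeries.coeff (setExp {i}) G = -MvPowerSeries.coeff (setExp {i}) F) ∧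
    ∀ i j, i ≠ j → MvPowerSeries.coeff (setExp {i, j}) G =
      MvPowerSeries.coeff (setExp {i}) F * MvPowerSeries.coeff (setExp {j}) F +
      MvPowerSeries.coeff (setExp {j}) F * MvPowerSeries.coeff (setExp {i}) F -
      MvPowerSeries.coeff (setExp {i, j}) F := by
  have hz : (setExp (∅ : Finset Pts)) = 0 := by simp [setExp]
  have hco : ∀ s : Finset Pts, s ≠ ∅ → ∑ t ∈ s.powerset, MvPowerSeries.coeff (setExp t) F *
      MvPowerSeries.coeff (setExp (s \ t)) G = 0 := by
    intro s hs
    rw [← coeff_mul_setExp, hmul, MvPowerSeries.coeff_one, if_neg]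
    rw [← hz]
    exact fun h => hs (setExp_injective h)
  have h0 : MvPowerSeries.coeff (setExp ∅) G = 1 := by
    have h2 := coeff_mul_setExp F G ∅
    rw [hmul, Finset.powerset_empty, Finset.sum_singleton, Finset.sdiff_self, hF, one_mul] at h2
    rw [← h2, hz, MvPowerSeries.coeff_zero_one]
  have h1 : ∀ i, MvPowerSeries.coeff (setExp {i}) G = -MvPowerSeries.coeff (setExp {i}) F := by
    intro i
    have := hco {i} (by simp)
    rw [← Finset.insert_empty, Finset.sum_powerset_insert (by simp)] at this
    simp only [Finset.powerset_empty, Finset.sum_singleton, Finset.sdiff_empty,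
      Finset.insert_empty, Finset.sdiff_self] at this
    rw [hF, h0, one_mul, mul_one] at this
    exact eq_neg_of_add_eq_zero_left this
  refine ⟨h0, h1, fun i j hij => ?_⟩
  have := hco {i, j} (by simp)
  rw [Finset.sum_powerset_insert (by simpa using hij), ← Finset.insert_empty (a := j),
    Finset.sum_powerset_insert (by simp), Finset.sum_powerset_insert (by simp)] at this
  simp only [Finset.powerset_empty, Finset.sum_singleton, Finset.sdiff_empty,
      Finset.insert_empty, Finset.sdiff_self] at this
  have e1 : ({i, j} : Finset Pts) \ {j} = {i} := by
    ext x
    simp only [Finset.mem_sdiff, Finset.mem_insert, Finset.mem_singleton]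
    constructor
    · rintro ⟨h | h, h2⟩
      · exact h
      · exact absurd h h2
    · rintro rfl
      exact ⟨Or.inl rfl, hij⟩
  have e2 : ({i, j} : Finset Pts) \ {i} = {j} := by
    ext x
    simp only [Finset.mem_sdiff, Finset.mem_insert, Finset.mem_singleton]
    constructor
    · rintro ⟨h | h, h2⟩
      · exact absurd h h2
      · exact h
    · rintro rfl
      exact ⟨Or.inr rfl, hij.symm⟩
  rw [e1, e2, hF, h0, one_mul, mul_one, h1, h1] at this
  rw [eq_sub_iff_add_eq, ← sub_eq_zero, ← this]
  noncomm_ring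

lemma smul_identity_inverse {R : Type*} [Ring R] [Algebra ℂ R] (x y t : R) :
    Complex.I • x * Complex.I • y + Complex.I • y * Complex.I • x - Complex.I ^ 2 • t =
      t - x * y - y * x := by
  simp only [smul_mul_smul_comm, ← pow_two, Complex.I_sq, neg_smul, one_smul]
  abel

/-- The prefactor `(-i)⁴` is one; the terms carry `i⁴`, `i³ · i`, `i³ · i` and `i²`, so that only
signs remain. -/
lemma smul_identity_advanced {R : Type*} [Ring R] [Algebra ℂ R] (w u v a x y t : R) :
    (-Complex.I) ^ (2 + 2) • (Complex.I ^ 4 • w * 1 + Complex.I ^ 3 • u * -(Complex.I • x) +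
      Complex.I ^ 3 • v * -(Complex.I • y) + Complex.I ^ 2 • a * (t - x * y - y * x)) =
      w - u * x - v * y + a * (x * y + y * x - t) := by
  have hI : ((-Complex.I) ^ (2 + 2) : ℂ) = 1 := by
    rw [show (2 + 2 : ℕ) = 2 * 2 from rfl, pow_mul, neg_sq, Complex.I_sq]
    norm_num
  rw [hI, one_smul, Complex.I_pow_three, Complex.I_pow_four]
  simp only [one_smul, mul_one, neg_smul, Complex.I_sq, mul_neg, neg_mul, neg_neg,
    smul_mul_smul_comm, Complex.I_mul_I]
  noncomm_ring

lemma smul_identity_retarded {R : Type*} [Ring R] [Algebra ℂ R] (w u v a x y t : R) :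
    (-Complex.I) ^ (2 + 2) • (1 * Complex.I ^ 4 • w + -(Complex.I • x) * Complex.I ^ 3 • u +
      -(Complex.I • y) * Complex.I ^ 3 • v + (t - x * y - y * x) * Complex.I ^ 2 • a) =
      w - x * u - y * v + (x * y + y * x - t) * a := by
  have hI : ((-Complex.I) ^ (2 + 2) : ℂ) = 1 := by
    rw [show (2 + 2 : ℕ) = 2 * 2 from rfl, pow_mul, neg_sq, Complex.I_sq]
    norm_num
  rw [hI, one_smul, Complex.I_pow_three, Complex.I_pow_four]
  simp only [one_smul, one_mul, neg_smul, Complex.I_sq, mul_neg, neg_mul, neg_neg,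
    smul_mul_smul_comm, Complex.I_mul_I]
  noncomm_ring

lemma coeff_invOfUnit_pts {R : Type*} [Ring R] {F : MvPowerSeries Pts R}
    (hF : MvPowerSeries.coeff (setExp ∅) F = 1) :
    MvPowerSeries.coeff (setExp ∅) (MvPowerSeries.invOfUnit F 1) = 1 ∧
    (∀ i, MvPowerSeries.coeff (setExp {i}) (MvPowerSeries.invOfUnit F 1) =
      -MvPowerSeries.coeff (setExp {i}) F) ∧
    ∀ i j, i ≠ j → MvPowerSeries.coeff (setExp {i, j}) (MvPowerSeries.invOfUnit F 1) =
      MvPowerSeries.coeff (setExp {i}) F * MvPowerSeries.coeff (setExp {j}) F +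
      MvPowerSeries.coeff (setExp {j}) F * MvPowerSeries.coeff (setExp {i}) F -
      MvPowerSeries.coeff (setExp {i, j}) F := by
  refine coeff_inverse_pts hF (MvPowerSeries.mul_invOfUnit F 1 ?_)
  have hz : (setExp (∅ : Finset Pts)) = 0 := by simp [setExp]
  rw [← MvPowerSeries.coeff_zero_eq_constantCoeff_apply, ← hz, hF]
  rfl

lemma coeff_genInv_inr (k : Fin 2) (e : Pts →₀ ℕ) (he : e (Sum.inr k) ≠ 0) :
    MvPowerSeries.coeff e (P.genInv 2 B g) = 0 :=
  coeff_invOfUnit_eq_zero (i := Sum.inr k) (fun e he =>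
    P.coeff_genFun_eq_zero (Sum.elim B fun _ => 0) (Sum.elim g fun _ => 0) rfl e he) 1 e he

lemma coeff_genFun_of_image {n : ℕ} {s : Finset Pts} (j : Fin n → Pts)
    (hj : Function.Injective j) (hs : Finset.univ.image j = s) (B : Pts → Sym)
    (g : Pts → 𝓢(Mink, ℂ)) : MvPowerSeries.coeff (setExp s) (P.genFun B g) =
      Complex.I ^ n • P.T n (B ∘ j) (tensor n (g ∘ j)) := by
  rw [← hs]
  exact P.coeff_genFun_setExp B g hj

lemma comp_vec_four {α β : Type*} (f : α → β) (a b c d : α) :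
    f ∘ ![a, b, c, d] = ![f a, f b, f c, f d] := by
  funext j
  fin_cases j <;> rfl

lemma comp_vec_three {α β : Type*} (f : α → β) (a b c : α) :
    f ∘ ![a, b, c] = ![f a, f b, f c] := by
  funext j
  fin_cases j <;> rfl

lemma comp_vec_two {α β : Type*} (f : α → β) (a b : α) :
    f ∘ ![a, b] = ![f a, f b] := by
  funext j
  fin_cases j <;> rfl

lemma comp_vec_one {α β : Type*} (f : α → β) (a : α) :
    f ∘ ![a] = ![f a] := by
  funext j
  fin_cases j; rfl

lemma coeff_genInv :
    MvPowerSeries.coeff (setExp ∅) (P.genInv 2 B g) = 1 ∧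
    (∀ i, MvPowerSeries.coeff (setExp {.inl i}) (P.genInv 2 B g) =
      -(Complex.I • P.T 1 ![B i] (tensor 1 ![g i]))) ∧
    MvPowerSeries.coeff (setExp {.inl 0, .inl 1}) (P.genInv 2 B g) =
      P.T 2 ![B 0, B 1] (tensor 2 ![g 0, g 1]) -
      P.T 1 ![B 0] (tensor 1 ![g 0]) * P.T 1 ![B 1] (tensor 1 ![g 1]) -
      P.T 1 ![B 1] (tensor 1 ![g 1]) * P.T 1 ![B 0] (tensor 1 ![g 0]) := by
  have h0 : MvPowerSeries.coeff (setExp ∅)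
      (P.genFun (Sum.elim B fun _ : Fin 2 => 0) (Sum.elim g fun _ => 0)) = 1 := by
    have ht : ∀ g' : Fin 0 → 𝓢(Mink, ℂ), tensor 0 g' 0 = 1 := fun _ => rfl
    rw [P.coeff_genFun_of_image (n := 0) (fun i => i.elim0) (fun i => i.elim0) (by simp), P.empty,
      ht]
    simp
  obtain ⟨a, b, c⟩ := coeff_invOfUnit_pts (R := Module.End ℂ (domain m))
    (F := P.genFun (Sum.elim B fun _ : Fin 2 => 0) (Sum.elim g fun _ => 0)) h0
  have h1 : ∀ i, MvPowerSeries.coeff (setExp {.inl i})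
      (P.genFun (Sum.elim B fun _ : Fin 2 => 0) (Sum.elim g fun _ => 0)) =
      Complex.I • P.T 1 ![B i] (tensor 1 ![g i]) := by
    intro i
    rw [P.coeff_genFun_of_image (n := 1) ![.inl i] (Function.injective_of_subsingleton _) (by simp),
      comp_vec_one, comp_vec_one, pow_one]
    rfl
  have h2 : MvPowerSeries.coeff (setExp {.inl 0, .inl 1})
      (P.genFun (Sum.elim B fun _ : Fin 2 => 0) (Sum.elim g fun _ => 0)) =
      Complex.I ^ 2 • P.T 2 ![B 0, B 1] (tensor 2 ![g 0, g 1]) := by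
    rw [P.coeff_genFun_of_image (n := 2) ![.inl 0, .inl 1] (by decide) (by decide),
      comp_vec_two, comp_vec_two]
    rfl
  refine ⟨a, fun i => (b _).trans (congrArg Neg.neg (h1 i)), (c (.inl 0) (.inl 1) (by decide)).trans ?_⟩
  rw [h1, h1, h2]
  exact smul_identity_inverse (R := Module.End ℂ (domain m)) _ _ _

/-- The advanced product with two arguments of each kind. -/
lemma advanced_two : P.advanced B C g h =
    P.T 4 ![B 0, B 1, C 0, C 1] (tensor 4 ![g 0, g 1, h 0, h 1]) -
    P.T 3 ![B 1, C 0, C 1] (tensor 3 ![g 1, h 0, h 1]) * P.T 1 ![B 0] (tensor 1 ![g 0]) -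
    P.T 3 ![B 0, C 0, C 1] (tensor 3 ![g 0, h 0, h 1]) * P.T 1 ![B 1] (tensor 1 ![g 1]) +
    P.T 2 ![C 0, C 1] (tensor 2 ![h 0, h 1]) *
      (P.T 1 ![B 0] (tensor 1 ![g 0]) * P.T 1 ![B 1] (tensor 1 ![g 1]) +
      P.T 1 ![B 1] (tensor 1 ![g 1]) * P.T 1 ![B 0] (tensor 1 ![g 0]) -
      P.T 2 ![B 0, B 1] (tensor 2 ![g 0, g 1])) := by
  obtain ⟨a, b, c⟩ := P.coeff_genInv B g
  rw [advanced, allOnes_eq, coeff_mul_pts (P.coeff_genInv_inr B g), a, b, b, c, genFull,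
    P.coeff_genFun_of_image (n := 4) ![.inl 0, .inl 1, .inr 0, .inr 1] (by decide) (by decide),
    P.coeff_genFun_of_image (n := 3) ![.inl 1, .inr 0, .inr 1] (by decide) (by decide),
    P.coeff_genFun_of_image (n := 3) ![.inl 0, .inr 0, .inr 1] (by decide) (by decide),
    P.coeff_genFun_of_image (n := 2) ![.inr 0, .inr 1] (by decide) (by decide)]
  simp only [comp_vec_four, comp_vec_three, comp_vec_two, Sum.elim_inl, Sum.elim_inr]
  exact smul_identity_advanced (R := Module.End ℂ (domain m)) _ _ _ _ _ _ _

/-- The retarded product with two arguments of each kind. -/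
lemma retarded_two : P.retarded B C g h =
    P.T 4 ![C 0, C 1, B 0, B 1] (tensor 4 ![h 0, h 1, g 0, g 1]) -
    P.T 1 ![B 0] (tensor 1 ![g 0]) * P.T 3 ![C 0, C 1, B 1] (tensor 3 ![h 0, h 1, g 1]) -
    P.T 1 ![B 1] (tensor 1 ![g 1]) * P.T 3 ![C 0, C 1, B 0] (tensor 3 ![h 0, h 1, g 0]) +
      (P.T 1 ![B 0] (tensor 1 ![g 0]) * P.T 1 ![B 1] (tensor 1 ![g 1]) +
      P.T 1 ![B 1] (tensor 1 ![g 1]) * P.T 1 ![B 0] (tensor 1 ![g 0]) -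
      P.T 2 ![B 0, B 1] (tensor 2 ![g 0, g 1])) *
      P.T 2 ![C 0, C 1] (tensor 2 ![h 0, h 1]) := by
  obtain ⟨a, b, c⟩ := P.coeff_genInv B g
  rw [retarded, allOnes_eq, coeff_mul_pts' (P.coeff_genInv_inr B g), a, b, b, c, genFull,
    P.coeff_genFun_of_image (n := 4) ![.inr 0, .inr 1, .inl 0, .inl 1] (by decide) (by decide),
    P.coeff_genFun_of_image (n := 3) ![.inr 0, .inr 1, .inl 1] (by decide) (by decide),
    P.coeff_genFun_of_image (n := 3) ![.inr 0, .inr 1, .inl 0] (by decide) (by decide),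
    P.coeff_genFun_of_image (n := 2) ![.inr 0, .inr 1] (by decide) (by decide)]
  simp only [comp_vec_four, comp_vec_three, comp_vec_two, Sum.elim_inl, Sum.elim_inr]
  exact smul_identity_retarded (R := Module.End ℂ (domain m)) _ _ _ _ _ _ _

end FourPoints

/-! ### Causal factorization -/

section Factorization

/-- The points of the first set are not in the causal past of the points of the second one. -/
def NotBefore (X Y : Set Mink) : Prop := ∀ x ∈ X, ∀ y ∈ Y, y - x ∉ closedForwardCone

/-- Here `t = T(L, L)`, `a = T(φ, φ)` and `x = L`: for late vertices the four-point product is `t a`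
and the three-point products are `x a`. The summand `-a t` of the last bracket completes the
commutator. -/
lemma ring_identity_advanced {R : Type*} [Ring R] [Algebra ℂ R] (t a x : R) :
    t * a - x * a * x - x * a * x + a * (x * x + x * x - t) =
      t * a - a * t - (2 : ℂ) • (x * a * x) + (2 : ℂ) • (a * (x * x)) := by
  rw [two_smul, two_smul]
  noncomm_ring

lemma ring_identity_retarded {R : Type*} [Ring R] [Algebra ℂ R] (t a x : R) :
    a * t - x * (a * x) - x * (a * x) + (x * x + x * x - t) * a =
      a * t - t * a - (2 : ℂ) • (x * a * x) + (2 : ℂ) • (x * x * a) := by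
  rw [two_smul, two_smul]
  noncomm_ring

variable {P} {B C : Sym} {g h₀ h₁ : 𝓢(Mink, ℂ)}

lemma append_two_two {α : Type*} (a b c d : α) :
    Fin.append ![a, b] ![c, d] = ![a, b, c, d] := by
  funext j
  fin_cases j <;> rfl

lemma append_one_two {α : Type*} (a b c : α) : Fin.append ![a] ![b, c] = ![a, b, c] := by
  funext j
  fin_cases j <;> rfl

lemma append_two_one {α : Type*} (a b c : α) : Fin.append ![a, b] ![c] = ![a, b, c] := by
  funext j
  fin_cases j <;> rfl

variable (P B C) in
/-- The advanced product factorizes if the arguments `y` are late. -/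
lemma advanced_of_notBefore (hg0 : NotBefore (tsupport g) (tsupport h₀))
    (hg1 : NotBefore (tsupport g) (tsupport h₁)) :
    P.advanced ![B, B] ![C, C] ![g, g] ![h₀, h₁] =
      P.T 2 ![B, B] (tensor 2 ![g, g]) * P.T 2 ![C, C] (tensor 2 ![h₀, h₁]) -
      P.T 2 ![C, C] (tensor 2 ![h₀, h₁]) * P.T 2 ![B, B] (tensor 2 ![g, g]) -
      (2 : ℂ) • (P.T 1 ![B] (tensor 1 ![g]) * P.T 2 ![C, C] (tensor 2 ![h₀, h₁]) *
        P.T 1 ![B] (tensor 1 ![g])) +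
      (2 : ℂ) • (P.T 2 ![C, C] (tensor 2 ![h₀, h₁]) *
        (P.T 1 ![B] (tensor 1 ![g]) * P.T 1 ![B] (tensor 1 ![g]))) := by
  have h4 := P.causality 2 2 ![B, B] ![C, C] ![g, g] ![h₀, h₁] (by
    intro i j
    fin_cases i <;> fin_cases j
    exacts [hg0, hg1, hg0, hg1])
  have h3 := P.causality 1 2 ![B] ![C, C] ![g] ![h₀, h₁] (by
    intro i j
    fin_cases i
    fin_cases j
    exacts [hg0, hg1])
  rw [append_two_two, append_two_two] at h4
  rw [append_one_two, append_one_two] at h3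
  rw [advanced_two]
  simp only [Matrix.cons_val_zero, Matrix.cons_val_one]
  erw [h4, h3]
  exact ring_identity_advanced (R := Module.End ℂ (domain m)) _ _ _

variable (P B C) in
/-- The retarded product factorizes if the arguments `y` are early. -/
lemma retarded_of_notBefore (hg0 : NotBefore (tsupport h₀) (tsupport g))
    (hg1 : NotBefore (tsupport h₁) (tsupport g)) :
    P.retarded ![B, B] ![C, C] ![g, g] ![h₀, h₁] =
      P.T 2 ![C, C] (tensor 2 ![h₀, h₁]) * P.T 2 ![B, B] (tensor 2 ![g, g]) -
      P.T 2 ![B, B] (tensor 2 ![g, g]) * P.T 2 ![C, C] (tensor 2 ![h₀, h₁]) -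
      (2 : ℂ) • (P.T 1 ![B] (tensor 1 ![g]) * P.T 2 ![C, C] (tensor 2 ![h₀, h₁]) *
        P.T 1 ![B] (tensor 1 ![g])) +
      (2 : ℂ) • (P.T 1 ![B] (tensor 1 ![g]) * P.T 1 ![B] (tensor 1 ![g]) *
        P.T 2 ![C, C] (tensor 2 ![h₀, h₁])) := by
  have h4 := P.causality 2 2 ![C, C] ![B, B] ![h₀, h₁] ![g, g] (by
    intro i j
    fin_cases i <;> fin_cases j
    exacts [hg0, hg0, hg1, hg1])
  have h3 := P.causality 2 1 ![C, C] ![B] ![h₀, h₁] ![g] (by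
    intro i j
    fin_cases j
    fin_cases i
    exacts [hg0, hg1])
  rw [append_two_two, append_two_two] at h4
  rw [append_two_one, append_two_one] at h3
  rw [retarded_two]
  simp only [Matrix.cons_val_zero, Matrix.cons_val_one]
  erw [h4, h3]
  exact ring_identity_retarded (R := Module.End ℂ (domain m)) _ _ _

end Factorization

end TimeOrdered
end EG
end

/-! ### Continuity in the test function of the fields -/

noncomputable section
namespace EG

section TensorRight

variable {V W : Type*} [NormedAddCommGroup V] [NormedSpace ℝ V] [NormedAddCommGroup W]
  [NormedSpace ℝ W]

/-- The tensor product as a continuous linear map of the second factor. -/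
def tensorRight (g : 𝓢(V, ℂ)) : 𝓢(W, ℂ) →L[ℂ] 𝓢(V × W, ℂ) :=
  (SchwartzMap.compCLMOfContinuousLinearEquiv ℂ (ContinuousLinearEquiv.prodComm ℝ V W)).comp
    (tensorLeft g)

lemma tensorRight_apply (g : 𝓢(V, ℂ)) (f : 𝓢(W, ℂ)) : tensorRight g f = tensorLeft f g := by
  ext z
  have : tensorRight g f z = f z.2 * g z.1 := rfl
  rw [this, tensorLeft_apply, mul_comm]

end TensorRight

lemma tensor_two_apply (g h : 𝓢(Mink, ℂ)) (x : Cfg 2) :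
    tensor 2 ![g, h] x = g (pt x 0) * h (pt x 1) := by
  rw [tensor_apply, Fin.prod_univ_two]
  rfl

lemma schwartzMul_tensor_two (χ : 𝓢(Mink, ℂ)) (h : Fin 2 → 𝓢(Mink, ℂ)) :
    schwartzMul (tensor 2 ![χ, χ]) (tensor 2 h) =
      tensor 2 ![schwartzMul χ (h 0), schwartzMul χ (h 1)] := by
  ext x
  rw [schwartzMul_apply, tensor_two_apply, tensor_two_apply, tensor_apply, Fin.prod_univ_two,
    schwartzMul_apply, schwartzMul_apply]
  ring

lemma tsupport_schwartzMul_subset {E : Type*} [NormedAddCommGroup E] [NormedSpace ℝ E]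
    (χ h : 𝓢(E, ℂ)) : tsupport (schwartzMul χ h) ⊆ tsupport χ := by
  have : (schwartzMul χ h : E → ℂ) = (χ : E → ℂ) * h := funext fun x => schwartzMul_apply χ h x
  rw [this]
  exact tsupport_mul_subset_left

/-- Superpositions, with polynomially bounded weights, of values on the mass shell. -/
lemma exists_clm_onShell (m : ℝ) {n : ℕ} {v : (Fin n → OneP) → ℂ} (hv : Continuous v) {C : ℝ}
    {M : ℕ} (hC : ∀ κ, ‖v κ‖ ≤ C * ∏ j, (1 + ‖(κ j).2‖) ^ M) :
    ∃ D : 𝓢(Cfg n, ℂ) →L[ℂ] ℂ, ∀ F : 𝓢(Cfg n, ℂ),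
      Integrable (fun κ => v κ * F (cfg fun j => onShell m (κ j))) (shellPi m n) ∧
      D F = ∫ κ, v κ * F (cfg fun j => onShell m (κ j)) ∂(shellPi m n) := by
  -- Of the `5 + M` powers of decay, `M` absorb the growth of the weight and five make the invariant
  -- measure integrable.
  obtain ⟨A, hA, hb⟩ := exists_decay_schwartz_onShell m n (5 + M)
  have hcont : ∀ F : 𝓢(Cfg n, ℂ), Continuous fun κ : Fin n → OneP =>
      v κ * F (cfg fun j => onShell m (κ j)) := fun F => hv.mul (F.continuous.comp
    (continuous_cfg fun j => (continuous_onShell m).comp (continuous_apply j)))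
  have hC0 : 0 ≤ C := by
    have h := (norm_nonneg _).trans (hC fun _ => (true, 0))
    exact nonneg_of_mul_nonneg_left h (Finset.prod_pos fun j _ => by positivity)
  have hle : ∀ (F : 𝓢(Cfg n, ℂ)) κ, ‖v κ * F (cfg fun j => onShell m (κ j))‖ ≤
      C * A * schwartzNorm ((5 + M) * n) F * ∏ j, ((1 + ‖(κ j).2‖) ^ 5)⁻¹ := by
    intro F κ
    rw [norm_mul]
    refine (mul_le_mul (hC κ) (hb F κ) (norm_nonneg _)
      (mul_nonneg hC0 (Finset.prod_nonneg fun j _ => by positivity))).trans (le_of_eq ?_)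
    have : (∏ j, (1 + ‖(κ j).2‖) ^ M) * ∏ j, ((1 + ‖(κ j).2‖) ^ (5 + M))⁻¹ =
        ∏ j, ((1 + ‖(κ j).2‖) ^ 5)⁻¹ := by
      rw [← Finset.prod_mul_distrib]
      refine Finset.prod_congr rfl fun j _ => ?_
      have : (1 + ‖(κ j).2‖) ≠ 0 := by positivity
      rw [pow_add]
      field_simp
    rw [← this]
    ring
  have hint : ∀ F : 𝓢(Cfg n, ℂ), Integrable (fun κ => v κ * F (cfg fun j => onShell m (κ j)))
      (shellPi m n) := fun F =>
    ((integrable_prod_decay m n).const_mul _).mono' (hcont F).aestronglyMeasurable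
      (Eventually.of_forall (hle F))
  refine ⟨SchwartzMap.mkCLMtoNormedSpace (σ := RingHom.id ℂ)
    (fun F => ∫ κ, v κ * F (cfg fun j => onShell m (κ j)) ∂(shellPi m n)) (fun F G => ?_)
    (fun a F => ?_) ⟨Finset.Iic ((5 + M) * n, (5 + M) * n),
      C * A * ∫ κ : Fin n → OneP, ∏ j, ((1 + ‖(κ j).2‖) ^ 5)⁻¹ ∂(shellPi m n), ?_, fun F => ?_⟩,
    fun F => ⟨hint F, rfl⟩⟩
  · rw [← integral_add (hint F) (hint G)]
    exact integral_congr_ae (Eventually.of_forall fun κ => mul_add _ _ _)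
  · simp only [RingHom.id_apply, smul_eq_mul]
    rw [← integral_const_mul]
    refine integral_congr_ae (Eventually.of_forall fun κ => ?_)
    change v κ * (a * F _) = _
    ring
  · exact mul_nonneg (mul_nonneg hC0 hA) (integral_nonneg fun κ => prod_decay_nonneg κ 5)
  · refine (norm_integral_le_of_norm_le ((integrable_prod_decay m n).const_mul _)
      (Eventually.of_forall (hle F))).trans (le_of_eq ?_)
    rw [integral_const_mul, schwartzNorm]
    ring

/-- A polynomial bound for distributions applied to modulated test functions. -/
lemma exists_bound_modulate_shellCovec (m : ℝ) {n : ℕ} (D : 𝓢(Cfg n, ℂ) →L[ℂ] ℂ)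
    (H : 𝓢(Cfg n, ℂ)) {s : ℝ} (hs : |s| = 1) : ∃ (C : ℝ) (M : ℕ), ∀ κ : Fin n → OneP,
      ‖D (modulate (s • shellCovec m κ) H)‖ ≤ C * ∏ j, (1 + ‖(κ j).2‖) ^ M := by
  obtain ⟨N, C, hC, hD⟩ := exists_bound_clm D
  refine ⟨C * (2 ^ N * 2 ^ N * (1 + 4 * n * (1 + |m|)) ^ N * schwartzNorm N H), N, fun κ => ?_⟩
  have h1 := norm_shellCovec_le m κ
  have h2 : 1 ≤ ∏ j, (1 + ‖(κ j).2‖) := one_le_prod_one_add_norm _ κ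
  have h3 : 1 + ‖s • shellCovec m κ‖ ≤ (1 + 4 * n * (1 + |m|)) * ∏ j, (1 + ‖(κ j).2‖) := by
    rw [norm_smul, Real.norm_eq_abs, hs, one_mul, add_mul, one_mul]
    exact add_le_add h2 h1
  have h4 := pow_le_pow_left₀ (by positivity) h3 N
  rw [mul_pow, ← Finset.prod_pow] at h4
  have hn := apply_nonneg (schwartzNorm N) H
  calc _ ≤ C * (2 ^ N * 2 ^ N * (1 + ‖s • shellCovec m κ‖) ^ N * schwartzNorm N H) :=
        (hD _).trans (mul_le_mul_of_nonneg_left (schwartzNorm_modulate_le N _ H) hC)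
    _ ≤ C * (2 ^ N * 2 ^ N * ((1 + 4 * n * (1 + |m|)) ^ N * ∏ j, (1 + ‖(κ j).2‖) ^ N) *
          schwartzNorm N H) := by gcongr
    _ = _ := by ring

lemma integrable_shellPi_comp {m : ℝ} (n : ℕ) (e : Fin n ≃ Fin n) {F : (Fin n → OneP) → ℂ}
    (hF : Integrable F (shellPi m n)) : Integrable (fun κ => F (κ ∘ e)) (shellPi m n) := by
  have h := measurePreserving_piCongrLeft (fun _ : Fin n => shell m) e.symm
  refine ((h.integrable_comp_emb (MeasurableEquiv.measurableEmbedding _)).2 hF).congr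
    (Eventually.of_forall fun κ => ?_)
  simp only [Function.comp_apply]
  congr 1
  funext j
  have := MeasurableEquiv.piCongrLeft_apply_apply (β := fun _ : Fin n => OneP) e.symm κ (e j)
  simpa using this

/-! ### The vacuum expectation values in the causal region -/

namespace TimeOrdered

variable {m : ℝ} {ce : ℕ} (P : TimeOrdered m ce)

/-- One half of the commutator is a continuous functional of the test function of the fields. -/
lemma exists_clm_pairWave (D : 𝓢(Cfg 2, ℂ) →L[ℂ] ℂ) (H : 𝓢(Cfg 2, ℂ)) {s : ℝ} (hs : |s| = 1) :
    ∃ E : 𝓢(Cfg 2, ℂ) →L[ℂ] ℂ, ∀ f, E f = ∫ κ, (speciesInd ![false, false] κ * pairWave m s f κ) *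
        D (modulate (s • shellCovec m κ) H) ∂(shellPi m 2) := by
  obtain ⟨C, M, hC⟩ := exists_bound_modulate_shellCovec m D H hs
  have hs0 : s ≠ 0 := by
    rintro rfl
    simp at hs
  set v : (Fin 2 → OneP) → ℂ := fun κ => speciesInd ![false, false] κ *
    D (modulate (s • shellCovec m κ) H) with hv
  have hvc : Continuous v := (continuous_speciesInd _).mul (D.continuous.comp
    ((continuous_modulate H).comp ((continuous_shellCovec m 2).const_smul s)))
  have hvb : ∀ κ, ‖v κ‖ ≤ C * ∏ j, (1 + ‖(κ j).2‖) ^ M := by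
    intro κ
    rw [hv, norm_mul]
    exact (mul_le_of_le_one_left (norm_nonneg _) (norm_speciesInd_le _ κ)).trans (hC κ)
  -- The exchanged term of the two-particle wave function is treated by relabelling the particles,
  -- which moves the exchange onto the weight.
  set v' : (Fin 2 → OneP) → ℂ := fun κ => v (κ ∘ Equiv.swap 0 1)
  have hvc' : Continuous v' := hvc.comp (by fun_prop)
  have hvb' : ∀ κ, ‖v' κ‖ ≤ C * ∏ j, (1 + ‖(κ j).2‖) ^ M := by
    intro κ
    refine (hvb _).trans (le_of_eq ?_)
    congr 1
    exact Equiv.prod_comp (Equiv.swap (0 : Fin 2) 1) fun j => (1 + ‖(κ j).2‖) ^ M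
  obtain ⟨D₁, hD₁⟩ := exists_clm_onShell m hvc hvb
  obtain ⟨D₂, hD₂⟩ := exists_clm_onShell m hvc' hvb'
  refine ⟨(D₁ + D₂).comp ((scaleArg s).comp (fourierM 2)), fun f => ?_⟩
  have h1 := hD₁ (scaleArg s (fourierM 2 f))
  have h2 := hD₂ (scaleArg s (fourierM 2 f))
  have hswap : ∫ κ, v' κ * scaleArg s (fourierM 2 f) (cfg fun j => onShell m (κ j))
      ∂(shellPi m 2) = ∫ κ, v κ * scaleArg s (fourierM 2 f)
        (cfg fun j => onShell m (κ (Equiv.swap 0 1 j))) ∂(shellPi m 2) := by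
    rw [← integral_shellPi_comp 2 (Equiv.swap (0 : Fin 2) 1)]
    refine integral_congr_ae (Eventually.of_forall fun κ => ?_)
    simp [v', Function.comp_def]
  have hint2 : Integrable (fun κ => v κ * scaleArg s (fourierM 2 f)
      (cfg fun j => onShell m (κ (Equiv.swap 0 1 j)))) (shellPi m 2) := by
    refine (integrable_shellPi_comp 2 (Equiv.swap (0 : Fin 2) 1) h2.1).congr
      (Eventually.of_forall fun κ => ?_)
    simp [v', Function.comp_def]
  change D₁ (scaleArg s (fourierM 2 f)) + D₂ (scaleArg s (fourierM 2 f)) = _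
  rw [h1.2, h2.2, hswap, ← integral_add h1.1 hint2]
  refine integral_congr_ae (Eventually.of_forall fun κ => ?_)
  simp only [hv, pairWave, scaleArg_apply hs0]
  ring

/-- `(Ω| T(L, L) T(φ, φ) Ω) - (Ω| T(φ, φ) T(L, L) Ω)`. -/
def commForm (H f : 𝓢(Cfg 2, ℂ)) : ℂ :=
  innerLin (vac m) (P.T 2 ![vertex, vertex] H (P.T 2 ![phi, phi] f (vac m))) -
    innerLin (vac m) (P.T 2 ![phi, phi] f (P.T 2 ![vertex, vertex] H (vac m)))

/-- `(Ω| L T(φ, φ) L Ω)`. -/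
def midForm (f : 𝓢(Cfg 2, ℂ)) (g₁ g₂ : 𝓢(Cfg 1, ℂ)) : ℂ :=
  innerLin (vac m) (P.vertexOp g₁ (P.T 2 ![phi, phi] f (P.vertexOp g₂ (vac m))))

/-- `(Ω| T(φ, φ) L L Ω)`. -/
def leftForm (f : 𝓢(Cfg 2, ℂ)) (g₁ g₂ : 𝓢(Cfg 1, ℂ)) : ℂ :=
  innerLin (vac m) (P.T 2 ![phi, phi] f (P.vertexOp g₁ (P.vertexOp g₂ (vac m))))

/-- `(Ω| L L T(φ, φ) Ω)`. -/
def rightForm (f : 𝓢(Cfg 2, ℂ)) (g₁ g₂ : 𝓢(Cfg 1, ℂ)) : ℂ :=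
  innerLin (vac m) (P.vertexOp g₁ (P.vertexOp g₂ (P.T 2 ![phi, phi] f (vac m))))

lemma exists_clm_innerLin {n : ℕ} (B : Fin n → Sym) (Ψ Φ : domain m) :
    ∃ D : 𝓢(Cfg n, ℂ) →L[ℂ] ℂ, ∀ g, D g = innerLin Ψ (P.T n B g Φ) :=
  P.distribution n B Ψ Φ

/-- The distribution property concerns a single time-ordered product between fixed vectors, whereas
here `T(φ, φ)(f)` acts on one side of `T(L, L)`. Continuity in `f` is therefore read off from the
momentum integral for the commutator. -/
lemma exists_clm_commForm (H : 𝓢(Cfg 2, ℂ)) :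
    ∃ D : 𝓢(Cfg 2, ℂ) →L[ℂ] ℂ, ∀ f, D f = P.commForm H f := by
  obtain ⟨D₁, h1⟩ := exists_clm_pairWave (m := m) (P.vev ![psi ^ 2, psi ^ 2]) H (s := 1) (by simp)
  obtain ⟨D₂, h2⟩ := exists_clm_pairWave (m := m) (P.vev ![psi ^ 2, psi ^ 2]) H (s := -1) (by simp)
  refine ⟨(1 / 4 : ℂ) • (D₁ - D₂), fun f => ?_⟩
  rw [commForm, innerLin_commutator]
  refine Eq.trans ?_ (congrArg _ (congrArg₂ _ (h1 f) (h2 f)))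
  rfl

/-- Moving operators to the left vector by their adjoints leaves one time-ordered product between
fixed vectors, to which the distribution property applies. The separate continuity of the other
forms is obtained in the same way. -/
lemma exists_clm_midForm (g₁ g₂ : 𝓢(Cfg 1, ℂ)) :
    ∃ D : 𝓢(Cfg 2, ℂ) →L[ℂ] ℂ, ∀ f, D f = P.midForm f g₁ g₂ := by
  obtain ⟨D, h⟩ := P.exists_clm_innerLin ![phi, phi] (P.vertexOp (conjTest g₁) (vac m))
    (P.vertexOp g₂ (vac m))
  exact ⟨D, fun f => by rw [h, midForm, innerLin_vertexOp_conj]⟩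

lemma exists_clm_leftForm (g₁ g₂ : 𝓢(Cfg 1, ℂ)) :
    ∃ D : 𝓢(Cfg 2, ℂ) →L[ℂ] ℂ, ∀ f, D f = P.leftForm f g₁ g₂ :=
  P.exists_clm_innerLin ![phi, phi] _ _

lemma exists_clm_rightForm (g₁ g₂ : 𝓢(Cfg 1, ℂ)) :
    ∃ D : 𝓢(Cfg 2, ℂ) →L[ℂ] ℂ, ∀ f, D f = P.rightForm f g₁ g₂ := by
  obtain ⟨D, h⟩ := P.exists_clm_innerLin ![phi, phi]
    (P.vertexOp (conjTest g₂) (P.vertexOp (conjTest g₁) (vac m))) (vac m)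
  exact ⟨D, fun f => by rw [h, rightForm, innerLin_vertexOp_conj, innerLin_vertexOp_conj]⟩

lemma exists_clm_midForm_left (f : 𝓢(Cfg 2, ℂ)) (g₂ : 𝓢(Cfg 1, ℂ)) :
    ∃ D : 𝓢(Cfg 1, ℂ) →L[ℂ] ℂ, ∀ g, D g = P.midForm f g g₂ :=
  P.exists_clm_innerLin ![vertex] _ _

lemma exists_clm_midForm_right (f : 𝓢(Cfg 2, ℂ)) (g₁ : 𝓢(Cfg 1, ℂ)) :
    ∃ D : 𝓢(Cfg 1, ℂ) →L[ℂ] ℂ, ∀ g, D g = P.midForm f g₁ g := by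
  obtain ⟨D, h⟩ := P.exists_clm_innerLin ![vertex]
    (P.phiPairAdjoint f (P.vertexOp (conjTest g₁) (vac m))) (vac m)
  exact ⟨D, fun g => by rw [h, innerLin_phiPairAdjoint, innerLin_vertexOp_conj]; rfl⟩

lemma exists_clm_leftForm_left (f : 𝓢(Cfg 2, ℂ)) (g₂ : 𝓢(Cfg 1, ℂ)) :
    ∃ D : 𝓢(Cfg 1, ℂ) →L[ℂ] ℂ, ∀ g, D g = P.leftForm f g g₂ := by
  obtain ⟨D, h⟩ := P.exists_clm_innerLin ![vertex] (P.phiPairAdjoint f (vac m))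
    (P.vertexOp g₂ (vac m))
  exact ⟨D, fun g => by rw [h, innerLin_phiPairAdjoint]; rfl⟩

lemma exists_clm_leftForm_right (f : 𝓢(Cfg 2, ℂ)) (g₁ : 𝓢(Cfg 1, ℂ)) :
    ∃ D : 𝓢(Cfg 1, ℂ) →L[ℂ] ℂ, ∀ g, D g = P.leftForm f g₁ g := by
  obtain ⟨D, h⟩ := P.exists_clm_innerLin ![vertex]
    (P.vertexOp (conjTest g₁) (P.phiPairAdjoint f (vac m))) (vac m)
  exact ⟨D, fun g => by rw [h, innerLin_vertexOp_conj, innerLin_phiPairAdjoint]; rfl⟩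

lemma exists_clm_rightForm_left (f : 𝓢(Cfg 2, ℂ)) (g₂ : 𝓢(Cfg 1, ℂ)) :
    ∃ D : 𝓢(Cfg 1, ℂ) →L[ℂ] ℂ, ∀ g, D g = P.rightForm f g g₂ :=
  P.exists_clm_innerLin ![vertex] _ _

lemma exists_clm_rightForm_right (f : 𝓢(Cfg 2, ℂ)) (g₁ : 𝓢(Cfg 1, ℂ)) :
    ∃ D : 𝓢(Cfg 1, ℂ) →L[ℂ] ℂ, ∀ g, D g = P.rightForm f g₁ g := by
  obtain ⟨D, h⟩ := P.exists_clm_innerLin ![vertex] (P.vertexOp (conjTest g₁) (vac m))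
    (P.T 2 ![phi, phi] f (vac m))
  exact ⟨D, fun g => by rw [h, innerLin_vertexOp_conj]; rfl⟩

lemma notBefore_of_time {X Y : Set Mink} {R : ℝ} (hX : ∀ x ∈ X, R < x 0) (hY : ∀ y ∈ Y, y 0 ≤ R) :
    NotBefore X Y := by
  intro x hx y hy hcone
  have h1 := hcone.1
  have h2 : (y - x) 0 = y 0 - x 0 := rfl
  have := hX x hx
  have := hY y hy
  linarith

/-- The advanced product for late arguments of the vertices. -/
lemma advVEV_eq {a : 𝓢'(Cfg 2 × Cfg 2, ℂ)} (ha : P.IsAdvVEV ![vertex, vertex] ![phi, phi] a)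
    {g χ : 𝓢(Mink, ℂ)} {R : ℝ} (hg : ∀ y ∈ tsupport g, R < y 0) (hχ : ∀ x ∈ tsupport χ, x 0 ≤ R)
    (f : 𝓢(Cfg 2, ℂ)) :
    a (tensorLeft (schwartzMul (tensor 2 ![χ, χ]) f) (tensor 2 ![g, g])) =
      P.commForm (tensor 2 ![g, g]) (schwartzMul (tensor 2 ![χ, χ]) f) -
      2 * P.midForm (schwartzMul (tensor 2 ![χ, χ]) f) (tensor 1 ![g]) (tensor 1 ![g]) +
      2 * P.leftForm (schwartzMul (tensor 2 ![χ, χ]) f) (tensor 1 ![g]) (tensor 1 ![g]) := by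
  obtain ⟨D₁, h1⟩ := P.exists_clm_commForm (tensor 2 ![g, g])
  obtain ⟨D₂, h2⟩ := P.exists_clm_midForm (tensor 1 ![g]) (tensor 1 ![g])
  obtain ⟨D₃, h3⟩ := P.exists_clm_leftForm (tensor 1 ![g]) (tensor 1 ![g])
  -- Both sides are continuous in `f`, so products of test functions suffice. For these the vacuum
  -- expectation value is given by `ha`, and the cutoff `χ` confines the fields to times at most
  -- `R`, before the vertices.
  have h := clm_ext_tensor_two
    (D₁ := ((a : 𝓢(Cfg 2 × Cfg 2, ℂ) →L[ℂ] ℂ).comp (tensorRight (tensor 2 ![g, g]))).comp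
      (schwartzMul (tensor 2 ![χ, χ])))
    (D₂ := (D₁ - (2 : ℂ) • D₂ + (2 : ℂ) • D₃).comp (schwartzMul (tensor 2 ![χ, χ]))) fun h => ?_
  · have h4 := DFunLike.congr_fun h f
    change a (tensorRight (tensor 2 ![g, g]) (schwartzMul (tensor 2 ![χ, χ]) f)) = _ at h4
    rw [tensorRight_apply] at h4
    rw [h4, ← h1, ← h2, ← h3]
    rfl
  · change a (tensorRight (tensor 2 ![g, g]) (schwartzMul (tensor 2 ![χ, χ]) (tensor 2 h))) =
      D₁ (schwartzMul (tensor 2 ![χ, χ]) (tensor 2 h)) -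
        2 * D₂ (schwartzMul (tensor 2 ![χ, χ]) (tensor 2 h)) +
        2 * D₃ (schwartzMul (tensor 2 ![χ, χ]) (tensor 2 h))
    have hb : ∀ u : 𝓢(Mink, ℂ), NotBefore (tsupport g) (tsupport (schwartzMul χ u)) := fun u =>
      notBefore_of_time hg fun x hx => hχ x (tsupport_schwartzMul_subset χ u hx)
    rw [tensorRight_apply, schwartzMul_tensor_two, ha,
      P.advanced_of_notBefore vertex phi (hb (h 0)) (hb (h 1)), h1, h2, h3]
    refine (innerLin_apply _ _).symm.trans ?_
    simp only [LinearMap.add_apply, LinearMap.sub_apply, LinearMap.smul_apply, Module.End.mul_apply,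
      map_add, map_sub, map_smul, smul_eq_mul]
    rfl

/-- The retarded product for early arguments of the vertices. -/
lemma retVEV_eq {r : 𝓢'(Cfg 2 × Cfg 2, ℂ)} (hr : P.IsRetVEV ![vertex, vertex] ![phi, phi] r)
    {g χ : 𝓢(Mink, ℂ)} {R : ℝ} (hg : ∀ y ∈ tsupport g, y 0 ≤ R) (hχ : ∀ x ∈ tsupport χ, R < x 0)
    (f : 𝓢(Cfg 2, ℂ)) :
    r (tensorLeft (schwartzMul (tensor 2 ![χ, χ]) f) (tensor 2 ![g, g])) =
      -P.commForm (tensor 2 ![g, g]) (schwartzMul (tensor 2 ![χ, χ]) f) -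
      2 * P.midForm (schwartzMul (tensor 2 ![χ, χ]) f) (tensor 1 ![g]) (tensor 1 ![g]) +
      2 * P.rightForm (schwartzMul (tensor 2 ![χ, χ]) f) (tensor 1 ![g]) (tensor 1 ![g]) := by
  obtain ⟨D₁, h1⟩ := P.exists_clm_commForm (tensor 2 ![g, g])
  obtain ⟨D₂, h2⟩ := P.exists_clm_midForm (tensor 1 ![g]) (tensor 1 ![g])
  obtain ⟨D₃, h3⟩ := P.exists_clm_rightForm (tensor 1 ![g]) (tensor 1 ![g])
  have h := clm_ext_tensor_two
    (D₁ := ((r : 𝓢(Cfg 2 × Cfg 2, ℂ) →L[ℂ] ℂ).comp (tensorRight (tensor 2 ![g, g]))).comp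
      (schwartzMul (tensor 2 ![χ, χ])))
    (D₂ := (-D₁ - (2 : ℂ) • D₂ + (2 : ℂ) • D₃).comp (schwartzMul (tensor 2 ![χ, χ]))) fun h => ?_
  · have h4 := DFunLike.congr_fun h f
    change r (tensorRight (tensor 2 ![g, g]) (schwartzMul (tensor 2 ![χ, χ]) f)) = _ at h4
    rw [tensorRight_apply] at h4
    rw [h4, ← h1, ← h2, ← h3]
    rfl
  · change r (tensorRight (tensor 2 ![g, g]) (schwartzMul (tensor 2 ![χ, χ]) (tensor 2 h))) =
      -D₁ (schwartzMul (tensor 2 ![χ, χ]) (tensor 2 h)) -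
        2 * D₂ (schwartzMul (tensor 2 ![χ, χ]) (tensor 2 h)) +
        2 * D₃ (schwartzMul (tensor 2 ![χ, χ]) (tensor 2 h))
    have hb : ∀ u : 𝓢(Mink, ℂ), NotBefore (tsupport (schwartzMul χ u)) (tsupport g) := fun u =>
      notBefore_of_time (fun x hx => hχ x (tsupport_schwartzMul_subset χ u hx)) hg
    rw [tensorRight_apply, schwartzMul_tensor_two, hr,
      P.retarded_of_notBefore vertex phi (hb (h 0)) (hb (h 1)), h1, h2, h3, commForm, neg_sub]
    refine (innerLin_apply _ _).symm.trans ?_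
    simp only [LinearMap.add_apply, LinearMap.sub_apply, LinearMap.smul_apply, Module.End.mul_apply,
      map_add, map_sub, map_smul, smul_eq_mul]
    rfl

end TimeOrdered
end EG
end

/-! ### Scaling limits below the mass threshold and removal of cutoffs -/

noncomputable section
namespace EG

lemma exists_inverse_fourierM (n : ℕ) : ∃ R : 𝓢(Cfg n, ℂ) →L[ℂ] 𝓢(Cfg n, ℂ),
    (∀ f, fourierM n (R f) = f) ∧ ∀ f, R (fourierM n f) = f := by
  refine ⟨(FourierTransform.fourierInvCLM ℂ 𝓢(Cfg n, ℂ)).comp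
    (SchwartzMap.compCLMOfContinuousLinearEquiv ℂ (fourierScale n).symm), fun f => ?_, fun f => ?_⟩
  · change fourierM n (FourierTransformInv.fourierInv
      (SchwartzMap.compCLMOfContinuousLinearEquiv ℂ (fourierScale n).symm f)) = f
    simp only [fourierM, ContinuousLinearMap.comp_apply, SchwartzMap.fourierTransformCLM_apply,
      FourierTransform.fourier_fourierInv_eq]
    ext x
    simp
  · change FourierTransformInv.fourierInv (SchwartzMap.compCLMOfContinuousLinearEquiv ℂ
      (fourierScale n).symm (SchwartzMap.compCLMOfContinuousLinearEquiv ℂ (fourierScale n)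
        (FourierTransform.fourier f))) = f
    have : SchwartzMap.compCLMOfContinuousLinearEquiv ℂ
      (fourierScale n).symm (SchwartzMap.compCLMOfContinuousLinearEquiv ℂ (fourierScale n)
        (FourierTransform.fourier f)) = FourierTransform.fourier f := by
      ext x
      simp
    rw [this, FourierTransform.fourierInv_fourier_eq]

lemma fourierM_scaleArg {n : ℕ} {ε : ℝ} (hε : 0 < ε) (g : 𝓢(Cfg n, ℂ)) (q : Cfg n) :
    fourierM n (scaleArg ε g) q = ((ε : ℂ) ^ (4 * n))⁻¹ * fourierM n g (ε⁻¹ • q) := by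
  have h : scaleArg ε g = ((ε : ℂ) ^ (4 * n))⁻¹ • dilate ε⁻¹ g := by
    ext x
    change _ = ((ε : ℂ) ^ (4 * n))⁻¹ * dilate ε⁻¹ g x
    rw [scaleArg_apply hε.ne', dilate_apply (inv_ne_zero hε.ne'), inv_inv]
    have : (ε : ℂ) ≠ 0 := by exact_mod_cast hε.ne'
    push_cast
    rw [inv_pow, inv_inv, inv_mul_cancel_left₀ (pow_ne_zero _ this)]
  rw [h, map_smul, fourierM_dilate (inv_pos.2 hε)]
  change _ * scaleArg ε⁻¹ (fourierM n g) q = _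
  rw [scaleArg_apply (inv_ne_zero hε.ne')]

/-- Bilinear forms which do not see second arguments with momenta above a threshold. -/
lemma tendsto_bilinear_scaleArg {m : ℝ} (hm : 0 < m) {B : ℕ → 𝓢(Cfg 1, ℂ) → 𝓢(Cfg 1, ℂ) → ℂ}
    (h1 : ∀ i g, ∃ D : 𝓢(Cfg 1, ℂ) →L[ℂ] ℂ, ∀ f, D f = B i f g)
    (h2 : ∀ i f, ∃ D : 𝓢(Cfg 1, ℂ) →L[ℂ] ℂ, ∀ g, D g = B i f g)
    (hb : ∀ f g, ∃ C, ∀ i, ‖B i f g‖ ≤ C)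
    (hv : ∀ i f g, (∀ q, m ≤ ‖q‖ → fourierM 1 g q = 0) → B i f g = 0)
    {ε : ℕ → ℝ} (hε0 : ∀ i, 0 < ε i) (hε1 : ∀ i, ε i ≤ 1) (hε : Tendsto ε atTop (𝓝 0))
    (g : 𝓢(Cfg 1, ℂ)) :
    Tendsto (fun i => B i (scaleArg (ε i) g) (scaleArg (ε i) g)) atTop (𝓝 0) := by
  obtain ⟨N, C, hC, hB⟩ := exists_uniform_bound_bilinear B h1 h2 hb
  obtain ⟨R, hR, hR'⟩ := exists_inverse_fourierM 1
  obtain ⟨N', C', hC', hRb⟩ := exists_bound_map R N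
  obtain ⟨K, hK, hcut⟩ := exists_bound_cutoff (bump (Cfg 1)) (fun x hx => bump_eq_one hx) N'
  obtain ⟨w, hw⟩ : ∃ w, R w = g := ⟨_, hR' g⟩
  set A : ℝ := C * schwartzNorm N g * (C' * (K * (2 / m) ^ (2 * N + 1) *
    schwartzNorm (N' + (2 * N + 1)) w)) with hA
  have hlim : Tendsto (fun i => A * ε i) atTop (𝓝 0) := by simpa using hε.const_mul A
  refine squeeze_zero_norm' ?_ hlim
  have hsmall : ∀ᶠ i in atTop, ε i ≤ m / 2 := hε.eventually_le_const (by positivity)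
  filter_upwards [hsmall] with i hi
  have he := hε0 i
  -- The momentum cutoff `bump(η q)` vanishes for `‖q‖ ≥ 2/η = m/ε`. After the dilation by `ε` the
  -- cut-off part therefore has no momenta of norm `m` or more, and the form vanishes on it.
  set η : ℝ := 2 * ε i / m with hη
  have hη0 : 0 < η := by positivity
  have hη1 : η ≤ 1 := by
    rw [hη, div_le_one hm]
    linarith
  set ρ := schwartzMul (scaleArg η (bump (Cfg 1))) w with hρ
  obtain ⟨D, hD⟩ := h2 i (scaleArg (ε i) g)
  have hz : B i (scaleArg (ε i) g) (scaleArg (ε i) (R ρ)) = 0 := by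
    refine hv i _ _ fun q hq => ?_
    rw [fourierM_scaleArg he, hR, hρ, schwartzMul_apply, scaleArg_apply hη0.ne', bump_eq_zero,
      zero_mul, mul_zero]
    rw [norm_smul, norm_smul, norm_inv, Real.norm_of_nonneg hη0.le, Real.norm_of_nonneg he.le, hη]
    have : 2 * ε i / m * ((ε i)⁻¹ * ‖q‖) = 2 * (‖q‖ / m) := by
      field_simp
    rw [this]
    have := (one_le_div hm).2 hq
    linarith
  have heq : B i (scaleArg (ε i) g) (scaleArg (ε i) g) =
      B i (scaleArg (ε i) g) (scaleArg (ε i) (R (w - ρ))) := by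
    rw [← hD (scaleArg (ε i) (R (w - ρ))), map_sub, map_sub, map_sub, hD, hD, hz, sub_zero, hw]
  rw [heq]
  have e1 := schwartzNorm_scaleArg_le he (hε1 i) N g
  have e2 := schwartzNorm_scaleArg_le he (hε1 i) N (R (w - ρ))
  have e3 := hRb (w - ρ)
  -- The rest has momenta of order `ε⁻¹` and is small to any order. The power `2N + 1` beats the
  -- loss `ε⁻²ᴺ` of the two dilations and leaves one factor `ε`.
  have e4 := hcut (2 * N + 1) η hη0 hη1 w
  have p1 := apply_nonneg (schwartzNorm N) g
  have p2 := apply_nonneg (schwartzNorm (N' + (2 * N + 1))) w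
  have e5 : schwartzNorm N (scaleArg (ε i) (R (w - ρ))) ≤ (ε i)⁻¹ ^ N * (C' * (K * η ^ (2 * N + 1) *
      schwartzNorm (N' + (2 * N + 1)) w)) :=
    e2.trans (mul_le_mul_of_nonneg_left (e3.trans (mul_le_mul_of_nonneg_left e4 hC'))
      (by positivity))
  calc _ ≤ C * schwartzNorm N (scaleArg (ε i) g) * schwartzNorm N (scaleArg (ε i) (R (w - ρ))) :=
        hB _ _ _
    _ ≤ C * ((ε i)⁻¹ ^ N * schwartzNorm N g) * ((ε i)⁻¹ ^ N * (C' * (K * η ^ (2 * N + 1) *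
          schwartzNorm (N' + (2 * N + 1)) w))) :=
        mul_le_mul (mul_le_mul_of_nonneg_left e1 hC) e5 (apply_nonneg _ _) (by positivity)
    _ = A * ε i := by
        have h3 : η = (2 / m) * ε i := by
          rw [hη]
          ring
        rw [hA, h3, mul_pow, pow_succ (ε i), two_mul, pow_add (ε i), inv_pow]
        have : ε i ^ N ≠ 0 := (pow_pos he N).ne'
        field_simp

lemma exists_bound_tensorLeft {V W : Type*} [NormedAddCommGroup V] [NormedSpace ℝ V]
    [NormedAddCommGroup W] [NormedSpace ℝ W] (N : ℕ) : ∃ C : ℝ, 0 ≤ C ∧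
      ∀ (f : 𝓢(W, ℂ)) (g : 𝓢(V, ℂ)),
        schwartzNorm N (tensorLeft f g) ≤ C * schwartzNorm N f * schwartzNorm N g := by
  refine ⟨2 ^ N * (2 ^ N * 2 ^ N), by positivity, fun f g => ?_⟩
  have p1 := apply_nonneg (schwartzNorm N) f
  have p2 := apply_nonneg (schwartzNorm N) g
  refine schwartzNorm_le' (by positivity) fun k hk n hn x => ?_
  have h1 : ((Finset.Iic (k, n)).sup (schwartzSeminormFamily ℂ W ℂ)) f ≤ schwartzNorm N f :=
    (Finset.sup_mono (Finset.Iic_subset_Iic.2 (Prod.mk_le_mk.2 ⟨hk, hn⟩)) :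
      (Finset.Iic (k, n)).sup (schwartzSeminormFamily ℂ W ℂ) ≤ schwartzNorm N) f
  have h2 : ((Finset.Iic (k, n)).sup (schwartzSeminormFamily ℂ V ℂ)) g ≤ schwartzNorm N g :=
    (Finset.sup_mono (Finset.Iic_subset_Iic.2 (Prod.mk_le_mk.2 ⟨hk, hn⟩)) :
      (Finset.Iic (k, n)).sup (schwartzSeminormFamily ℂ V ℂ) ≤ schwartzNorm N) g
  have h3 : (2 : ℝ) ^ k ≤ 2 ^ N := pow_le_pow_right₀ one_le_two hk
  have h4 : (2 : ℝ) ^ n ≤ 2 ^ N := pow_le_pow_right₀ one_le_two hn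
  refine (tensor_bound f k n g x).trans ?_
  calc _ ≤ (2 ^ N * (2 ^ N * (2 ^ N * schwartzNorm N f))) * schwartzNorm N g := by gcongr
    _ = _ := by ring

/-- The cutoff functions `χ(δ x₁) χ(δ x₂)`. -/
def pairCutoff (δ : ℝ) : 𝓢(Cfg 2, ℂ) := tensor 2 ![scaleArg δ (bump Mink), scaleArg δ (bump Mink)]

lemma scaleArg_tensor_two {ε : ℝ} (hε : ε ≠ 0) (g h : 𝓢(Mink, ℂ)) :
    scaleArg ε (tensor 2 ![g, h]) = tensor 2 ![scaleArg ε g, scaleArg ε h] := by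
  ext x
  rw [scaleArg_apply hε, tensor_two_apply, tensor_two_apply, scaleArg_apply hε, scaleArg_apply hε]
  rfl

lemma scaleArg_tensor_one {ε : ℝ} (hε : ε ≠ 0) (g : 𝓢(Mink, ℂ)) :
    scaleArg ε (tensor 1 ![g]) = tensor 1 ![scaleArg ε g] := by
  ext x
  rw [scaleArg_apply hε, tensor_apply, tensor_apply, Fin.prod_univ_one, Fin.prod_univ_one]
  exact (scaleArg_apply hε g (pt x 0)).symm

lemma norm_pt_le {n : ℕ} (x : Cfg n) (j : Fin n) : ‖pt x j‖ ≤ ‖x‖ := by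
  rw [EuclideanSpace.norm_eq, EuclideanSpace.norm_eq]
  refine Real.sqrt_le_sqrt ?_
  rw [Fintype.sum_prod_type]
  exact Finset.single_le_sum (f := fun i => ∑ μ, ‖x (i, μ)‖ ^ 2)
    (fun i _ => Finset.sum_nonneg fun μ _ => by positivity) (Finset.mem_univ j)

lemma exists_bound_pairCutoff (N : ℕ) : ∃ C, 0 ≤ C ∧ ∀ (M : ℕ) (δ : ℝ), 0 < δ → δ ≤ 1 →
    ∀ f : 𝓢(Cfg 2, ℂ), schwartzNorm N (f - schwartzMul (pairCutoff δ) f) ≤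
      C * δ ^ M * schwartzNorm (N + M) f := by
  obtain ⟨C, hC, h⟩ := exists_bound_cutoff (tensor 2 ![bump Mink, bump Mink]) (fun x hx => by
    rw [tensor_two_apply, bump_eq_one ((norm_pt_le x 0).trans_lt hx),
      bump_eq_one ((norm_pt_le x 1).trans_lt hx), mul_one]) N
  refine ⟨C, hC, fun M δ h0 h1 f => ?_⟩
  have := h M δ h0 h1 f
  rwa [scaleArg_tensor_two h0.ne'] at this

lemma tendsto_schwartzMul_pairCutoff {δ : ℕ → ℝ} (h0 : ∀ i, 0 < δ i) (h1 : ∀ i, δ i ≤ 1)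
    (hδ : Tendsto δ atTop (𝓝 0)) (f : 𝓢(Cfg 2, ℂ)) :
    Tendsto (fun i => schwartzMul (pairCutoff (δ i)) f) atTop (𝓝 f) := by
  refine tendsto_schwartz_iff.2 fun N => ?_
  obtain ⟨C, hC, h⟩ := exists_bound_pairCutoff N
  refine squeeze_zero (fun i => apply_nonneg _ _)
    (g := fun i => C * δ i ^ 1 * schwartzNorm (N + 1) f) (fun i => ?_) ?_
  · rw [← neg_sub, map_neg_eq_map]
    exact h 1 _ (h0 i) (h1 i) f
  · have := ((hδ.pow 1).const_mul C).mul_const (schwartzNorm (N + 1) f)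
    simpa using this

/-- The cutoff on the fields may be removed after the rescaling of the other arguments. -/
lemma tendsto_tensorLeft_cutoff (a : 𝓢(Cfg 2 × Cfg 2, ℂ) →L[ℂ] ℂ) {δ : ℕ → ℝ} (h0 : ∀ i, 0 < δ i)
    (h1 : ∀ i, δ i ≤ 1) (hδ : Tendsto δ atTop (𝓝 0)) (f u : 𝓢(Cfg 2, ℂ)) :
    Tendsto (fun i => a (tensorLeft (f - schwartzMul (pairCutoff (δ i)) f)
      (scaleArg (δ i ^ 2) u))) atTop (𝓝 0) := by
  obtain ⟨N, C, hC, ha⟩ := exists_bound_clm a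
  obtain ⟨C', hC', ht⟩ := exists_bound_tensorLeft (V := Cfg 2) (W := Cfg 2) N
  obtain ⟨K, hK, hcut⟩ := exists_bound_pairCutoff N
  set A : ℝ := C * (C' * (K * schwartzNorm (N + (2 * N + 1)) f) * schwartzNorm N u) with hA
  have hlim : Tendsto (fun i => A * δ i) atTop (𝓝 0) := by simpa using hδ.const_mul A
  refine squeeze_zero_norm (fun i => ?_) hlim
  have he := h0 i
  have e1 := schwartzNorm_scaleArg_le (pow_pos he 2) (pow_le_one₀ he.le (h1 i)) N u
  -- The dilation by `δ²` costs `δ⁻²ᴺ`, so the error of the cutoff is taken to order `2N + 1` and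
  -- one factor `δ` remains.
  have e2 := hcut (2 * N + 1) (δ i) he (h1 i) f
  have p1 := apply_nonneg (schwartzNorm N) u
  have p2 := apply_nonneg (schwartzNorm (N + (2 * N + 1))) f
  calc _ ≤ C * (C' * schwartzNorm N (f - schwartzMul (pairCutoff (δ i)) f) *
          schwartzNorm N (scaleArg (δ i ^ 2) u)) :=
        (ha _).trans (mul_le_mul_of_nonneg_left (ht _ _) hC)
    _ ≤ C * (C' * (K * δ i ^ (2 * N + 1) * schwartzNorm (N + (2 * N + 1)) f) *
          ((δ i ^ 2)⁻¹ ^ N * schwartzNorm N u)) := by gcongr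
    _ = A * δ i := by
        rw [hA, pow_succ (δ i), pow_mul (δ i), inv_pow]
        have : (δ i ^ 2) ^ N ≠ 0 := (pow_pos (pow_pos he 2) N).ne'
        field_simp

lemma tsupport_scaleArg_subset {E : Type*} [NormedAddCommGroup E] [NormedSpace ℝ E] {ε : ℝ}
    (hε : ε ≠ 0) (g : 𝓢(E, ℂ)) {x : E} (hx : x ∈ tsupport (scaleArg ε g)) :
    ε • x ∈ tsupport g := by
  have h : (scaleArg ε g : E → ℂ) = (g : E → ℂ) ∘ fun x => ε • x :=
    funext fun x => scaleArg_apply hε g x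
  rw [h] at hx
  exact tsupport_comp_subset_preimage _ (continuous_const_smul ε) hx

lemma norm_le_of_mem_tsupport_bump {x : Mink} (hx : x ∈ tsupport (bump Mink)) : ‖x‖ ≤ 2 := by
  have h : tsupport (bump Mink) ⊆ Metric.closedBall 0 2 := by
    refine closure_minimal (fun y hy => ?_) Metric.isClosed_closedBall
    by_contra hcon
    rw [mem_closedBall_zero_iff, not_le] at hcon
    exact hy (bump_eq_zero hcon.le)
  exact mem_closedBall_zero_iff.1 (h hx)

lemma abs_time_le_norm (x : Mink) : |x 0| ≤ ‖x‖ := PiLp.norm_apply_le x 0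

/-! ### Existence of the value forces the commutator to vanish in the limit -/

namespace TimeOrdered

variable {m : ℝ} {ce : ℕ} (P : TimeOrdered m ce)

lemma bounded_of_clm {D : 𝓢(Cfg 2, ℂ) →L[ℂ] ℂ} {F : ℕ → 𝓢(Cfg 2, ℂ)} {f : 𝓢(Cfg 2, ℂ)}
    (hF : Tendsto F atTop (𝓝 f)) : ∃ C, ∀ i, ‖D (F i)‖ ≤ C := by
  have h : Tendsto (fun i => D (F i)) atTop (𝓝 (D f)) := (D.continuous.tendsto f).comp hF
  obtain ⟨C, hC⟩ := (Metric.isBounded_range_of_tendsto _ h).exists_norm_le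
  exact ⟨C, fun i => hC _ ⟨i, rfl⟩⟩

lemma vertexOp_vac_eq_zero {g : 𝓢(Cfg 1, ℂ)} (hg : ∀ q, m ≤ ‖q‖ → fourierM 1 g q = 0) :
    P.vertexOp g (vac m) = 0 :=
  eq_zero_of_innerLin_self (P.innerLin_vertexOp_vac_eq_zero hg _)

/-- The vector `L(g)Ω` is zero if `g` has only momenta below the threshold. Convergence of `F i`
makes the forms pointwise bounded, which is the uniformity required. -/
lemma tendsto_midForm (hm : 0 < m) {F : ℕ → 𝓢(Cfg 2, ℂ)} {f : 𝓢(Cfg 2, ℂ)}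
    (hF : Tendsto F atTop (𝓝 f)) {ε : ℕ → ℝ} (hε0 : ∀ i, 0 < ε i) (hε1 : ∀ i, ε i ≤ 1)
    (hε : Tendsto ε atTop (𝓝 0)) (g : 𝓢(Cfg 1, ℂ)) :
    Tendsto (fun i => P.midForm (F i) (scaleArg (ε i) g) (scaleArg (ε i) g)) atTop (𝓝 0) := by
  refine tendsto_bilinear_scaleArg hm (B := fun i => P.midForm (F i))
    (fun i => P.exists_clm_midForm_left _) (fun i => P.exists_clm_midForm_right _)
    (fun g₁ g₂ => ?_) (fun i g₁ g₂ h => ?_) hε0 hε1 hε g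
  · obtain ⟨D, hD⟩ := P.exists_clm_midForm g₁ g₂
    simp only [← hD]
    exact bounded_of_clm hF
  · simp [midForm, P.vertexOp_vac_eq_zero h]

lemma tendsto_leftForm (hm : 0 < m) {F : ℕ → 𝓢(Cfg 2, ℂ)} {f : 𝓢(Cfg 2, ℂ)}
    (hF : Tendsto F atTop (𝓝 f)) {ε : ℕ → ℝ} (hε0 : ∀ i, 0 < ε i) (hε1 : ∀ i, ε i ≤ 1)
    (hε : Tendsto ε atTop (𝓝 0)) (g : 𝓢(Cfg 1, ℂ)) :
    Tendsto (fun i => P.leftForm (F i) (scaleArg (ε i) g) (scaleArg (ε i) g)) atTop (𝓝 0) := by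
  refine tendsto_bilinear_scaleArg hm (B := fun i => P.leftForm (F i))
    (fun i => P.exists_clm_leftForm_left _) (fun i => P.exists_clm_leftForm_right _)
    (fun g₁ g₂ => ?_) (fun i g₁ g₂ h => ?_) hε0 hε1 hε g
  · obtain ⟨D, hD⟩ := P.exists_clm_leftForm g₁ g₂
    simp only [← hD]
    exact bounded_of_clm hF
  · simp [leftForm, P.vertexOp_vac_eq_zero h]

/-- Here the threshold acts through `(Ω|L(g)`, that is, on the first vertex; the arguments are
exchanged accordingly. -/
lemma tendsto_rightForm (hm : 0 < m) {F : ℕ → 𝓢(Cfg 2, ℂ)} {f : 𝓢(Cfg 2, ℂ)}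
    (hF : Tendsto F atTop (𝓝 f)) {ε : ℕ → ℝ} (hε0 : ∀ i, 0 < ε i) (hε1 : ∀ i, ε i ≤ 1)
    (hε : Tendsto ε atTop (𝓝 0)) (g : 𝓢(Cfg 1, ℂ)) :
    Tendsto (fun i => P.rightForm (F i) (scaleArg (ε i) g) (scaleArg (ε i) g)) atTop (𝓝 0) := by
  refine tendsto_bilinear_scaleArg hm (B := fun i g₁ g₂ => P.rightForm (F i) g₂ g₁)
    (fun i => P.exists_clm_rightForm_right _) (fun i => P.exists_clm_rightForm_left _)
    (fun g₁ g₂ => ?_) (fun i g₁ g₂ h => ?_) hε0 hε1 hε g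
  · obtain ⟨D, hD⟩ := P.exists_clm_rightForm g₂ g₁
    simp only [← hD]
    exact bounded_of_clm hF
  · exact P.innerLin_vac_vertexOp_eq_zero h _

/-- The scales of the cutoff on the fields. -/
def cutScale (n : ℕ) : ℝ := 1 / ((n : ℝ) + 1)

lemma cutScale_pos (n : ℕ) : 0 < cutScale n := Nat.one_div_pos_of_nat

lemma cutScale_le_one (n : ℕ) : cutScale n ≤ 1 := by
  rw [cutScale, div_le_one (by positivity)]
  linarith [Nat.cast_nonneg (α := ℝ) n]

lemma tendsto_cutScale : Tendsto cutScale atTop (𝓝 0) := tendsto_one_div_add_atTop_nhds_zero_nat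

lemma tendsto_cutScale_sq : Tendsto (fun n => cutScale n ^ 2) atTop (𝓝 0) := by
  simpa using tendsto_cutScale.pow 2

/-- The existence of the value at zero implies that the smeared product tends to zero. -/
lemma tendsto_of_value {a : 𝓢'(Cfg 2 × Cfg 2, ℂ)} {f : 𝓢(Cfg 2, ℂ)}
    (hv : ∃ v : ℂ, HasLojasiewiczValue (fourierDist (smearRight a f)) v) {u : 𝓢(Cfg 2, ℂ)}
    (hu : u 0 = 0) :
    Tendsto (fun n => a (tensorLeft (schwartzMul (pairCutoff (cutScale n)) f)
      (scaleArg (cutScale n ^ 2) u))) atTop (𝓝 0) := by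
  obtain ⟨v, hv⟩ := hv
  have h1 := (hv.tendsto_scaleArg u).comp (tendsto_nhdsWithin_iff.2
    ⟨tendsto_cutScale_sq, Eventually.of_forall fun n => pow_pos (cutScale_pos n) 2⟩)
  -- Since `u` vanishes at the origin, the limit is zero whatever the value `v` is.
  rw [hu, mul_zero] at h1
  have h2 := tendsto_tensorLeft_cutoff a cutScale_pos cutScale_le_one tendsto_cutScale f u
  have h3 := h1.sub h2
  rw [sub_zero] at h3
  refine h3.congr fun n => ?_
  have h4 : smearRight a f (scaleArg (cutScale n ^ 2) u) =
      a (tensorRight (scaleArg (cutScale n ^ 2) u) f) := by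
    rw [tensorRight_apply]
    rfl
  have h5 : a (tensorRight (scaleArg (cutScale n ^ 2) u) f) -
      a (tensorRight (scaleArg (cutScale n ^ 2) u)
        (f - schwartzMul (pairCutoff (cutScale n)) f)) =
      a (tensorRight (scaleArg (cutScale n ^ 2) u)
        (schwartzMul (pairCutoff (cutScale n)) f)) := by
    rw [map_sub, map_sub, sub_sub_cancel]
  rw [tensorRight_apply, tensorRight_apply, tensorRight_apply, ← tensorRight_apply, ← h4] at h5
  exact h5

/-- This is the reason for the two scales: the vertices move away like `δ⁻²`, the fields are
confined to times of order `δ⁻¹`, and causality applies for small `δ`. -/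
lemma eventually_time_lt {δ₀ : ℝ} (h0 : 0 < δ₀) :
    ∀ᶠ n in atTop, 2 / cutScale n < δ₀ / cutScale n ^ 2 := by
  filter_upwards [tendsto_cutScale.eventually_lt_const (by positivity : 0 < δ₀ / 2)] with n hn
  have := cutScale_pos n
  rw [div_lt_div_iff₀ this (pow_pos this 2)]
  nlinarith

lemma time_le_of_mem_tsupport {ε δ₀ : ℝ} (hε : 0 < ε) {g : 𝓢(Mink, ℂ)}
    (hg : ∀ y ∈ tsupport g, δ₀ ≤ y 0) {y : Mink} (hy : y ∈ tsupport (scaleArg ε g)) :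
    δ₀ / ε ≤ y 0 := by
  have := hg _ (tsupport_scaleArg_subset hε.ne' g hy)
  rw [div_le_iff₀ hε, mul_comm]
  exact this

lemma le_time_of_mem_tsupport {ε δ₀ : ℝ} (hε : 0 < ε) {g : 𝓢(Mink, ℂ)}
    (hg : ∀ y ∈ tsupport g, y 0 ≤ δ₀) {y : Mink} (hy : y ∈ tsupport (scaleArg ε g)) :
    y 0 ≤ δ₀ / ε := by
  have := hg _ (tsupport_scaleArg_subset hε.ne' g hy)
  rw [le_div_iff₀ hε, mul_comm]
  exact this

lemma abs_time_le_of_mem_tsupport_bump {δ : ℝ} (hδ : 0 < δ) {x : Mink}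
    (hx : x ∈ tsupport (scaleArg δ (bump Mink))) : |x 0| ≤ 2 / δ := by
  have h := norm_le_of_mem_tsupport_bump (tsupport_scaleArg_subset hδ.ne' _ hx)
  rw [norm_smul, Real.norm_of_nonneg hδ.le] at h
  rw [le_div_iff₀ hδ, mul_comm]
  exact (mul_le_mul_of_nonneg_left (abs_time_le_norm x) hδ.le).trans h

/-- If the value of the advanced product exists, the commutator tends to zero. -/
lemma tendsto_commForm_of_adv (hm : 0 < m) {a : 𝓢'(Cfg 2 × Cfg 2, ℂ)}
    (ha : P.IsAdvVEV ![vertex, vertex] ![phi, phi] a) {f : 𝓢(Cfg 2, ℂ)}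
    (hv : ∃ v : ℂ, HasLojasiewiczValue (fourierDist (smearRight a f)) v) {g : 𝓢(Mink, ℂ)} {δ₀ : ℝ}
    (h0 : 0 < δ₀) (hg : ∀ y ∈ tsupport g, δ₀ ≤ y 0) :
    Tendsto (fun n => P.commForm (scaleArg (cutScale n ^ 2) (tensor 2 ![g, g]))
      (schwartzMul (pairCutoff (cutScale n)) f)) atTop (𝓝 0) := by
  have hF := tendsto_schwartzMul_pairCutoff cutScale_pos cutScale_le_one tendsto_cutScale f
  have hε0 : ∀ n, 0 < cutScale n ^ 2 := fun n => pow_pos (cutScale_pos n) 2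
  have hε1 : ∀ n, cutScale n ^ 2 ≤ 1 := fun n => pow_le_one₀ (cutScale_pos n).le (cutScale_le_one n)
  have h1 := P.tendsto_midForm hm hF hε0 hε1 tendsto_cutScale_sq (tensor 1 ![g])
  have h2 := P.tendsto_leftForm hm hF hε0 hε1 tendsto_cutScale_sq (tensor 1 ![g])
  have hg0 : g 0 = 0 := by
    refine image_eq_zero_of_notMem_tsupport fun h => ?_
    have := hg 0 h
    simp only [PiLp.zero_apply] at this
    linarith
  have h3 := tendsto_of_value hv (u := tensor 2 ![g, g]) (by
    rw [tensor_two_apply]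
    have : pt (0 : Cfg 2) 0 = 0 := rfl
    rw [this, hg0, zero_mul])
  have h4 := (h3.add (h1.const_mul 2)).sub (h2.const_mul 2)
  rw [mul_zero, add_zero, sub_zero] at h4
  refine h4.congr' ?_
  filter_upwards [eventually_time_lt h0] with n hn
  have key := P.advVEV_eq ha (g := scaleArg (cutScale n ^ 2) g)
    (χ := scaleArg (cutScale n) (bump Mink)) (R := 2 / cutScale n)
    (fun y hy => hn.trans_le (time_le_of_mem_tsupport (hε0 n) hg hy))
    (fun x hx => (le_abs_self _).trans (abs_time_le_of_mem_tsupport_bump (cutScale_pos n) hx)) f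
  rw [scaleArg_tensor_two (hε0 n).ne', scaleArg_tensor_one (hε0 n).ne', pairCutoff, key]
  ring

/-- If the value of the retarded product exists, the commutator tends to zero. -/
lemma tendsto_commForm_of_ret (hm : 0 < m) {r : 𝓢'(Cfg 2 × Cfg 2, ℂ)}
    (hr : P.IsRetVEV ![vertex, vertex] ![phi, phi] r) {f : 𝓢(Cfg 2, ℂ)}
    (hv : ∃ v : ℂ, HasLojasiewiczValue (fourierDist (smearRight r f)) v) {g : 𝓢(Mink, ℂ)} {δ₀ : ℝ}
    (h0 : 0 < δ₀) (hg : ∀ y ∈ tsupport g, y 0 ≤ -δ₀) :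
    Tendsto (fun n => P.commForm (scaleArg (cutScale n ^ 2) (tensor 2 ![g, g]))
      (schwartzMul (pairCutoff (cutScale n)) f)) atTop (𝓝 0) := by
  have hF := tendsto_schwartzMul_pairCutoff cutScale_pos cutScale_le_one tendsto_cutScale f
  have hε0 : ∀ n, 0 < cutScale n ^ 2 := fun n => pow_pos (cutScale_pos n) 2
  have hε1 : ∀ n, cutScale n ^ 2 ≤ 1 := fun n => pow_le_one₀ (cutScale_pos n).le (cutScale_le_one n)
  have h1 := P.tendsto_midForm hm hF hε0 hε1 tendsto_cutScale_sq (tensor 1 ![g])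
  have h2 := P.tendsto_rightForm hm hF hε0 hε1 tendsto_cutScale_sq (tensor 1 ![g])
  have hg0 : g 0 = 0 := by
    refine image_eq_zero_of_notMem_tsupport fun h => ?_
    have := hg 0 h
    simp only [PiLp.zero_apply] at this
    linarith
  have h3 := tendsto_of_value hv (u := tensor 2 ![g, g]) (by
    rw [tensor_two_apply]
    have : pt (0 : Cfg 2) 0 = 0 := rfl
    rw [this, hg0, zero_mul])
  have h4 := ((h2.const_mul 2).sub (h1.const_mul 2)).sub h3
  simp only [mul_zero, sub_zero] at h4
  refine h4.congr' ?_
  filter_upwards [eventually_time_lt h0] with n hn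
  -- The separating time is the upper end `-δ₀/δ²` of the support of the rescaled `g`, eventually
  -- earlier than `-2/δ`, before which there are no fields.
  have key := P.retVEV_eq hr (g := scaleArg (cutScale n ^ 2) g)
    (χ := scaleArg (cutScale n) (bump Mink)) (R := -δ₀ / cutScale n ^ 2)
    (fun y hy => le_time_of_mem_tsupport (hε0 n) hg hy)
    (fun x hx => by
      have := (abs_le.1 (abs_time_le_of_mem_tsupport_bump (cutScale_pos n) hx)).1
      rw [neg_div]
      linarith) f
  rw [scaleArg_tensor_two (hε0 n).ne', scaleArg_tensor_one (hε0 n).ne', pairCutoff, key]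
  ring

end TimeOrdered
end EG
end

/-! ### Phase space of two massless particles -/

noncomputable section
namespace EG

/-- The weight of the invariant measure on the light cone. -/
def lightWeight (k : Mom) : ℝ := 1 / ((2 * Real.pi) ^ 3 * (2 * ‖k‖))

/-- The labels of two massless particles. -/
def lightPair (p : Mom × Mom) : Fin 2 → OneP := ![(false, p.1), (false, p.2)]

lemma energy_light (m : ℝ) (k : Mom) : energy m (false, k) = ‖k‖ := by
  simp [energy, mass]

lemma shellDensity_light (m : ℝ) (k : Mom) : shellDensity m (false, k) = lightWeight k := by
  rw [shellDensity, energy_light, lightWeight]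

lemma lightWeight_nonneg (k : Mom) : 0 ≤ lightWeight k := by
  unfold lightWeight
  positivity

@[fun_prop]
lemma measurable_lightWeight : Measurable lightWeight := by
  unfold lightWeight
  fun_prop

lemma lightWeight_smul {ε : ℝ} (hε : 0 < ε) (k : Mom) :
    lightWeight (ε • k) = ε⁻¹ * lightWeight k := by
  rw [lightWeight, lightWeight, norm_smul, Real.norm_of_nonneg hε.le]
  by_cases hk : ‖k‖ = 0
  · simp [hk]
  · have := Real.pi_ne_zero
    field_simp

/-- The invariant measure on the light cone. -/
def lightShell : Measure Mom :=
  (volume : Measure Mom).withDensity fun k => ENNReal.ofReal (lightWeight k)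

instance : SigmaFinite lightShell := by
  unfold lightShell
  exact SigmaFinite.withDensity_of_ne_top (Eventually.of_forall fun k => ENNReal.ofReal_ne_top)

lemma shell_restrict_light (m : ℝ) :
    (shell m).restrict ({false} ×ˢ Set.univ) = lightShell.map (Prod.mk false) := by
  have hS : MeasurableSet (({false} : Set Species) ×ˢ (Set.univ : Set Mom)) :=
    (measurableSet_singleton false).prod MeasurableSet.univ
  have he : MeasurableEmbedding (Prod.mk false : Mom → OneP) := measurableEmbedding_prodMk_left false
  have h1 : ((Measure.count : Measure Species).prod (volume : Measure Mom)).restrict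
      ({false} ×ˢ Set.univ) = (volume : Measure Mom).map (Prod.mk false) := by
    rw [← Measure.prod_restrict, Measure.restrict_univ, Measure.restrict_singleton,
      Measure.count_singleton, one_smul, Measure.dirac_prod]
  rw [shell_eq, restrict_withDensity hS, h1, lightShell]
  ext s hs
  rw [withDensity_apply _ hs, he.map_apply, withDensity_apply _ (he.measurable hs),
    he.restrict_map, he.lintegral_map]
  simp only [shellDensity_light]

lemma integral_light_pair (m : ℝ) (F : (Fin 2 → OneP) → ℂ) :
    ∫ κ, speciesInd ![false, false] κ * F κ ∂(shellPi m 2) =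
      ∫ p : Mom × Mom, ((lightWeight p.1 * lightWeight p.2 : ℝ) : ℂ) * F (lightPair p) := by
  set S : Set OneP := {false} ×ˢ Set.univ with hS
  have hSm : MeasurableSet S := (measurableSet_singleton false).prod MeasurableSet.univ
  have h1 := (measurePreserving_finTwoArrow (shell m)).symm.integral_comp
    (MeasurableEquiv.measurableEmbedding _) fun κ => speciesInd ![false, false] κ * F κ
  have h2 : ∀ z : OneP × OneP, speciesInd ![false, false]
      ((MeasurableEquiv.finTwoArrow (α := OneP)).symm z) *
        F ((MeasurableEquiv.finTwoArrow (α := OneP)).symm z) =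
      (S ×ˢ S).indicator (fun z => F ![z.1, z.2]) z := by
    rintro ⟨a, b⟩
    have h3 : (MeasurableEquiv.finTwoArrow (α := OneP)).symm (a, b) = ![a, b] := rfl
    rw [h3]
    by_cases h : (a, b) ∈ S ×ˢ S
    · rw [Set.indicator_of_mem h]
      simp only [hS, Set.mem_prod, Set.mem_singleton_iff, Set.mem_univ, and_true] at h
      simp [speciesInd, Fin.forall_fin_two, h]
    · rw [Set.indicator_of_notMem h]
      simp only [hS, Set.mem_prod, Set.mem_singleton_iff, Set.mem_univ, and_true] at h
      rw [speciesInd, if_neg, zero_mul]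
      simpa [Fin.forall_fin_two] using h
  rw [← h1]
  simp only [h2]
  rw [integral_indicator (hSm.prod hSm), ← Measure.prod_restrict, shell_restrict_light,
    Measure.map_prod_map _ _ (measurable_prodMk_left) (measurable_prodMk_left)]
  have he : MeasurableEmbedding (Prod.mk false : Mom → OneP) := measurableEmbedding_prodMk_left false
  rw [(he.prodMap he).integral_map, lightShell, prod_withDensity
    (by fun_prop) (by fun_prop), integral_withDensity_eq_integral_toReal_smul]
  · refine integral_congr_ae (Eventually.of_forall fun p => ?_)
    simp [lightPair, lightWeight_nonneg]
  · fun_prop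
  · exact Eventually.of_forall fun p => ENNReal.mul_lt_top ENNReal.ofReal_lt_top ENNReal.ofReal_lt_top

/-- The two momentum integrals contribute `ε⁶`, and the two densities, homogeneous of degree `-1`,
take away `ε²`. -/
lemma integral_smul_pair {ε : ℝ} (hε : 0 < ε) (X : Mom × Mom → ℂ) :
    ∫ p : Mom × Mom, ((lightWeight p.1 * lightWeight p.2 : ℝ) : ℂ) * X p =
      (ε : ℂ) ^ 4 * ∫ p : Mom × Mom, ((lightWeight p.1 * lightWeight p.2 : ℝ) : ℂ) * X (ε • p) := by
  have : (volume : Measure (Mom × Mom)).IsAddHaarMeasure := by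
    rw [Measure.volume_eq_prod]
    infer_instance
  have h := Measure.integral_comp_smul (volume : Measure (Mom × Mom))
    (fun p => ((lightWeight p.1 * lightWeight p.2 : ℝ) : ℂ) * X p) ε
  have hfin : Module.finrank ℝ (Mom × Mom) = 6 := by simp
  rw [hfin] at h
  have h2 : ∀ p : Mom × Mom, ((lightWeight (ε • p).1 * lightWeight (ε • p).2 : ℝ) : ℂ) * X (ε • p) =
      ((ε : ℂ) ^ 2)⁻¹ * (((lightWeight p.1 * lightWeight p.2 : ℝ) : ℂ) * X (ε • p)) := by
    intro p
    rw [Prod.smul_fst, Prod.smul_snd, lightWeight_smul hε, lightWeight_smul hε]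
    push_cast
    ring
  simp only [h2] at h
  rw [integral_const_mul, abs_of_pos (by positivity)] at h
  have hε' : (ε : ℂ) ≠ 0 := by exact_mod_cast hε.ne'
  have h3 : ∫ p : Mom × Mom, ((lightWeight p.1 * lightWeight p.2 : ℝ) : ℂ) * X p =
      (ε : ℂ) ^ 6 * (((ε ^ 6)⁻¹ : ℝ) •
        ∫ p : Mom × Mom, ((lightWeight p.1 * lightWeight p.2 : ℝ) : ℂ) * X p) := by
    rw [Complex.real_smul, ← mul_assoc]
    push_cast
    rw [mul_inv_cancel₀ (pow_ne_zero _ hε'), one_mul]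
  rw [h3, ← h, ← mul_assoc]
  congr 1
  field_simp

lemma onShell_light_smul (m : ℝ) {ε : ℝ} (hε : 0 < ε) (k : Mom) :
    onShell m (false, ε • k) = ε • onShell m (false, k) := by
  ext μ
  refine Fin.cases ?_ (fun j => ?_) μ
  · rw [PiLp.smul_apply, onShell_zero, onShell_zero, energy_light, energy_light, norm_smul,
      Real.norm_of_nonneg hε.le, smul_eq_mul]
  · rw [PiLp.smul_apply, onShell_succ, onShell_succ]
    rfl

lemma onShell_lightPair_smul (m : ℝ) {ε : ℝ} (hε : 0 < ε) (p : Mom × Mom) (j : Fin 2) :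
    onShell m (lightPair (ε • p) j) = ε • onShell m (lightPair p j) := by
  fin_cases j <;> exact onShell_light_smul m hε _

lemma shellCovec_lightPair_smul (m : ℝ) {ε : ℝ} (hε : 0 < ε) (p : Mom × Mom) :
    shellCovec m (lightPair (ε • p)) = ε • shellCovec m (lightPair p) := by
  refine ext_inner_right ℝ fun x => ?_
  rw [inner_smul_left, inner_shellCovec, inner_shellCovec]
  simp only [onShell_lightPair_smul m hε, mdot, PiLp.smul_apply, smul_eq_mul, conj_trivial,
    Finset.mul_sum, mul_neg]
  congr 1
  refine Finset.sum_congr rfl fun j _ => Finset.sum_congr rfl fun μ _ => ?_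
  ring

lemma modulate_smul_scaleArg {V : Type*} [NormedAddCommGroup V] [InnerProductSpace ℝ V]
    {ε : ℝ} (hε : ε ≠ 0) (k : V) (u : 𝓢(V, ℂ)) :
    modulate (ε • k) (scaleArg ε u) = scaleArg ε (modulate k u) := by
  ext x
  rw [modulate_apply, scaleArg_apply hε, scaleArg_apply hε, modulate_apply, planeWave, planeWave,
    inner_smul_left, inner_smul_right]
  rfl

/-- The unit vector in the time direction. -/
def timeVec : Mink := EuclideanSpace.single 0 1

/-- For translations in time the total momentum component is minus the sum of the two energies.
Energies do not cancel, so decay in this single quantity controls both momenta. -/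
lemma inner_shellCovec_timeVec (m : ℝ) (p : Mom × Mom) :
    inner ℝ (shellCovec m (lightPair p)) (diagVec timeVec) = -(‖p.1‖ + ‖p.2‖) := by
  have h : ∀ κ : OneP, mdot (onShell m κ) timeVec = energy m κ := by
    intro κ
    simp [mdot, timeVec, metricSign, onShell_zero]
  have h2 : ∀ j, pt (diagVec timeVec) j = timeVec := by
    intro j
    ext μ
    exact diagVec_apply timeVec (j, μ)
  rw [inner_shellCovec]
  simp only [h2, h, Fin.sum_univ_two]
  rw [← energy_light m p.1, ← energy_light m p.2]
  rfl

/-- Repeated integration by parts in the common time gives decay in the total energy of any order,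
in spite of the polynomial growth of the norms of modulated functions. -/
lemma exists_decay_diagIntegral (m : ℝ) (N : ℕ) (u : 𝓢(Cfg 2, ℂ)) {s : ℝ} (hs : |s| = 1) :
    ∃ C, 0 ≤ C ∧ ∀ p : Mom × Mom,
      schwartzNorm N (diagIntegral (modulate (s • shellCovec m (lightPair p)) u)) ≤
        C * (((1 + ‖p.1‖) ^ 5)⁻¹ * ((1 + ‖p.2‖) ^ 5)⁻¹) := by
  obtain ⟨M, hM⟩ := exists_bound_diagIntegral_modulate timeVec N
  obtain ⟨C₀, hC₀, h0⟩ := hM 0 u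
  -- The covector has norm of order `(1 + r)²`, so the growth is `(1 + r)²ᴹ`. Of the `2M + 10`
  -- powers gained, ten remain, five for each particle.
  obtain ⟨C₁, hC₁, h1⟩ := hM (2 * M + 10) u
  set A : ℝ := 1 + 4 * 2 * (1 + |m|) with hA
  refine ⟨2 ^ (2 * M + 10) * ((C₀ + C₁) * A ^ M), by positivity, fun p => ?_⟩
  set X := schwartzNorm N (diagIntegral (modulate (s • shellCovec m (lightPair p)) u)) with hX
  have hX0 : 0 ≤ X := apply_nonneg _ _
  set r := ‖p.1‖ + ‖p.2‖ with hr
  have hr0 : 0 ≤ r := by positivity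
  have hk : 1 + ‖s • shellCovec m (lightPair p)‖ ≤ A * (1 + r) ^ 2 := by
    have h := norm_shellCovec_le m (lightPair p)
    rw [Fin.prod_univ_two] at h
    have h2 : (1 + ‖(lightPair p 0).2‖) * (1 + ‖(lightPair p 1).2‖) ≤ (1 + r) ^ 2 := by
      change (1 + ‖p.1‖) * (1 + ‖p.2‖) ≤ _
      rw [hr, pow_two]
      gcongr
      · linarith [norm_nonneg p.2]
      · linarith [norm_nonneg p.1]
    have h3 : (1 : ℝ) ≤ (1 + r) ^ 2 := one_le_pow₀ (by linarith)
    rw [norm_smul, Real.norm_eq_abs, hs, one_mul, hA, add_mul, one_mul]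
    refine add_le_add h3 (h.trans ?_)
    push_cast
    exact mul_le_mul_of_nonneg_left h2 (by positivity)
  have hkM : (1 + ‖s • shellCovec m (lightPair p)‖) ^ M ≤ A ^ M * (1 + r) ^ (2 * M) := by
    rw [pow_mul, ← mul_pow]
    exact pow_le_pow_left₀ (by positivity) hk M
  have hin : |inner ℝ (s • shellCovec m (lightPair p)) (diagVec timeVec)| = r := by
    rw [inner_smul_left, inner_shellCovec_timeVec]
    simp only [conj_trivial]
    rw [abs_mul, hs, one_mul, abs_neg, abs_of_nonneg hr0]
  have e0 := h0 (s • shellCovec m (lightPair p))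
  have e1 := h1 (s • shellCovec m (lightPair p))
  rw [pow_zero, one_mul] at e0
  rw [hin] at e1
  have hpow : (1 + r) ^ (2 * M + 10) ≤ 2 ^ (2 * M + 10) * (1 + r ^ (2 * M + 10)) := by
    have h := add_pow_le (zero_le_one (α := ℝ)) hr0 (2 * M + 10)
    rw [one_pow] at h
    refine h.trans (mul_le_mul_of_nonneg_right ?_ (by positivity))
    exact pow_le_pow_right₀ one_le_two (by omega)
  have hmain : (1 + r) ^ (2 * M + 10) * X ≤
      2 ^ (2 * M + 10) * ((C₀ + C₁) * (A ^ M * (1 + r) ^ (2 * M))) := by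
    calc _ ≤ 2 ^ (2 * M + 10) * (1 + r ^ (2 * M + 10)) * X := mul_le_mul_of_nonneg_right hpow hX0
      _ = 2 ^ (2 * M + 10) * (X + r ^ (2 * M + 10) * X) := by ring
      _ ≤ 2 ^ (2 * M + 10) * (C₀ * (1 + ‖s • shellCovec m (lightPair p)‖) ^ M +
            C₁ * (1 + ‖s • shellCovec m (lightPair p)‖) ^ M) := by gcongr
      _ = 2 ^ (2 * M + 10) * ((C₀ + C₁) * (1 + ‖s • shellCovec m (lightPair p)‖) ^ M) := by ring
      _ ≤ _ := by gcongr
  have hX1 : X ≤ 2 ^ (2 * M + 10) * ((C₀ + C₁) * A ^ M) * ((1 + r) ^ 10)⁻¹ := by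
    rw [← div_eq_mul_inv, le_div_iff₀ (by positivity)]
    have hp : (0 : ℝ) < (1 + r) ^ (2 * M) := by positivity
    refine le_of_mul_le_mul_right ?_ hp
    calc _ = (1 + r) ^ (2 * M + 10) * X := by ring
      _ ≤ _ := hmain
      _ = _ := by ring
  refine hX1.trans (mul_le_mul_of_nonneg_left ?_ (by positivity))
  rw [← mul_inv]
  refine inv_anti₀ (by positivity) ?_
  calc (1 + ‖p.1‖) ^ 5 * (1 + ‖p.2‖) ^ 5 ≤ (1 + r) ^ 5 * (1 + r) ^ 5 := by
        have a1 : ‖p.1‖ ≤ r := by rw [hr]; linarith [norm_nonneg p.2]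
        have a2 : ‖p.2‖ ≤ r := by rw [hr]; linarith [norm_nonneg p.1]
        gcongr
    _ = _ := by ring

lemma integrable_lightWeight_decay :
    Integrable fun k : Mom => lightWeight k * ((1 + ‖k‖) ^ 5)⁻¹ := by
  have h := (integrable_inv_norm_pow (a := 1) (by norm_num)).const_mul (1 / ((2 * Real.pi) ^ 3 * 2))
  refine h.congr (Eventually.of_forall fun k => ?_)
  simp only [lightWeight, pow_one]
  rw [one_div, one_div, ← mul_assoc ((2 * Real.pi) ^ 3) 2, mul_inv ((2 * Real.pi) ^ 3 * 2)]
  ring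

lemma integrable_lightWeight_pair_decay :
    Integrable fun p : Mom × Mom => lightWeight p.1 * lightWeight p.2 *
      (((1 + ‖p.1‖) ^ 5)⁻¹ * ((1 + ‖p.2‖) ^ 5)⁻¹) := by
  refine (integrable_lightWeight_decay.mul_prod integrable_lightWeight_decay).congr
    (Eventually.of_forall fun p => ?_)
  ring

/-- The limit of one half of the commutator. -/
def pairIntegral (m s : ℝ) (u : 𝓢(Cfg 2, ℂ)) : ℂ :=
  ∫ p : Mom × Mom, ((lightWeight p.1 * lightWeight p.2 : ℝ) : ℂ) *
    ∫ y, modulate (s • shellCovec m (lightPair p)) u (diagVec y)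

lemma continuous_lightPair : Continuous lightPair := by
  refine continuous_pi fun j => ?_
  fin_cases j
  · exact continuous_const.prodMk continuous_fst
  · exact continuous_const.prodMk continuous_snd

/-! ### The scaling limit of the commutator -/

namespace TimeOrdered

variable {m : ℝ} {ce : ℕ} (P : TimeOrdered m ce)

lemma norm_pairWave_le (s : ℝ) (f : 𝓢(Cfg 2, ℂ)) (κ : Fin 2 → OneP) :
    ‖pairWave m s f κ‖ ≤ 2 * schwartzNorm 0 (fourierM 2 f) := by
  refine (norm_add_le _ _).trans ?_
  rw [two_mul]
  exact add_le_add (norm_apply_le_schwartzNorm 0 _ _) (norm_apply_le_schwartzNorm 0 _ _)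

/-- Both rescaled momenta tend to zero, and the direct and the exchanged term each contribute
`f̃(0)`. Uniform convergence of the Fourier transforms accommodates the change of `F i`. -/
lemma tendsto_pairWave (s : ℝ) {F : ℕ → 𝓢(Cfg 2, ℂ)} {f : 𝓢(Cfg 2, ℂ)}
    (hF : Tendsto F atTop (𝓝 f)) {ε : ℕ → ℝ} (hε0 : ∀ i, 0 < ε i) (hε : Tendsto ε atTop (𝓝 0))
    (p : Mom × Mom) : Tendsto (fun i => pairWave m s (F i) (lightPair (ε i • p))) atTop
      (𝓝 (2 * fourierM 2 f 0)) := by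
  have hG : Tendsto (fun i => fourierM 2 (F i)) atTop (𝓝 (fourierM 2 f)) :=
    ((fourierM 2).continuous.tendsto f).comp hF
  have hN := tendsto_schwartz_iff.1 hG 0
  have key : ∀ v : Fin 2 → Mink, Tendsto (fun i => fourierM 2 (F i) (s • cfg fun j => ε i • v j))
      atTop (𝓝 (fourierM 2 f 0)) := by
    intro v
    have h1 : Tendsto (fun i => fourierM 2 f (s • cfg fun j => ε i • v j)) atTop
        (𝓝 (fourierM 2 f 0)) := by
      have h2 : Tendsto (fun i => s • cfg fun j => ε i • v j) atTop (𝓝 (0 : Cfg 2)) := by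
        have h3 : ∀ i, (s • cfg fun j => ε i • v j : Cfg 2) = ε i • (s • cfg v) := by
          intro i
          ext q
          change s * (ε i * v q.1 q.2) = ε i * (s * v q.1 q.2)
          ring
        simp only [h3]
        simpa using hε.smul_const (s • cfg v)
      exact ((fourierM 2 f).continuous.tendsto 0).comp h2
    have h4 : Tendsto (fun i => fourierM 2 (F i) (s • cfg fun j => ε i • v j) -
        fourierM 2 f (s • cfg fun j => ε i • v j)) atTop (𝓝 0) :=
      squeeze_zero_norm (fun i => norm_apply_le_schwartzNorm 0 (fourierM 2 (F i) - fourierM 2 f) _)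
        hN
    simpa using h4.add h1
  have h := (key fun j => onShell m (lightPair p j)).add
    (key fun j => onShell m (lightPair p (Equiv.swap 0 1 j)))
  rw [← two_mul] at h
  refine h.congr fun i => ?_
  simp only [pairWave, onShell_lightPair_smul m (hε0 i)]

/-- The limit of one half of the commutator under a simultaneous rescaling. -/
lemma tendsto_half_commutator {t : 𝓢'(Cfg 2, ℂ)} {τ : 𝓢'(Cfg 1, ℂ)} (ht : IsReduction t τ) {c : ℂ}
    (hc : HasLojasiewiczValue (fourierDist τ) c) {F : ℕ → 𝓢(Cfg 2, ℂ)} {f : 𝓢(Cfg 2, ℂ)}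
    (hF : Tendsto F atTop (𝓝 f)) {ε : ℕ → ℝ} (hε0 : ∀ i, 0 < ε i) (hε : Tendsto ε atTop (𝓝 0))
    (u : 𝓢(Cfg 2, ℂ)) {s : ℝ} (hs : |s| = 1) :
    Tendsto (fun i => ∫ κ, (speciesInd ![false, false] κ * pairWave m s (F i) κ) *
        t (modulate (s • shellCovec m κ) (scaleArg (ε i) u)) ∂(shellPi m 2)) atTop
      (𝓝 (2 * fourierM 2 f 0 * c * pairIntegral m s u)) := by
  -- Substituting `ε p` for `p` makes the on-shell covectors scale linearly, because the particles
  -- are massless, so modulation and dilation combine into a dilation of a fixed modulated function.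
  -- The `ε⁴` of the measure cancels the `ε⁻⁴` of `diagIntegral`.
  have hrew : ∀ i, ∫ κ, (speciesInd ![false, false] κ * pairWave m s (F i) κ) *
        t (modulate (s • shellCovec m κ) (scaleArg (ε i) u)) ∂(shellPi m 2) =
      ∫ p : Mom × Mom, ((lightWeight p.1 * lightWeight p.2 : ℝ) : ℂ) *
        (pairWave m s (F i) (lightPair (ε i • p)) *
          τ (scaleArg (ε i) (diagIntegral (modulate (s • shellCovec m (lightPair p)) u)))) := by
    intro i
    simp only [mul_assoc]
    rw [integral_light_pair m fun κ => pairWave m s (F i) κ *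
      t (modulate (s • shellCovec m κ) (scaleArg (ε i) u)), integral_smul_pair (hε0 i),
      ← integral_const_mul]
    refine integral_congr_ae (Eventually.of_forall fun p => ?_)
    beta_reduce
    have hε' : (ε i : ℂ) ≠ 0 := by exact_mod_cast (hε0 i).ne'
    rw [shellCovec_lightPair_smul m (hε0 i), smul_comm, modulate_smul_scaleArg (hε0 i).ne',
      ht.eq_diagIntegral, diagIntegral_scaleArg (hε0 i), map_smul, smul_eq_mul]
    field_simp
  simp only [hrew]
  have hlim1 : ∀ h : 𝓢(Cfg 1, ℂ), Tendsto (fun i => τ (scaleArg (ε i) h)) atTop (𝓝 (c * h 0)) :=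
    fun h => (hc.tendsto_scaleArg h).comp (tendsto_nhdsWithin_iff.2
      ⟨hε, Eventually.of_forall fun i => hε0 i⟩)
  -- The rescaled self-energies converge on every test function, hence are bounded by one norm.
  -- Together with the decay of `diagIntegral` this supplies the majorant for dominated convergence.
  obtain ⟨N, C, hC, hτ⟩ := exists_uniform_bound
    (fun i : ℕ => (τ : 𝓢(Cfg 1, ℂ) →L[ℂ] ℂ).comp (scaleArg (ε i))) fun h => by
      obtain ⟨C, hC⟩ := (Metric.isBounded_range_of_tendsto _ (hlim1 h)).exists_norm_le
      exact ⟨C, fun i => hC _ ⟨i, rfl⟩⟩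
  obtain ⟨A, hA⟩ : ∃ A, ∀ i, schwartzNorm 0 (fourierM 2 (F i)) ≤ A := by
    have hG : Tendsto (fun i => schwartzNorm 0 (fourierM 2 (F i))) atTop
        (𝓝 (schwartzNorm 0 (fourierM 2 f))) :=
      ((continuous_schwartzNorm 0).tendsto _).comp (((fourierM 2).continuous.tendsto f).comp hF)
    obtain ⟨A, hA⟩ := (Metric.isBounded_range_of_tendsto _ hG).exists_norm_le
    exact ⟨A, fun i => (le_abs_self _).trans (hA _ ⟨i, rfl⟩)⟩
  obtain ⟨K, hK, hdec⟩ := exists_decay_diagIntegral m N u hs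
  have hA0 : 0 ≤ A := (apply_nonneg _ _).trans (hA 0)
  have hmeas : ∀ i, Continuous fun p : Mom × Mom => pairWave m s (F i) (lightPair (ε i • p)) *
      τ (scaleArg (ε i) (diagIntegral (modulate (s • shellCovec m (lightPair p)) u))) := by
    intro i
    have c1 : Continuous fun p : Mom × Mom => lightPair (ε i • p) :=
      continuous_lightPair.comp (continuous_const_smul _)
    have c2 : Continuous fun κ : Fin 2 → OneP => pairWave m s (F i) κ := by
      unfold pairWave
      exact ((fourierM 2 (F i)).continuous.comp ((continuous_cfg fun j =>
        (continuous_onShell m).comp (continuous_apply j)).const_smul s)).add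
        ((fourierM 2 (F i)).continuous.comp ((continuous_cfg fun j =>
          (continuous_onShell m).comp (continuous_apply _)).const_smul s))
    refine (c2.comp c1).mul ((τ : 𝓢(Cfg 1, ℂ) →L[ℂ] ℂ).continuous.comp
      ((scaleArg (ε i)).continuous.comp (diagIntegral.continuous.comp
        ((continuous_modulate u).comp ((continuous_shellCovec m 2).comp
          continuous_lightPair |>.const_smul s)))))
  have hw : Measurable fun p : Mom × Mom => ((lightWeight p.1 * lightWeight p.2 : ℝ) : ℂ) :=
    Complex.measurable_ofReal.comp ((measurable_lightWeight.comp measurable_fst).mul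
      (measurable_lightWeight.comp measurable_snd))
  have hdom := tendsto_integral_of_dominated_convergence
    (F := fun i (p : Mom × Mom) => ((lightWeight p.1 * lightWeight p.2 : ℝ) : ℂ) *
        (pairWave m s (F i) (lightPair (ε i • p)) *
          τ (scaleArg (ε i) (diagIntegral (modulate (s • shellCovec m (lightPair p)) u)))))
    (f := fun p => ((lightWeight p.1 * lightWeight p.2 : ℝ) : ℂ) * (2 * fourierM 2 f 0 *
      (c * diagIntegral (modulate (s • shellCovec m (lightPair p)) u) 0)))
    (bound := fun p => (2 * A * (C * K)) * (lightWeight p.1 * lightWeight p.2 *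
      (((1 + ‖p.1‖) ^ 5)⁻¹ * ((1 + ‖p.2‖) ^ 5)⁻¹)))
    (fun i => hw.aestronglyMeasurable.mul (hmeas i).aestronglyMeasurable)
    (integrable_lightWeight_pair_decay.const_mul _)
    (fun i => Eventually.of_forall fun p => ?_) (Eventually.of_forall fun p => ?_)
  · refine Tendsto.congr (fun i => rfl) (hdom.trans (le_of_eq ?_))
    congr 1
    rw [pairIntegral, ← integral_const_mul]
    refine integral_congr_ae (Eventually.of_forall fun p => ?_)
    beta_reduce
    rw [diagIntegral_apply_zero]
    ring
  · have hwn : 0 ≤ lightWeight p.1 * lightWeight p.2 :=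
      mul_nonneg (lightWeight_nonneg _) (lightWeight_nonneg _)
    rw [norm_mul, Complex.norm_real, Real.norm_of_nonneg hwn, norm_mul]
    have b1 := (norm_pairWave_le (m := m) s (F i) (lightPair (ε i • p))).trans
      (mul_le_mul_of_nonneg_left (hA i) zero_le_two)
    have b2 := (hτ i (diagIntegral (modulate (s • shellCovec m (lightPair p)) u))).trans
      (mul_le_mul_of_nonneg_left (hdec p) hC)
    refine (mul_le_mul_of_nonneg_left (mul_le_mul b1 b2 (norm_nonneg _) (by positivity))
      hwn).trans (le_of_eq (by ring))
  · exact ((tendsto_pairWave s hF hε0 hε p).mul (hlim1 _)).const_mul _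

lemma tendsto_commForm {c : ℂ} (hc : P.SelfEnergyAtZero c) {F : ℕ → 𝓢(Cfg 2, ℂ)} {f : 𝓢(Cfg 2, ℂ)}
    (hF : Tendsto F atTop (𝓝 f)) {ε : ℕ → ℝ} (hε0 : ∀ i, 0 < ε i) (hε : Tendsto ε atTop (𝓝 0))
    (u : 𝓢(Cfg 2, ℂ)) :
    Tendsto (fun i => P.commForm (scaleArg (ε i) u) (F i)) atTop
      (𝓝 ((1 / 4 : ℂ) * (2 * fourierM 2 f 0 * c * pairIntegral m 1 u -
        2 * fourierM 2 f 0 * c * pairIntegral m (-1) u))) := by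
  obtain ⟨τ, h1, h2⟩ := hc
  refine Tendsto.congr (fun i => (P.innerLin_commutator _ _).symm) (Tendsto.const_mul _
    (Tendsto.sub ?_ ?_))
  · exact tendsto_half_commutator h1 h2 hF hε0 hε u (by simp)
  · exact tendsto_half_commutator h1 h2 hF hε0 hε u (by simp)

end TimeOrdered
end EG
end

/-! ### Two massless particles with nearly vanishing total spatial momentum -/

noncomputable section
namespace EG

/-- A partition weight for the exchange of two massless particles. -/
def exchangeWeight (p : Mom × Mom) : ℝ := 2 * ‖p.2‖ ^ 2 / (‖p.1‖ ^ 2 + ‖p.2‖ ^ 2)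

lemma lightWeight_zero : lightWeight 0 = 0 := by simp [lightWeight]

lemma exchangeWeight_nonneg (p : Mom × Mom) : 0 ≤ exchangeWeight p := by
  unfold exchangeWeight
  positivity

lemma exchangeWeight_le (p : Mom × Mom) : exchangeWeight p ≤ 2 := by
  rw [exchangeWeight]
  refine div_le_of_le_mul₀ (by positivity) zero_le_two ?_
  nlinarith [sq_nonneg ‖p.1‖]

lemma measurable_exchangeWeight : Measurable exchangeWeight := by
  unfold exchangeWeight
  fun_prop

lemma exchangeWeight_add_swap {p : Mom × Mom} (h : p.1 ≠ 0) :
    exchangeWeight p + exchangeWeight p.swap = 2 := by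
  have h1 : 0 < ‖p.1‖ ^ 2 := by positivity
  have h2 : 0 ≤ ‖p.2‖ ^ 2 := by positivity
  have h3 : ‖p.1‖ ^ 2 + ‖p.2‖ ^ 2 ≠ 0 := by linarith
  rw [exchangeWeight, exchangeWeight, Prod.fst_swap, Prod.snd_swap,
    add_comm (‖p.2‖ ^ 2) (‖p.1‖ ^ 2), ← add_div, div_eq_iff h3]
  ring

/-- The weight and its exchange add up to two and the integrand is symmetric. The points with `p.1 =
0` are excluded by `h0`, since at the origin the weight has the default value zero. -/
lemma integral_exchangeWeight {h : Mom × Mom → ℂ} (hint : Integrable h)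
    (hsymm : ∀ p, h p.swap = h p) (h0 : ∀ p, p.1 = 0 → h p = 0) :
    ∫ p, (exchangeWeight p : ℂ) * h p = ∫ p, h p := by
  have h1 : Integrable fun p => (exchangeWeight p : ℂ) * h p :=
    hint.bdd_mul (c := 2) (Complex.measurable_ofReal.comp measurable_exchangeWeight).aestronglyMeasurable
      (Eventually.of_forall fun p => by
        rw [Complex.norm_real, Real.norm_of_nonneg (exchangeWeight_nonneg p)]
        exact exchangeWeight_le p)
  have hmp : MeasurePreserving (Prod.swap : Mom × Mom → Mom × Mom) volume volume :=
    Measure.measurePreserving_swap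
  have h2 : ∫ p : Mom × Mom, (exchangeWeight p.swap : ℂ) * h p =
      ∫ p, (exchangeWeight p : ℂ) * h p := by
    rw [← hmp.integral_comp MeasurableEquiv.prodComm.measurableEmbedding]
    refine integral_congr_ae (Eventually.of_forall fun p => ?_)
    beta_reduce
    rw [Prod.swap_swap, hsymm]
  have h3 : Integrable fun p : Mom × Mom => (exchangeWeight p.swap : ℂ) * h p :=
    hint.bdd_mul (c := 2) (Complex.measurable_ofReal.comp
      (measurable_exchangeWeight.comp measurable_swap)).aestronglyMeasurable
      (Eventually.of_forall fun p => by
        rw [Complex.norm_real, Real.norm_of_nonneg (exchangeWeight_nonneg _)]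
        exact exchangeWeight_le _)
  have h4 : ∫ p, ((exchangeWeight p : ℂ) * h p + (exchangeWeight p.swap : ℂ) * h p) =
      ∫ p, 2 * h p := by
    refine integral_congr_ae (Eventually.of_forall fun p => ?_)
    beta_reduce
    by_cases hp : p.1 = 0
    · rw [h0 p hp]
      ring
    · have := exchangeWeight_add_swap hp
      rw [← add_mul, ← Complex.ofReal_add, this]
      norm_num
  rw [integral_add h1 h3, h2, ← two_mul, integral_const_mul] at h4
  exact mul_left_cancel₀ two_ne_zero h4

/-- The product of the densities is singular at both `p.1 = 0` and `p.2 = 0`. The exchange weight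
suppresses the second singularity, leaving `‖p.1‖⁻²`, which is integrable in three dimensions and
does not involve `p.2`. -/
lemma lightWeight_mul_exchangeWeight_le (p : Mom × Mom) :
    lightWeight p.1 * lightWeight p.2 * exchangeWeight p ≤
      (1 / ((2 * Real.pi) ^ 3 * 2)) ^ 2 * 2 * (‖p.1‖ ^ 2)⁻¹ := by
  by_cases h1 : p.1 = 0
  · rw [h1, lightWeight_zero, zero_mul, zero_mul]
    positivity
  by_cases h2 : p.2 = 0
  · rw [h2, lightWeight_zero, mul_zero, zero_mul]
    positivity
  have n1 : 0 < ‖p.1‖ := norm_pos_iff.2 h1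
  have n2 : 0 < ‖p.2‖ := norm_pos_iff.2 h2
  have key : ‖p.2‖ / (‖p.1‖ * (‖p.1‖ ^ 2 + ‖p.2‖ ^ 2)) ≤ (‖p.1‖ ^ 2)⁻¹ := by
    rw [← one_div, div_le_div_iff₀ (by positivity) (by positivity), one_mul]
    have : ‖p.2‖ * ‖p.1‖ ≤ ‖p.1‖ ^ 2 + ‖p.2‖ ^ 2 := by
      nlinarith [sq_nonneg (‖p.1‖ - ‖p.2‖), sq_nonneg ‖p.1‖, sq_nonneg ‖p.2‖]
    calc _ = ‖p.1‖ * (‖p.2‖ * ‖p.1‖) := by ring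
      _ ≤ _ := mul_le_mul_of_nonneg_left this n1.le
  calc _ = (1 / ((2 * Real.pi) ^ 3 * 2)) ^ 2 * 2 *
        (‖p.2‖ / (‖p.1‖ * (‖p.1‖ ^ 2 + ‖p.2‖ ^ 2))) := by
        rw [lightWeight, lightWeight, exchangeWeight]
        have := Real.pi_pos
        field_simp
    _ ≤ _ := mul_le_mul_of_nonneg_left key (by positivity)

lemma continuousAt_lightWeight {k : Mom} (hk : k ≠ 0) : ContinuousAt lightWeight k := by
  unfold lightWeight
  have : (2 * Real.pi) ^ 3 * (2 * ‖k‖) ≠ 0 := by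
    have := norm_pos_iff.2 hk
    positivity
  fun_prop (disch := assumption)

/-- The integral over pairs of massless particles with total momentum of order `l`. -/
def narrowIntegral (β : 𝓢(Mom, ℂ)) (D : ℝ → ℂ) (l : ℝ) : ℂ :=
  ∫ p : Mom × Mom, ((lightWeight p.1 * lightWeight p.2 : ℝ) : ℂ) *
    (((l : ℂ) ^ 3)⁻¹ * β (l⁻¹ • (p.1 + p.2)) * D (‖p.1‖ + ‖p.2‖))

section Narrow

variable (β : 𝓢(Mom, ℂ)) {D : ℝ → ℂ} {C : ℝ}

lemma inv_pow_ten_le (p : Mom × Mom) :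
    ((1 + (‖p.1‖ + ‖p.2‖)) ^ 10)⁻¹ ≤ ((1 + ‖p.1‖) ^ 5)⁻¹ * ((1 + ‖p.2‖) ^ 5)⁻¹ := by
  rw [← mul_inv]
  refine inv_anti₀ (by positivity) ?_
  have h1 := norm_nonneg p.1
  have h2 := norm_nonneg p.2
  calc (1 + ‖p.1‖) ^ 5 * (1 + ‖p.2‖) ^ 5 ≤
      (1 + (‖p.1‖ + ‖p.2‖)) ^ 5 * (1 + (‖p.1‖ + ‖p.2‖)) ^ 5 := by
        gcongr <;> linarith
    _ = _ := by ring

lemma nonneg_of_decay (hDb : ∀ ω, 0 ≤ ω → ‖D ω‖ ≤ C * ((1 + ω) ^ 10)⁻¹) : 0 ≤ C := by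
  have := (norm_nonneg _).trans (hDb 0 le_rfl)
  simpa using this

lemma measurable_weights :
    Measurable fun p : Mom × Mom => ((lightWeight p.1 * lightWeight p.2 : ℝ) : ℂ) :=
  Complex.measurable_ofReal.comp ((measurable_lightWeight.comp measurable_fst).mul
      (measurable_lightWeight.comp measurable_snd))

lemma integrable_pair_mul {X : Mom × Mom → ℂ} (hX : Continuous X) {K : ℝ}
    (hb : ∀ p, ‖X p‖ ≤ K * (((1 + ‖p.1‖) ^ 5)⁻¹ * ((1 + ‖p.2‖) ^ 5)⁻¹)) :
    Integrable fun p : Mom × Mom => ((lightWeight p.1 * lightWeight p.2 : ℝ) : ℂ) * X p := by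
  refine (integrable_lightWeight_pair_decay.const_mul K).mono'
    (measurable_weights.aestronglyMeasurable.mul hX.aestronglyMeasurable)
    (Eventually.of_forall fun p => ?_)
  have hwn : 0 ≤ lightWeight p.1 * lightWeight p.2 :=
    mul_nonneg (lightWeight_nonneg _) (lightWeight_nonneg _)
  rw [norm_mul, Complex.norm_real, Real.norm_of_nonneg hwn]
  refine (mul_le_mul_of_nonneg_left (hb p) hwn).trans (le_of_eq (by ring))

lemma integral_comp_smul_sub {l : ℝ} (hl : 0 < l) (p : Mom) (f : Mom → ℂ) :
    ∫ k, f k = (l : ℂ) ^ 3 * ∫ q, f (l • q - p) := by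
  have h := Measure.integral_comp_smul (volume : Measure Mom) (fun k => f (k - p)) l
  rw [integral_sub_right_eq_self f p, finrank_euclideanSpace_fin, abs_of_pos (by positivity)] at h
  rw [h, Complex.real_smul, ← mul_assoc]
  have hl' : (l : ℂ) ≠ 0 := by exact_mod_cast hl.ne'
  push_cast
  rw [mul_inv_cancel₀ (pow_ne_zero _ hl'), one_mul]

/-- The integrand of `narrowIntegral` in terms of one momentum and the rescaled total momentum. -/
def narrowKernel (β : 𝓢(Mom, ℂ)) (D : ℝ → ℂ) (l : ℝ) (z : Mom × Mom) : ℂ :=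
  ((lightWeight z.1 * lightWeight (l • z.2 - z.1) * exchangeWeight (z.1, l • z.2 - z.1) : ℝ) : ℂ) *
    (β z.2 * D (‖z.1‖ + ‖l • z.2 - z.1‖))

lemma norm_narrowKernel_le (hDb : ∀ ω, 0 ≤ ω → ‖D ω‖ ≤ C * ((1 + ω) ^ 10)⁻¹)
    (l : ℝ) (z : Mom × Mom) : ‖narrowKernel β D l z‖ ≤
    (1 / ((2 * Real.pi) ^ 3 * 2)) ^ 2 * 2 * C *
      (((‖z.1‖ ^ 2)⁻¹ * ((1 + ‖z.1‖) ^ 5)⁻¹) * ‖β z.2‖) := by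
  have hC := nonneg_of_decay hDb
  have hw := lightWeight_mul_exchangeWeight_le (z.1, l • z.2 - z.1)
  have hwn : 0 ≤ lightWeight z.1 * lightWeight (l • z.2 - z.1) *
      exchangeWeight (z.1, l • z.2 - z.1) :=
    mul_nonneg (mul_nonneg (lightWeight_nonneg _) (lightWeight_nonneg _)) (exchangeWeight_nonneg _)
  have hd : ‖D (‖z.1‖ + ‖l • z.2 - z.1‖)‖ ≤ C * ((1 + ‖z.1‖) ^ 5)⁻¹ := by
    refine (hDb _ (by positivity)).trans (mul_le_mul_of_nonneg_left ?_ hC)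
    refine (inv_pow_ten_le (z.1, l • z.2 - z.1)).trans ?_
    exact mul_le_of_le_one_right (by positivity) (one_add_norm_pow_inv_le_one _ 5)
  rw [narrowKernel, norm_mul, norm_mul, Complex.norm_real, Real.norm_of_nonneg hwn]
  calc _ ≤ ((1 / ((2 * Real.pi) ^ 3 * 2)) ^ 2 * 2 * (‖z.1‖ ^ 2)⁻¹) *
        (‖β z.2‖ * (C * ((1 + ‖z.1‖) ^ 5)⁻¹)) := by gcongr
    _ = _ := by ring

lemma integrable_narrow_bound (K : ℝ) : Integrable fun z : Mom × Mom =>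
    K * (((‖z.1‖ ^ 2)⁻¹ * ((1 + ‖z.1‖) ^ 5)⁻¹) * ‖β z.2‖) :=
  ((integrable_inv_norm_pow (a := 2) le_rfl).mul_prod
    (β.integrable (μ := volume)).norm).const_mul K

lemma measurable_narrowKernel (hD : Continuous D) (l : ℝ) : Measurable (narrowKernel β D l) := by
  have h1 : Measurable fun z : Mom × Mom => l • z.2 - z.1 := by fun_prop
  have h2 : Measurable fun z : Mom × Mom => lightWeight z.1 := measurable_lightWeight.comp measurable_fst
  have h3 : Measurable fun z : Mom × Mom => lightWeight (l • z.2 - z.1) :=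
    measurable_lightWeight.comp h1
  have h4 : Measurable fun z : Mom × Mom => exchangeWeight (z.1, l • z.2 - z.1) :=
    measurable_exchangeWeight.comp (measurable_fst.prodMk h1)
  have h5 : Continuous fun z : Mom × Mom => β z.2 * D (‖z.1‖ + ‖l • z.2 - z.1‖) :=
    (β.continuous.comp continuous_snd).mul (hD.comp (by fun_prop))
  exact (Complex.measurable_ofReal.comp ((h2.mul h3).mul h4)).mul h5.measurable

/-- Symmetry allows the exchange weight to be inserted, and the total momentum in units of `l`
becomes the new variable, which absorbs `l⁻³`. The resulting integrand has a majorant independent of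
`l`. -/
lemma narrowIntegral_eq (hD : Continuous D)
    (hDb : ∀ ω, 0 ≤ ω → ‖D ω‖ ≤ C * ((1 + ω) ^ 10)⁻¹) {l : ℝ} (hl : 0 < l) :
    narrowIntegral β D l = ∫ z, narrowKernel β D l z := by
  have hC := nonneg_of_decay hDb
  set h : Mom × Mom → ℂ := fun p => ((lightWeight p.1 * lightWeight p.2 : ℝ) : ℂ) *
    (((l : ℂ) ^ 3)⁻¹ * β (l⁻¹ • (p.1 + p.2)) * D (‖p.1‖ + ‖p.2‖)) with hh
  have hl' : (l : ℂ) ≠ 0 := by exact_mod_cast hl.ne'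
  have hint : Integrable h := by
    refine integrable_pair_mul (K := ‖((l : ℂ) ^ 3)⁻¹‖ * schwartzNorm 0 β * C)
      ((continuous_const.mul (β.continuous.comp (by fun_prop))).mul (hD.comp (by fun_prop)))
      fun p => ?_
    rw [norm_mul, norm_mul]
    calc _ ≤ ‖((l : ℂ) ^ 3)⁻¹‖ * schwartzNorm 0 β *
          (C * ((1 + (‖p.1‖ + ‖p.2‖)) ^ 10)⁻¹) := by
          gcongr
          · exact norm_apply_le_schwartzNorm 0 _ _
          · exact hDb _ (by positivity)
      _ ≤ ‖((l : ℂ) ^ 3)⁻¹‖ * schwartzNorm 0 β *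
          (C * (((1 + ‖p.1‖) ^ 5)⁻¹ * ((1 + ‖p.2‖) ^ 5)⁻¹)) := by
          have := inv_pow_ten_le p
          have h0 : 0 ≤ ‖((l : ℂ) ^ 3)⁻¹‖ * schwartzNorm 0 β :=
            mul_nonneg (norm_nonneg _) (apply_nonneg _ _)
          gcongr
      _ = _ := by ring
  have h1 : narrowIntegral β D l = ∫ p, (exchangeWeight p : ℂ) * h p := by
    refine (integral_exchangeWeight hint (fun p => ?_) fun p hp => ?_).symm
    · simp only [hh, Prod.fst_swap, Prod.snd_swap]
      rw [add_comm p.2 p.1, add_comm ‖p.2‖ ‖p.1‖, mul_comm (lightWeight p.2)]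
    · simp only [hh, hp, lightWeight_zero]
      simp
  have hint2 : Integrable fun p => (exchangeWeight p : ℂ) * h p :=
    hint.bdd_mul (c := 2) (Complex.measurable_ofReal.comp measurable_exchangeWeight).aestronglyMeasurable
      (Eventually.of_forall fun p => by
        rw [Complex.norm_real, Real.norm_of_nonneg (exchangeWeight_nonneg p)]
        exact exchangeWeight_le p)
  have hint3 : Integrable (narrowKernel β D l) :=
    (integrable_narrow_bound β _).mono' (measurable_narrowKernel β hD l).aestronglyMeasurable
      (Eventually.of_forall (norm_narrowKernel_le β hDb l))
  rw [h1, Measure.volume_eq_prod, integral_prod _ hint2, integral_prod _ hint3]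
  refine integral_congr_ae (Eventually.of_forall fun p => ?_)
  beta_reduce
  rw [integral_comp_smul_sub hl p, ← integral_const_mul]
  refine integral_congr_ae (Eventually.of_forall fun q => ?_)
  have h2 : l⁻¹ • (p + (l • q - p)) = q := by
    rw [add_sub_cancel, inv_smul_smul₀ hl.ne']
  simp only [hh, narrowKernel, h2]
  push_cast
  field_simp

/-- In the limit the second momentum is the negative of the first, so the densities multiply to a
square, the energies add to `2‖k‖`, and the exchange weight equals one. -/
lemma tendsto_narrowIntegral (hD : Continuous D)
    (hDb : ∀ ω, 0 ≤ ω → ‖D ω‖ ≤ C * ((1 + ω) ^ 10)⁻¹)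
    {l : ℕ → ℝ} (hl0 : ∀ i, 0 < l i) (hl : Tendsto l atTop (𝓝 0)) :
    Tendsto (fun i => narrowIntegral β D (l i)) atTop
      (𝓝 ((∫ k, ((lightWeight k ^ 2 : ℝ) : ℂ) * D (2 * ‖k‖)) * ∫ q, β q)) := by
  have h := tendsto_integral_of_dominated_convergence
    (F := fun i => narrowKernel β D (l i))
    (f := fun z : Mom × Mom => (((lightWeight z.1 ^ 2 : ℝ) : ℂ) * D (2 * ‖z.1‖)) * β z.2)
    _ (fun i => (measurable_narrowKernel β hD (l i)).aestronglyMeasurable)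
    (integrable_narrow_bound β _)
    (fun i => Eventually.of_forall (norm_narrowKernel_le β hDb (l i)))
    (Eventually.of_forall fun z => ?_)
  · rw [Measure.volume_eq_prod, integral_prod_mul
      (fun k : Mom => ((lightWeight k ^ 2 : ℝ) : ℂ) * D (2 * ‖k‖)) (fun q => β q)] at h
    refine h.congr fun i => ?_
    rw [narrowIntegral_eq β hD hDb (hl0 i)]
    rfl
  · by_cases hz : z.1 = 0
    · simp [narrowKernel, hz, lightWeight_zero]
    have hlim : Tendsto (fun i => l i • z.2 - z.1) atTop (𝓝 (-z.1)) := by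
      simpa using (hl.smul_const z.2).sub_const z.1
    have hneg : -z.1 ≠ 0 := neg_ne_zero.2 hz
    have h1 := (continuousAt_lightWeight hneg).tendsto.comp hlim
    have h2 : Tendsto (fun i => ‖l i • z.2 - z.1‖) atTop (𝓝 ‖z.1‖) := by
      simpa using hlim.norm
    have h3 : Tendsto (fun i => exchangeWeight (z.1, l i • z.2 - z.1)) atTop (𝓝 1) := by
      have hn : 0 < ‖z.1‖ ^ 2 := by positivity
      have := ((h2.pow 2).const_mul 2).div ((h2.pow 2).const_add (‖z.1‖ ^ 2)) (by positivity)
      have h4 : 2 * ‖z.1‖ ^ 2 / (‖z.1‖ ^ 2 + ‖z.1‖ ^ 2) = 1 := by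
        field_simp
        ring
      rw [h4] at this
      exact this
    have h5 : Tendsto (fun i => D (‖z.1‖ + ‖l i • z.2 - z.1‖)) atTop (𝓝 (D (2 * ‖z.1‖))) := by
      rw [two_mul]
      exact (hD.tendsto _).comp (h2.const_add _)
    have h6 : lightWeight (-z.1) = lightWeight z.1 := by simp [lightWeight]
    rw [h6] at h1
    have h7 := ((Complex.continuous_ofReal.tendsto _).comp
      ((h1.const_mul (lightWeight z.1)).mul h3)).mul (h5.const_mul (β z.2))
    rw [mul_one, ← pow_two] at h7
    refine (h7.trans (le_of_eq ?_))
    congr 1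
    ring

end Narrow

end EG
end

/-! ### The radial integral -/

noncomputable section
namespace EG

section Radial

lemma tendsto_schwartz_atTop (E : 𝓢(ℝ, ℂ)) : Tendsto E atTop (𝓝 0) := by
  have h : Tendsto (fun x : ℝ => ‖x‖ ^ (-1 : ℝ)) (cocompact ℝ) (𝓝 0) :=
    (tendsto_rpow_neg_atTop one_pos).comp (tendsto_norm_cocompact_atTop (E := ℝ))
  exact ((E.isBigO_cocompact_rpow (-1)).trans_tendsto h).mono_left atTop_le_cocompact

lemma integral_deriv_schwartz_mul (E : 𝓢(ℝ, ℂ)) {α : ℝ} (hα : 0 < α) {s : ℝ} (hs : s = 1 ∨ s = -1) :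
    ∫ r in Set.Ioi (0 : ℝ), deriv E (s * α * r) = -((s : ℂ) * α)⁻¹ * E 0 := by
  have hsα : s * α ≠ 0 := by
    rcases hs with rfl | rfl <;> simp [hα.ne']
  have hd : ∀ x ∈ Set.Ici (0 : ℝ), HasDerivAt (fun r : ℝ => ((s : ℂ) * α)⁻¹ * E (s * α * r))
      (deriv E (s * α * x)) x := by
    intro x _
    have h1 : HasDerivAt (fun r : ℝ => s * α * r) (s * α) x := by
      simpa using (hasDerivAt_id x).const_mul (s * α)
    have h2 : HasDerivAt E (deriv E (s * α * x)) (s * α * x) :=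
      (E.differentiable _).hasDerivAt
    have h3 := (h2.scomp x h1).const_mul ((s : ℂ) * α)⁻¹
    have h4 : ((s : ℂ) * α) ≠ 0 := by exact_mod_cast hsα
    have h5 : ((s : ℂ) * α)⁻¹ * (s * α) • deriv E (s * α * x) = deriv E (s * α * x) := by
      rw [Complex.real_smul, Complex.ofReal_mul, inv_mul_cancel_left₀ h4]
    rw [h5] at h3
    exact h3
  have hint : IntegrableOn (fun r : ℝ => deriv E (s * α * r)) (Set.Ioi 0) := by
    have := ((SchwartzMap.derivCLM ℂ ℂ E).integrable (μ := volume)).comp_mul_left' hsα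
    exact this.integrableOn
  have hlim : Tendsto (fun r : ℝ => ((s : ℂ) * α)⁻¹ * E (s * α * r)) atTop (𝓝 0) := by
    have h0 : Tendsto (fun r : ℝ => (scaleArg (s * α) E) r) atTop (𝓝 0) := tendsto_schwartz_atTop _
    have h1 := h0.const_mul ((s : ℂ) * α)⁻¹
    rw [mul_zero] at h1
    refine h1.congr fun r => ?_
    rw [scaleArg_apply hsα, smul_eq_mul]
  rw [integral_Ioi_of_hasDerivAt_of_tendsto' hd hint hlim, mul_zero, zero_sub, neg_mul]

/-- The square of the density is proportional to `‖k‖⁻²` and cancels the factor `r²` of the radial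
measure exactly. The constant contains the surface `3 vol(B)` of the unit sphere. -/
lemma exists_integral_lightWeight_sq : ∃ K : ℂ, K ≠ 0 ∧ ∀ D : ℝ → ℂ,
    ∫ k, ((lightWeight k ^ 2 : ℝ) : ℂ) * D (2 * ‖k‖) =
      K * ∫ r in Set.Ioi (0 : ℝ), D (2 * r) := by
  have hb : (volume : Measure Mom).real (Metric.ball 0 1) ≠ 0 :=
    (ENNReal.toReal_pos (Metric.measure_ball_pos _ _ one_pos).ne' measure_ball_lt_top.ne).ne'
  refine ⟨3 * ((volume : Measure Mom).real (Metric.ball 0 1) : ℂ) *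
    (((1 / ((2 * Real.pi) ^ 3 * 2)) ^ 2 : ℝ) : ℂ), ?_, fun D => ?_⟩
  · refine mul_ne_zero (mul_ne_zero three_ne_zero (by exact_mod_cast hb)) ?_
    have : ((1 / ((2 * Real.pi) ^ 3 * 2)) ^ 2 : ℝ) ≠ 0 := by
      have := Real.pi_pos
      positivity
    exact_mod_cast this
  · have h := integral_fun_norm_addHaar (volume : Measure Mom)
      (fun r : ℝ => (((1 / ((2 * Real.pi) ^ 3 * (2 * r))) ^ 2 : ℝ) : ℂ) * D (2 * r))
    rw [finrank_euclideanSpace_fin] at h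
    refine h.trans ?_
    rw [mul_assoc, ← integral_const_mul, nsmul_eq_mul, Complex.real_smul, ← mul_assoc]
    congr 1
    refine setIntegral_congr_fun measurableSet_Ioi fun r hr => ?_
    have hr' : (r : ℝ) ≠ 0 := (ne_of_gt hr)
    rw [Complex.real_smul, ← mul_assoc, ← Complex.ofReal_mul]
    congr 2
    have := Real.pi_ne_zero
    field_simp

end Radial

/-! ### Separation of time and space -/

section TimeSpace

/-- The spatial part of a point of Minkowski space. -/
def spatial (y : Mink) : Mom := WithLp.toLp 2 fun j => y j.succ

lemma contDiff_spatial : ContDiff ℝ ((⊤ : ℕ∞) : WithTop ℕ∞) spatial := by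
  unfold spatial
  fun_prop

lemma integral_time_space (F : ℝ → ℂ) (G : Mom → ℂ) :
    ∫ y : Mink, F (y 0) * G (spatial y) = (∫ t, F t) * ∫ x, G x := by
  have h1 := (PiLp.volume_preserving_toLp (Fin 4)).integral_comp
    (MeasurableEquiv.toLp 2 (Fin 4 → ℝ)).measurableEmbedding
    (fun y : Mink => F (y 0) * G (spatial y))
  have h2 := (volume_preserving_piFinSuccAbove (fun _ : Fin 4 => ℝ) 0).integral_comp
    (MeasurableEquiv.piFinSuccAbove (fun _ : Fin 4 => ℝ) 0).measurableEmbedding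
    (fun z : ℝ × (Fin 3 → ℝ) => F z.1 * G (WithLp.toLp 2 z.2))
  have h3 := (PiLp.volume_preserving_toLp (Fin 3)).integral_comp
    (MeasurableEquiv.toLp 2 (Fin 3 → ℝ)).measurableEmbedding G
  rw [← h1, ← h3, ← integral_prod_mul, ← Measure.volume_eq_prod]
  exact h2

lemma mdot_onShell_light (m : ℝ) (k : Mom) (y : Mink) :
    mdot (onShell m (false, k)) y = ‖k‖ * y 0 - inner ℝ (spatial y) k := by
  rw [mdot, Fin.sum_univ_succ, onShell_zero, energy_light, PiLp.inner_apply]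
  simp only [onShell_succ, metricSign, spatial]
  simp [Finset.sum_neg_distrib, sub_eq_add_neg]

lemma planeWave_lightPair (m s : ℝ) (p : Mom × Mom) (y : Mink) :
    planeWave (s • shellCovec m (lightPair p)) (diagVec y) =
      Complex.exp (((-(s * (‖p.1‖ + ‖p.2‖) * y 0) : ℝ) : ℂ) * Complex.I) *
        Complex.exp (((s * inner ℝ (spatial y) (p.1 + p.2) : ℝ) : ℂ) * Complex.I) := by
  have hp : ∀ j, pt (diagVec y) j = y := by
    intro j
    ext μ
    exact diagVec_apply y (j, μ)
  rw [planeWave, inner_smul_left, inner_shellCovec, ← Complex.exp_add, ← add_mul,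
    ← Complex.ofReal_add, mul_comm Complex.I]
  congr 3
  simp only [hp, Fin.sum_univ_two, conj_trivial]
  change s * -(mdot (onShell m (false, p.1)) y + mdot (onShell m (false, p.2)) y) = _
  rw [mdot_onShell_light, mdot_onShell_light, inner_add_right]
  ring

end TimeSpace

end EG
end

/-! ### Choice of the switching function -/

noncomputable section
namespace EG

open scoped FourierTransform

/-- The Fourier transform `∫ exp(i q·x) b(x) dx`. -/
def spaceTransform (b : 𝓢(Mom, ℂ)) : 𝓢(Mom, ℂ) := scaleArg (-(2 * Real.pi)⁻¹) (𝓕 b)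

lemma neg_inv_two_pi_ne_zero : -(2 * Real.pi)⁻¹ ≠ 0 :=
  neg_ne_zero.2 (inv_ne_zero (by positivity))

lemma spaceTransform_apply (b : 𝓢(Mom, ℂ)) (q : Mom) :
    spaceTransform b q = ∫ x, Complex.exp (((inner ℝ x q : ℝ) : ℂ) * Complex.I) * b x := by
  rw [spaceTransform, scaleArg_apply neg_inv_two_pi_ne_zero, SchwartzMap.fourier_coe,
    Real.fourier_eq']
  refine integral_congr_ae (Eventually.of_forall fun x => ?_)
  beta_reduce
  rw [smul_eq_mul, inner_smul_right]
  congr 4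
  have := Real.pi_ne_zero
  field_simp

/-- By Fourier inversion at the origin, the integral of the transform is a nonzero multiple of `b
0`. -/
lemma integral_spaceTransform_ne_zero {b : 𝓢(Mom, ℂ)} (hb : b 0 ≠ 0) :
    ∫ q, spaceTransform b q ≠ 0 := by
  have h1 : ∫ q, (𝓕 b) q = b 0 := by
    have h2 : (𝓕⁻ (𝓕 b)) 0 = b 0 := by rw [FourierTransform.fourierInv_fourier_eq]
    rw [SchwartzMap.fourierInv_coe, Real.fourierInv_eq'] at h2
    rw [← h2]
    simp
  have h3 := Measure.integral_comp_smul (volume : Measure Mom) (𝓕 b : 𝓢(Mom, ℂ)) (-(2 * Real.pi)⁻¹)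
  have h4 : ∫ q, spaceTransform b q = ∫ q, (𝓕 b) (-(2 * Real.pi)⁻¹ • q) :=
    integral_congr_ae (Eventually.of_forall fun q => scaleArg_apply neg_inv_two_pi_ne_zero _ q)
  rw [h4, h3, h1]
  refine smul_ne_zero ?_ hb
  exact abs_ne_zero.2 (inv_ne_zero (pow_ne_zero _ neg_inv_two_pi_ne_zero))

/-- The Fourier transform `∫ exp(-i s ω t) t c(t) dt`. -/
def timeTransform (c : 𝓢(ℝ, ℂ)) (s ω : ℝ) : ℂ :=
  (-2 * Real.pi * Complex.I)⁻¹ * deriv (𝓕 c : 𝓢(ℝ, ℂ)) (s * (2 * Real.pi)⁻¹ * ω)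

/-- The factor `t` in the integrand becomes a derivative in frequency. The derivative form is chosen
as the definition so that the later integral over the half-line is a boundary term. -/
lemma timeTransform_eq (c : 𝓢(ℝ, ℂ)) (s ω : ℝ) :
    timeTransform c s ω =
      ∫ t : ℝ, Complex.exp (((-(s * ω * t) : ℝ) : ℂ) * Complex.I) * (t * c t) := by
  have hi : Integrable fun x : ℝ => x • c x := by
    have := c.integrable_pow_mul volume 1
    refine (integrable_norm_iff (by fun_prop)).1 ?_
    simpa [norm_smul] using this
  have h := Real.deriv_fourier (f := c) c.integrable hi
  rw [timeTransform, SchwartzMap.fourier_coe, h, Real.fourier_real_eq_integral_exp_smul,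
    ← integral_const_mul]
  refine integral_congr_ae (Eventually.of_forall fun t => ?_)
  beta_reduce
  have h1 : -2 * Real.pi * t * (s * (2 * Real.pi)⁻¹ * ω) = -(s * ω * t) := by
    have := Real.pi_ne_zero
    field_simp
  rw [h1, smul_eq_mul, smul_eq_mul]
  have h2 : (-2 * Real.pi * Complex.I : ℂ) ≠ 0 := by simp [Real.pi_ne_zero]
  field_simp

lemma continuous_timeTransform (c : 𝓢(ℝ, ℂ)) (s : ℝ) : Continuous (timeTransform c s) := by
  have : Continuous (deriv (𝓕 c : 𝓢(ℝ, ℂ))) := (SchwartzMap.derivCLM ℂ ℂ (𝓕 c)).continuous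
  unfold timeTransform
  fun_prop

lemma timeTransform_decay (c : 𝓢(ℝ, ℂ)) {s : ℝ} (hs : s ≠ 0) :
    ∃ C, ∀ ω, 0 ≤ ω → ‖timeTransform c s ω‖ ≤ C * ((1 + ω) ^ 10)⁻¹ := by
  have hs' : s * (2 * Real.pi)⁻¹ ≠ 0 := mul_ne_zero hs (inv_ne_zero (by positivity))
  set G := scaleArg (s * (2 * Real.pi)⁻¹) (SchwartzMap.derivCLM ℂ ℂ (𝓕 c)) with hG
  refine ⟨‖(-2 * Real.pi * Complex.I : ℂ)⁻¹‖ * (2 ^ 10 * schwartzNorm 10 G), fun ω hω => ?_⟩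
  have h : timeTransform c s ω = (-2 * Real.pi * Complex.I)⁻¹ * G ω := by
    rw [hG, scaleArg_apply hs', smul_eq_mul]
    rfl
  have h1 := norm_apply_le_one_add_inv 10 G ω
  rw [Real.norm_of_nonneg hω] at h1
  rw [h, norm_mul, mul_assoc (‖_‖)]
  exact mul_le_mul_of_nonneg_left h1 (norm_nonneg _)

/-- A derivative integrated over the half-line leaves the boundary value `∫ c`, and the chain rule
contributes the sign `s`. This oddness in `s` is what distinguishes the two halves of the
commutator. -/
lemma integral_timeTransform (c : 𝓢(ℝ, ℂ)) {s : ℝ} (hs : s = 1 ∨ s = -1) :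
    ∫ r in Set.Ioi (0 : ℝ), timeTransform c s (2 * r) = -(Complex.I / 2) * s * ∫ t, c t := by
  have h1 := integral_deriv_schwartz_mul (𝓕 c) (inv_pos.2 Real.pi_pos) hs
  have h2 : (𝓕 c) 0 = ∫ t, c t := by
    rw [SchwartzMap.fourier_coe, Real.fourier_real_eq_integral_exp_smul]
    simp
  have hp : (Real.pi : ℂ) ≠ 0 := by exact_mod_cast Real.pi_ne_zero
  have h3 : ∀ r : ℝ, s * (2 * Real.pi)⁻¹ * (2 * r) = s * Real.pi⁻¹ * r := by
    intro r
    have := Real.pi_ne_zero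
    field_simp
  simp only [timeTransform, h3]
  rw [integral_const_mul, h1, h2]
  push_cast
  rcases hs with rfl | rfl
  · push_cast
    field_simp
    simp
  · push_cast
    field_simp
    simp

lemma integral_modulate_diagVec (m : ℝ) {g : 𝓢(Mink, ℂ)} {c : 𝓢(ℝ, ℂ)} {b : 𝓢(Mom, ℂ)} {l : ℝ}
    (hl : 0 < l) (hg : ∀ y, g y * g y = (y 0 * c (y 0)) * b (l • spatial y)) (s : ℝ)
    (p : Mom × Mom) :
    ∫ y, modulate (s • shellCovec m (lightPair p)) (tensor 2 ![g, g]) (diagVec y) =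
      ((l : ℂ) ^ 3)⁻¹ * spaceTransform b (l⁻¹ • (s • (p.1 + p.2))) *
        timeTransform c s (‖p.1‖ + ‖p.2‖) := by
  have hp : ∀ y j, pt (diagVec y) j = y := by
    intro y j
    ext μ
    exact diagVec_apply y (j, μ)
  have h1 : ∀ y, modulate (s • shellCovec m (lightPair p)) (tensor 2 ![g, g]) (diagVec y) =
      (fun t : ℝ => Complex.exp (((-(s * (‖p.1‖ + ‖p.2‖) * t) : ℝ) : ℂ) * Complex.I) * (t * c t))
          (y 0) *
        (fun x : Mom => Complex.exp (((s * inner ℝ x (p.1 + p.2) : ℝ) : ℂ) * Complex.I) * b (l • x))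
          (spatial y) := by
    intro y
    rw [modulate_apply, tensor_two_apply, hp, hp, hg, planeWave_lightPair]
    ring
  have h2 := Measure.integral_comp_smul (volume : Measure Mom) (fun x : Mom =>
    Complex.exp (((inner ℝ x (l⁻¹ • (s • (p.1 + p.2))) : ℝ) : ℂ) * Complex.I) * b x) l
  have h3 : ∀ x : Mom, inner ℝ (l • x) (l⁻¹ • (s • (p.1 + p.2))) = s * inner ℝ x (p.1 + p.2) := by
    intro x
    rw [inner_smul_left, inner_smul_right, inner_smul_right, conj_trivial,
      mul_inv_cancel_left₀ hl.ne']
  simp only [h3] at h2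
  refine (integral_congr_ae (Eventually.of_forall h1)).trans
    ((integral_time_space
      (fun t : ℝ => Complex.exp (((-(s * (‖p.1‖ + ‖p.2‖) * t) : ℝ) : ℂ) * Complex.I) * (t * c t))
      (fun x : Mom => Complex.exp (((s * inner ℝ x (p.1 + p.2) : ℝ) : ℂ) * Complex.I) *
        b (l • x))).trans ?_)
  rw [← timeTransform_eq, h2, spaceTransform_apply,
    finrank_euclideanSpace_fin, abs_of_pos (by positivity), Complex.real_smul, mul_comm]
  push_cast
  rfl

/-- For `s = -1` the reflection of both momenta removes the sign from the spatial transform. Since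
the energies are even, the sign survives only in the time transform. -/
lemma pairIntegral_eq_narrowIntegral (m : ℝ) {g : 𝓢(Mink, ℂ)} {c : 𝓢(ℝ, ℂ)} {b : 𝓢(Mom, ℂ)}
    {l : ℝ} (hl : 0 < l) (hg : ∀ y, g y * g y = (y 0 * c (y 0)) * b (l • spatial y)) {s : ℝ}
    (hs : s = 1 ∨ s = -1) :
    pairIntegral m s (tensor 2 ![g, g]) =
      narrowIntegral (spaceTransform b) (timeTransform c s) l := by
  simp only [pairIntegral, integral_modulate_diagVec m hl hg]
  rcases hs with rfl | rfl
  · simp only [one_smul]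
    rfl
  · have hmp : MeasurePreserving (Prod.map Neg.neg Neg.neg : Mom × Mom → Mom × Mom) volume volume :=
      (Measure.measurePreserving_neg volume).prod (Measure.measurePreserving_neg volume)
    rw [← hmp.integral_comp ((MeasurableEquiv.neg Mom).prodCongr
      (MeasurableEquiv.neg Mom)).measurableEmbedding, narrowIntegral]
    refine integral_congr_ae (Eventually.of_forall fun p => ?_)
    simp only [Prod.map_fst, Prod.map_snd, norm_neg, lightWeight, neg_smul, one_smul, neg_add_rev,
      neg_neg]
    rw [add_comm p.2 p.1]

lemma exists_time_cutoff {σ : ℝ} (hσ : σ = 1 ∨ σ = -1) : ∃ χ : ℝ → ℝ,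
    ContDiff ℝ ((⊤ : ℕ∞) : WithTop ℕ∞) χ ∧ HasCompactSupport χ ∧
      (∀ t ∈ tsupport χ, 1 ≤ σ * t) ∧ ∫ t, t * χ t ^ 2 ≠ 0 := by
  -- A bump centred at `2σ` with outer radius one lives where `σ t ≥ 1`. There `σ t χ²` is
  -- nonnegative, and it is positive at the centre, so its integral does not vanish.
  set χ : ContDiffBump (2 * σ) := ⟨1 / 2, 1, by norm_num, by norm_num⟩ with hχ
  have hσ2 : σ * σ = 1 := by rcases hσ with rfl | rfl <;> norm_num
  have hσa : |σ| = 1 := by rcases hσ with rfl | rfl <;> norm_num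
  have hsupp : ∀ t ∈ tsupport χ, 1 ≤ σ * t := by
    intro t ht
    rw [χ.tsupport_eq, Metric.mem_closedBall, Real.dist_eq] at ht
    have h1 : |σ * (t - 2 * σ)| ≤ 1 := by
      rw [abs_mul, hσa, one_mul]
      exact ht
    have h2 := (abs_le.1 h1).1
    nlinarith
  refine ⟨χ, χ.contDiff, χ.hasCompactSupport, hsupp, ?_⟩
  have hpos : 0 < ∫ t, σ * (t * χ t ^ 2) := by
    refine Continuous.integral_pos_of_hasCompactSupport_nonneg_nonzero (x := 2 * σ) ?_ ?_ ?_ ?_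
    · have := χ.continuous
      fun_prop
    · refine χ.hasCompactSupport.mono fun t ht => ?_
      contrapose! ht
      simp [Function.notMem_support.1 ht]
    · intro t
      by_cases ht : t ∈ tsupport χ
      · have := hsupp t ht
        have h0 : 0 ≤ σ * t := by linarith
        have : σ * (t * χ t ^ 2) = (σ * t) * χ t ^ 2 := by ring
        beta_reduce
        rw [this]
        exact mul_nonneg h0 (sq_nonneg _)
      · simp [image_eq_zero_of_notMem_tsupport ht]
    · rw [χ.one_of_mem_closedBall (Metric.mem_closedBall_self (by norm_num))]
      rcases hσ with rfl | rfl <;> norm_num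
  rw [integral_const_mul] at hpos
  intro h0
  rw [h0, mul_zero] at hpos
  exact lt_irrefl _ hpos

lemma hasCompactSupport_time_space {A : ℝ → ℝ} {G : Mom → ℝ} (hA : HasCompactSupport A)
    (hG : HasCompactSupport G) : HasCompactSupport fun y : Mink => A (y 0) * G (spatial y) := by
  obtain ⟨R₁, h1⟩ := hA.isCompact.isBounded.subset_closedBall 0
  obtain ⟨R₂, h2⟩ := hG.isCompact.isBounded.subset_closedBall 0
  refine HasCompactSupport.intro (isCompact_closedBall (0 : Mink) (R₁ + R₂)) fun y hy => ?_
  by_contra h0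
  have a1 := h1 (subset_tsupport _ (left_ne_zero_of_mul h0))
  have a2 := h2 (subset_tsupport _ (right_ne_zero_of_mul h0))
  rw [mem_closedBall_zero_iff] at a1 a2 hy
  refine hy (le_trans ?_ (add_le_add a1 a2))
  have h3 : ‖y‖ ^ 2 = ‖y 0‖ ^ 2 + ‖spatial y‖ ^ 2 := by
    rw [EuclideanSpace.norm_sq_eq, EuclideanSpace.norm_sq_eq, Fin.sum_univ_succ]
    rfl
  have := norm_nonneg (y 0)
  have := norm_nonneg (spatial y)
  refine le_of_sq_le_sq ?_ (by positivity)
  nlinarith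

/-- A smooth function of time, cut off to compact support and to spatial distances of order
`l⁻¹`. -/
lemma exists_time_space {A : ℝ → ℝ} {G : Mom → ℝ} (hA : ContDiff ℝ ((⊤ : ℕ∞) : WithTop ℕ∞) A)
    (hA' : HasCompactSupport A) (hG : ContDiff ℝ ((⊤ : ℕ∞) : WithTop ℕ∞) G)
    (hG' : HasCompactSupport G) {l : ℝ} (hl : 0 < l) :
    ∃ g : 𝓢(Mink, ℂ), ∀ y, g y = ((A (y 0) * G (l • spatial y) : ℝ) : ℂ) := by
  have h1 : HasCompactSupport fun y : Mink => A (y 0) * G (l • spatial y) :=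
    hasCompactSupport_time_space (G := fun x => G (l • x)) hA' (hG'.comp_smul hl.ne')
  have h2 : HasCompactSupport fun y : Mink => ((A (y 0) * G (l • spatial y) : ℝ) : ℂ) :=
    h1.comp_left (g := Complex.ofReal) Complex.ofReal_zero
  have h3 : ContDiff ℝ ((⊤ : ℕ∞) : WithTop ℕ∞) fun y : Mink => A (y 0) * G (l • spatial y) := by
    have := contDiff_spatial
    fun_prop
  exact ⟨h2.toSchwartzMap (Complex.ofRealCLM.contDiff.comp h3), fun y => rfl⟩

/-- If the two integrals agreed for every admissible `g`, so would their limits for spatial cutoffs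
growing to infinity; but these limits are nonzero and opposite. -/
lemma exists_pairIntegral_ne (m : ℝ) {σ : ℝ} (hσ : σ = 1 ∨ σ = -1) : ∃ g : 𝓢(Mink, ℂ),
    (∀ y ∈ tsupport g, 1 ≤ σ * y 0) ∧
      pairIntegral m 1 (tensor 2 ![g, g]) ≠ pairIntegral m (-1) (tensor 2 ![g, g]) := by
  obtain ⟨χ, hχ, hχc, hχs, hχi⟩ := exists_time_cutoff hσ
  set B : ContDiffBump (0 : Mom) := ⟨1, 2, one_pos, one_lt_two⟩
  have hcs : HasCompactSupport fun t : ℝ => ((t * χ t ^ 2 : ℝ) : ℂ) :=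
    hχc.mono fun t ht => by
      contrapose! ht
      simp [Function.notMem_support.1 ht]
  have hAs : HasCompactSupport fun t : ℝ => t * χ t :=
    hχc.mono fun t ht => by
      contrapose! ht
      simp [Function.notMem_support.1 ht]
  have hbs : HasCompactSupport fun x : Mom => ((B x ^ 2 : ℝ) : ℂ) :=
    B.hasCompactSupport.mono fun t ht => by
      contrapose! ht
      simp [Function.notMem_support.1 ht]
  have hB : ContDiff ℝ ((⊤ : ℕ∞) : WithTop ℕ∞) B := B.contDiff
  -- With `g = t χ(t) B(l x)` the square `g²` is `t c(t) b(l x)` for `c = t χ²` and `b = B²`. The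
  -- factor `t` left in front of `c` is the one that makes the time transform a derivative.
  set c : 𝓢(ℝ, ℂ) := hcs.toSchwartzMap
    (Complex.ofRealCLM.contDiff.comp (contDiff_id.mul (hχ.pow 2)))
  set b : 𝓢(Mom, ℂ) := hbs.toSchwartzMap (Complex.ofRealCLM.contDiff.comp (hB.pow 2))
  have hcv : ∀ t, c t = ((t * χ t ^ 2 : ℝ) : ℂ) := fun t => rfl
  have hbv : ∀ x, b x = ((B x ^ 2 : ℝ) : ℂ) := fun t => rfl
  choose g hg using fun n : ℕ => exists_time_space (contDiff_id.mul hχ) hAs hB B.hasCompactSupport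
    (TimeOrdered.cutScale_pos n)
  have hgs : ∀ n, ∀ y ∈ tsupport (g n), 1 ≤ σ * y 0 := by
    intro n y hy
    refine closure_minimal (s := Function.support (g n)) (t := {y : Mink | 1 ≤ σ * y 0}) ?_
      (isClosed_le continuous_const (by fun_prop)) hy
    intro z hz
    refine hχs _ (subset_tsupport _ fun h0 => hz ?_)
    rw [hg n]
    simp [h0]
  have hgg : ∀ n y, g n y * g n y = (y 0 * c (y 0)) * b (TimeOrdered.cutScale n • spatial y) := by
    intro n y
    rw [hg n, hcv, hbv]
    push_cast
    simp only [id]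
    ring
  by_contra! hall
  obtain ⟨K, hK, hKD⟩ := exists_integral_lightWeight_sq
  have hlim : ∀ s : ℝ, (s = 1 ∨ s = -1) →
      Tendsto (fun n => pairIntegral m s (tensor 2 ![g n, g n])) atTop
        (𝓝 ((K * (-(Complex.I / 2) * s * ∫ t, c t)) * ∫ q, spaceTransform b q)) := by
    intro s hs
    obtain ⟨C, hC⟩ := timeTransform_decay c (s := s) (by rcases hs with rfl | rfl <;> norm_num)
    have h := tendsto_narrowIntegral (spaceTransform b) (continuous_timeTransform c s) hC
      TimeOrdered.cutScale_pos TimeOrdered.tendsto_cutScale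
    rw [hKD, integral_timeTransform c hs] at h
    exact h.congr fun n => (pairIntegral_eq_narrowIntegral m (TimeOrdered.cutScale_pos n) (hgg n) hs).symm
  have h1 := hlim 1 (Or.inl rfl)
  have h2 := hlim (-1) (Or.inr rfl)
  have h3 := tendsto_nhds_unique (h1.congr fun n => hall (g n) (hgs n)) h2
  have hb0 : ∫ q, spaceTransform b q ≠ 0 := by
    refine integral_spaceTransform_ne_zero ?_
    rw [hbv, B.one_of_mem_closedBall (Metric.mem_closedBall_self (by norm_num))]
    norm_num
  have hc0 : ∫ t, c t ≠ 0 := by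
    have : ∫ t, c t = ((∫ t, t * χ t ^ 2 : ℝ) : ℂ) := by
      rw [← integral_complex_ofReal]
      rfl
    rw [this]
    exact_mod_cast hχi
  -- After cancelling the nonzero factors, equality of the limits would say `-i/2 = i/2`.
  have h4 := mul_left_cancel₀ hK (mul_right_cancel₀ hb0 h3)
  have h5 := mul_right_cancel₀ hc0 h4
  push_cast at h5
  have h6 : Complex.I = 0 := by linear_combination -h5
  exact Complex.I_ne_zero h6

end EG
end

/-! ### Conclusion -/

theorem mainTheorem9 (m : ℝ) (hm : 0 < m) (ce : ℕ) (hce : ce ≤ 1) (P : EG.TimeOrdered m ce)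
    (c : ℂ) (hc : P.SelfEnergyAtZero c) (hc0 : c ≠ 0)
    (a r : 𝓢'(EG.Cfg 2 × EG.Cfg 2, ℂ))
    (ha : P.IsAdvVEV ![EG.vertex, EG.vertex] ![EG.phi, EG.phi] a)
    (hr : P.IsRetVEV ![EG.vertex, EG.vertex] ![EG.phi, EG.phi] r)
    (f : 𝓢(EG.Cfg 2, ℂ)) (hf : EG.fourierM 2 f 0 ≠ 0) :
    (¬ ∃ v : ℂ, EG.HasLojasiewiczValue (EG.fourierDist (EG.smearRight a f)) v) ∧
      ¬ ∃ v : ℂ, EG.HasLojasiewiczValue (EG.fourierDist (EG.smearRight r f)) v := by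
  -- The commutator converges to `½ f̃(0) c` times the difference of the two pair integrals. All
  -- three factors are nonzero, so it cannot also tend to zero.
  have hdiff : ∀ g : 𝓢(EG.Mink, ℂ),
      EG.pairIntegral m 1 (EG.tensor 2 ![g, g]) ≠ EG.pairIntegral m (-1) (EG.tensor 2 ![g, g]) →
      ¬ Tendsto (fun n => P.commForm (EG.scaleArg (EG.TimeOrdered.cutScale n ^ 2) (EG.tensor 2 ![g, g]))
        (EG.schwartzMul (EG.pairCutoff (EG.TimeOrdered.cutScale n)) f)) atTop (𝓝 0) := by
    intro g hg h
    have hlim := P.tendsto_commForm hc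
      (EG.tendsto_schwartzMul_pairCutoff EG.TimeOrdered.cutScale_pos EG.TimeOrdered.cutScale_le_one EG.TimeOrdered.tendsto_cutScale f)
      (fun n => pow_pos (EG.TimeOrdered.cutScale_pos n) 2) EG.TimeOrdered.tendsto_cutScale_sq (EG.tensor 2 ![g, g])
    have h0 := tendsto_nhds_unique hlim h
    rw [← mul_sub] at h0
    have hfc : 2 * EG.fourierM 2 f 0 * c ≠ 0 := mul_ne_zero (mul_ne_zero two_ne_zero hf) hc0
    exact mul_ne_zero (by norm_num) (mul_ne_zero hfc (sub_ne_zero.2 hg)) h0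
  constructor
  · intro hv
    -- The advanced product requires vertices in the future of the fields, the retarded one vertices
    -- in the past.
    obtain ⟨g, hg, hne⟩ := EG.exists_pairIntegral_ne m (Or.inl rfl : (1 : ℝ) = 1 ∨ (1 : ℝ) = -1)
    exact hdiff g hne (P.tendsto_commForm_of_adv hm ha hv one_pos fun y hy => by
      simpa using hg y hy)
  · intro hv
    obtain ⟨g, hg, hne⟩ := EG.exists_pairIntegral_ne m (Or.inr rfl : (-1 : ℝ) = 1 ∨ (-1 : ℝ) = -1)
    exact hdiff g hne (P.tendsto_commForm_of_ret hm hr hv one_pos fun y hy => by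
      linarith [hg y hy])
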